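/- Let $n,m\ge 1$, let $\mathbb R^{1+n}_+=\{(t,x):t>0,\ x\in\mathbb R^n\}$, and let $A=(A_{i,j}^{\alpha,\beta})_{0\le i,j\le n}^{1\le\alpha,\beta\le m}\in L^\infty(\mathbb R^{1+n}_+;\mathcal L(\mathbb C^{m(1+n)}))$ be a bounded measurable complex matrix function, with no further regularity and no $t$-independence assumed, such that for some $\lambda>0$ the Gårding inequality $$\int_{\mathbb R^{1+n}_+}\operatorname{Re}\big(A\nabla g\cdot\overline{\nabla g}\big)\ \ge\ \lambda\sum_{i=0}^n\sum_{\alpha=1}^m\int_{\mathbb R^{1+n}_+}|\partial_i g^\alpha|^2$$ holds for all $C^1$ functions $g:\mathbb R^{1+n}_+\to\mathbb C^m$ with compact support in the open half-space. Here $A\xi\cdot\overline\eta=\sum A_{i,j}^{\alpha,\beta}\xi_j^\beta\,\overline{\eta_i^\alpha}$, $\partial_0=\partial_t$, and $A^*$ is the pointwise adjoint of $A$. Let $\mathcal E$ be the space of $u\in L^2_{loc}(\mathbb R^{1+n}_+;\mathbb C^m)$ with $\nabla u\in L^2(\mathbb R^{1+n}_+)$ in the sense of distributions. Every $u\in\mathcal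 E$ has a trace $u_0=u|_{t=0}=\lim_{t\to0}u(t,\cdot)$ in $L^2_{loc}(\mathbb R^n;\mathbb C^m)$; write $\nabla u_0$ for its tangential gradient $\nabla_x u_0$ in the sense of distributions. If $u\in\mathcal E$ solves $\operatorname{div}A\nabla u=0$ in $\mathbb R^{1+n}_+$ in the sense of distributions, its conormal derivative $\partial_{\nu_A}u_0$ is the distribution on $\mathbb R^n$ determined by $$\int_{\mathbb R^{1+n}_+}A\nabla u\cdot\overline{\nabla\phi}=-\langle\partial_{\nu_A}u_0,\phi_0\rangle$$ for all $\phi\in\mathcal E$ with trace $\phi_0\in C_0^\infty(\mathbb R^n;\mathbb C^m)$, where $\langle\cdot,\cdot\rangle$ is the sesquilinear pairing; similarly for $A^*$. For $1<p<\infty$ and $1/p+1/p'=1$, let $\dot W^{-1,p'}(\mathbb R^n)$ be the dual of $\dot W^{1,p}(\mathbb R^n)$, that is, the space of distributions $T$ with $$\|T\|_{\dot W^{-1,p'}}=\sup\{|\langle T,\psi\rangle|:\psi\in C_0^\infty(\mathbb R^n),\ \|\nabla\psi\|_p\le1\}<\infty ,$$ and similarly for vector-valued distributions. A norm of a distribution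 is $+\infty$ if the distribution is not in the corresponding space, and an estimate with infinite right-hand side claims nothing. Then for every $1<p<\infty$ the following are equivalent. 1. There exists $C_p<\infty$ such that $\|\partial_{\nu_A}u_0\|_p\le C_p\|\nabla u_0\|_p$ for every $u\in\mathcal E$ with $\operatorname{div}A\nabla u=0$ in $\mathbb R^{1+n}_+$. 2. There exists $C_{p'}<\infty$ such that $\|\partial_{\nu_{A^*}}w_0\|_{\dot W^{-1,p'}}\le C_{p'}\|\nabla w_0\|_{\dot W^{-1,p'}}$ for every $w\in\mathcal E$ with $\operatorname{div}A^*\nabla w=0$ in $\mathbb R^{1+n}_+$. -/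

import Mathlib

open MeasureTheory Filter Topology Matrix
open scoped Distributions LineDeriv NNReal ENNReal ComplexConjugate

noncomputable section

namespace HalfSpaceSystem

/-- The boundary `ℝⁿ`, with its Euclidean norm. -/
abbrev Bdry (n : ℕ) : Type := EuclideanSpace ℝ (Fin n)

/-- `ℝ^{1+n} = ℝ × ℝⁿ`, with points `(t, x)`. -/
abbrev Space (n : ℕ) : Type := ℝ × Bdry n

/-- The upper half-space `{(t, x) : t > 0}`, as an open set. -/
def half (n : ℕ) : TopologicalSpace.Opens (Space n) :=
  ⟨{z | 0 < z.1}, isOpen_lt continuous_const continuous_fst⟩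

/-- The coordinate vectors of `ℝ^{1+n}`: index `0` is the direction `t`, index `j + 1` the
direction `x_j`. -/
def dir {n : ℕ} (i : Fin (n + 1)) : Space n :=
  Fin.cases ((1 : ℝ), (0 : Bdry n)) (fun j => ((0 : ℝ), EuclideanSpace.single j (1 : ℝ))) i

/-- The distribution on `Ω` attached to a locally integrable function. -/
def funDistr {X : Type*} [NormedAddCommGroup X] [NormedSpace ℝ X] [MeasureSpace X]
    [OpensMeasurableSpace X] (Ω : TopologicalSpace.Opens X) (f : X → ℂ) : 𝓓'(Ω, ℂ) :=
  TestFunction.integralAgainstBilinCLM (ContinuousLinearMap.lsmul ℝ ℝ) volume f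

theorem funDistr_apply {X : Type*} [NormedAddCommGroup X] [NormedSpace ℝ X] [MeasureSpace X]
    [OpensMeasurableSpace X] {Ω : TopologicalSpace.Opens X} {f : X → ℂ}
    (hf : LocallyIntegrableOn f Ω volume) (ψ : 𝓓(Ω, ℝ)) :
    funDistr Ω f ψ = ∫ x, (ψ x : ℂ) * f x := by
  have h : funDistr Ω f ψ = ∫ x, ContinuousLinearMap.lsmul ℝ ℝ (ψ x) (f x) :=
    TestFunction.integralAgainstBilinCLM_eq_integral hf
  simpa using h

/-! ### Coefficients -/

/-- The coefficients of a system of `m` equations on the half-space: the entry of `A z` at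
`((i, α), (j, β))` is `A_{i,j}^{α,β}(z)`. -/
abbrev Coeff (n m : ℕ) : Type :=
  Space n → Matrix (Fin (n + 1) × Fin m) (Fin (n + 1) × Fin m) ℂ

/-- `A` is measurable and essentially bounded on the half-space. -/
structure IsBoundedMeasurable {n m : ℕ} (A : Coeff n m) : Prop where
  measurable : ∀ p q, AEStronglyMeasurable (fun z => A z p q) (volume.restrict (half n))
  bounded : ∃ M : ℝ, ∀ᵐ z ∂volume.restrict (half n : Set (Space n)), ∀ p q, ‖A z p q‖ ≤ M

/-- The adjoint coefficients: `(A*)_{i,j}^{α,β}` is the conjugate of `A_{j,i}^{β,α}`. -/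
def adjointCoeff {n m : ℕ} (A : Coeff n m) : Coeff n m := fun z => (A z)ᴴ

/-- The classical gradient `(∂_i g^α)_{(i, α)}` of a function on `ℝ^{1+n}`. -/
def classicalGrad {n m : ℕ} (g : Space n → EuclideanSpace ℂ (Fin m)) (z : Space n) :
    EuclideanSpace ℂ (Fin (n + 1) × Fin m) :=
  WithLp.toLp 2 fun q => fderiv ℝ g z (dir q.1) q.2

/-- The Gårding inequality on the half-space, for `C¹` functions `g` whose support is a compact
subset of the open half-space. -/
def Garding {n m : ℕ} (A : Coeff n m) : Prop :=
  ∃ lam : ℝ, 0 < lam ∧ ∀ g : 𝓓^{1}(half n, EuclideanSpace ℂ (Fin m)),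
    lam * ∑ i : Fin (n + 1), ∑ α : Fin m, ∫ z in half n, ‖classicalGrad g z (i, α)‖ ^ 2 ≤
      ∫ z in half n, ((A z *ᵥ (classicalGrad g z).ofLp) ⬝ᵥ star (classicalGrad g z).ofLp).re

/-! ### Energy solutions -/

/-- An element of the energy space `𝓔 = Ḣ¹`, i.e. a function in `L²_loc` of the open half-space
whose distributional gradient is in `L²` of the half-space, given with this gradient. -/
structure EnergyFunction (n m : ℕ) where
  toFun : Space n → EuclideanSpace ℂ (Fin m)
  grad : Space n → EuclideanSpace ℂ (Fin (n + 1) × Fin m)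
  memLp_loc : ∀ K : Set (Space n), IsCompact K → K ⊆ half n → MemLp toFun 2 (volume.restrict K)
  memLp_grad : MemLp grad 2 (volume.restrict (half n))
  isGrad : ∀ (i : Fin (n + 1)) (α : Fin m),
    ∂_{dir i} (funDistr (half n) fun z => toFun z α) = funDistr (half n) fun z => grad z (i, α)

/-- The flux `A ∇u`. -/
def flux {n m : ℕ} (A : Coeff n m) (u : EnergyFunction n m) (z : Space n) :
    Fin (n + 1) × Fin m → ℂ :=
  A z *ᵥ (u.grad z).ofLp

/-- `div A ∇u = 0` in the half-space in the sense of distributions. -/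
def IsSolution {n m : ℕ} (A : Coeff n m) (u : EnergyFunction n m) : Prop :=
  ∀ α : Fin m,
    ∑ i : Fin (n + 1), ∂_{dir i} (funDistr (half n) fun z => flux A u z (i, α)) = 0

/-- The form `∫ A ∇u · conj ∇φ` over the half-space. -/
def energyForm {n m : ℕ} (A : Coeff n m) (u φ : EnergyFunction n m) : ℂ :=
  ∫ z in half n, flux A u z ⬝ᵥ star (φ.grad z).ofLp

/-- `f = u|_{t=0}`: the function `f` is in `L²_loc(ℝⁿ)`, and it is the limit in `L²_loc(ℝⁿ)` of
`u(t, ·)` as `t → 0+`. Since `u` is a class of functions modulo null sets, the limit is taken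
along almost every `t`; elements of the energy space have a representative in
`C([0, ∞); L²_loc(ℝⁿ))`, and then this says that its value at `t = 0` is `f`. -/
def IsTrace {n m : ℕ} (u : EnergyFunction n m) (f : Bdry n → EuclideanSpace ℂ (Fin m)) : Prop :=
  (∀ K : Set (Bdry n), IsCompact K → MemLp f 2 (volume.restrict K)) ∧
  ∀ K : Set (Bdry n), IsCompact K →
    Tendsto (fun t : ℝ => eLpNorm (fun x => u.toFun (t, x) - f x) 2 (volume.restrict K))
      (𝓝[>] 0 ⊓ ae volume) (𝓝 0)

/-! ### Distributions on the boundary -/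

/-- Distributions on `ℝⁿ` with values in `ℂ^ι`, as tuples of complex distributions. -/
abbrev VecDistr (n : ℕ) (ι : Type) : Type := ι → 𝓓'((⊤ : TopologicalSpace.Opens (Bdry n)), ℂ)

/-- Smooth compactly supported functions on `ℝⁿ` with values in `ℂ^ι`. -/
abbrev VecTest (n : ℕ) (ι : Type) [Fintype ι] : Type :=
  𝓓((⊤ : TopologicalSpace.Opens (Bdry n)), EuclideanSpace ℂ ι)

/-- The sesquilinear pairing `⟨T, Ψ⟩ = ∑ₐ Tₐ(conj Ψₐ) = ∑ₐ (Tₐ(Re Ψₐ) - i Tₐ(Im Ψₐ))`. -/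
def pairing {n : ℕ} {ι : Type} [Fintype ι] (T : VecDistr n ι) (Ψ : VecTest n ι) : ℂ :=
  ∑ a, (T a (TestFunction.postcompCLM
          (Complex.reCLM ∘L (EuclideanSpace.proj a : _ →L[ℂ] ℂ).restrictScalars ℝ) Ψ)
    - Complex.I * T a (TestFunction.postcompCLM
          (Complex.imCLM ∘L (EuclideanSpace.proj a : _ →L[ℂ] ℂ).restrictScalars ℝ) Ψ))

/-- The distributional tangential gradient `∇f = (∂_j f^α)_{(j, α)}`. -/
def tangGrad {n m : ℕ} (f : Bdry n → EuclideanSpace ℂ (Fin m)) : VecDistr n (Fin n × Fin m) :=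
  fun q => ∂_{EuclideanSpace.single q.1 (1 : ℝ)} (funDistr ⊤ fun x => f x q.2)

/-- `T` is the conormal derivative `∂_{ν_A} u|_{t=0}`:
`∫ A ∇u · conj ∇φ = - ⟨T, φ|_{t=0}⟩` for the elements `φ` of the energy space whose trace is a
test function. Every test function is such a trace, so `T` is unique; it exists when `u` is
a solution and `A` is bounded and measurable. -/
def IsConormalDerivative {n m : ℕ} (A : Coeff n m) (u : EnergyFunction n m)
    (T : VecDistr n (Fin m)) : Prop :=
  ∀ (φ : EnergyFunction n m) (Ψ : VecTest n (Fin m)), IsTrace φ Ψ →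
    energyForm A u φ = - pairing T Ψ

/-- The norm of a distribution in `L^p(ℝⁿ; ℂ^ι)`; it is `∞` if the distribution is not given by
an `L^p` function. -/
def distrLpNorm {n : ℕ} {ι : Type} [Fintype ι] (p : ℝ) (T : VecDistr n ι) : ℝ≥0∞ :=
  ⨅ (h : Bdry n → EuclideanSpace ℂ ι) (_ : MemLp h (ENNReal.ofReal p) volume)
    (_ : ∀ a, T a = funDistr ⊤ fun x => h x a), eLpNorm h (ENNReal.ofReal p) volume

/-- The `Ẇ^{1,p}` norm `‖∇Ψ‖_p` of a test function. -/
def sobolevNorm {n : ℕ} {ι : Type} [Fintype ι] (p : ℝ) (Ψ : VecTest n ι) : ℝ≥0∞ :=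
  eLpNorm (fun x => (WithLp.toLp 2 fun q : Fin n × ι =>
    fderiv ℝ Ψ x (EuclideanSpace.single q.1 (1 : ℝ)) q.2 : EuclideanSpace ℂ (Fin n × ι)))
    (ENNReal.ofReal p) volume

/-- The norm of a distribution in `Ẇ^{-1,q}(ℝⁿ; ℂ^ι)`, the dual of `Ẇ^{1,q'}(ℝⁿ; ℂ^ι)`, where
`q' = q / (q - 1)`; test functions are dense in `Ẇ^{1,q'}`. It is `∞` if the distribution does not
extend to a continuous functional on `Ẇ^{1,q'}`. -/
def negSobolevNorm {n : ℕ} {ι : Type} [Fintype ι] (q : ℝ) (T : VecDistr n ι) : ℝ≥0∞ :=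
  ⨆ (Ψ : VecTest n ι) (_ : sobolevNorm q.conjExponent Ψ ≤ 1), ‖pairing T Ψ‖ₑ

end HalfSpaceSystem

end

open HalfSpaceSystem

noncomputable section

namespace HalfSpaceSystem

set_option linter.unusedSectionVars false
set_option linter.style.haveILetI false

/-! The theorem is the duality of the two Dirichlet-to-Neumann maps. If `u` solves the equation for
`A` and `w` the one for `A*`, then `energyForm A u w` and `energyForm (adjointCoeff A) w u` are
conjugate numbers, so formally ⟨∂_{ν_A}u₀, w₀⟩ is the conjugate of ⟨∂_{ν_{A*}}w₀, u₀⟩. A bound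
Ẇ^{1,p} → L^p for one map is therefore a bound L^{p'} → Ẇ^{-1,p'} for the other, and the norm of w₀
in L^{p'} is comparable to that of ∇w₀ in Ẇ^{-1,p'}. In either implication the conormal derivative
to be estimated is tested against a test function, the other equation is solved with that function
as boundary value (`exists_isSolution`), and the form is estimated through the conormal derivative
of the new solution.

Two things are missing in this sketch. The trace of the given solution is not a test function, so
the other conormal derivative cannot be paired with it; and the comparison of norms is a bound for
singular integrals, the second order Riesz transforms. `exists_rieszKernel` settles both: it gives
smooth compactly supported fields κ with div κ close to the point mass at 0, such that convolution
with each ∂_jκ_i is bounded on L^p uniformly. The form between `u` and the tangential translates of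
`φ` is a continuous function of the translation which vanishes at infinity, so its value at 0 is
almost ∑ᵢ ∫ ∂ᵢκᵢ(y) (form at y) dy, that is, the sum of the forms of `u` with the convolutions ∂ᵢκᵢ
* φ. Since ∂ᵢκᵢ * φ = κᵢ * ∂ᵢφ is in L², it may be cut off at infinity, and its trace becomes a test
function. This is `exists_norm_energyForm_le`. The remaining estimates move the second derivative of
the kernel to where the L^p bound applies (`norm_integral_cutoffConv_le`,
`sobolevNorm_cutoffConv_le`).

The kernels are built from a random walk. With τ_i the translation by s in the direction x_i and
τ_i* its inverse, let T be the product of the means (1 + τ_i)/2 and U = TT*. The geometric sum G of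
U^k, k < N, satisfies (1 - U)G = 1 - U^N, and 1 - U telescopes into second differences in the n
directions; this writes ρ - U^N ρ as a divergence for a concentrated density ρ, while U^N e tends
uniformly to 0 for continuous e vanishing at infinity. The operators (τ_a - τ_b)(τ_a - τ_b)*G are
bounded on L^p independently of s and N: by commutativity they pair g and h as ∑ₖ ∫ D T^k g · D T^k
h with D = τ_a - τ_b, and a Bellman function B with B ± xy convex bounds ∑ₖ ∫ |D T^k g| |D T^k h|,
since each averaging step lowers ∫ B(T^k g, T^k h) by the k-th term (`bellman_jensen`,
`diffSum_le`).

On the side of the equation, the form of a solution with φ depends only on the trace of φ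
(`energyForm_eq_of_trace_eq`), because a solenoidal L² field is orthogonal to gradients of functions
with zero trace; this gives the existence of the conormal derivative. In the direction from the
negative Sobolev estimate to the L^p estimate, a distribution bounded in the L^q norm has to be
recognised as an L^p function, which is the duality of L^q and L^p (`exists_funDistr_of_bound`). -/

instance instIsAddHaarMeasureSpace (n : ℕ) : (volume : Measure (Space n)).IsAddHaarMeasure :=
  inferInstanceAs ((volume : Measure ℝ).prod (volume : Measure (Bdry n))).IsAddHaarMeasure

/-! ### Convolution along a linear map -/

section TransConv

variable {V X F : Type} [NormedAddCommGroup V] [NormedSpace ℝ V] [MeasureSpace V] [BorelSpace V]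
  [FiniteDimensional ℝ V] [(volume : Measure V).IsAddHaarMeasure]
  [NormedAddCommGroup X] [NormedSpace ℝ X] [MeasureSpace X] [BorelSpace X]
  [FiniteDimensional ℝ X] [(volume : Measure X).IsAddHaarMeasure]
  [NormedAddCommGroup F] [NormedSpace ℝ F]

/-- The convolution `∫ K(y) f(z - ι y) dy` of `f` with a kernel on `V` along `ι : V → X`. -/
def tconv (ι : V →L[ℝ] X) (K : V → ℝ) (f : X → F) (z : X) : F := ∫ y, K y • f (z - ι y)

/-- Needed because `f` is only measurable up to null sets: joint measurability of f(z - ιy) requires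
that (y, z) ↦ z - ιy pull null sets back to null sets. -/
theorem measurePreserving_shear (ι : V →L[ℝ] X) :
    MeasurePreserving (fun p : V × X => (p.1, p.2 - ι p.1)) (volume.prod volume)
      (volume.prod volume) := by
  refine (MeasurePreserving.id (volume : Measure V)).skew_product
    (g := fun (y : V) (z : X) => z - ι y) ?_ ?_
  · have : Continuous (Function.uncurry fun (y : V) (z : X) => z - ι y) := by
      unfold Function.uncurry; fun_prop
    exact this.measurable
  · exact Eventually.of_forall fun y => (measurePreserving_sub_right volume (ι y)).map_eq

theorem quasiMeasurePreserving_shear (ι : V →L[ℝ] X) :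
    Measure.QuasiMeasurePreserving (fun p : V × X => p.2 - ι p.1) (volume.prod volume) volume :=
  Measure.quasiMeasurePreserving_snd.comp (measurePreserving_shear ι).quasiMeasurePreserving

theorem aestronglyMeasurable_shear (ι : V →L[ℝ] X) {f : X → F}
    (hf : AEStronglyMeasurable f volume) :
    AEStronglyMeasurable (fun p : V × X => f (p.2 - ι p.1)) (volume.prod volume) :=
  hf.comp_quasiMeasurePreserving (quasiMeasurePreserving_shear ι)

theorem aestronglyMeasurable_tconv_integrand (ι : V →L[ℝ] X) {K : V → ℝ} {f : X → F}
    (hK : AEStronglyMeasurable K volume) (hf : AEStronglyMeasurable f volume) :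
    AEStronglyMeasurable (fun p : V × X => K p.1 • f (p.2 - ι p.1)) (volume.prod volume) :=
  hK.comp_fst.smul (aestronglyMeasurable_shear ι hf)

theorem aestronglyMeasurable_tconv (ι : V →L[ℝ] X) {K : V → ℝ} {f : X → F}
    (hK : AEStronglyMeasurable K volume) (hf : AEStronglyMeasurable f volume) :
    AEStronglyMeasurable (tconv ι K f) volume :=
  (aestronglyMeasurable_tconv_integrand ι hK hf).prod_swap.integral_prod_right'

/-- Hölder's inequality for the measure a dμ: split a = a^{1/r'} a^{1/r} and give the second factor
to b. -/
theorem lintegral_mul_rpow_le {Y : Type} [MeasurableSpace Y] {μ : Measure Y} {a b : Y → ℝ≥0∞}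
    (ha : AEMeasurable a μ) (hb : AEMeasurable b μ) {r : ℝ} (hr : 1 ≤ r) :
    (∫⁻ y, a y * b y ∂μ) ^ r ≤ (∫⁻ y, a y ∂μ) ^ (r - 1) * ∫⁻ y, a y * b y ^ r ∂μ := by
  rcases eq_or_lt_of_le hr with rfl | hr1
  · simp
  have hc : r.HolderConjugate r.conjExponent := Real.HolderConjugate.conjExponent hr1
  have hr0 : 0 < r := by linarith
  have hc0 : r.conjExponent ≠ 0 := hc.symm.ne_zero
  have h := ENNReal.lintegral_mul_le_Lp_mul_Lq μ hc.symm
    (f := fun y => a y ^ (1 / r.conjExponent)) (g := fun y => a y ^ (1 / r) * b y)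
    (ha.pow_const _) ((ha.pow_const _).mul hb)
  have hsum : 1 / r.conjExponent + 1 / r = 1 := by
    have := hc.symm.inv_add_inv_eq_one; simpa [one_div] using this
  have e1 : ∀ y, a y ^ (1 / r.conjExponent) * (a y ^ (1 / r) * b y) = a y * b y := fun y => by
    rw [← mul_assoc, ← ENNReal.rpow_add_of_nonneg _ _ (by have := hc.symm.pos; positivity)
      (by positivity), hsum, ENNReal.rpow_one]
  have e2 : ∀ y, (a y ^ (1 / r.conjExponent)) ^ r.conjExponent = a y := fun y => by
    rw [← ENNReal.rpow_mul, one_div, inv_mul_cancel₀ hc0, ENNReal.rpow_one]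
  have e3 : ∀ y, (a y ^ (1 / r) * b y) ^ r = a y * b y ^ r := fun y => by
    rw [ENNReal.mul_rpow_of_nonneg _ _ hr0.le, ← ENNReal.rpow_mul, one_div,
      inv_mul_cancel₀ hr0.ne', ENNReal.rpow_one]
  simp only [Pi.mul_apply, e1, e2, e3] at h
  have h2 := ENNReal.rpow_le_rpow h hr0.le
  rw [ENNReal.mul_rpow_of_nonneg _ _ hr0.le, ← ENNReal.rpow_mul, ← ENNReal.rpow_mul, one_div r,
    inv_mul_cancel₀ hr0.ne', ENNReal.rpow_one] at h2
  have e4 : 1 / r.conjExponent * r = r - 1 := by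
    have : 1 / r.conjExponent = 1 - 1 / r := by linarith
    rw [this]; field_simp
  rwa [e4] at h2

/-- Young's inequality `‖K * f‖_p ≤ ‖K‖_1 ‖f‖_p`. -/
theorem eLpNorm_tconv_le (ι : V →L[ℝ] X) {K : V → ℝ} {f : X → F} (hK : Integrable K volume)
    (hf : AEStronglyMeasurable f volume) {p : ℝ≥0∞} (hp : 1 ≤ p) (hpt : p ≠ ∞) :
    eLpNorm (tconv ι K f) p volume ≤ eLpNorm K 1 volume * eLpNorm f p volume := by
  have hp0 : p ≠ 0 := (zero_lt_one.trans_le hp).ne'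
  set r := p.toReal with hr
  have hr1 : 1 ≤ r := by
    rw [hr]; have := ENNReal.toReal_mono hpt hp; simpa using this
  have hr0 : 0 < r := by linarith
  set A := ∫⁻ y, ‖K y‖ₑ ∂(volume : Measure V) with hA
  have hAt : A ≠ ∞ := hK.2.ne
  -- Hölder with weight |K| in y, then Tonelli and the translation invariance of the measure in z.
  have key : ∫⁻ z, ‖tconv ι K f z‖ₑ ^ r ≤ A ^ r * ∫⁻ z, ‖f z‖ₑ ^ r := by
    have hm : AEMeasurable (fun q : V × X => ‖K q.1‖ₑ * ‖f (q.2 - ι q.1)‖ₑ ^ r)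
        (volume.prod volume) :=
      hK.1.comp_fst.enorm.mul ((aestronglyMeasurable_shear ι hf).enorm.pow_const r)
    have hslice : ∀ᵐ z : X, AEMeasurable (fun y : V => ‖f (z - ι y)‖ₑ) volume := by
      have := (aestronglyMeasurable_shear ι hf).prod_swap.prodMk_left
      filter_upwards [this] with z hz using hz.enorm
    calc ∫⁻ z, ‖tconv ι K f z‖ₑ ^ r
        ≤ ∫⁻ z, (A ^ (r - 1) * ∫⁻ y, ‖K y‖ₑ * ‖f (z - ι y)‖ₑ ^ r) := by
          refine lintegral_mono_ae ?_
          filter_upwards [hslice] with z hz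
          refine le_trans (ENNReal.rpow_le_rpow (enorm_integral_le_lintegral_enorm _) hr0.le) ?_
          simp only [enorm_smul]
          exact lintegral_mul_rpow_le hK.1.enorm hz hr1
      _ = A ^ (r - 1) * ∫⁻ z, ∫⁻ y, ‖K y‖ₑ * ‖f (z - ι y)‖ₑ ^ r := by
          rw [lintegral_const_mul']
          exact ENNReal.rpow_ne_top_of_nonneg (by linarith) hAt
      _ = A ^ (r - 1) * ∫⁻ y, ∫⁻ z, ‖K y‖ₑ * ‖f (z - ι y)‖ₑ ^ r := by
          rw [lintegral_lintegral_swap]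
          exact hm.prod_swap
      _ = A ^ (r - 1) * ∫⁻ y, ‖K y‖ₑ * ∫⁻ z, ‖f z‖ₑ ^ r := by
          congr 1
          refine lintegral_congr fun y => ?_
          rw [lintegral_const_mul' _ _ enorm_ne_top]
          congr 1
          exact lintegral_sub_right_eq_self (fun z => ‖f z‖ₑ ^ r) (ι y)
      _ = A ^ r * ∫⁻ z, ‖f z‖ₑ ^ r := by
          rw [lintegral_mul_const'' _ hK.1.enorm, ← mul_assoc]
          congr 1
          nth_rewrite 2 [← ENNReal.rpow_one A]
          rw [← hA, ← ENNReal.rpow_one A, ← ENNReal.rpow_mul, one_mul,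
            ← ENNReal.rpow_add_of_nonneg _ _ (by linarith) zero_le_one]
          simp
  rw [eLpNorm_one_eq_lintegral_enorm, eLpNorm_eq_lintegral_rpow_enorm_toReal hp0 hpt,
    eLpNorm_eq_lintegral_rpow_enorm_toReal hp0 hpt, ← hr, ← hA]
  refine (ENNReal.rpow_le_rpow key (by positivity : 0 ≤ 1 / r)).trans_eq ?_
  rw [ENNReal.mul_rpow_of_nonneg _ _ (by positivity), ← ENNReal.rpow_mul, mul_one_div,
    div_self hr0.ne', ENNReal.rpow_one]

theorem memLp_tconv (ι : V →L[ℝ] X) {K : V → ℝ} {f : X → F} (hK : Integrable K volume)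
    {p : ℝ≥0∞} (hf : MemLp f p volume) (hp : 1 ≤ p) (hpt : p ≠ ∞) :
    MemLp (tconv ι K f) p volume :=
  ⟨aestronglyMeasurable_tconv ι hK.1 hf.1, (eLpNorm_tconv_le ι hK hf.1 hp hpt).trans_lt
    (ENNReal.mul_lt_top (memLp_one_iff_integrable.2 hK).2 hf.2)⟩

/-- Fubini for the pairing of a convolution. -/
theorem integral_mul_tconv (ι : V →L[ℝ] X) {K : V → ℝ} {f G : X → ℂ} (hK : Integrable K volume)
    (hf : AEStronglyMeasurable f volume) (hG : AEStronglyMeasurable G volume) {C : ℝ}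
    (hint : ∀ y, K y ≠ 0 → Integrable (fun z => G z * f (z - ι y)) volume)
    (hC : ∀ y, K y ≠ 0 → ∫ z, ‖G z * f (z - ι y)‖ ≤ C) :
    ∫ z, G z * tconv ι K f z = ∫ y, (K y : ℂ) * ∫ z, G z * f (z - ι y) := by
  have hm : AEStronglyMeasurable (fun p : V × X => (K p.1 : ℂ) * (G p.2 * f (p.2 - ι p.1)))
      (volume.prod volume) :=
    (Complex.continuous_ofReal.comp_aestronglyMeasurable hK.1).comp_fst.mul
      (hG.comp_snd.mul (aestronglyMeasurable_shear ι hf))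
  have hI : Integrable (fun p : V × X => (K p.1 : ℂ) * (G p.2 * f (p.2 - ι p.1)))
      (volume.prod volume) := by
    rw [integrable_prod_iff hm]
    refine ⟨Eventually.of_forall fun y => ?_, ?_⟩
    · by_cases h : K y = 0
      · simp [h]
      · exact (hint y h).const_mul (K y : ℂ)
    · refine Integrable.mono' (hK.norm.mul_const C) hm.norm.integral_prod_right'
        (Eventually.of_forall fun y => ?_)
      by_cases h : K y = 0
      · simp [h]
      · rw [Real.norm_of_nonneg (integral_nonneg fun _ => norm_nonneg _)]
        simp only [norm_mul (K y : ℂ), integral_const_mul, Complex.norm_real]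
        exact mul_le_mul_of_nonneg_left (hC y h) (norm_nonneg _)
  calc ∫ z, G z * tconv ι K f z = ∫ z, ∫ y, (K y : ℂ) * (G z * f (z - ι y)) := by
        refine integral_congr_ae (Eventually.of_forall fun z => ?_)
        simp only [tconv]
        rw [← integral_const_mul]
        refine integral_congr_ae (Eventually.of_forall fun y => ?_)
        simp only [Complex.real_smul]; ring
    _ = ∫ y, ∫ z, (K y : ℂ) * (G z * f (z - ι y)) := integral_integral_swap hI.swap
    _ = _ := by simp only [integral_const_mul]

theorem hasFDerivAt_tconv (ι : V →L[ℝ] X) {K : V → ℝ} {f : X → F} (hK : Integrable K volume)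
    (hf : ContDiff ℝ 1 f) (hfc : HasCompactSupport f) (z : X) :
    HasFDerivAt (tconv ι K f) (tconv ι K (fderiv ℝ f) z) z := by
  have hc : Continuous (fderiv ℝ f) := hf.continuous_fderiv (by simp)
  obtain ⟨C, hC⟩ := hc.bounded_above_of_compact_support (hfc.fderiv ℝ)
  obtain ⟨D, hD⟩ := hf.continuous.bounded_above_of_compact_support hfc
  refine hasFDerivAt_integral_of_dominated_of_fderiv_le (s := Set.univ)
    (bound := fun y => ‖K y‖ * C) (F' := fun z y => K y • fderiv ℝ f (z - ι y)) univ_mem ?_ ?_ ?_ ?_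
    (hK.norm.mul_const C) ?_
  · exact Eventually.of_forall fun w => hK.1.smul
      ((hf.continuous.comp (by fun_prop : Continuous fun y => w - ι y)).aestronglyMeasurable)
  · refine Integrable.mono' (hK.norm.mul_const D) (hK.1.smul
      ((hf.continuous.comp (by fun_prop : Continuous fun y => z - ι y)).aestronglyMeasurable))
      (Eventually.of_forall fun y => ?_)
    rw [norm_smul]
    exact mul_le_mul_of_nonneg_left (hD _) (norm_nonneg _)
  · exact hK.1.smul
      ((hc.comp (by fun_prop : Continuous fun y => z - ι y)).aestronglyMeasurable)
  · refine Eventually.of_forall fun y w _ => ?_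
    rw [norm_smul]
    exact mul_le_mul_of_nonneg_left (hC _) (norm_nonneg _)
  · refine Eventually.of_forall fun y w _ => ?_
    have h1 : HasFDerivAt f (fderiv ℝ f (w - ι y)) (w - ι y) :=
      (hf.differentiable (by simp) _).hasFDerivAt
    have h2 : HasFDerivAt (fun w => w - ι y) (ContinuousLinearMap.id ℝ X) w :=
      (hasFDerivAt_id w).sub_const _
    have h3 := (h1.comp w h2).const_smul (K y)
    rw [ContinuousLinearMap.comp_id] at h3
    exact h3

/-- Derivatives fall on `f`, since the kernel is merely integrable. The target space varies in the
induction because the derivative of `f` takes values in `X →L[ℝ] F`. One derivative is lost by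
counting, which is harmless for smooth `f`. -/
theorem contDiff_tconv (ι : V →L[ℝ] X) {K : V → ℝ} (hK : Integrable K volume) (N : ℕ) :
    ∀ {F : Type} [NormedAddCommGroup F] [NormedSpace ℝ F] {f : X → F}, ContDiff ℝ (N + 1) f →
      HasCompactSupport f → ContDiff ℝ N (tconv ι K f) := by
  induction N with
  | zero =>
    intro F _ _ f hf hfc
    rw [show ((0 : ℕ) : WithTop ℕ∞) = 0 by rfl, contDiff_zero]
    exact continuous_iff_continuousAt.2 fun z =>
      (hasFDerivAt_tconv ι hK (by simpa using hf) hfc z).continuousAt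
  | succ N ih =>
    intro F _ _ f hf hfc
    have h1 : ContDiff ℝ 1 f := hf.of_le (by norm_cast; omega)
    have hd : fderiv ℝ (tconv ι K f) = tconv ι K (fderiv ℝ f) :=
      funext fun z => (hasFDerivAt_tconv ι hK h1 hfc z).fderiv
    have := contDiff_succ_iff_fderiv (𝕜 := ℝ) (f := tconv ι K f) (n := (N : WithTop ℕ∞))
    push_cast
    rw [this]
    refine ⟨fun z => (hasFDerivAt_tconv ι hK h1 hfc z).differentiableAt, by simp, ?_⟩
    rw [hd]
    refine ih ?_ (hfc.fderiv ℝ)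
    exact hf.fderiv_right (by push_cast; rfl)

theorem contDiff_infty_tconv (ι : V →L[ℝ] X) {K : V → ℝ} (hK : Integrable K volume) {f : X → F}
    (hf : ContDiff ℝ ((⊤ : ℕ∞) : WithTop ℕ∞) f) (hfc : HasCompactSupport f) :
    ContDiff ℝ ((⊤ : ℕ∞) : WithTop ℕ∞) (tconv ι K f) :=
  contDiff_infty.2 fun N => contDiff_tconv ι hK N (hf.of_le (by exact_mod_cast le_top)) hfc

theorem tsupport_tconv_subset (ι : V →L[ℝ] X) {K : V → ℝ} {f : X → F}
    (hK : HasCompactSupport K) (hf : HasCompactSupport f) :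
    tsupport (tconv ι K f) ⊆ (fun q : X × V => q.1 + ι q.2) '' (tsupport f ×ˢ tsupport K) := by
  have hc : IsCompact ((fun q : X × V => q.1 + ι q.2) '' (tsupport f ×ˢ tsupport K)) :=
    (hf.isCompact.prod hK.isCompact).image (by fun_prop)
  refine closure_minimal (fun z hz => ?_) hc.isClosed
  by_contra hcon
  apply hz
  refine integral_eq_zero_of_ae (Eventually.of_forall fun y => ?_)
  by_cases hy : y ∈ tsupport K
  · by_cases hzy : z - ι y ∈ tsupport f
    · exact absurd ⟨(z - ι y, y), ⟨hzy, hy⟩, by simp⟩ hcon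
    · simp [image_eq_zero_of_notMem_tsupport hzy]
  · simp [image_eq_zero_of_notMem_tsupport hy]

theorem hasCompactSupport_tconv (ι : V →L[ℝ] X) {K : V → ℝ} {f : X → F}
    (hK : HasCompactSupport K) (hf : HasCompactSupport f) : HasCompactSupport (tconv ι K f) :=
  ((hf.isCompact.prod hK.isCompact).image (by fun_prop)).of_isClosed_subset
    (isClosed_tsupport _) (tsupport_tconv_subset ι hK hf)

end TransConv

/-! ### Correlations of square integrable functions -/

theorem integrable_mul_of_memLp {Y : Type} [MeasurableSpace Y] {μ : Measure Y} {p q : ℝ≥0∞}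
    [hpq : p.HolderConjugate q] {G h : Y → ℂ} (hG : MemLp G p μ) (hh : MemLp h q μ) :
    Integrable (fun z => G z * h z) μ :=
  hG.integrable_mul hh

theorem integral_norm_mul_le {Y : Type} [MeasurableSpace Y] {μ : Measure Y} {p q : ℝ≥0∞}
    [hpq : p.HolderConjugate q] {G h : Y → ℂ} (hG : MemLp G p μ) (hh : MemLp h q μ) :
    ∫ z, ‖G z * h z‖ ∂μ ≤ (eLpNorm G p μ).toReal * (eLpNorm h q μ).toReal := by
  have h1 : eLpNorm (fun z => G z * h z) 1 μ ≤ eLpNorm G p μ * eLpNorm h q μ := by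
    have := eLpNorm_smul_le_mul_eLpNorm (p := p) (q := q) (r := 1) hh.1 hG.1
    exact this
  change ∫ z, ‖(G * h) z‖ ∂μ ≤ _
  rw [← ENNReal.toReal_mul, integral_norm_eq_lintegral_enorm (hG.1.mul hh.1),
    ← eLpNorm_one_eq_lintegral_enorm]
  exact ENNReal.toReal_mono (ENNReal.mul_ne_top hG.2.ne hh.2.ne) h1

theorem norm_integral_mul_le {Y : Type} [MeasurableSpace Y] {μ : Measure Y} {p q : ℝ≥0∞}
    [hpq : p.HolderConjugate q] {G h : Y → ℂ} (hG : MemLp G p μ) (hh : MemLp h q μ) :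
    ‖∫ z, G z * h z ∂μ‖ ≤ (eLpNorm G p μ).toReal * (eLpNorm h q μ).toReal :=
  (norm_integral_le_integral_norm _).trans (integral_norm_mul_le hG hh)

section Correlation

variable {V X : Type} [NormedAddCommGroup V] [NormedSpace ℝ V] [MeasureSpace V] [BorelSpace V]
  [FiniteDimensional ℝ V] [(volume : Measure V).IsAddHaarMeasure]
  [NormedAddCommGroup X] [NormedSpace ℝ X] [MeasureSpace X] [BorelSpace X]
  [FiniteDimensional ℝ X] [(volume : Measure X).IsAddHaarMeasure]

/-- The correlation `∫ G(z) f(z - ι y) dz`. -/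
def correl (ι : V →L[ℝ] X) (G f : X → ℂ) (y : V) : ℂ := ∫ z, G z * f (z - ι y)

theorem MemLp_comp_sub {p : ℝ≥0∞} {f : X → ℂ} (hf : MemLp f p volume) (a : X) :
    MemLp (fun z => f (z - a)) p volume :=
  hf.comp_measurePreserving (measurePreserving_sub_right volume a)

theorem eLpNorm_comp_sub {p : ℝ≥0∞} {f : X → ℂ} (hf : AEStronglyMeasurable f volume) (a : X) :
    eLpNorm (fun z => f (z - a)) p volume = eLpNorm f p volume :=
  eLpNorm_comp_measurePreserving hf (measurePreserving_sub_right volume a)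

theorem norm_correl_le (ι : V →L[ℝ] X) {p q : ℝ≥0∞} [hpq : p.HolderConjugate q] {G f : X → ℂ}
    (hG : MemLp G p volume) (hf : MemLp f q volume) (y : V) :
    ‖correl ι G f y‖ ≤ (eLpNorm G p volume).toReal * (eLpNorm f q volume).toReal := by
  refine (norm_integral_mul_le hG (MemLp_comp_sub hf (ι y))).trans_eq ?_
  rw [eLpNorm_comp_sub hf.1]

theorem continuous_correl_of_compact (ι : V →L[ℝ] X) {G f : X → ℂ} (hG : Continuous G)
    (hGc : HasCompactSupport G) (hf : Continuous f) (hfc : HasCompactSupport f) :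
    Continuous (correl ι G f) := by
  obtain ⟨D, hD⟩ := hf.bounded_above_of_compact_support hfc
  refine continuous_of_dominated (bound := fun z => ‖G z‖ * D)
    (fun y => (hG.mul (hf.comp (by fun_prop : Continuous fun z => z - ι y))).aestronglyMeasurable)
    (fun y => Eventually.of_forall fun z => ?_)
    ((hG.integrable_of_hasCompactSupport hGc).norm.mul_const D)
    (Eventually.of_forall fun z => by fun_prop)
  rw [norm_mul]
  exact mul_le_mul_of_nonneg_left (hD _) (norm_nonneg _)

theorem eventually_correl_eq_zero (ι : V →L[ℝ] X) (hι : ∀ y, ‖y‖ ≤ ‖ι y‖) {G f : X → ℂ}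
    (hGc : HasCompactSupport G) (hfc : HasCompactSupport f) :
    ∀ᶠ y in cocompact V, correl ι G f y = 0 := by
  obtain ⟨R, hR⟩ := hGc.isCompact.isBounded.exists_norm_le
  obtain ⟨S, hS⟩ := hfc.isCompact.isBounded.exists_norm_le
  have hb : {y : V | ‖y‖ ≤ R + S}ᶜ ∈ cocompact V := by
    have : {y : V | ‖y‖ ≤ R + S} = Metric.closedBall 0 (R + S) := by ext; simp
    rw [this]
    exact (isCompact_closedBall _ _).compl_mem_cocompact
  filter_upwards [hb] with y hy
  refine integral_eq_zero_of_ae (Eventually.of_forall fun z => ?_)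
  by_cases hz : z ∈ tsupport G
  · by_cases hz' : z - ι y ∈ tsupport f
    · exfalso
      apply hy
      have h1 := hR z hz
      have h2 := hS _ hz'
      have h3 : ‖ι y‖ ≤ ‖z‖ + ‖z - ι y‖ := by
        have := norm_sub_le z (z - ι y); simpa using this
      exact (hι y).trans (h3.trans (add_le_add h1 h2))
    · simp [image_eq_zero_of_notMem_tsupport hz']
  · simp [image_eq_zero_of_notMem_tsupport hz]

/-- Cauchy–Schwarz bounds a correlation uniformly in the translation, so L² approximation by
continuous functions of compact support is uniform in `y`. Continuity and decay at infinity thus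
reduce to that case. -/
theorem exists_correl_approx {G f : X → ℂ} (hG : MemLp G 2 volume)
    (hf : MemLp f 2 volume) {ε : ℝ} (hε : 0 < ε) :
    ∃ g h : X → ℂ, Continuous g ∧ HasCompactSupport g ∧ Continuous h ∧ HasCompactSupport h ∧
      ∀ (ι : V →L[ℝ] X) (y : V), ‖correl ι G f y - correl ι g h y‖ ≤ ε := by
  set a := (eLpNorm G 2 volume).toReal
  set b := (eLpNorm f 2 volume).toReal
  have ha : 0 ≤ a := ENNReal.toReal_nonneg
  have hb : 0 ≤ b := ENNReal.toReal_nonneg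
  -- The total error is at most δb + (a + δ)δ, which is at most δ(a + b + 1) once δ ≤ 1.
  set δ := min 1 (ε / (a + b + 1)) with hδ
  have hδ0 : 0 < δ := by positivity
  obtain ⟨g, hgc, hge, hg, hgm⟩ := hG.exists_hasCompactSupport_eLpNorm_sub_le
    (by norm_num) (ε := ENNReal.ofReal δ) (by simpa using hδ0)
  obtain ⟨h, hhc, hhe, hh, hhm⟩ := hf.exists_hasCompactSupport_eLpNorm_sub_le
    (by norm_num) (ε := ENNReal.ofReal δ) (by simpa using hδ0)
  refine ⟨g, h, hg, hgc, hh, hhc, fun ι y => ?_⟩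
  have hGg : MemLp (G - g) 2 volume := hG.sub hgm
  have hfh : MemLp (f - h) 2 volume := hf.sub hhm
  have e1 : (eLpNorm (G - g) 2 volume).toReal ≤ δ := ENNReal.toReal_le_of_le_ofReal hδ0.le hge
  have e2 : (eLpNorm (f - h) 2 volume).toReal ≤ δ := ENNReal.toReal_le_of_le_ofReal hδ0.le hhe
  have e3 : (eLpNorm g 2 volume).toReal ≤ a + δ := by
    have : eLpNorm g 2 volume ≤ eLpNorm G 2 volume + eLpNorm (G - g) 2 volume := by
      have := eLpNorm_sub_le (p := 2) hG.1 hGg.1 (by norm_num)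
      simpa using this
    refine (ENNReal.toReal_mono (ENNReal.add_ne_top.2 ⟨hG.2.ne, hGg.2.ne⟩) this).trans ?_
    rw [ENNReal.toReal_add hG.2.ne hGg.2.ne]
    exact add_le_add le_rfl e1
  have split : correl ι G f y - correl ι g h y = correl ι (G - g) f y + correl ι g (f - h) y := by
    have i1 := integrable_mul_of_memLp hG (MemLp_comp_sub hf (ι y))
    have i2 := integrable_mul_of_memLp hgm (MemLp_comp_sub hhm (ι y))
    have i3 := integrable_mul_of_memLp hGg (MemLp_comp_sub hf (ι y))
    have i4 := integrable_mul_of_memLp hgm (MemLp_comp_sub hfh (ι y))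
    unfold correl
    rw [← integral_sub i1 i2, ← integral_add i3 i4]
    refine integral_congr_ae (Eventually.of_forall fun z => ?_)
    simp only [Pi.sub_apply]; ring
  rw [split]
  refine (norm_add_le _ _).trans ?_
  have n1 := norm_correl_le ι hGg hf y
  have n2 := norm_correl_le ι hgm hfh y
  have : δ * (a + b + 1) ≤ ε := by
    have : δ ≤ ε / (a + b + 1) := min_le_right _ _
    rwa [le_div_iff₀ (by positivity)] at this
  have hδ1 : δ ≤ 1 := min_le_left _ _
  calc _ ≤ δ * b + (a + δ) * δ := add_le_add (n1.trans (mul_le_mul_of_nonneg_right e1 hb))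
        (n2.trans (mul_le_mul e3 e2 ENNReal.toReal_nonneg (by positivity)))
    _ ≤ δ * (a + b + 1) := by nlinarith
    _ ≤ ε := this

theorem continuous_correl (ι : V →L[ℝ] X) {G f : X → ℂ} (hG : MemLp G 2 volume)
    (hf : MemLp f 2 volume) : Continuous (correl ι G f) := by
  refine continuous_of_uniform_approx_of_continuous fun u hu => ?_
  obtain ⟨ε, hε, hεu⟩ := Metric.mem_uniformity_dist.1 hu
  obtain ⟨g, h, hg, hgc, hh, hhc, H⟩ := exists_correl_approx (V := V) hG hf (half_pos hε)
  refine ⟨correl ι g h, continuous_correl_of_compact ι hg hgc hh hhc, fun y => hεu ?_⟩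
  rw [dist_eq_norm]
  exact (H ι y).trans_lt (half_lt_self hε)

theorem tendsto_correl_cocompact (ι : V →L[ℝ] X) (hι : ∀ y, ‖y‖ ≤ ‖ι y‖) {G f : X → ℂ}
    (hG : MemLp G 2 volume) (hf : MemLp f 2 volume) :
    Tendsto (correl ι G f) (cocompact V) (𝓝 0) := by
  rw [Metric.tendsto_nhds]
  intro ε hε
  obtain ⟨g, h, hg, hgc, hh, hhc, H⟩ := exists_correl_approx (V := V) hG hf (half_pos hε)
  filter_upwards [eventually_correl_eq_zero ι hι hgc hhc] with y hy
  have := H ι y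
  rw [hy, sub_zero] at this
  rw [dist_zero_right]
  exact this.trans_lt (half_lt_self hε)

/-- A pairing with a mollified function is an average of correlations, so removing the mollification
is continuity of the correlation at 0; no convergence of mollifiers in L² is needed. -/
theorem integral_mul_tconv_eq_correl (ι : V →L[ℝ] X) {K : V → ℝ} {f G : X → ℂ} {p q : ℝ≥0∞}
    [hpq : p.HolderConjugate q] (hK : Integrable K volume) (hG : MemLp G p volume)
    (hf : MemLp f q volume) :
    ∫ z, G z * tconv ι K f z = ∫ y, (K y : ℂ) * correl ι G f y := by
  refine integral_mul_tconv ι hK hf.1 hG.1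
    (C := (eLpNorm G p volume).toReal * (eLpNorm f q volume).toReal) (fun y _ =>
      integrable_mul_of_memLp hG (MemLp_comp_sub hf (ι y))) fun y _ => ?_
  refine (integral_norm_mul_le hG (MemLp_comp_sub hf (ι y))).trans_eq ?_
  rw [eLpNorm_comp_sub hf.1]

end Correlation

/-! ### Weak derivatives -/

section WeakDeriv

/-- `g` is the weak derivative of `f` on `Ω` in the direction `v`. -/
def WeakDeriv {X : Type} [NormedAddCommGroup X] [NormedSpace ℝ X] [MeasureSpace X]
    (Ω : Set X) (v : X) (f g : X → ℂ) : Prop :=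
  ∀ θ : X → ℝ, ContDiff ℝ ((⊤ : ℕ∞) : WithTop ℕ∞) θ → HasCompactSupport θ → tsupport θ ⊆ Ω →
    ∫ x, (θ x : ℂ) * g x = - ∫ x, ((fderiv ℝ θ x v : ℝ) : ℂ) * f x

theorem lineDeriv_funDistr_eq_iff {X : Type} [NormedAddCommGroup X] [NormedSpace ℝ X]
    [MeasureSpace X] [OpensMeasurableSpace X] {Ω : TopologicalSpace.Opens X} {v : X} {f g : X → ℂ}
    (hf : LocallyIntegrableOn f Ω volume) (hg : LocallyIntegrableOn g Ω volume) :
    (∂_{v} (funDistr Ω f) = funDistr Ω g) ↔ WeakDeriv (Ω : Set X) v f g := by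
  have key : ∀ ψ : 𝓓(Ω, ℝ), (∂_{v} (funDistr Ω f)) ψ
      = - ∫ x, ((fderiv ℝ ψ x v : ℝ) : ℂ) * f x := fun ψ => by
    rw [Distribution.lineDerivOp_apply_apply, map_neg, funDistr_apply hf]
    congr 1
  constructor
  · intro h θ hθ hθc hθs
    have h1 := key ⟨θ, hθ, hθc, hθs⟩
    rw [h, funDistr_apply hg] at h1
    exact h1
  · intro h
    ext ψ
    rw [key, funDistr_apply hg]
    exact (h ψ ψ.contDiff ψ.hasCompactSupport ψ.tsupport_subset).symm

end WeakDeriv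

/-! ### Convolution and weak derivatives -/

section WeakConv

variable {V X : Type} [NormedAddCommGroup V] [NormedSpace ℝ V] [MeasureSpace V] [BorelSpace V]
  [FiniteDimensional ℝ V] [(volume : Measure V).IsAddHaarMeasure]
  [NormedAddCommGroup X] [NormedSpace ℝ X] [MeasureSpace X] [BorelSpace X]
  [FiniteDimensional ℝ X] [(volume : Measure X).IsAddHaarMeasure]

/-- The set `S - ι (tsupport K)`. -/
def sweep (ι : V →L[ℝ] X) (K : V → ℝ) (S : Set X) : Set X :=
  (fun q : X × V => q.1 - ι q.2) '' (S ×ˢ tsupport K)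

theorem isCompact_sweep (ι : V →L[ℝ] X) {K : V → ℝ} (hK : HasCompactSupport K) {S : Set X}
    (hS : IsCompact S) : IsCompact (sweep ι K S) :=
  (hS.prod hK.isCompact).image (by fun_prop)

theorem sub_mem_sweep (ι : V →L[ℝ] X) {K : V → ℝ} {S : Set X} {z : X} {y : V} (hz : z ∈ S)
    (hy : y ∈ tsupport K) : z - ι y ∈ sweep ι K S := ⟨(z, y), ⟨hz, hy⟩, rfl⟩

theorem sweep_subset (ι : V →L[ℝ] X) {K : V → ℝ} {S Ω : Set X} (hS : S ⊆ Ω)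
    (hΩ : ∀ z y, z ∈ Ω → z - ι y ∈ Ω) : sweep ι K S ⊆ Ω := by
  rintro _ ⟨⟨z, y⟩, ⟨hz, -⟩, rfl⟩
  exact hΩ z y (hS hz)

theorem tconv_indicator_sweep {F : Type} [NormedAddCommGroup F] [NormedSpace ℝ F]
    (ι : V →L[ℝ] X) {K : V → ℝ} {S : Set X} (f : X → F) {z : X} (hz : z ∈ S) :
    tconv ι K ((sweep ι K S).indicator f) z = tconv ι K f z := by
  refine integral_congr_ae (Eventually.of_forall fun y => ?_)
  by_cases hy : y ∈ tsupport K
  · simp only [Set.indicator_of_mem (sub_mem_sweep ι hz hy)]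
  · simp [image_eq_zero_of_notMem_tsupport hy]

theorem eLpNorm_tconv_restrict_le {F : Type} [NormedAddCommGroup F] [NormedSpace ℝ F]
    (ι : V →L[ℝ] X) {K : V → ℝ} {f : X → F} (hK : Integrable K volume)
    (hKc : HasCompactSupport K) {S : Set X} (hS : IsCompact S)
    (hf : AEStronglyMeasurable f (volume.restrict (sweep ι K S))) {p : ℝ≥0∞} (hp : 1 ≤ p)
    (hpt : p ≠ ∞) :
    eLpNorm (tconv ι K f) p (volume.restrict S) ≤
      eLpNorm K 1 volume * eLpNorm f p (volume.restrict (sweep ι K S)) := by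
  have hm := (isCompact_sweep ι hKc hS).measurableSet
  rw [← eLpNorm_indicator_eq_eLpNorm_restrict hm]
  refine le_trans ?_ (eLpNorm_tconv_le ι hK ((aestronglyMeasurable_indicator_iff hm).2 hf) hp hpt)
  refine le_trans (eLpNorm_congr_ae ?_).le (eLpNorm_restrict_le _ _ _ S)
  filter_upwards [ae_restrict_mem hS.measurableSet] with z hz
  exact (tconv_indicator_sweep ι f hz).symm

theorem memLp_tconv_restrict {F : Type} [NormedAddCommGroup F] [NormedSpace ℝ F]
    (ι : V →L[ℝ] X) {K : V → ℝ} {f : X → F} (hK : Integrable K volume)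
    (hKc : HasCompactSupport K) {S : Set X} (hS : IsCompact S) {p : ℝ≥0∞}
    (hf : MemLp f p (volume.restrict (sweep ι K S))) (hp : 1 ≤ p) (hpt : p ≠ ∞) :
    MemLp (tconv ι K f) p (volume.restrict S) := by
  have hm := (isCompact_sweep ι hKc hS).measurableSet
  refine ⟨?_, (eLpNorm_tconv_restrict_le ι hK hKc hS hf.1 hp hpt).trans_lt
    (ENNReal.mul_lt_top (memLp_one_iff_integrable.2 hK).2 hf.2)⟩
  refine (aestronglyMeasurable_tconv ι hK.1
    ((aestronglyMeasurable_indicator_iff hm).2 hf.1)).restrict.congr ?_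
  filter_upwards [ae_restrict_mem hS.measurableSet] with z hz
  exact tconv_indicator_sweep ι f hz

theorem locallyIntegrableOn_tconv (ι : V →L[ℝ] X) {K : V → ℝ} {f : X → ℂ} {Ω : Set X}
    (hΩo : IsOpen Ω) (hΩ : ∀ z y, z ∈ Ω → z - ι y ∈ Ω) (hK : Integrable K volume)
    (hKc : HasCompactSupport K) (hf : LocallyIntegrableOn f Ω volume) :
    LocallyIntegrableOn (tconv ι K f) Ω volume := by
  rw [locallyIntegrableOn_iff hΩo.isLocallyClosed] at hf ⊢
  intro S hSΩ hS
  have := hf _ (sweep_subset ι hSΩ hΩ) (isCompact_sweep ι hKc hS)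
  exact memLp_one_iff_integrable.1 (memLp_tconv_restrict ι hK hKc hS
    (memLp_one_iff_integrable.2 this) le_rfl (by simp))

theorem tconv_ofReal (ι : V →L[ℝ] X) (K : V → ℝ) (f : X → ℝ) (z : X) :
    tconv ι K (fun z => (f z : ℂ)) z = ((tconv ι K f z : ℝ) : ℂ) := by
  unfold tconv
  rw [← integral_complex_ofReal]
  simp

/-- The adjoint of the convolution operator. -/
theorem integral_mul_tconv_adjoint (ι : V →L[ℝ] X) {K : V → ℝ} {f : X → ℂ} {θ : X → ℝ} {Ω : Set X}
    (hΩo : IsOpen Ω) (hΩ : ∀ z y, z ∈ Ω → z - ι y ∈ Ω) (hK : Integrable K volume)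
    (hKc : HasCompactSupport K) (hf : LocallyIntegrableOn f Ω volume) (hθ : Continuous θ)
    (hθc : HasCompactSupport θ) (hθs : tsupport θ ⊆ Ω) :
    ∫ z, (θ z : ℂ) * tconv ι K f z = ∫ z, ((tconv (-ι) K θ z : ℝ) : ℂ) * f z := by
  set S := sweep ι K (tsupport θ) with hSdef
  have hSc : IsCompact S := isCompact_sweep ι hKc hθc.isCompact
  have hSm := hSc.measurableSet
  -- `f` is only locally integrable on Ω. Both sides see it only on supp θ - ι(supp K), a compact
  -- subset of Ω, and truncation to this set makes Fubini's theorem available.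
  set f' := S.indicator f with hf'
  have hfi : Integrable f' volume :=
    (integrable_indicator_iff hSm).2
      (hf.integrableOn_compact_subset (sweep_subset ι hθs hΩ) hSc)
  obtain ⟨D, hD⟩ := hθ.bounded_above_of_compact_support hθc
  have hθC : Continuous fun z => (θ z : ℂ) := Complex.continuous_ofReal.comp hθ
  have hbd : ∀ a : X, Integrable (fun z => (θ z : ℂ) * f' (z - a)) volume ∧
      ∫ z, ‖(θ z : ℂ) * f' (z - a)‖ ≤ D * ∫ z, ‖f' z‖ := by
    intro a
    have hfa : Integrable (fun z => f' (z - a)) volume := hfi.comp_sub_right a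
    refine ⟨hfa.bdd_mul hθC.aestronglyMeasurable (c := D) (Eventually.of_forall fun z => ?_), ?_⟩
    · simpa using hD z
    · rw [← integral_sub_right_eq_self (fun z => ‖f' z‖) a, ← integral_const_mul]
      refine integral_mono_of_nonneg (Eventually.of_forall fun z => norm_nonneg _)
        (hfa.norm.const_mul D) (Eventually.of_forall fun z => ?_)
      simp only [norm_mul, Complex.norm_real]
      exact mul_le_mul_of_nonneg_right (hD z) (norm_nonneg _)
  have h1 : ∫ z, (θ z : ℂ) * tconv ι K f z = ∫ z, (θ z : ℂ) * tconv ι K f' z := by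
    refine integral_congr_ae (Eventually.of_forall fun z => ?_)
    by_cases hz : z ∈ tsupport θ
    · simp only [hf', hSdef, tconv_indicator_sweep ι f hz]
    · simp [image_eq_zero_of_notMem_tsupport hz]
  have h2 : ∫ z, ((tconv (-ι) K θ z : ℝ) : ℂ) * f z
      = ∫ z, f' z * tconv (-ι) K (fun z => (θ z : ℂ)) z := by
    refine integral_congr_ae (Eventually.of_forall fun z => ?_)
    simp only [tconv_ofReal]
    by_cases hz : z ∈ S
    · simp only [hf', Set.indicator_of_mem hz]; ring
    · have : tconv (-ι) K θ z = 0 := by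
        refine integral_eq_zero_of_ae (Eventually.of_forall fun y => ?_)
        by_cases hy : y ∈ tsupport K
        · have : z - (-ι) y ∉ tsupport θ := fun h => hz (by
            have := sub_mem_sweep ι (S := tsupport θ) h hy
            simpa using this)
          change K y • θ (z - (-ι) y) = 0
          rw [image_eq_zero_of_notMem_tsupport this, smul_zero]
        · simp [image_eq_zero_of_notMem_tsupport hy]
      simp [this, hf', Set.indicator_of_notMem hz]
  rw [h1, h2, integral_mul_tconv ι hK hfi.1 hθC.aestronglyMeasurable (fun y _ => (hbd _).1)
    (fun y _ => (hbd _).2)]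
  have hflip : ∀ y : V, ∀ z, f' z * (θ (z - (-ι) y) : ℂ)
      = (fun w => (θ w : ℂ) * f' (w - ι y)) (z - (-ι) y) := fun y z => by simp [mul_comm]
  rw [integral_mul_tconv (-ι) hK hθC.aestronglyMeasurable hfi.1 (C := D * ∫ z, ‖f' z‖)]
  · refine integral_congr_ae (Eventually.of_forall fun y => ?_)
    simp only [hflip]
    rw [integral_sub_right_eq_self (fun w => (θ w : ℂ) * f' (w - ι y))]
  · intro y _
    simp only [hflip]
    exact (hbd (ι y)).1.comp_sub_right _
  · intro y _
    simp only [hflip]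
    rw [integral_sub_right_eq_self (fun w => ‖(θ w : ℂ) * f' (w - ι y)‖)]
    exact (hbd (ι y)).2

theorem tsupport_tconv_neg_subset (ι : V →L[ℝ] X) {K : V → ℝ} {θ : X → ℝ} {Ω : Set X}
    (hΩ : ∀ z y, z ∈ Ω → z - ι y ∈ Ω) (hKc : HasCompactSupport K) (hθc : HasCompactSupport θ)
    (hθs : tsupport θ ⊆ Ω) : tsupport (tconv (-ι) K θ) ⊆ Ω := by
  refine (tsupport_tconv_subset (-ι) hKc hθc).trans ?_
  rintro _ ⟨⟨z, y⟩, ⟨hz, -⟩, rfl⟩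
  have := hΩ z y (hθs hz)
  simpa [sub_eq_add_neg] using this

theorem fderiv_tconv_apply (ι : V →L[ℝ] X) {K : V → ℝ} {F : Type} [NormedAddCommGroup F]
    [NormedSpace ℝ F] {f : X → F} (hK : Integrable K volume)
    (hf : ContDiff ℝ 1 f) (hfc : HasCompactSupport f) (z v : X) :
    fderiv ℝ (tconv ι K f) z v = tconv ι K (fun x => fderiv ℝ f x v) z := by
  rw [(hasFDerivAt_tconv ι hK hf hfc z).fderiv]
  unfold tconv
  have hc : Continuous (fderiv ℝ f) := hf.continuous_fderiv (by simp)
  obtain ⟨C, hC⟩ := hc.bounded_above_of_compact_support (hfc.fderiv ℝ)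
  have hi : Integrable (fun y => K y • fderiv ℝ f (z - ι y)) volume := by
    refine Integrable.mono' (hK.norm.mul_const C) (hK.1.smul
      ((hc.comp (by fun_prop : Continuous fun y => z - ι y)).aestronglyMeasurable))
      (Eventually.of_forall fun y => ?_)
    rw [norm_smul]
    exact mul_le_mul_of_nonneg_left (hC _) (norm_nonneg _)
  rw [ContinuousLinearMap.integral_apply hi]
  simp

/-- The convolution is moved onto the test function. The result is again a test function on Ω
because Ω is invariant under the translations along ι. -/
theorem WeakDeriv.tconv (ι : V →L[ℝ] X) {K : V → ℝ} {f g : X → ℂ} {Ω : Set X} {v : X}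
    (hΩo : IsOpen Ω) (hΩ : ∀ z y, z ∈ Ω → z - ι y ∈ Ω) (hK : Integrable K volume)
    (hKc : HasCompactSupport K) (hf : LocallyIntegrableOn f Ω volume)
    (hg : LocallyIntegrableOn g Ω volume) (h : WeakDeriv Ω v f g) :
    WeakDeriv Ω v (tconv ι K f) (tconv ι K g) := by
  intro θ hθ hθc hθs
  have hθ1 : ContDiff ℝ 1 θ := hθ.of_le (by exact_mod_cast le_top)
  have hd : Continuous fun x => fderiv ℝ θ x v :=
    (hθ1.continuous_fderiv (by simp)).clm_apply continuous_const
  have hdc : HasCompactSupport fun x => fderiv ℝ θ x v := hθc.fderiv_apply ℝ v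
  have hds : tsupport (fun x => fderiv ℝ θ x v) ⊆ Ω :=
    (tsupport_fderiv_apply_subset ℝ v).trans hθs
  rw [integral_mul_tconv_adjoint ι hΩo hΩ hK hKc hg hθ.continuous hθc hθs,
    integral_mul_tconv_adjoint ι hΩo hΩ hK hKc hf hd hdc hds,
    h _ (contDiff_infty_tconv (-ι) hK hθ hθc) (hasCompactSupport_tconv (-ι) hKc hθc)
      (tsupport_tconv_neg_subset ι hΩ hKc hθc hθs)]
  congr 1
  refine integral_congr_ae (Eventually.of_forall fun z => ?_)
  simp only [fderiv_tconv_apply (-ι) hK hθ1 hθc]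

theorem tconv_fderiv_kernel (ι : V →L[ℝ] X) {κ : V → ℝ} {θ : X → ℝ} {b : V}
    (hκ : ContDiff ℝ 1 κ) (hκc : HasCompactSupport κ) (hθ : ContDiff ℝ 1 θ) (z : X) :
    tconv ι (fun y => fderiv ℝ κ y b) θ z = tconv ι κ (fun x => fderiv ℝ θ x (ι b)) z := by
  have hd : Continuous fun y => fderiv ℝ κ y b :=
    (hκ.continuous_fderiv (by simp)).clm_apply continuous_const
  have hdc : HasCompactSupport fun y => fderiv ℝ κ y b := hκc.fderiv_apply ℝ b
  have hc1 : Continuous fun y => θ (z - ι y) := hθ.continuous.comp (by fun_prop)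
  have hθ' : Continuous fun x => fderiv ℝ θ x (ι b) :=
    (hθ.continuous_fderiv (by simp)).clm_apply continuous_const
  have hder : ∀ y, HasFDerivAt (fun y => θ (z - ι y)) (-((fderiv ℝ θ (z - ι y)).comp ι)) y := by
    intro y
    have h1 : HasFDerivAt θ (fderiv ℝ θ (z - ι y)) (z - ι y) :=
      (hθ.differentiable (by simp) _).hasFDerivAt
    have h2 : HasFDerivAt (fun y => z - ι y) (-ι) y := ι.hasFDerivAt.const_sub z
    have := h1.comp y h2
    rw [ContinuousLinearMap.comp_neg] at this
    exact this
  have hfd : ∀ y, fderiv ℝ (fun y => θ (z - ι y)) y b = - fderiv ℝ θ (z - ι y) (ι b) := by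
    intro y; rw [(hder y).fderiv]; simp
  have hc2 : Continuous fun y => fderiv ℝ (fun y => θ (z - ι y)) y b := by
    simp only [hfd]
    exact (hθ'.comp (by fun_prop : Continuous fun y => z - ι y)).neg
  have := integral_mul_fderiv_eq_neg_fderiv_mul_of_integrable (μ := (volume : Measure V))
    (f := κ) (g := fun y => θ (z - ι y)) (v := b)
    ((hd.mul hc1).integrable_of_hasCompactSupport hdc.mul_right)
    ((hκ.continuous.mul hc2).integrable_of_hasCompactSupport hκc.mul_right)
    ((hκ.continuous.mul hc1).integrable_of_hasCompactSupport hκc.mul_right)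
    (fun y _ => hκ.differentiable (by simp) y) (fun y _ => (hder y).differentiableAt)
  simp only [hfd, mul_neg, integral_neg, neg_inj] at this
  simp only [tconv, smul_eq_mul]
  exact this.symm

/-- `(∂_b κ) * f = κ * ∂_b f` for weak derivatives. -/
theorem tconv_fderiv_kernel_ae_eq (ι : V →L[ℝ] X) {κ : V → ℝ} {f g : X → ℂ} {Ω : Set X} {b : V}
    (hΩo : IsOpen Ω) (hΩ : ∀ z y, z ∈ Ω → z - ι y ∈ Ω) (hκ : ContDiff ℝ 1 κ)
    (hκc : HasCompactSupport κ) (hf : LocallyIntegrableOn f Ω volume)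
    (hg : LocallyIntegrableOn g Ω volume) (h : WeakDeriv Ω (ι b) f g) :
    ∀ᵐ z, z ∈ Ω → tconv ι (fun y => fderiv ℝ κ y b) f z = tconv ι κ g z := by
  have hd : Continuous fun y => fderiv ℝ κ y b :=
    (hκ.continuous_fderiv (by simp)).clm_apply continuous_const
  have hdc : HasCompactSupport fun y => fderiv ℝ κ y b := hκc.fderiv_apply ℝ b
  have hdi := hd.integrable_of_hasCompactSupport (μ := volume) hdc
  have hκi := hκ.continuous.integrable_of_hasCompactSupport (μ := volume) hκc
  have l1 := locallyIntegrableOn_tconv ι hΩo hΩ hdi hdc hf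
  have l2 := locallyIntegrableOn_tconv ι hΩo hΩ hκi hκc hg
  have := hΩo.ae_eq_zero_of_integral_contDiff_smul_eq_zero (l1.sub l2) fun θ hθ hθc hθs => by
    have hθ1 : ContDiff ℝ 1 θ := hθ.of_le (by exact_mod_cast le_top)
    have hint : ∀ {w : X → ℂ}, LocallyIntegrableOn w Ω volume →
        Integrable (fun x => (θ x : ℂ) * w x) volume := fun hw => by
      have := TestFunction.integrable_bilin (ContinuousLinearMap.lsmul ℝ ℝ) (Ω := ⟨Ω, hΩo⟩) hw
        (⟨θ, hθ, hθc, hθs⟩ : 𝓓(⟨Ω, hΩo⟩, ℝ))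
      simpa using this
    simp only [Pi.sub_apply, Complex.real_smul, mul_sub]
    rw [integral_sub (hint l1) (hint l2), sub_eq_zero,
      integral_mul_tconv_adjoint ι hΩo hΩ hdi hdc hf hθ.continuous hθc hθs,
      integral_mul_tconv_adjoint ι hΩo hΩ hκi hκc hg hθ.continuous hθc hθs,
      h _ (contDiff_infty_tconv (-ι) hκi hθ hθc) (hasCompactSupport_tconv (-ι) hκc hθc)
      (tsupport_tconv_neg_subset ι hΩ hκc hθc hθs), ← integral_neg]
    refine integral_congr_ae (Eventually.of_forall fun z => ?_)
    simp only [fderiv_tconv_apply (-ι) hκi hθ1 hθc, tconv_fderiv_kernel (-ι) hκ hκc hθ1]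
    have : ∀ x, fderiv ℝ θ x ((-ι) b) = - fderiv ℝ θ x (ι b) := fun x => by simp
    simp only [this, tconv, smul_neg, integral_neg]
    push_cast; ring
  filter_upwards [this] with z hz hzΩ
  exact sub_eq_zero.1 (hz hzΩ)

end WeakConv

/-! ### Cutoff functions -/

theorem exists_unit_cutoff (X : Type) [NormedAddCommGroup X] [NormedSpace ℝ X]
    [FiniteDimensional ℝ X] :
    ∃ Θ : X → ℝ, ContDiff ℝ ((⊤ : ℕ∞) : WithTop ℕ∞) Θ ∧ HasCompactSupport Θ ∧
      (∀ z, 0 ≤ Θ z ∧ Θ z ≤ 1) ∧ (∀ z, ‖z‖ ≤ 1 → Θ z = 1) ∧ (∀ z, 2 ≤ ‖z‖ → Θ z = 0) := by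
  let Θ : ContDiffBump (0 : X) := ⟨1, 2, one_pos, one_lt_two⟩
  refine ⟨Θ, Θ.contDiff, Θ.hasCompactSupport, fun z => ⟨Θ.nonneg, Θ.le_one⟩, fun z hz => ?_,
    fun z hz => ?_⟩
  · exact Θ.one_of_mem_closedBall (by rw [mem_closedBall_zero_iff]; exact hz)
  · exact Θ.zero_of_le_dist (by rw [dist_zero_right]; exact hz)

/-- All the cutoffs are dilations of one bump, which makes the constants independent of `R`. -/
theorem exists_cutoff (X : Type) [NormedAddCommGroup X] [NormedSpace ℝ X] [FiniteDimensional ℝ X] :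
    ∃ (C : ℝ) (D : X → ℝ), 0 ≤ C ∧ ∀ R : ℝ, 0 < R → ∃ θ : X → ℝ,
      ContDiff ℝ ((⊤ : ℕ∞) : WithTop ℕ∞) θ ∧ HasCompactSupport θ ∧
      (∀ z, 0 ≤ θ z ∧ θ z ≤ 1) ∧ (∀ z, ‖z‖ ≤ R → θ z = 1) ∧ (∀ z, ‖fderiv ℝ θ z‖ ≤ C / R) ∧
      (∀ z, ‖z‖ < R → fderiv ℝ θ z = 0) ∧ (∀ z, 2 * R < ‖z‖ → fderiv ℝ θ z = 0) ∧
      (∀ v z, ‖fderiv ℝ (fun x => fderiv ℝ θ x v) z v‖ ≤ D v / R ^ 2) := by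
  obtain ⟨Θ, hΘ, hΘc, hΘ01, hΘone, hΘzero⟩ := exists_unit_cutoff X
  have hΘ1 : ContDiff ℝ ((⊤ : ℕ∞) : WithTop ℕ∞) (fderiv ℝ Θ) := hΘ.fderiv_right (by simp)
  have hΘv : ∀ v, ContDiff ℝ ((⊤ : ℕ∞) : WithTop ℕ∞) fun x => fderiv ℝ Θ x v :=
    fun v => hΘ1.clm_apply contDiff_const
  obtain ⟨C1, hC1⟩ := hΘ1.continuous.bounded_above_of_compact_support (hΘc.fderiv ℝ)
  have hD : ∀ v, ∃ D : ℝ, ∀ z, ‖fderiv ℝ (fun x => fderiv ℝ Θ x v) z v‖ ≤ D := fun v =>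
    (((hΘv v).continuous_fderiv (by simp)).clm_apply
      continuous_const).bounded_above_of_compact_support ((hΘc.fderiv_apply ℝ v).fderiv_apply ℝ v)
  choose D hD using hD
  have hC0 : 0 ≤ C1 := (norm_nonneg _).trans (hC1 0)
  refine ⟨C1, D, hC0, fun R hR => ?_⟩
  have hRi : (0 : ℝ) < R⁻¹ := inv_pos.2 hR
  have hsm : ContDiff ℝ ((⊤ : ℕ∞) : WithTop ℕ∞) fun z : X => R⁻¹ • z := contDiff_const_smul _
  have hd1 : ∀ z : X, fderiv ℝ (fun z : X => Θ (R⁻¹ • z)) z = R⁻¹ • fderiv ℝ Θ (R⁻¹ • z) :=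
    fun z => by rw [fderiv_comp_smul]
  have hd2 : ∀ v z : X, fderiv ℝ (fun x => fderiv ℝ (fun z : X => Θ (R⁻¹ • z)) x v) z v
      = R⁻¹ * (R⁻¹ * fderiv ℝ (fun x => fderiv ℝ Θ x v) (R⁻¹ • z) v) := fun v z => by
    rw [show (fun x => fderiv ℝ (fun z : X => Θ (R⁻¹ • z)) x v)
      = fun x => R⁻¹ * (fun x => fderiv ℝ Θ x v) (R⁻¹ • x) from
      funext fun x => by rw [hd1]; rfl]
    have hdiff : DifferentiableAt ℝ (fun x => (fun x => fderiv ℝ Θ x v) (R⁻¹ • x)) z :=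
      ((hΘv v).comp hsm).differentiable (by simp) z
    have h3 := fderiv_comp_smul (𝕜 := ℝ) (f := fun x => fderiv ℝ Θ x v) (x := z) R⁻¹
    rw [fderiv_const_mul hdiff, h3]
    rfl
  have hn : ∀ z : X, ‖R⁻¹ • z‖ = R⁻¹ * ‖z‖ := fun z => by
    rw [norm_smul, Real.norm_of_nonneg hRi.le]
  have hnc : Continuous fun z : X => ‖R⁻¹ • z‖ := by fun_prop
  refine ⟨fun z => Θ (R⁻¹ • z), hΘ.comp hsm, hΘc.comp_smul hRi.ne', fun z => hΘ01 _,
    fun z hz => hΘone _ ?_, fun z => ?_, fun z hz => ?_, fun z hz => ?_, fun v z => ?_⟩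
  · rw [hn, inv_mul_le_iff₀ hR]; simpa using hz
  · rw [hd1, norm_smul, Real.norm_of_nonneg hRi.le, div_eq_inv_mul]
    exact mul_le_mul_of_nonneg_left (hC1 _) hRi.le
  · have h1 : ‖R⁻¹ • z‖ < 1 := by rw [hn, inv_mul_lt_iff₀ hR]; simpa using hz
    have : (fun z => Θ (R⁻¹ • z)) =ᶠ[𝓝 z] fun _ => 1 := by
      filter_upwards [hnc.continuousAt.eventually_lt_const h1] with w hw using hΘone _ hw.le
    rw [this.fderiv_eq]; simp
  · have h1 : 2 < ‖R⁻¹ • z‖ := by rw [hn, lt_inv_mul_iff₀ hR]; linarith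
    have : (fun z => Θ (R⁻¹ • z)) =ᶠ[𝓝 z] fun _ => 0 := by
      filter_upwards [hnc.continuousAt.eventually_const_lt h1] with w hw using hΘzero _ hw.le
    rw [this.fderiv_eq]; simp
  · rw [hd2, norm_mul, norm_mul, Real.norm_of_nonneg hRi.le, ← mul_assoc,
      show D v / R ^ 2 = R⁻¹ * R⁻¹ * D v by field_simp]
    exact mul_le_mul_of_nonneg_left (hD _ _) (by positivity)

/-! ### One-dimensional estimates -/

theorem enorm_intervalIntegral_sq_le {F : Type} [NormedAddCommGroup F] [NormedSpace ℝ F]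
    {h : ℝ → F} (hh : AEStronglyMeasurable h (volume.restrict (Set.Ioi 0))) {t : ℝ} (ht : 0 ≤ t) :
    ‖∫ s in (0 : ℝ)..t, h s‖ₑ ^ (2 : ℝ) ≤
      ENNReal.ofReal t * ∫⁻ s in Set.Ioi 0, ‖h s‖ₑ ^ (2 : ℝ) := by
  rw [intervalIntegral.integral_of_le ht]
  have hsub : Set.Ioc 0 t ⊆ Set.Ioi (0 : ℝ) := fun s hs => hs.1
  have h1 := lintegral_mul_rpow_le (μ := volume.restrict (Set.Ioc 0 t)) (a := fun _ => 1)
    (b := fun s => ‖h s‖ₑ) aemeasurable_const (hh.mono_set hsub).enorm one_le_two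
  simp only [one_mul, lintegral_const, Measure.restrict_apply_univ, Real.volume_Ioc, sub_zero] at h1
  refine (ENNReal.rpow_le_rpow (enorm_integral_le_lintegral_enorm _) (by norm_num)).trans ?_
  refine h1.trans ?_
  rw [show (2 : ℝ) - 1 = 1 by norm_num, ENNReal.rpow_one]
  gcongr

/-! ### The zero extension -/

section ZeroExtension

variable {n : ℕ}

theorem dir_zero : (dir 0 : Space n) = ((1 : ℝ), (0 : Bdry n)) := rfl

theorem dir_succ (j : Fin n) :
    (dir j.succ : Space n) = ((0 : ℝ), EuclideanSpace.single j (1 : ℝ)) := rfl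

/-- A function whose slices tend to zero in `L¹_loc` as `t → 0`. -/
def VanishesAtBdry (v : Space n → ℂ) : Prop :=
  ∀ K : Set (Bdry n), IsCompact K →
    Tendsto (fun t : ℝ => eLpNorm (fun x => v (t, x)) 1 (volume.restrict K))
      (𝓝[>] 0 ⊓ ae volume) (𝓝 0)

theorem VanishesAtBdry.exists_slab {v : Space n → ℂ} (h : VanishesAtBdry v) {K : Set (Bdry n)}
    (hK : IsCompact K) {ε : ℝ≥0∞} (hε : 0 < ε) :
    ∃ δ : ℝ, 0 < δ ∧ ∀ᵐ t : ℝ, t ∈ Set.Ioo 0 δ →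
      ∫⁻ x in K, ‖v (t, x)‖ₑ ≤ ε := by
  have h1 := (h K hK).eventually (ge_mem_nhds hε)
  obtain ⟨s, hs, r, hr, hsr⟩ := Filter.mem_inf_iff_superset.1 h1
  obtain ⟨δ, hδ, hδs⟩ := mem_nhdsGT_iff_exists_Ioo_subset.1 hs
  refine ⟨δ, hδ, ?_⟩
  filter_upwards [hr] with t ht htδ
  have := hsr ⟨hδs htδ, ht⟩
  simpa [eLpNorm_one_eq_lintegral_enorm] using this

theorem lintegral_slab {v : Space n → ℂ} (hvm : AEStronglyMeasurable v volume) {a b : ℝ}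
    {K : Set (Bdry n)} {ε : ℝ≥0∞}
    (h : ∀ᵐ t : ℝ, t ∈ Set.Ioo a b → ∫⁻ x in K, ‖v (t, x)‖ₑ ≤ ε) :
    ∫⁻ z in Set.Ioo a b ×ˢ K, ‖v z‖ₑ ≤ ENNReal.ofReal (b - a) * ε := by
  rw [Measure.volume_eq_prod, ← Measure.prod_restrict]
  rw [lintegral_prod _ (by
    rw [Measure.prod_restrict, ← Measure.volume_eq_prod]; exact hvm.enorm.restrict)]
  refine (lintegral_mono_ae ((ae_restrict_iff' measurableSet_Ioo).2 h)).trans ?_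
  rw [lintegral_const, Measure.restrict_apply_univ, Real.volume_Ioo, mul_comm]

theorem exists_box {S : Set (Space n)} (hS : IsCompact S) :
    ∃ M : ℝ, 0 < M ∧ ∀ z ∈ S, |z.1| ≤ M ∧ z.2 ∈ Metric.closedBall (0 : Bdry n) M := by
  obtain ⟨M, hM⟩ := hS.isBounded.exists_norm_le
  refine ⟨max M 1, by positivity, fun z hz => ⟨?_, ?_⟩⟩
  · exact ((norm_fst_le z).trans (hM z hz)).trans (le_max_left _ _)
  · rw [mem_closedBall_zero_iff]
    exact ((norm_snd_le z).trans (hM z hz)).trans (le_max_left _ _)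

/-- A compact set is covered by three pieces: a thin slab at the boundary, where the slices are
bounded in L¹; a compact part of the open half-space; and the complement of the half-space, where
`v` vanishes. -/
theorem VanishesAtBdry.locallyIntegrable {v : Space n → ℂ} (hv : VanishesAtBdry v)
    (hvm : AEStronglyMeasurable v volume) (hv0 : ∀ z ∉ half n, v z = 0)
    (hvl : LocallyIntegrableOn v (half n) volume) : LocallyIntegrable v volume := by
  rw [locallyIntegrable_iff]
  intro S hS
  obtain ⟨M, hM0, hM⟩ := exists_box hS
  obtain ⟨δ, hδ, h1⟩ := hv.exists_slab (isCompact_closedBall (0 : Bdry n) M) one_pos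
  have i1 : IntegrableOn v (Set.Ioo 0 δ ×ˢ Metric.closedBall (0 : Bdry n) M) volume := by
    refine ⟨hvm.restrict, ?_⟩
    exact (lintegral_slab hvm h1).trans_lt (by simp)
  have i2 : IntegrableOn v (S ∩ {z | δ / 2 ≤ z.1}) volume := by
    refine hvl.integrableOn_compact_subset (fun z hz => ?_)
      (hS.inter_right (isClosed_le continuous_const continuous_fst))
    exact lt_of_lt_of_le (half_pos hδ) hz.2
  have i3 : IntegrableOn v {z : Space n | z.1 ≤ 0} volume := by
    refine (integrableOn_zero (ε' := ℂ)).congr_fun (fun z hz => ?_)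
      (isClosed_le continuous_fst continuous_const).measurableSet
    exact (hv0 z fun h : (0 : ℝ) < z.1 => absurd h (not_lt.2 hz)).symm
  refine ((i1.union i2).union i3).mono_set fun z hz => ?_
  rcases le_or_gt z.1 0 with h | h
  · exact Or.inr h
  · rcases le_or_gt (δ / 2) z.1 with h' | h'
    · exact Or.inl (Or.inr ⟨hz, h'⟩)
    · exact Or.inl (Or.inl ⟨⟨h, by linarith⟩, (hM z hz).2⟩)

theorem exists_deriv_smoothTransition_le : ∃ M : ℝ, 0 ≤ M ∧
    (∀ x, |deriv Real.smoothTransition x| ≤ M) ∧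
    (∀ x, x < 0 ∨ 1 < x → deriv Real.smoothTransition x = 0) := by
  have hc : Continuous (deriv Real.smoothTransition) :=
    (Real.smoothTransition.contDiff (n := 1)).continuous_deriv (by simp)
  have hz : ∀ x, x < 0 ∨ 1 < x → deriv Real.smoothTransition x = 0 := by
    rintro x (hx | hx)
    · have : Real.smoothTransition =ᶠ[𝓝 x] fun _ => 0 := by
        filter_upwards [Iio_mem_nhds hx] with y hy
        exact Real.smoothTransition.zero_of_nonpos (le_of_lt hy)
      rw [this.deriv_eq]; simp
    · have : Real.smoothTransition =ᶠ[𝓝 x] fun _ => 1 := by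
        filter_upwards [Ioi_mem_nhds hx] with y hy
        exact Real.smoothTransition.one_of_one_le (le_of_lt hy)
      rw [this.deriv_eq]; simp
  have hcs : HasCompactSupport (deriv Real.smoothTransition) := by
    refine HasCompactSupport.intro (isCompact_Icc (a := (0 : ℝ)) (b := 1)) fun x hx => hz x ?_
    simp only [Set.mem_Icc, not_and_or, not_le] at hx
    exact hx
  obtain ⟨M, hM⟩ := hc.bounded_above_of_compact_support hcs
  exact ⟨M, (norm_nonneg _).trans (hM 0), hM, hz⟩

/-- The cutoff `η(k t)`, vanishing for `t ≤ 1/k` and equal to `1` for `t ≥ 2/k`. -/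
def bdryCutoff (k : ℝ) (z : Space n) : ℝ := Real.smoothTransition (k * z.1 - 1)

theorem contDiff_bdryCutoff (k : ℝ) :
    ContDiff ℝ ((⊤ : ℕ∞) : WithTop ℕ∞) (bdryCutoff k : Space n → ℝ) :=
  Real.smoothTransition.contDiff.comp ((contDiff_const.mul contDiff_fst).sub contDiff_const)

theorem fderiv_bdryCutoff (k : ℝ) (z v : Space n) :
    fderiv ℝ (bdryCutoff k : Space n → ℝ) z v
      = deriv Real.smoothTransition (k * z.1 - 1) * (k * v.1) := by
  have h1 : HasDerivAt Real.smoothTransition (deriv Real.smoothTransition (k * z.1 - 1))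
      (k * z.1 - 1) :=
    ((Real.smoothTransition.contDiff (n := 1)).differentiable (by simp) _).hasDerivAt
  have h2 : HasFDerivAt (fun z : Space n => k * z.1 - 1)
      (k • ContinuousLinearMap.fst ℝ ℝ (Bdry n)) z :=
    (((hasFDerivAt_fst (p := z)).const_mul k).sub_const 1)
  have := (h1.comp_hasFDerivAt z h2).fderiv
  change fderiv ℝ (Real.smoothTransition ∘ fun z : Space n => k * z.1 - 1) z v = _
  rw [this]
  simp

theorem abs_fst_dir_le (i : Fin (n + 1)) : |(dir i : Space n).1| ≤ 1 := by
  refine Fin.cases ?_ (fun j => ?_) i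
  · simp [dir_zero]
  · simp [dir_succ]

theorem tendsto_bdryCutoff {z : Space n} (hz : z ∈ half n) :
    ∀ᶠ k : ℕ in atTop, bdryCutoff (k : ℝ) z = 1 := by
  have hz' : 0 < z.1 := hz
  obtain ⟨N, hN⟩ := exists_nat_gt (2 / z.1)
  filter_upwards [eventually_ge_atTop N] with k hk
  apply Real.smoothTransition.one_of_one_le
  have : 2 / z.1 < k := hN.trans_le (by exact_mod_cast hk)
  rw [div_lt_iff₀ hz'] at this
  linarith

theorem tendsto_integral_bdryCutoff {w : Space n → ℂ} (hw : Integrable w volume)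
    (hw0 : ∀ z ∉ half n, w z = 0) :
    Tendsto (fun k : ℕ => ∫ z, ((bdryCutoff (k : ℝ) z : ℝ) : ℂ) * w z) atTop (𝓝 (∫ z, w z)) := by
  refine tendsto_integral_of_dominated_convergence (fun z => ‖w z‖) (fun k => ?_) hw.norm
    (fun k => Eventually.of_forall fun z => ?_) (Eventually.of_forall fun z => ?_)
  · exact (Complex.continuous_ofReal.comp
      (contDiff_bdryCutoff (k : ℝ)).continuous).aestronglyMeasurable.mul hw.1
  · rw [norm_mul, Complex.norm_real, Real.norm_of_nonneg (show 0 ≤ bdryCutoff (k : ℝ) z from Real.smoothTransition.nonneg _)]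
    exact mul_le_of_le_one_left (norm_nonneg _) (Real.smoothTransition.le_one _)
  · by_cases hz : z ∈ half n
    · refine tendsto_const_nhds.congr' ?_
      filter_upwards [tendsto_bdryCutoff hz] with k hk
      simp [hk]
    · simp [hw0 z hz]

/-- The derivative of the cutoff is of size k on a slab of width of order 1/k, so the integral is
controlled by the L¹ norms of the slices of `v` in that slab, and these tend to zero. -/
theorem tendsto_integral_fderiv_bdryCutoff {v : Space n → ℂ} (hv : VanishesAtBdry v)
    (hvm : AEStronglyMeasurable v volume) {θ : Space n → ℝ} (hθ : Continuous θ)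
    (hθc : HasCompactSupport θ) (i : Fin (n + 1)) :
    Tendsto (fun k : ℕ => ∫ z, ((θ z * fderiv ℝ (bdryCutoff (k : ℝ)) z (dir i) : ℝ) : ℂ) * v z)
      atTop (𝓝 0) := by
  obtain ⟨M, hM0, hM, hMz⟩ := exists_deriv_smoothTransition_le
  obtain ⟨D, hD⟩ := hθ.bounded_above_of_compact_support hθc
  have hD0 : 0 ≤ D := (norm_nonneg _).trans (hD 0)
  obtain ⟨B, hB0, hB⟩ := exists_box hθc.isCompact
  rw [tendsto_zero_iff_norm_tendsto_zero]
  have key : ∀ ε : ℝ, 0 < ε → ∀ᶠ k : ℕ in atTop,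
      ‖∫ z, ((θ z * fderiv ℝ (bdryCutoff (k : ℝ)) z (dir i) : ℝ) : ℂ) * v z‖ ≤ D * M * (2 * ε) := by
    intro ε hε
    obtain ⟨δ, hδ, hs⟩ := hv.exists_slab (isCompact_closedBall (0 : Bdry n) B)
      (ε := ENNReal.ofReal ε) (by simpa using hε)
    obtain ⟨N, hN⟩ := exists_nat_gt (3 / δ)
    filter_upwards [eventually_ge_atTop N, eventually_gt_atTop 0] with k hk hk0
    have hk0' : (0 : ℝ) < k := by exact_mod_cast hk0
    have hkδ : 3 / k < δ := by
      have : 3 / δ < k := hN.trans_le (by exact_mod_cast hk)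
      rw [div_lt_iff₀ hδ] at this
      rw [div_lt_iff₀ hk0']; linarith
    -- The derivative of the cutoff lives on 1/k ≤ t ≤ 2/k. The interval (a, b) is slightly larger,
    -- and its length 2/k cancels the factor k.
    set a : ℝ := 1 / (2 * k) with ha
    set b : ℝ := 5 / (2 * k) with hb
    have hab : Set.Ioo a b ⊆ Set.Ioo 0 δ := by
      intro t ht
      refine ⟨lt_trans (by positivity) ht.1, ht.2.trans (lt_trans ?_ hkδ)⟩
      rw [hb, div_lt_div_iff₀ (by positivity) hk0']; linarith
    have hle := lintegral_slab hvm (a := a) (b := b)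
      (K := Metric.closedBall (0 : Bdry n) B) (by
        filter_upwards [hs] with t ht htab using ht (hab htab))
    have hba : b - a = 2 / k := by rw [hb, ha]; field_simp; norm_num
    have hpt : ∀ z, ‖((θ z * fderiv ℝ (bdryCutoff (k : ℝ)) z (dir i) : ℝ) : ℂ) * v z‖ₑ
        ≤ ENNReal.ofReal (D * M * k) *
          (Set.Ioo a b ×ˢ Metric.closedBall (0 : Bdry n) B).indicator (fun z => ‖v z‖ₑ) z := by
      intro z
      by_cases hz : z ∈ Set.Ioo a b ×ˢ Metric.closedBall (0 : Bdry n) B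
      · rw [Set.indicator_of_mem hz, enorm_mul]
        gcongr
        rw [← ofReal_norm, Complex.norm_real, norm_mul, fderiv_bdryCutoff]
        refine ENNReal.ofReal_le_ofReal ?_
        rw [mul_assoc]
        refine mul_le_mul (hD z) ?_ (norm_nonneg _) hD0
        rw [Real.norm_eq_abs, abs_mul, abs_mul, abs_of_pos hk0']
        refine mul_le_mul (hM _) ?_ (by positivity) hM0
        exact mul_le_of_le_one_right hk0'.le (abs_fst_dir_le i)
      · rw [Set.indicator_of_notMem hz]
        have : θ z * fderiv ℝ (bdryCutoff (k : ℝ)) z (dir i) = 0 := by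
          by_cases hz1 : z ∈ tsupport θ
          · have h1 : z.1 ∉ Set.Ioo a b := fun h => hz ⟨h, (hB z hz1).2⟩
            rw [fderiv_bdryCutoff, hMz, zero_mul, mul_zero]
            simp only [Set.mem_Ioo, not_and_or, not_lt] at h1
            rcases h1 with h1 | h1
            · left
              have : (k : ℝ) * z.1 ≤ k * a := mul_le_mul_of_nonneg_left h1 hk0'.le
              have e : (k : ℝ) * a = 1 / 2 := by rw [ha]; field_simp
              linarith
            · right
              have : (k : ℝ) * b ≤ k * z.1 := mul_le_mul_of_nonneg_left h1 hk0'.le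
              have e : (k : ℝ) * b = 5 / 2 := by rw [hb]; field_simp
              linarith
          · rw [image_eq_zero_of_notMem_tsupport hz1, zero_mul]
        simp [this]
    have hfin : ∫⁻ z, ‖((θ z * fderiv ℝ (bdryCutoff (k : ℝ)) z (dir i) : ℝ) : ℂ) * v z‖ₑ
        ≤ ENNReal.ofReal (D * M * (2 * ε)) := by
      refine (lintegral_mono hpt).trans ?_
      rw [lintegral_const_mul' _ _ ENNReal.ofReal_ne_top, lintegral_indicator
        (measurableSet_Ioo.prod Metric.isClosed_closedBall.measurableSet)]
      refine (mul_le_mul_right hle _).trans_eq ?_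
      rw [hba, ← ENNReal.ofReal_mul (by positivity), ← ENNReal.ofReal_mul (by positivity)]
      congr 1; field_simp
    have h3 := (enorm_integral_le_lintegral_enorm _).trans hfin
    rw [← ofReal_norm] at h3
    exact (ENNReal.ofReal_le_ofReal_iff (by positivity)).1 h3
  rw [Metric.tendsto_nhds]
  intro ε hε
  filter_upwards [key (ε / (2 * (D * M + 1))) (by positivity)] with k hk
  rw [dist_zero_right, norm_norm]
  refine hk.trans_lt ?_
  rw [show D * M * (2 * (ε / (2 * (D * M + 1)))) = ε * (D * M / (D * M + 1)) by field_simp]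
  refine mul_lt_of_lt_one_right hε ?_
  rw [div_lt_one (by positivity)]
  linarith

/-- The zero extension of a function with zero boundary values is weakly differentiable. -/
theorem WeakDeriv.of_vanishesAtBdry {v g : Space n → ℂ} {i : Fin (n + 1)}
    (hv : VanishesAtBdry v) (hvm : AEStronglyMeasurable v volume) (hv0 : ∀ z ∉ half n, v z = 0)
    (hvl : LocallyIntegrableOn v (half n) volume) (hg0 : ∀ z ∉ half n, g z = 0)
    (hg : LocallyIntegrable g volume) (h : WeakDeriv (half n : Set (Space n)) (dir i) v g) :
    WeakDeriv Set.univ (dir i) v g := by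
  intro θ hθ hθc _
  have hvL := hv.locallyIntegrable hvm hv0 hvl
  have hint : ∀ {w : Space n → ℂ} {φ : Space n → ℝ}, LocallyIntegrable w volume → Continuous φ →
      HasCompactSupport φ → Integrable (fun z => ((φ z : ℝ) : ℂ) * w z) volume := by
    intro w φ hw hφ hφc
    have := hw.integrable_smul_left_of_hasCompactSupport hφ hφc
    simpa using this
  have hθ1 : ContDiff ℝ 1 θ := hθ.of_le (by exact_mod_cast le_top)
  have hdθ : Continuous fun z => fderiv ℝ θ z (dir i) :=
    (hθ1.continuous_fderiv (by simp)).clm_apply continuous_const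
  have hdθc : HasCompactSupport fun z => fderiv ℝ θ z (dir i) := hθc.fderiv_apply ℝ _
  have hη1 : ∀ k : ℝ, ContDiff ℝ 1 (bdryCutoff k : Space n → ℝ) := fun k =>
    (contDiff_bdryCutoff k).of_le (by exact_mod_cast le_top)
  have hdη : ∀ k : ℝ, Continuous fun z : Space n => fderiv ℝ (bdryCutoff k : Space n → ℝ) z (dir i) :=
    fun k => ((hη1 k).continuous_fderiv (by simp)).clm_apply continuous_const
  have hsupp : ∀ k : ℕ, 0 < k →
      tsupport (fun z => bdryCutoff (k : ℝ) z * θ z) ⊆ (half n : Set (Space n)) := by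
    intro k hk
    have hk0' : (0 : ℝ) < k := by exact_mod_cast hk
    have : Function.support (fun z => bdryCutoff (k : ℝ) z * θ z) ⊆ {z : Space n | 1 / (k : ℝ) ≤ z.1} := by
      intro z hz
      by_contra hcon
      apply hz
      have : bdryCutoff (k : ℝ) z = 0 := by
        apply Real.smoothTransition.zero_of_nonpos
        simp only [Set.mem_ofPred_eq, not_le] at hcon
        rw [lt_div_iff₀ hk0'] at hcon
        linarith
      simp [this]
    refine (closure_minimal this (isClosed_le continuous_const continuous_fst)).trans ?_
    intro z hz
    exact lt_of_lt_of_le (show (0 : ℝ) < 1 / (k : ℝ) by positivity) hz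
  -- The weak derivative on the half-space is tested with the cutoff times θ. As k grows the cutoff
  -- tends to 1 in the first two integrals, and the third, where it is differentiated, disappears.
  have e1 := tendsto_integral_bdryCutoff (hint hg hθ.continuous hθc) fun z hz => by simp [hg0 z hz]
  have e2 := tendsto_integral_bdryCutoff (hint hvL hdθ hdθc) fun z hz => by simp [hv0 z hz]
  have e3 := tendsto_integral_fderiv_bdryCutoff hv hvm hθ.continuous hθc i
  have e4 := (e2.add e3).neg
  rw [add_zero] at e4
  refine tendsto_nhds_unique e1 (e4.congr' ?_)
  filter_upwards [eventually_gt_atTop 0] with k hk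
  have h1 := h (fun z => bdryCutoff (k : ℝ) z * θ z) ((contDiff_bdryCutoff _).mul hθ)
    hθc.mul_left (hsupp k hk)
  have h2 : ∀ z, ((fderiv ℝ (fun z => bdryCutoff (k : ℝ) z * θ z) z (dir i) : ℝ) : ℂ) * v z
      = ((bdryCutoff (k : ℝ) z : ℝ) : ℂ) * (((fderiv ℝ θ z (dir i) : ℝ) : ℂ) * v z)
        + ((θ z * fderiv ℝ (bdryCutoff (k : ℝ)) z (dir i) : ℝ) : ℂ) * v z := by
    intro z
    rw [fderiv_fun_mul ((hη1 k).differentiable (by simp) z) (hθ1.differentiable (by simp) z)]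
    simp only [_root_.add_apply, _root_.smul_apply, smul_eq_mul]
    push_cast; ring
  simp only [h2] at h1
  have i1 : Integrable (fun z => ((bdryCutoff (k : ℝ) z : ℝ) : ℂ) *
      (((fderiv ℝ θ z (dir i) : ℝ) : ℂ) * v z)) volume := by
    have := hint (φ := fun z => bdryCutoff (k : ℝ) z * fderiv ℝ θ z (dir i)) hvL
      ((contDiff_bdryCutoff (k : ℝ)).continuous.mul hdθ) hdθc.mul_left
    refine this.congr (Eventually.of_forall fun z => ?_)
    simp only; push_cast; ring
  have i2 := hint (φ := fun z => θ z * fderiv ℝ (bdryCutoff (k : ℝ)) z (dir i)) hvL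
    (hθ.continuous.mul (hdη k)) hθc.mul_right
  rw [integral_add i1 i2] at h1
  rw [← h1]
  refine integral_congr_ae (Eventually.of_forall fun z => ?_)
  simp only; push_cast; ring

end ZeroExtension

/-! ### A Hardy type inequality -/

section Hardy

variable {n : ℕ}

theorem half_eq_prod : (half n : Set (Space n)) = Set.Ioi (0 : ℝ) ×ˢ (Set.univ : Set (Bdry n)) := by
  ext z; simp [half]

theorem restrict_half : (volume : Measure (Space n)).restrict (half n)
    = (volume.restrict (Set.Ioi (0 : ℝ))).prod (volume : Measure (Bdry n)) := by
  rw [half_eq_prod, Measure.volume_eq_prod, ← Measure.prod_restrict, Measure.restrict_univ]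

theorem lintegral_half {w : Space n → ℝ≥0∞} (hw : AEMeasurable w (volume.restrict (half n))) :
    ∫⁻ z in half n, w z = ∫⁻ x, ∫⁻ t in Set.Ioi (0 : ℝ), w (t, x) := by
  rw [restrict_half] at hw ⊢
  exact lintegral_prod_symm _ hw

theorem ae_aestronglyMeasurable_slice {E : Type} [TopologicalSpace E]
    {h : Space n → E} (hh : AEStronglyMeasurable h (volume.restrict (half n))) :
    ∀ᵐ x : Bdry n, AEStronglyMeasurable (fun t => h (t, x)) (volume.restrict (Set.Ioi (0 : ℝ))) := by
  rw [restrict_half] at hh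
  exact hh.prod_swap.prodMk_left

/-- Cauchy–Schwarz on each vertical line gives |f(t, x)|² ≤ t ∫ |h(s, x)|² ds. Bounding t by L and
integrating over 0 < t ≤ L produces L². -/
theorem lintegral_hardy {E : Type} [NormedAddCommGroup E] [NormedSpace ℝ E] {f h : Space n → E}
    (hh : AEStronglyMeasurable h (volume.restrict (half n)))
    (hfm : AEStronglyMeasurable f (volume.restrict (half n)))
    (hf : ∀ᵐ x : Bdry n, ∀ t : ℝ, 0 < t → f (t, x) = ∫ s in (0 : ℝ)..t, h (s, x)) {L : ℝ}
    (hL : 0 ≤ L) :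
    ∫⁻ z in (half n : Set (Space n)) ∩ {z | z.1 ≤ L}, ‖f z‖ₑ ^ (2 : ℝ) ≤
      ENNReal.ofReal (L ^ 2) * ∫⁻ z in half n, ‖h z‖ₑ ^ (2 : ℝ) := by
  have hms : MeasurableSet {z : Space n | z.1 ≤ L} :=
    (isClosed_le continuous_fst continuous_const).measurableSet
  rw [Set.inter_comm, ← Measure.restrict_restrict hms, ← lintegral_indicator hms,
    lintegral_half ((hfm.enorm.pow_const _).indicator hms), lintegral_half (hh.enorm.pow_const _),
    ← lintegral_const_mul' _ _ ENNReal.ofReal_ne_top]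
  refine lintegral_mono_ae ?_
  filter_upwards [hf, ae_aestronglyMeasurable_slice hh] with x hx hxm
  calc ∫⁻ t in Set.Ioi (0 : ℝ), {z : Space n | z.1 ≤ L}.indicator (fun z => ‖f z‖ₑ ^ (2 : ℝ)) (t, x)
      ≤ ∫⁻ t in Set.Ioi (0 : ℝ), (Set.Iic L).indicator (fun _ => ENNReal.ofReal L *
          ∫⁻ s in Set.Ioi (0 : ℝ), ‖h (s, x)‖ₑ ^ (2 : ℝ)) t := by
        refine setLIntegral_mono_ae' measurableSet_Ioi (Eventually.of_forall fun t ht => ?_)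
        by_cases htL : t ≤ L
        · rw [Set.indicator_of_mem (show (t, x) ∈ {z : Space n | z.1 ≤ L} from htL),
            Set.indicator_of_mem (show t ∈ Set.Iic L from htL), hx t ht]
          refine (enorm_intervalIntegral_sq_le hxm (le_of_lt ht)).trans ?_
          gcongr
        · rw [Set.indicator_of_notMem (show (t, x) ∉ {z : Space n | z.1 ≤ L} from htL)]
          exact zero_le
    _ = ENNReal.ofReal (L ^ 2) * ∫⁻ s in Set.Ioi (0 : ℝ), ‖h (s, x)‖ₑ ^ (2 : ℝ) := by
        rw [lintegral_indicator measurableSet_Iic, lintegral_const,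
          Measure.restrict_restrict measurableSet_Iic, Measure.restrict_apply_univ,
          Set.inter_comm, Set.Ioi_inter_Iic, Real.volume_Ioc, sub_zero, mul_comm, ← mul_assoc,
          ← ENNReal.ofReal_mul hL, sq]

theorem eLpNorm_two_eq {Y E : Type} [MeasurableSpace Y] [NormedAddCommGroup E] (f : Y → E)
    (μ : Measure Y) : eLpNorm f 2 μ = (∫⁻ z, ‖f z‖ₑ ^ (2 : ℝ) ∂μ) ^ (1 / (2 : ℝ)) := by
  rw [eLpNorm_eq_lintegral_rpow_enorm_toReal (by norm_num) (by norm_num)]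
  simp

theorem eLpNorm_hardy {E : Type} [NormedAddCommGroup E] [NormedSpace ℝ E] {f h : Space n → E}
    (hh : AEStronglyMeasurable h (volume.restrict (half n)))
    (hfm : AEStronglyMeasurable f (volume.restrict (half n)))
    (hf : ∀ᵐ x : Bdry n, ∀ t : ℝ, 0 < t → f (t, x) = ∫ s in (0 : ℝ)..t, h (s, x)) {L : ℝ}
    (hL : 0 ≤ L) :
    eLpNorm f 2 (volume.restrict ((half n : Set (Space n)) ∩ {z | z.1 ≤ L})) ≤
      ENNReal.ofReal L * eLpNorm h 2 (volume.restrict (half n)) := by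
  rw [eLpNorm_two_eq, eLpNorm_two_eq]
  refine (ENNReal.rpow_le_rpow (lintegral_hardy hh hfm hf hL) (by norm_num)).trans_eq ?_
  rw [ENNReal.mul_rpow_of_nonneg _ _ (by norm_num), ENNReal.ofReal_rpow_of_nonneg (by positivity)
    (by norm_num), ← Real.rpow_natCast, ← Real.rpow_mul hL]
  norm_num

end Hardy

/-! ### Solenoidal fields are orthogonal to gradients of functions vanishing on the boundary -/

section Orthogonality

variable {n : ℕ}

theorem fderiv_re {X : Type} [NormedAddCommGroup X] [NormedSpace ℝ X] {φ : X → ℂ} {z : X}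
    (h : DifferentiableAt ℝ φ z) (v : X) :
    fderiv ℝ (fun z => (φ z).re) z v = (fderiv ℝ φ z v).re := by
  have := (Complex.reCLM.hasFDerivAt.comp z h.hasFDerivAt).fderiv
  change fderiv ℝ (Complex.reCLM ∘ φ) z v = _
  rw [this]; rfl

theorem fderiv_im {X : Type} [NormedAddCommGroup X] [NormedSpace ℝ X] {φ : X → ℂ} {z : X}
    (h : DifferentiableAt ℝ φ z) (v : X) :
    fderiv ℝ (fun z => (φ z).im) z v = (fderiv ℝ φ z v).im := by
  have := (Complex.imCLM.hasFDerivAt.comp z h.hasFDerivAt).fderiv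
  change fderiv ℝ (Complex.imCLM ∘ φ) z v = _
  rw [this]; rfl

/-- `F` is solenoidal in the half-space: `∑ᵢ ∫ Fᵢ ∂ᵢθ = 0` for real test functions. -/
def Solenoidal (F : Fin (n + 1) → Space n → ℂ) : Prop :=
  ∀ θ : Space n → ℝ, ContDiff ℝ ((⊤ : ℕ∞) : WithTop ℕ∞) θ → HasCompactSupport θ →
    tsupport θ ⊆ (half n : Set (Space n)) →
    ∑ i, ∫ z, F i z * ((fderiv ℝ θ z (dir i) : ℝ) : ℂ) = 0

theorem integrable_mul_of_continuous {X : Type} [NormedAddCommGroup X] [NormedSpace ℝ X]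
    [MeasureSpace X] [BorelSpace X] [FiniteDimensional ℝ X]
    [IsLocallyFiniteMeasure (volume : Measure X)] {G φ : X → ℂ} (hG : LocallyIntegrable G volume)
    (hφ : Continuous φ) (hφc : HasCompactSupport φ) : Integrable (fun z => G z * φ z) volume := by
  have := hG.integrable_smul_right_of_hasCompactSupport hφ hφc
  simpa using this

theorem Solenoidal.complex {F : Fin (n + 1) → Space n → ℂ} (hF : ∀ i, LocallyIntegrable (F i) volume)
    (h : Solenoidal F) {φ : Space n → ℂ} (hφ : ContDiff ℝ ((⊤ : ℕ∞) : WithTop ℕ∞) φ)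
    (hφc : HasCompactSupport φ) (hφs : tsupport φ ⊆ (half n : Set (Space n))) :
    ∑ i, ∫ z, F i z * fderiv ℝ φ z (dir i) = 0 := by
  have hφ1 : ContDiff ℝ 1 φ := hφ.of_le (by exact_mod_cast le_top)
  have hd : ∀ i, Continuous fun z => fderiv ℝ φ z (dir i) := fun i =>
    (hφ1.continuous_fderiv (by simp)).clm_apply continuous_const
  have hdc : ∀ i : Fin (n + 1), HasCompactSupport fun z => fderiv ℝ φ z (dir i) :=
    fun i => hφc.fderiv_apply ℝ _
  have hr := h (fun z => (φ z).re) (Complex.reCLM.contDiff.comp hφ)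
    (hφc.comp_left (g := Complex.re) rfl)
    ((tsupport_comp_subset (g := Complex.re) rfl φ).trans hφs)
  have hi := h (fun z => (φ z).im) (Complex.imCLM.contDiff.comp hφ)
    (hφc.comp_left (g := Complex.im) rfl)
    ((tsupport_comp_subset (g := Complex.im) rfl φ).trans hφs)
  have key : ∀ i, ∫ z, F i z * fderiv ℝ φ z (dir i) =
      (∫ z, F i z * ((fderiv ℝ (fun z => (φ z).re) z (dir i) : ℝ) : ℂ)) +
      Complex.I * ∫ z, F i z * ((fderiv ℝ (fun z => (φ z).im) z (dir i) : ℝ) : ℂ) := by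
    intro i
    rw [← integral_const_mul, ← integral_add]
    · refine integral_congr_ae (Eventually.of_forall fun z => ?_)
      simp only [fderiv_re (hφ1.differentiable (by simp) z), fderiv_im (hφ1.differentiable (by simp) z)]
      conv_lhs => rw [← Complex.re_add_im (fderiv ℝ φ z (dir i))]
      ring
    · refine integrable_mul_of_continuous (hF i) ?_ ?_
      · simp only [fderiv_re (hφ1.differentiable (by simp) _)]
        exact Complex.continuous_ofReal.comp (Complex.continuous_re.comp (hd i))
      · simp only [fderiv_re (hφ1.differentiable (by simp) _)]
        exact (hdc i).comp_left (g := fun w : ℂ => ((w.re : ℝ) : ℂ)) (by simp)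
    · refine (integrable_mul_of_continuous (hF i) ?_ ?_).const_mul _
      · simp only [fderiv_im (hφ1.differentiable (by simp) _)]
        exact Complex.continuous_ofReal.comp (Complex.continuous_im.comp (hd i))
      · simp only [fderiv_im (hφ1.differentiable (by simp) _)]
        exact (hdc i).comp_left (g := fun w : ℂ => ((w.im : ℝ) : ℂ)) (by simp)
  simp only [key, Finset.sum_add_distrib, ← Finset.mul_sum, hr, hi]
  simp

theorem tendsto_eLpNorm_tail {X : Type} [NormedAddCommGroup X] [MeasureSpace X]
    [OpensMeasurableSpace X] {F : X → ℂ} (hF : MemLp F 2 volume) :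
    Tendsto (fun k : ℕ => (eLpNorm ({z | (k : ℝ) ≤ ‖z‖}.indicator F) 2 volume).toReal) atTop
      (𝓝 0) := by
  have hms : ∀ k : ℕ, MeasurableSet {z : X | (k : ℝ) ≤ ‖z‖} := fun k =>
    (isClosed_le continuous_const continuous_norm).measurableSet
  have h0 : Tendsto (fun k : ℕ => ∫⁻ z, ‖({z | (k : ℝ) ≤ ‖z‖}.indicator F) z‖ₑ ^ (2 : ℝ)) atTop
      (𝓝 (∫⁻ _ : X, 0)) := by
    refine tendsto_lintegral_of_dominated_convergence' (fun z => ‖F z‖ₑ ^ (2 : ℝ))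
      (fun k => ((hF.1.indicator (hms k)).enorm.pow_const _)) (fun k => Eventually.of_forall
      fun z => ?_) ?_ (Eventually.of_forall fun z => ?_)
    · refine ENNReal.rpow_le_rpow ?_ (by norm_num)
      exact enorm_indicator_le_enorm_self _ _
    · have := lintegral_rpow_enorm_lt_top_of_eLpNorm_lt_top (by norm_num) (by norm_num) hF.2
      simpa using this.ne
    · refine tendsto_const_nhds.congr' ?_
      obtain ⟨N, hN⟩ := exists_nat_gt ‖z‖
      filter_upwards [eventually_ge_atTop N] with k hk
      have : z ∉ {z : X | (k : ℝ) ≤ ‖z‖} := by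
        simp only [Set.mem_ofPred_eq, not_le]
        exact hN.trans_le (by exact_mod_cast hk)
      simp [Set.indicator_of_notMem this]
  rw [lintegral_zero] at h0
  have h1 := (ENNReal.continuous_rpow_const (y := 1 / (2 : ℝ))).continuousAt.tendsto.comp h0
  have h2 := (ENNReal.continuousAt_toReal (by simp)).tendsto.comp h1
  simpa [eLpNorm_two_eq, Function.comp_def] using h2

/-- `f` need not have compact support, so it is multiplied by cutoffs θ_k at scale k + 1. The error
is the integral of F · f ∇θ_k. Here |∇θ_k| ≤ C/(k + 1), while by Hardy's inequality the L² norm of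
`f` on t ≤ 2(k + 1) is at most 2(k + 1) times that of ∂_t f; thus f ∇θ_k stays bounded in L². Its
support escapes to infinity, where the L² norm of `F` tends to zero. -/
theorem Solenoidal.smooth {F : Fin (n + 1) → Space n → ℂ} (hF : ∀ i, MemLp (F i) 2 volume)
    (h : Solenoidal F) {f : Space n → ℂ} (hf : ContDiff ℝ ((⊤ : ℕ∞) : WithTop ℕ∞) f) {δ : ℝ}
    (hδ : 0 < δ) (hf0 : ∀ z, z.1 < δ → f z = 0)
    (hdf : ∀ i, MemLp (fun z => fderiv ℝ f z (dir i)) 2 volume) :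
    ∑ i, ∫ z, F i z * fderiv ℝ f z (dir i) = 0 := by
  obtain ⟨C, D, hC0, hcut⟩ := exists_cutoff (Space n)
  have hpos : ∀ k : ℕ, (0 : ℝ) < k + 1 := fun k => by positivity
  choose θ hθ hθc hθ01 hθ1 hθd hθd0 hθd0' _ using fun k : ℕ => hcut (k + 1) (hpos k)
  have hf1 : ContDiff ℝ 1 f := hf.of_le (by exact_mod_cast le_top)
  have hθ1' : ∀ k, ContDiff ℝ 1 (θ k) := fun k => (hθ k).of_le (by exact_mod_cast le_top)
  have hfl : ∀ i, LocallyIntegrable (F i) volume := fun i => (hF i).locallyIntegrable (by norm_num)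
  have hcd : ∀ (k : ℕ) i, Continuous fun z => fderiv ℝ (θ k) z (dir i) := fun k i =>
    ((hθ1' k).continuous_fderiv (by simp)).clm_apply continuous_const
  have hcf : ∀ i, Continuous fun z => fderiv ℝ f z (dir i) := fun i =>
    (hf1.continuous_fderiv (by simp)).clm_apply continuous_const
  have hzero : ∀ k, ∑ i, ((∫ z, F i z * ((θ k z : ℝ) * fderiv ℝ f z (dir i)))
      + ∫ z, F i z * (((fderiv ℝ (θ k) z (dir i) : ℝ) : ℂ) * f z)) = 0 := by
    intro k
    have hsm : ContDiff ℝ ((⊤ : ℕ∞) : WithTop ℕ∞) fun z => θ k z • f z := (hθ k).smul hf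
    have hsc : HasCompactSupport fun z => θ k z • f z := (hθc k).smul_right
    have hss : tsupport (fun z => θ k z • f z) ⊆ (half n : Set (Space n)) := by
      have : Function.support (fun z => θ k z • f z) ⊆ {z : Space n | δ ≤ z.1} := by
        intro z hz
        by_contra hcon
        apply hz
        simp [hf0 z (not_le.1 hcon)]
      exact (closure_minimal this (isClosed_le continuous_const continuous_fst)).trans
        fun z hz => lt_of_lt_of_le hδ hz
    have := h.complex hfl hsm hsc hss
    rw [← this]
    refine Finset.sum_congr rfl fun i _ => ?_
    rw [← integral_add]
    · refine integral_congr_ae (Eventually.of_forall fun z => ?_)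
      simp only
      rw [fderiv_fun_smul ((hθ1' k).differentiable (by simp) z) (hf1.differentiable (by simp) z)]
      simp only [_root_.add_apply, _root_.smul_apply, ContinuousLinearMap.smulRight_apply,
        Complex.real_smul]
      ring
    · exact integrable_mul_of_continuous (hfl i)
        ((Complex.continuous_ofReal.comp (hθ k).continuous).mul (hcf i))
        (((hθc k).comp_left (g := Complex.ofReal) (by simp)).mul_right)
    · exact integrable_mul_of_continuous (hfl i)
        ((Complex.continuous_ofReal.comp (hcd k i)).mul hf.continuous)
        ((((hθc k).fderiv_apply ℝ _).comp_left (g := Complex.ofReal) (by simp)).mul_right)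
  have lim1 : ∀ i, Tendsto (fun k => ∫ z, F i z * ((θ k z : ℝ) * fderiv ℝ f z (dir i))) atTop
      (𝓝 (∫ z, F i z * fderiv ℝ f z (dir i))) := by
    intro i
    have hint : Integrable (fun z => F i z * fderiv ℝ f z (dir i)) volume :=
      integrable_mul_of_memLp (hF i) (hdf i)
    refine tendsto_integral_of_dominated_convergence _ (fun k => ?_) hint.norm
      (fun k => Eventually.of_forall fun z => ?_) (Eventually.of_forall fun z => ?_)
    · exact (hF i).1.mul ((Complex.continuous_ofReal.comp (hθ k).continuous).aestronglyMeasurable.mul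
        (hcf i).aestronglyMeasurable)
    · rw [norm_mul, norm_mul, norm_mul, Complex.norm_real, Real.norm_of_nonneg (hθ01 k z).1]
      exact mul_le_mul_of_nonneg_left (mul_le_of_le_one_left (norm_nonneg _) (hθ01 k z).2)
        (norm_nonneg _)
    · refine tendsto_const_nhds.congr' ?_
      obtain ⟨N, hN⟩ := exists_nat_gt ‖z‖
      filter_upwards [eventually_ge_atTop N] with k hk
      rw [hθ1 k z (by have : (N : ℝ) ≤ k := by exact_mod_cast hk
                      linarith)]
      simp
  have hFTC : ∀ᵐ x : Bdry n, ∀ t : ℝ, 0 < t →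
      f (t, x) = ∫ s in (0 : ℝ)..t, fderiv ℝ f (s, x) (dir 0) := by
    refine Eventually.of_forall fun x t ht => ?_
    have hder : ∀ s : ℝ, HasDerivAt (fun s => f (s, x)) (fderiv ℝ f (s, x) (dir 0)) s := by
      intro s
      have h1 : HasFDerivAt f (fderiv ℝ f (s, x)) (s, x) :=
        (hf1.differentiable (by simp) _).hasFDerivAt
      have h2 : HasDerivAt (fun s : ℝ => (s, x)) ((1 : ℝ), (0 : Bdry n)) s :=
        (hasDerivAt_id s).prodMk (hasDerivAt_const s x)
      exact h1.comp_hasDerivAt s h2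
    rw [intervalIntegral.integral_eq_sub_of_hasDerivAt (fun s _ => hder s)
      (((hcf 0).comp (by fun_prop : Continuous fun s : ℝ => (s, x))).intervalIntegrable _ _),
      hf0 (0, x) hδ, sub_zero]
  have hardy := fun {L : ℝ} (hL : 0 ≤ L) =>
    eLpNorm_hardy (hcf 0).aestronglyMeasurable.restrict hf.continuous.aestronglyMeasurable.restrict
      hFTC hL
  have hN : eLpNorm (fun z => fderiv ℝ f z (dir 0)) 2 (volume.restrict (half n)) ≠ ∞ :=
    (lt_of_le_of_lt (eLpNorm_restrict_le _ _ _ _) (hdf 0).2).ne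
  set N := (eLpNorm (fun z => fderiv ℝ f z (dir 0)) 2 (volume.restrict (half n))).toReal with hNdef
  have hdir : ∀ i : Fin (n + 1), ‖(dir i : Space n)‖ ≤ 1 := by
    intro i
    refine Fin.cases ?_ (fun j => ?_) i
    · simp [dir_zero, Prod.norm_def]
    · simp [dir_succ, Prod.norm_def]
  have lim2 : ∀ i, Tendsto (fun k => ∫ z, F i z * (((fderiv ℝ (θ k) z (dir i) : ℝ) : ℂ) * f z))
      atTop (𝓝 0) := by
    intro i
    have hbound : ∀ k : ℕ, ‖∫ z, F i z * (((fderiv ℝ (θ k) z (dir i) : ℝ) : ℂ) * f z)‖ ≤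
        (eLpNorm ({z | (k : ℝ) ≤ ‖z‖}.indicator (F i)) 2 volume).toReal * (2 * C * N) := by
      intro k
      set w : Space n → ℂ := fun z => ((fderiv ℝ (θ k) z (dir i) : ℝ) : ℂ) * f z with hw
      have hms : MeasurableSet {z : Space n | (k : ℝ) ≤ ‖z‖} :=
        (isClosed_le continuous_const continuous_norm).measurableSet
      have hmT : MeasurableSet ((half n : Set (Space n)) ∩ {z | z.1 ≤ 2 * (k + 1)}) :=
        (half n).isOpen.measurableSet.inter
          (isClosed_le continuous_fst continuous_const).measurableSet
      have hwc : Continuous w := (Complex.continuous_ofReal.comp (hcd k i)).mul hf.continuous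
      have hwb : eLpNorm w 2 volume ≤ ENNReal.ofReal (2 * C * N) := by
        have hle : ∀ z, ‖w z‖ ≤ C / (k + 1) *
            ‖((half n : Set (Space n)) ∩ {z | z.1 ≤ 2 * (k + 1)}).indicator f z‖ := by
          intro z
          by_cases hz : z ∈ (half n : Set (Space n)) ∩ {z | z.1 ≤ 2 * (k + 1)}
          · rw [Set.indicator_of_mem hz, hw]
            simp only [norm_mul, Complex.norm_real]
            refine mul_le_mul_of_nonneg_right ?_ (norm_nonneg _)
            refine (ContinuousLinearMap.le_opNorm _ _).trans ?_
            exact (mul_le_of_le_one_right (norm_nonneg _) (hdir i)).trans (hθd k z)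
          · have : w z = 0 := by
              rw [hw]
              simp only [Set.mem_inter_iff, not_and_or, Set.mem_ofPred_eq, not_le] at hz
              rcases hz with hz | hz
              · have : ¬ 0 < z.1 := hz
                simp [hf0 z (by linarith)]
              · have : 2 * ((k : ℝ) + 1) < ‖z‖ :=
                  hz.trans_le ((le_abs_self _).trans (norm_fst_le z))
                simp [hθd0' k z this]
            rw [this, norm_zero]
            positivity
        refine (eLpNorm_le_mul_eLpNorm_of_ae_le_mul (Eventually.of_forall hle) 2).trans ?_
        rw [eLpNorm_indicator_eq_eLpNorm_restrict hmT]
        refine (mul_le_mul_right (hardy (L := 2 * (k + 1)) (by positivity)) _).trans_eq ?_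
        rw [← ENNReal.ofReal_toReal hN, ← hNdef, ← ENNReal.ofReal_mul (by positivity),
          ← ENNReal.ofReal_mul (by positivity)]
        congr 1
        field_simp
      have hwm : MemLp w 2 volume :=
        ⟨hwc.aestronglyMeasurable, hwb.trans_lt ENNReal.ofReal_lt_top⟩
      have heq : ∫ z, F i z * w z = ∫ z, {z | (k : ℝ) ≤ ‖z‖}.indicator (F i) z * w z := by
        refine integral_congr_ae (Eventually.of_forall fun z => ?_)
        by_cases hz : z ∈ {z : Space n | (k : ℝ) ≤ ‖z‖}
        · simp only [Set.indicator_of_mem hz]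
        · have h1 : ‖z‖ < k + 1 := by
            have : ‖z‖ < k := not_le.1 hz
            linarith
          simp [hw, hθd0 k z h1]
      rw [heq]
      refine (norm_integral_mul_le ((hF i).indicator hms) hwm).trans ?_
      exact mul_le_mul_of_nonneg_left (ENNReal.toReal_le_of_le_ofReal (by positivity) hwb)
        ENNReal.toReal_nonneg
    refine squeeze_zero_norm hbound ?_
    have := (tendsto_eLpNorm_tail (hF i)).mul_const (2 * C * N)
    simpa using this
  have lim := tendsto_finsetSum Finset.univ fun i _ => (lim1 i).add (lim2 i)
  simp only [add_zero] at lim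
  refine tendsto_nhds_unique lim ?_
  simp only [hzero]
  exact tendsto_const_nhds

end Orthogonality

/-! ### Mollification -/

section Mollify

variable {X : Type} [NormedAddCommGroup X] [NormedSpace ℝ X] [MeasureSpace X] [BorelSpace X]
  [FiniteDimensional ℝ X] [(volume : Measure X).IsAddHaarMeasure]

theorem tconv_id_eq_convolution {F : Type} [NormedAddCommGroup F] [NormedSpace ℝ F]
    (K : X → ℝ) (f : X → F) :
    tconv (ContinuousLinearMap.id ℝ X) K f
      = convolution K f (ContinuousLinearMap.lsmul ℝ ℝ) volume := by
  funext z
  simp [tconv, convolution]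

theorem contDiff_tconv_id {F : Type} [NormedAddCommGroup F] [NormedSpace ℝ F] {K : X → ℝ}
    {f : X → F} (hK : ContDiff ℝ ((⊤ : ℕ∞) : WithTop ℕ∞) K) (hKc : HasCompactSupport K)
    (hf : LocallyIntegrable f volume) :
    ContDiff ℝ ((⊤ : ℕ∞) : WithTop ℕ∞) (tconv (ContinuousLinearMap.id ℝ X) K f) := by
  rw [tconv_id_eq_convolution]
  exact hKc.contDiff_convolution_left _ hK hf

theorem fderiv_tconv_id {K : X → ℝ} {f : X → ℂ} (hK : ContDiff ℝ 1 K) (hKc : HasCompactSupport K)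
    (hf : LocallyIntegrable f volume) (z e : X) :
    fderiv ℝ (tconv (ContinuousLinearMap.id ℝ X) K f) z e
      = tconv (ContinuousLinearMap.id ℝ X) (fun y => fderiv ℝ K y e) f z := by
  rw [tconv_id_eq_convolution, (hKc.hasFDerivAt_convolution_left
    (ContinuousLinearMap.lsmul ℝ ℝ) hK hf z).fderiv]
  have hc : Continuous (fderiv ℝ K) := hK.continuous_fderiv (by simp)
  have hi := (hKc.fderiv ℝ).convolutionExists_left
    ((ContinuousLinearMap.lsmul ℝ ℝ : ℝ →L[ℝ] ℂ →L[ℝ] ℂ).precompL X) hc hf z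
  rw [convolution_def, ContinuousLinearMap.integral_apply hi]
  simp [tconv, ContinuousLinearMap.precompL_apply]

theorem tconv_fderiv_id_of_weakDeriv {K : X → ℝ} {f g : X → ℂ}
    (hK : ContDiff ℝ ((⊤ : ℕ∞) : WithTop ℕ∞) K) (hKc : HasCompactSupport K) {e : X}
    (h : WeakDeriv Set.univ e f g) (z : X) :
    tconv (ContinuousLinearMap.id ℝ X) (fun y => fderiv ℝ K y e) f z
      = tconv (ContinuousLinearMap.id ℝ X) K g z := by
  have hK1 : ContDiff ℝ 1 K := hK.of_le (by exact_mod_cast le_top)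
  have hsub : ContDiff ℝ ((⊤ : ℕ∞) : WithTop ℕ∞) fun y : X => z - y :=
    contDiff_const.sub contDiff_id
  have h1 := h (fun y => K (z - y)) (hK.comp hsub)
    (hKc.comp_homeomorph (Homeomorph.subLeft z)) (Set.subset_univ _)
  have hd : ∀ y, fderiv ℝ (fun y => K (z - y)) y e = - fderiv ℝ K (z - y) e := by
    intro y
    have h2 : HasFDerivAt (fun y : X => z - y) (-(ContinuousLinearMap.id ℝ X)) y :=
      (hasFDerivAt_id y).const_sub z
    have h3 := ((hK1.differentiable (by simp) (z - y)).hasFDerivAt.comp y h2).fderiv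
    change fderiv ℝ (K ∘ fun y => z - y) y e = _
    rw [h3]; simp
  simp only [hd, Complex.ofReal_neg, neg_mul, integral_neg, neg_neg] at h1
  simp only [tconv, Complex.real_smul, ContinuousLinearMap.id_apply]
  rw [← integral_sub_left_eq_self (fun y => ((fderiv ℝ K y e : ℝ) : ℂ) * f (z - y)) volume z,
    ← integral_sub_left_eq_self (fun y => (K y : ℂ) * g (z - y)) volume z]
  simpa using h1.symm

end Mollify

/-! ### Orthogonality by mollification away from the boundary -/

section Orthogonality2

variable {n : ℕ}

/-- The centre is moved upwards so that convolution with a function vanishing off the half-space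
vanishes for t < δ, as `Solenoidal.smooth` demands. -/
theorem exists_shifted_mollifier {δ : ℝ} (hδ : 0 < δ) : ∃ K : Space n → ℝ,
    ContDiff ℝ ((⊤ : ℕ∞) : WithTop ℕ∞) K ∧ HasCompactSupport K ∧ (∀ y, 0 ≤ K y) ∧ ∫ y, K y = 1 ∧
      ∀ y, K y ≠ 0 → δ < y.1 ∧ ‖y‖ ≤ 3 * δ := by
  let φ : ContDiffBump (((2 * δ : ℝ), (0 : Bdry n)) : Space n) := ⟨δ / 2, δ, by linarith, by linarith⟩
  refine ⟨φ.normed volume, φ.contDiff_normed, φ.hasCompactSupport_normed, φ.nonneg_normed,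
    φ.integral_normed, fun y hy => ?_⟩
  have hs : y ∈ Function.support (φ.normed volume) := hy
  rw [φ.support_normed_eq] at hs
  have hs' : ‖y - ((2 * δ : ℝ), (0 : Bdry n))‖ < δ := by
    rw [← dist_eq_norm]; exact hs
  have h1 := (norm_fst_le _).trans_lt hs'
  simp only [Prod.fst_sub, Real.norm_eq_abs, abs_lt] at h1
  refine ⟨by linarith [h1.1], ?_⟩
  have h2 : ‖(((2 * δ : ℝ), (0 : Bdry n)) : Space n)‖ = 2 * δ := by
    rw [Prod.norm_def]; simp [abs_of_pos hδ, hδ.le]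
  calc ‖y‖ = ‖(y - ((2 * δ : ℝ), (0 : Bdry n))) + ((2 * δ : ℝ), (0 : Bdry n))‖ := by simp
    _ ≤ δ + 2 * δ := (norm_add_le _ _).trans (add_le_add hs'.le h2.le)
    _ = 3 * δ := by ring

/-- Solenoidal fields are orthogonal to the gradients of functions vanishing on the boundary. -/
theorem Solenoidal.orthogonal {F g : Fin (n + 1) → Space n → ℂ} {v : Space n → ℂ}
    (h : Solenoidal F) (hF : ∀ i, MemLp (F i) 2 volume) (hg : ∀ i, MemLp (g i) 2 volume)
    (hg0 : ∀ i, ∀ z ∉ half n, g i z = 0)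
    (hv : VanishesAtBdry v) (hvm : AEStronglyMeasurable v volume) (hv0 : ∀ z ∉ half n, v z = 0)
    (hvl : LocallyIntegrableOn v (half n) volume)
    (hw : ∀ i, WeakDeriv (half n : Set (Space n)) (dir i) v (g i)) :
    ∑ i, ∫ z, F i z * g i z = 0 := by
  set ι := ContinuousLinearMap.id ℝ (Space n)
  have hvL := hv.locallyIntegrable hvm hv0 hvl
  have hgl : ∀ i, LocallyIntegrable (g i) volume := fun i => (hg i).locallyIntegrable (by norm_num)
  have hu : ∀ i, WeakDeriv Set.univ (dir i) v (g i) := fun i =>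
    (hw i).of_vanishesAtBdry hv hvm hv0 hvl (hg0 i) (hgl i)
  -- `e` is continuous, and ∫ K e = 0 for every shifted mollifier K: this integral pairs `F` with
  -- the gradient of K * v, which is smooth and vanishes near the boundary. Concentrating K at the
  -- origin gives e(0) = 0.
  set e : Space n → ℂ := fun y => ∑ i, correl ι (F i) (g i) y with he
  have hec : Continuous e := continuous_finsetSum _ fun i _ => continuous_correl ι (hF i) (hg i)
  have he0 : e 0 = ∑ i, ∫ z, F i z * g i z := by simp [he, correl, ι]
  rw [← he0]
  by_contra hne
  have hpos : 0 < ‖e 0‖ := norm_pos_iff.2 hne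
  obtain ⟨r, hr, hball⟩ := Metric.continuousAt_iff.1 hec.continuousAt (‖e 0‖ / 2) (half_pos hpos)
  obtain ⟨K, hK, hKc, hK0, hK1, hKs⟩ := exists_shifted_mollifier (n := n) (δ := r / 4) (by linarith)
  have hKi : Integrable K volume := hK.continuous.integrable_of_hasCompactSupport hKc
  have hzero : ∫ y, (K y : ℂ) * e y = 0 := by
    have hd : ∀ i z, fderiv ℝ (tconv ι K v) z (dir i) = tconv ι K (g i) z := fun i z => by
      rw [fderiv_tconv_id (hK.of_le (by exact_mod_cast le_top)) hKc hvL,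
        tconv_fderiv_id_of_weakDeriv hK hKc (hu i)]
    have hs := h.smooth hF (contDiff_tconv_id hK hKc hvL) (δ := r / 4) (by linarith)
      (fun z hz => ?_) (fun i => ?_)
    · have hd' : ∀ i z, fderiv ℝ (tconv (ContinuousLinearMap.id ℝ (Space n)) K v) z (dir i)
        = tconv ι K (g i) z := hd
      simp only [hd', integral_mul_tconv_eq_correl ι hKi (hF _) (hg _)] at hs
      rw [← integral_finsetSum] at hs
      · simpa [he, Finset.mul_sum] using hs
      · intro i _
        exact ((Complex.continuous_ofReal.comp hK.continuous).mul
          (continuous_correl ι (hF i) (hg i))).integrable_of_hasCompactSupport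
          ((hKc.comp_left (g := Complex.ofReal) (by simp)).mul_right)
    · refine integral_eq_zero_of_ae (Eventually.of_forall fun y => ?_)
      by_cases hy : K y = 0
      · simp [hy]
      · have h1 := (hKs y hy).1
        have : z - y ∉ half n := fun h2 => by
          have h3 : 0 < z.1 - y.1 := h2
          linarith
        have h4 : v (z - y) = 0 := hv0 _ this
        simp [h4]
    · have : (fun z => fderiv ℝ (tconv (ContinuousLinearMap.id ℝ (Space n)) K v) z (dir i))
        = tconv ι K (g i) := funext (hd i)
      rw [this]
      exact memLp_tconv ι hKi (hg i) (by norm_num) (by norm_num)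
  have hKe : Integrable (fun y => (K y : ℂ) * e y) volume :=
    ((Complex.continuous_ofReal.comp hK.continuous).mul hec).integrable_of_hasCompactSupport
      ((hKc.comp_left (g := Complex.ofReal) (by simp)).mul_right)
  have hdiff : e 0 = ∫ y, (K y : ℂ) * (e 0 - e y) := by
    have hI : Integrable (fun y => (K y : ℂ) * e 0) volume := hKi.ofReal.mul_const _
    simp only [mul_sub]
    rw [integral_sub hI hKe, hzero, sub_zero, integral_mul_const,
      integral_complex_ofReal, hK1]
    simp
  have hle : ‖e 0‖ ≤ ‖e 0‖ / 2 := by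
    calc ‖e 0‖ = ‖∫ y, (K y : ℂ) * (e 0 - e y)‖ := by rw [← hdiff]
      _ ≤ ∫ y, K y * (‖e 0‖ / 2) := by
          refine norm_integral_le_of_norm_le (hKi.mul_const _) (Eventually.of_forall fun y => ?_)
          rw [norm_mul, Complex.norm_real, Real.norm_of_nonneg (hK0 y)]
          by_cases hy : K y = 0
          · simp [hy]
          · refine mul_le_mul_of_nonneg_left ?_ (hK0 y)
            have := hball (x := y) (by rw [dist_zero_right]; linarith [(hKs y hy).2])
            rw [dist_comm, dist_eq_norm] at this
            exact this.le
      _ = ‖e 0‖ / 2 := by rw [integral_mul_const, hK1, one_mul]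
  linarith

end Orthogonality2

/-! ### A Bellman function and its convexity -/

section Bellman

/-- A function of Bellman type for the bilinear embedding of second order Riesz transforms. -/
def bellman (p q : ℝ) (z : ℝ × ℝ) : ℝ :=
  ((8 + 4 * p) ^ 2 / 4 + 5) / (q * (q - 1)) * z.2 ^ q
    + z.1 ^ 2 * (z.1 ^ p + z.2 ^ q) ^ (2 / q - 1)

/-- This is the second derivative of B + σxy along a segment with direction (ξ, η), written in the
relative variables u = ξ/x and v = η/y. With M = 8 + 4p, the coefficient of u² is at least 2, the
mixed term is at least -(u² + (M²/4) t v²) and the remaining v² term at least -4t v². Since F t ≤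
y^q, the part M²/4 + 4 of `L` absorbs the negative v² terms; one unit each of F u² and y^q v²
remains, and dominates 2|m u v| because m² ≤ F y^q. This is the origin of M²/4 + 5. -/
theorem bellman_hessian_nonneg {p q a σ F Yq m s t u v L : ℝ} (ha : 0 ≤ a) (ha1 : a ≤ 1)
    (hp : 2 ≤ p) (hq : 1 < q) (hq2 : q ≤ 2) (hσ : |σ| ≤ 1) (hF : 0 ≤ F) (hY : 0 ≤ Yq)
    (hs : 0 ≤ s) (ht : 0 ≤ t) (hst : s + t = 1) (hFt : F * t ≤ Yq)
    (hm : m ^ 2 ≤ F * Yq) (hL : (8 + 4 * p) ^ 2 / 4 + 5 ≤ L) :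
    0 ≤ F * (2 * u ^ 2 + 4 * a * u * (p * s * u + q * t * v)
        + a * (a - 1) * (p * s * u + q * t * v) ^ 2
        + a * (p * (p - 1) * s * u ^ 2 + q * (q - 1) * t * v ^ 2))
      + L * Yq * v ^ 2 + σ * (2 * m * u * v) := by
  have hs1 : s ≤ 1 := by linarith
  have ht1 : t ≤ 1 := by linarith
  set M := 8 + 4 * p with hM
  have h1 : 2 * u ^ 2 ≤ (2 + 4 * a * p * s + a * (a - 1) * p ^ 2 * s ^ 2 + a * p * (p - 1) * s)
      * u ^ 2 := by
    refine mul_le_mul_of_nonneg_right ?_ (sq_nonneg u)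
    have : a * (1 - a) * p ^ 2 * s ^ 2 ≤ a * (1 - a) * p ^ 2 * s := by
      refine mul_le_mul_of_nonneg_left (by nlinarith) ?_
      have : 0 ≤ 1 - a := by linarith
      positivity
    have h2 : 0 ≤ a * p * s * (3 + a * p) := by positivity
    linarith
  have h2 : |(4 * a * q + 2 * a * (a - 1) * p * q * s)| ≤ M := by
    have haq : a * q ≤ 2 := by nlinarith
    have haq0 : 0 ≤ a * q := by positivity
    have h3 : 0 ≤ (1 - a) * s ∧ (1 - a) * s ≤ 1 := ⟨by nlinarith, by nlinarith⟩
    have h4 : a * q * ((1 - a) * s) ≤ 2 := by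
      calc a * q * ((1 - a) * s) ≤ 2 * 1 := mul_le_mul haq h3.2 h3.1 (by norm_num)
        _ = 2 := mul_one 2
    have h5 : 0 ≤ a * q * ((1 - a) * s) := mul_nonneg haq0 h3.1
    have h6 : a * q * ((1 - a) * s) * p ≤ 2 * p := mul_le_mul_of_nonneg_right h4 (by linarith)
    have h7 : 0 ≤ a * q * ((1 - a) * s) * p := mul_nonneg h5 (by linarith)
    rw [abs_le]
    constructor <;> linarith
  have h3 : -(u ^ 2 + M ^ 2 / 4 * t * v ^ 2) ≤
      (4 * a * q + 2 * a * (a - 1) * p * q * s) * t * u * v := by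
    set c := 4 * a * q + 2 * a * (a - 1) * p * q * s
    have hc : c ^ 2 ≤ M ^ 2 := sq_le_sq' (by linarith [(abs_le.1 h2).1]) (abs_le.1 h2).2
    have h4 : c ^ 2 * t ^ 2 * v ^ 2 ≤ M ^ 2 * t * v ^ 2 := by
      have : t ^ 2 ≤ t := by nlinarith
      refine mul_le_mul_of_nonneg_right ?_ (sq_nonneg v)
      exact mul_le_mul hc this (sq_nonneg t) (sq_nonneg M)
    have h5 := sq_nonneg (u + c * t * v / 2)
    linarith
  have h4 : -(4 * t * v ^ 2) ≤ (a * (a - 1) * q ^ 2 * t ^ 2 + a * q * (q - 1) * t) * v ^ 2 := by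
    rw [← neg_mul]
    refine mul_le_mul_of_nonneg_right ?_ (sq_nonneg v)
    have h5 : a * (1 - a) * q ^ 2 ≤ 4 := by
      have : a * (1 - a) ≤ 1 := by nlinarith
      have hq4 : q ^ 2 ≤ 4 := by nlinarith
      calc a * (1 - a) * q ^ 2 ≤ 1 * 4 := mul_le_mul this hq4 (sq_nonneg q) zero_le_one
        _ = 4 := one_mul 4
    have h6 : a * (1 - a) * q ^ 2 * t ^ 2 ≤ 4 * t := by
      have : t ^ 2 ≤ t := by nlinarith
      exact mul_le_mul h5 this (sq_nonneg t) (by norm_num)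
    have h7 : 0 ≤ a * q * (q - 1) * t := by
      have : 0 ≤ q - 1 := by linarith
      positivity
    linarith
  have h5 : u ^ 2 - (M ^ 2 / 4 + 4) * t * v ^ 2 ≤
      2 * u ^ 2 + 4 * a * u * (p * s * u + q * t * v)
        + a * (a - 1) * (p * s * u + q * t * v) ^ 2
        + a * (p * (p - 1) * s * u ^ 2 + q * (q - 1) * t * v ^ 2) := by
    have e : 2 * u ^ 2 + 4 * a * u * (p * s * u + q * t * v)
        + a * (a - 1) * (p * s * u + q * t * v) ^ 2
        + a * (p * (p - 1) * s * u ^ 2 + q * (q - 1) * t * v ^ 2)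
        = (2 + 4 * a * p * s + a * (a - 1) * p ^ 2 * s ^ 2 + a * p * (p - 1) * s) * u ^ 2
          + (4 * a * q + 2 * a * (a - 1) * p * q * s) * t * u * v
          + (a * (a - 1) * q ^ 2 * t ^ 2 + a * q * (q - 1) * t) * v ^ 2 := by ring
    rw [e]
    linarith
  have h6 := mul_le_mul_of_nonneg_left h5 hF
  have h7 : F * t * v ^ 2 * (M ^ 2 / 4 + 4) ≤ Yq * v ^ 2 * (M ^ 2 / 4 + 4) := by
    gcongr
  have h8 : -(F * u ^ 2 + Yq * v ^ 2) ≤ σ * (2 * m * u * v) := by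
    have h9 : |2 * m * u * v| ≤ F * u ^ 2 + Yq * v ^ 2 := by
      refine abs_le_of_sq_le_sq ?_ (by positivity)
      have h10 : m ^ 2 * (u * v) ^ 2 ≤ F * Yq * (u * v) ^ 2 :=
        mul_le_mul_of_nonneg_right hm (sq_nonneg _)
      have h11 := sq_nonneg (F * u ^ 2 - Yq * v ^ 2)
      linarith
    have h10 : |σ * (2 * m * u * v)| ≤ F * u ^ 2 + Yq * v ^ 2 := by
      rw [abs_mul]
      exact (mul_le_of_le_one_left (abs_nonneg _) hσ).trans h9
    exact (abs_le.1 h10).1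
  have h9 : ((M ^ 2 / 4) + 5) * (Yq * v ^ 2) ≤ L * (Yq * v ^ 2) :=
    mul_le_mul_of_nonneg_right hL (by positivity)
  linarith

variable {p q : ℝ}

theorem bellman_exponents (hpq : p.HolderConjugate q) (hp : 2 ≤ p) :
    1 < q ∧ q ≤ 2 ∧ 0 ≤ 2 / q - 1 ∧ 2 / q - 1 ≤ 1 ∧ 2 / p + (2 / q - 1) = 1 := by
  have hq : 1 < q := hpq.symm.lt
  have h := hpq.inv_add_inv_eq_one
  have hp1 : p⁻¹ ≤ 1 / 2 := by
    rw [inv_le_comm₀ (by linarith) (by norm_num)]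
    norm_num
    exact hp
  have hq1 : (1 : ℝ) / 2 ≤ q⁻¹ := by linarith
  have hq3 : q⁻¹ < 1 := inv_lt_one_of_one_lt₀ hq
  refine ⟨hq, ?_, ?_, ?_, ?_⟩
  · rw [le_inv_comm₀ (by norm_num) (by linarith)] at hq1
    norm_num at hq1
    exact hq1
  all_goals rw [div_eq_mul_inv]; try rw [div_eq_mul_inv]
  all_goals linarith

theorem bellman_sq_mul_le (hpq : p.HolderConjugate q) (hp : 2 ≤ p) {x S : ℝ} (hx : 0 ≤ x)
    (hS : x ^ p ≤ S) : x ^ 2 * S ^ (2 / q - 1) ≤ S := by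
  obtain ⟨hq, hq2, ha, ha1, hsum⟩ := bellman_exponents hpq hp
  have hS0 : 0 ≤ S := (Real.rpow_nonneg hx p).trans hS
  have h1 : x ^ 2 ≤ S ^ (2 / p) := by
    have := Real.rpow_le_rpow (z := 2 / p) (Real.rpow_nonneg hx p) hS (by positivity)
    rwa [← Real.rpow_mul hx, mul_div_cancel₀ _ (by linarith), Real.rpow_two] at this
  calc x ^ 2 * S ^ (2 / q - 1) ≤ S ^ (2 / p) * S ^ (2 / q - 1) :=
        mul_le_mul_of_nonneg_right h1 (Real.rpow_nonneg hS0 _)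
    _ = S := by rw [← Real.rpow_add_of_nonneg hS0 (by positivity) ha, hsum, Real.rpow_one]

/-- On the open quadrant all powers are smooth, and it suffices that the second derivative along the
segment be nonnegative. -/
theorem bellman_segment_convex (hpq : p.HolderConjugate q) (hp : 2 ≤ p) {σ : ℝ} (hσ : |σ| ≤ 1)
    {x y ξ η : ℝ} {D : Set ℝ} (hD : Convex ℝ D) (hx : ∀ r ∈ D, 0 < x + r * ξ)
    (hy : ∀ r ∈ D, 0 < y + r * η) :
    ConvexOn ℝ D fun r =>
      bellman p q (x + r * ξ, y + r * η) + σ * ((x + r * ξ) * (y + r * η)) := by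
  obtain ⟨hq, hq2, ha, ha1, hsum⟩ := bellman_exponents hpq hp
  set a := 2 / q - 1 with hadef
  set L := ((8 + 4 * p) ^ 2 / 4 + 5) / (q * (q - 1)) with hLdef
  have hq0 : 0 < q * (q - 1) := mul_pos (by linarith) (by linarith)
  set X : ℝ → ℝ := fun r => x + r * ξ with hXdef
  set Y : ℝ → ℝ := fun r => y + r * η with hYdef
  set S : ℝ → ℝ := fun r => X r ^ p + Y r ^ q with hSdef
  set S' : ℝ → ℝ := fun r => ξ * p * X r ^ (p - 1) + η * q * Y r ^ (q - 1) with hS'def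
  set φ' : ℝ → ℝ := fun r => L * (η * q * Y r ^ (q - 1)) +
    (2 * X r * ξ * S r ^ a + X r ^ 2 * (S' r * a * S r ^ (a - 1))) + σ * (ξ * Y r + X r * η)
  have hX : ∀ r, HasDerivAt X ξ r := fun r => by
    have h := ((hasDerivAt_id r).mul_const ξ).const_add x
    rwa [one_mul] at h
  have hY : ∀ r, HasDerivAt Y η r := fun r => by
    have h := ((hasDerivAt_id r).mul_const η).const_add y
    rwa [one_mul] at h
  have hS : ∀ r ∈ D, HasDerivAt S (S' r) r := fun r hr =>
    ((hX r).rpow_const (Or.inl (hx r hr).ne')).add ((hY r).rpow_const (Or.inl (hy r hr).ne'))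
  have hSpos : ∀ r ∈ D, 0 < S r := fun r hr =>
    add_pos (Real.rpow_pos_of_pos (hx r hr) _) (Real.rpow_pos_of_pos (hy r hr) _)
  have hX2 : ∀ r, HasDerivAt (fun r => X r ^ 2) (2 * X r * ξ) r := fun r => by
    have h := (hX r).fun_pow 2
    simpa only [Nat.cast_ofNat, Nat.add_one_sub_one, pow_one] using h
  have hφ : ∀ r ∈ D, HasDerivAt (fun r => bellman p q (X r, Y r) + σ * (X r * Y r)) (φ' r) r := by
    intro r hr
    have h1 := (((hY r).rpow_const (p := q) (Or.inl (hy r hr).ne')).const_mul L).add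
      ((hX2 r).mul ((hS r hr).rpow_const (p := a) (Or.inl (hSpos r hr).ne')))
    exact h1.add (((hX r).mul (hY r)).const_mul σ)
  have hS1 : ∀ r ∈ D, HasDerivAt S' (ξ * p * (ξ * (p - 1) * X r ^ (p - 1 - 1))
      + η * q * (η * (q - 1) * Y r ^ (q - 1 - 1))) r := fun r hr =>
    (((hX r).rpow_const (Or.inl (hx r hr).ne')).const_mul _).add
      (((hY r).rpow_const (Or.inl (hy r hr).ne')).const_mul _)
  have hφ2 := fun r (hr : r ∈ D) => (((((hY r).rpow_const (p := q - 1)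
      (Or.inl (hy r hr).ne')).const_mul (η * q)).const_mul L).add
    (((((hX r).const_mul 2).mul_const ξ).mul
        ((hS r hr).rpow_const (p := a) (Or.inl (hSpos r hr).ne'))).add
      ((hX2 r).mul (((hS1 r hr).mul_const a).mul
        ((hS r hr).rpow_const (p := a - 1) (Or.inl (hSpos r hr).ne')))))).add
    ((((hY r).const_mul ξ).add ((hX r).mul_const η)).const_mul σ)
  refine convexOn_of_hasDerivWithinAt2_nonneg hD
    (fun r hr => (hφ r hr).continuousAt.continuousWithinAt)
    (fun r hr => (hφ r (interior_subset hr)).hasDerivWithinAt)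
    (f'' := _) (fun r hr => (hφ2 r (interior_subset hr)).hasDerivWithinAt) (fun r hr => ?_)
  have hr := interior_subset hr
  have hXp := hx r hr
  have hYp := hy r hr
  change 0 < X r at hXp
  change 0 < Y r at hYp
  have hSp := hSpos r hr
  -- Here S = x^p + y^q, so `s` and `t` are the shares of the two summands, F = x² S^a with a = 2/q
  -- - 1, and `u`, `v` are the logarithmic velocities.
  have key := bellman_hessian_nonneg (p := p) (q := q) (a := a) (σ := σ)
    (F := X r ^ 2 * S r ^ a) (Yq := Y r ^ q) (m := X r * Y r) (s := X r ^ p / S r)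
    (t := Y r ^ q / S r) (u := ξ / X r) (v := η / Y r) (L := L * (q * (q - 1))) ha ha1 hp hq hq2 hσ
    (by positivity) (by positivity) (by positivity) (by positivity)
    (by rw [← add_div]; exact div_self hSp.ne') ?_ ?_ ?_
  · refine key.trans_eq ?_
    have e : S' r = ξ * p * X r ^ (p - 1) + η * q * Y r ^ (q - 1) := rfl
    clear_value a L
    simp only [Pi.mul_apply, e]
    rw [Real.rpow_sub_one hXp.ne' (p - 1), Real.rpow_sub_one hYp.ne' (q - 1),
      Real.rpow_sub_one hXp.ne' p, Real.rpow_sub_one hYp.ne' q,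
      Real.rpow_sub_one hSp.ne' (a - 1), Real.rpow_sub_one hSp.ne' a]
    have hS0 := hSp.ne'
    have hX0 := hXp.ne'
    have hY0 := hYp.ne'
    generalize X r ^ p = P
    generalize Y r ^ q = Q
    generalize S r ^ a = A
    generalize S r = S0 at *
    generalize X r = X0 at *
    generalize Y r = Y0 at *
    field_simp
    ring
  · rw [mul_div_assoc', div_le_iff₀ hSp, mul_comm (Y r ^ q)]
    exact mul_le_mul_of_nonneg_right (bellman_sq_mul_le hpq hp hXp.le
      (le_add_of_nonneg_right (by positivity))) (by positivity)
  -- The exponent a is chosen for this: (y^q)^a = y^{2-q}, so that (xy)² ≤ x² S^a y^q.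
  · have h1 : Y r ^ (2 - q) ≤ S r ^ a := by
      have h2 : Y r ^ (2 - q) = (Y r ^ q) ^ a := by
        rw [← Real.rpow_mul hYp.le]
        congr 1
        rw [hadef]
        field_simp
      rw [h2]
      exact Real.rpow_le_rpow (by positivity) (le_add_of_nonneg_left (by positivity)) ha
    have h2 : Y r ^ 2 = Y r ^ (2 - q) * Y r ^ q := by
      rw [← Real.rpow_add hYp]; simp
    rw [mul_pow, h2, mul_assoc]
    gcongr
  · rw [hLdef, div_mul_cancel₀ _ hq0.ne']

theorem bellman_convexOn (hpq : p.HolderConjugate q) (hp : 2 ≤ p) {σ : ℝ} (hσ : |σ| ≤ 1) :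
    ConvexOn ℝ (Set.Ici (0 : ℝ × ℝ)) fun z => bellman p q z + σ * (z.1 * z.2) := by
  obtain ⟨hq, hq2, ha, ha1, hsum⟩ := bellman_exponents hpq hp
  have hcont : Continuous fun z : ℝ × ℝ => bellman p q z + σ * (z.1 * z.2) := by
    unfold bellman
    have h1 : Continuous fun z : ℝ × ℝ => z.2 ^ q :=
      continuous_snd.rpow_const fun _ => Or.inr (by linarith)
    have h2 : Continuous fun z : ℝ × ℝ => z.1 ^ p :=
      continuous_fst.rpow_const fun _ => Or.inr (by linarith)
    have h3 := (h2.add h1).rpow_const (p := 2 / q - 1) fun _ => Or.inr ha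
    fun_prop
  refine ⟨convex_Ici _, fun z hz w hw c d hc hd hcd => ?_⟩
  -- On the axes the powers need not be differentiable. The segment is shifted by (ε, ε) into the
  -- open quadrant, and convexity passes to the limit by continuity.
  have hlim : ∀ z : ℝ × ℝ, Tendsto (fun ε : ℝ => bellman p q (z + (ε, ε))
      + σ * ((z + (ε, ε)).1 * (z + (ε, ε)).2)) (𝓝[>] 0) (𝓝 (bellman p q z + σ * (z.1 * z.2))) := by
    intro z
    have h1 : Continuous fun ε : ℝ => z + (ε, ε) := by fun_prop
    have h2 := ((hcont.comp h1).tendsto 0).mono_left (nhdsWithin_le_nhds (s := Set.Ioi 0))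
    have h3 : z + ((0 : ℝ), (0 : ℝ)) = z := add_zero z
    simpa only [Function.comp_def, h3] using h2
  refine le_of_tendsto_of_tendsto (hlim _)
    (((hlim z).const_smul c).add ((hlim w).const_smul d)) ?_
  filter_upwards [self_mem_nhdsWithin] with ε hε
  have hε : 0 < ε := hε
  have hz1 : 0 ≤ z.1 := hz.1
  have hz2 : 0 ≤ z.2 := hz.2
  have hw1 : 0 ≤ w.1 := hw.1
  have hw2 : 0 ≤ w.2 := hw.2
  have hseg := bellman_segment_convex hpq hp hσ (x := z.1 + ε) (y := z.2 + ε)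
    (ξ := w.1 - z.1) (η := w.2 - z.2) (convex_Icc (0 : ℝ) 1)
    (fun r hr => by nlinarith [hr.1, hr.2]) (fun r hr => by nlinarith [hr.1, hr.2])
  have h := hseg.2 (x := 0) (y := 1) (by simp) (by simp) hc hd hcd
  obtain rfl : c = 1 - d := by linarith
  have e1 : z.1 + ε + (w.1 - z.1) = w.1 + ε := by ring
  have e2 : z.2 + ε + (w.2 - z.2) = w.2 + ε := by ring
  have e3 : z.1 + ε + d * (w.1 - z.1) = (1 - d) * z.1 + d * w.1 + ε := by ring
  have e4 : z.2 + ε + d * (w.2 - z.2) = (1 - d) * z.2 + d * w.2 + ε := by ring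
  simp only [smul_eq_mul, mul_zero, mul_one, zero_add, one_mul, zero_mul, add_zero] at h
  rw [e1, e2, e3, e4] at h
  exact h

theorem bellman_nonneg (hpq : p.HolderConjugate q) (hp : 2 ≤ p) {z : ℝ × ℝ} (hz : 0 ≤ z) :
    0 ≤ bellman p q z := by
  obtain ⟨hq, hq2, ha, ha1, hsum⟩ := bellman_exponents hpq hp
  have hz1 : 0 ≤ z.1 := hz.1
  have hz2 : 0 ≤ z.2 := hz.2
  have : 0 < q - 1 := by linarith
  unfold bellman
  positivity

theorem exists_bellman_le (hpq : p.HolderConjugate q) (hp : 2 ≤ p) :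
    ∃ C : ℝ≥0, ∀ z : ℝ × ℝ, 0 ≤ z → bellman p q z ≤ C * (z.1 ^ p + z.2 ^ q) := by
  obtain ⟨hq, hq2, ha, ha1, hsum⟩ := bellman_exponents hpq hp
  have hq1 : 0 < q - 1 := by linarith
  refine ⟨Real.toNNReal (((8 + 4 * p) ^ 2 / 4 + 5) / (q * (q - 1)) + 1), fun z hz => ?_⟩
  have hz1 : 0 ≤ z.1 := hz.1
  have hz2 : 0 ≤ z.2 := hz.2
  have h1 := bellman_sq_mul_le hpq hp hz1 (le_add_of_nonneg_right (Real.rpow_nonneg hz2 q))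
  have h2 : 0 ≤ ((8 + 4 * p) ^ 2 / 4 + 5) / (q * (q - 1)) := by positivity
  have h3 := Real.rpow_nonneg hz1 p
  have h4 := mul_nonneg h2 h3
  unfold bellman
  rw [Real.coe_toNNReal _ (by positivity)]
  linarith

/-- The gain in Jensen's inequality for the Bellman function. -/
theorem bellman_jensen (hpq : p.HolderConjugate q) (hp : 2 ≤ p) {E : Type} [Fintype E]
    [DecidableEq E] {a b : E} (hab : a ≠ b) {x y : E → ℝ} (hx : ∀ e, 0 ≤ x e) (hy : ∀ e, 0 ≤ y e) :
    bellman p q ((Fintype.card E : ℝ)⁻¹ * ∑ e, x e, (Fintype.card E : ℝ)⁻¹ * ∑ e, y e)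
        + (Fintype.card E : ℝ)⁻¹ * (|x a - x b| * |y a - y b| / 2) ≤
      (Fintype.card E : ℝ)⁻¹ * ∑ e, bellman p q (x e, y e) := by
  have hN : 0 < (Fintype.card E : ℝ) := by
    exact_mod_cast Fintype.card_pos_iff.2 ⟨a⟩
  -- Replacing the points at `a` and `b` by their midpoint does not change the mean. Ordinary Jensen
  -- is applied to the new family, and the gain is what the replacement saves.
  set z : E → ℝ × ℝ := fun e => if e = a ∨ e = b then ((x a + x b) / 2, (y a + y b) / 2)
    else (x e, y e) with hz
  have hz0 : ∀ e, z e ∈ Set.Ici (0 : ℝ × ℝ) := by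
    intro e
    simp only [hz]
    split_ifs
    · exact ⟨by have := hx a; have := hx b; simp; linarith,
        by have := hy a; have := hy b; simp; linarith⟩
    · exact ⟨hx e, hy e⟩
  have hsum : ∀ f : ℝ × ℝ → ℝ, ∑ e, f (z e) = ∑ e, f (x e, y e)
      - (f (x a, y a) + f (x b, y b) - 2 * f ((x a + x b) / 2, (y a + y b) / 2)) := by
    intro f
    have hsub : ∀ g : E → ℝ, ∑ e, g e = g a + g b + ∑ e ∈ Finset.univ \ {a, b}, g e := by
      intro g
      rw [← Finset.sum_sdiff (Finset.subset_univ {a, b}), Finset.sum_pair hab]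
      ring
    rw [hsub, hsub (fun e => f (x e, y e))]
    have : ∑ e ∈ Finset.univ \ {a, b}, f (z e) = ∑ e ∈ Finset.univ \ {a, b}, f (x e, y e) := by
      refine Finset.sum_congr rfl fun e he => ?_
      simp only [Finset.mem_sdiff, Finset.mem_univ, Finset.mem_insert, Finset.mem_singleton,
        true_and] at he
      simp [hz, he]
    rw [this]
    simp only [hz, true_or, or_true, if_true]
    ring
  have hconv := (bellman_convexOn hpq hp (σ := 0) (by simp)).map_sum_le
    (t := Finset.univ) (w := fun _ => (Fintype.card E : ℝ)⁻¹) (p := z)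
    (fun _ _ => inv_nonneg.2 hN.le) (by simp [hN.ne']) (fun e _ => hz0 e)
  have hfst : ∑ e, (z e).1 = ∑ e, x e := by rw [hsum Prod.fst]; ring
  have hsnd : ∑ e, (z e).2 = ∑ e, y e := by rw [hsum Prod.snd]; ring
  have hmean : ∑ e, (Fintype.card E : ℝ)⁻¹ • z e =
      ((Fintype.card E : ℝ)⁻¹ * ∑ e, x e, (Fintype.card E : ℝ)⁻¹ * ∑ e, y e) := by
    rw [← Finset.smul_sum, ← hfst, ← hsnd]
    ext <;> simp [Prod.fst_sum, Prod.snd_sum]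
  simp only [hmean, zero_mul, add_zero, smul_eq_mul] at hconv
  rw [← Finset.mul_sum, hsum] at hconv
  have hmid : |x a - x b| * |y a - y b| / 2 ≤ bellman p q (x a, y a) + bellman p q (x b, y b)
      - 2 * bellman p q ((x a + x b) / 2, (y a + y b) / 2) := by
    -- For the product xy, the sum of the end values minus twice the midpoint value is (x_a -
    -- x_b)(y_a - y_b)/2. Midpoint convexity with σ = 1 and with σ = -1 gives this with an absolute
    -- value.
    have h := fun (σ : ℝ) (hσ : |σ| ≤ 1) => (bellman_convexOn hpq hp (σ := σ) hσ).2 (x := (x a, y a))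
      ⟨hx a, hy a⟩ (y := (x b, y b)) ⟨hx b, hy b⟩ one_half_pos.le one_half_pos.le (add_halves 1)
    have h1 := h 1 (by simp)
    have h2 := h (-1) (by simp)
    have e : ((1 / 2 : ℝ) • ((x a, y a) : ℝ × ℝ) + (1 / 2 : ℝ) • ((x b, y b) : ℝ × ℝ))
        = ((x a + x b) / 2, (y a + y b) / 2) := by
      ext <;> simp <;> ring
    rw [e] at h1 h2
    simp only [smul_eq_mul] at h1 h2
    rw [← abs_mul]
    rcases abs_cases ((x a - x b) * (y a - y b)) with h3 | h3 <;> linarith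
  have h4 := mul_le_mul_of_nonneg_left hmid (inv_nonneg.2 hN.le)
  linarith

end Bellman

/-! ### Combinations of translations and the bilinear embedding -/

section ShiftAlgebra

variable {X : Type} [NormedAddCommGroup X] {F F' : Type} [NormedAddCommGroup F] [NormedSpace ℝ F]
  [NormedAddCommGroup F'] [NormedSpace ℝ F']

/-- Finite linear combinations of translations, with composition as product. -/
abbrev ShiftAlg (X : Type) [NormedAddCommGroup X] : Type := AddMonoidAlgebra ℝ X

/-- The action of combinations of translations on functions. -/
def act (F : Type) [NormedAddCommGroup F] [NormedSpace ℝ F] :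
    ShiftAlg X →ₐ[ℝ] Module.End ℝ (X → F) :=
  AddMonoidAlgebra.lift ℝ (Module.End ℝ (X → F)) X
    { toFun := fun v => LinearMap.funLeft ℝ F fun x => x - v.toAdd
      map_one' := by ext; simp [LinearMap.funLeft]
      map_mul' := fun v w => by
        ext f x
        simp only [LinearMap.funLeft_apply, toAdd_mul, Module.End.mul_apply]
        congr 1
        abel }

theorem act_single (v : X) (r : ℝ) (f : X → F) (x : X) :
    act F (AddMonoidAlgebra.single v r) f x = r • f (x - v) := by
  simp [act, AddMonoidAlgebra.lift_single, LinearMap.funLeft]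

theorem act_add_apply (a b : ShiftAlg X) (f : X → F) : act F (a + b) f = act F a f + act F b f := by
  rw [map_add]; rfl

theorem act_sub_apply (a b : ShiftAlg X) (f : X → F) : act F (a - b) f = act F a f - act F b f := by
  rw [map_sub]; rfl

theorem act_mul_apply (a b : ShiftAlg X) (f : X → F) : act F (a * b) f = act F a (act F b f) := by
  rw [map_mul]; rfl

theorem act_smul_apply (r : ℝ) (a : ShiftAlg X) (f : X → F) : act F (r • a) f = r • act F a f := by
  rw [map_smul]; rfl

theorem act_sum_apply {ι : Type} (s : Finset ι) (a : ι → ShiftAlg X) (f : X → F) :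
    act F (∑ i ∈ s, a i) f = ∑ i ∈ s, act F (a i) f := by
  rw [map_sum, LinearMap.sum_apply]

theorem act_comp (L : F →L[ℝ] F') (a : ShiftAlg X) (f : X → F) :
    act F' a (fun x => L (f x)) = fun x => L (act F a f x) := by
  induction a using AddMonoidAlgebra.induction_linear with
  | zero => ext; simp
  | add a b ha hb => ext x; rw [act_add_apply, act_add_apply, ha, hb]; simp
  | single v r => ext x; simp [act_single]

/-- Reflection of a combination of translations. -/
def refl : ShiftAlg X →ₐ[ℝ] ShiftAlg X :=
  AddMonoidAlgebra.mapDomainAlgHom ℝ ℝ (-AddMonoidHom.id X)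

theorem refl_single (v : X) (r : ℝ) :
    refl (AddMonoidAlgebra.single v r) = AddMonoidAlgebra.single (-v) r := by
  simp [refl, AddMonoidAlgebra.mapDomainAlgHom_apply, AddMonoidAlgebra.mapDomain_single]

theorem refl_refl (a : ShiftAlg X) : refl (refl a) = a := by
  induction a using AddMonoidAlgebra.induction_linear with
  | zero => simp
  | add a b ha hb => rw [map_add, map_add, ha, hb]
  | single v r => rw [refl_single, refl_single, neg_neg]

variable [MeasureSpace X] [BorelSpace X] [NormedSpace ℝ X] [FiniteDimensional ℝ X]
  [(volume : Measure X).IsAddHaarMeasure]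

theorem aestronglyMeasurable_act {f : X → F} (hf : AEStronglyMeasurable f volume)
    (a : ShiftAlg X) : AEStronglyMeasurable (act F a f) volume := by
  induction a using AddMonoidAlgebra.induction_linear with
  | zero => simpa using aestronglyMeasurable_zero
  | add a b ha hb => rw [act_add_apply]; exact ha.add hb
  | single v r =>
    have h : act F (AddMonoidAlgebra.single v r) f = fun x => r • f (x - v) :=
      funext (act_single v r f)
    rw [h]
    exact (hf.comp_quasiMeasurePreserving
      (measurePreserving_sub_right volume v).quasiMeasurePreserving).const_smul r

theorem memLp_comp_sub {p : ℝ≥0∞} {f : X → F} (hf : MemLp f p volume) (v : X) :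
    MemLp (fun x => f (x - v)) p volume :=
  hf.comp_measurePreserving (measurePreserving_sub_right volume v)

theorem eLpNorm_act_single {p : ℝ≥0∞} {f : X → F} (hf : AEStronglyMeasurable f volume) (v : X)
    (r : ℝ) : eLpNorm (act F (AddMonoidAlgebra.single v r) f) p volume
      = ‖r‖ₑ * eLpNorm f p volume := by
  have h : act F (AddMonoidAlgebra.single v r) f = r • fun x => f (x - v) :=
    funext (act_single v r f)
  rw [h, eLpNorm_const_smul]
  congr 1
  exact eLpNorm_comp_measurePreserving hf (measurePreserving_sub_right volume v)

theorem memLp_act {p : ℝ≥0∞} {f : X → F} (hf : MemLp f p volume) (a : ShiftAlg X) :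
    MemLp (act F a f) p volume := by
  induction a using AddMonoidAlgebra.induction_linear with
  | zero => simp
  | add a b ha hb => rw [act_add_apply]; exact ha.add hb
  | single v r =>
    have h : act F (AddMonoidAlgebra.single v r) f = r • fun x => f (x - v) :=
      funext (act_single v r f)
    rw [h]
    exact (memLp_comp_sub hf v).const_smul r

theorem integral_act_mul {p q : ℝ≥0∞} [hpq : p.HolderConjugate q] {g h : X → ℂ}
    (hg : MemLp g p volume) (hh : MemLp h q volume) (a : ShiftAlg X) :
    ∫ x, act ℂ a g x * h x = ∫ x, g x * act ℂ (refl a) h x := by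
  induction a using AddMonoidAlgebra.induction_linear with
  | zero => simp
  | add a b ha hb =>
    rw [act_add_apply, map_add refl, act_add_apply]
    simp only [Pi.add_apply, add_mul, mul_add]
    rw [integral_add (integrable_mul_of_memLp (memLp_act hg a) hh)
        (integrable_mul_of_memLp (memLp_act hg b) hh),
      integral_add (integrable_mul_of_memLp hg (memLp_act hh _))
        (integrable_mul_of_memLp hg (memLp_act hh _)), ha, hb]
  | single v r =>
    rw [refl_single]
    simp only [act_single, sub_neg_eq_add]
    rw [← integral_add_right_eq_self _ v]
    refine integral_congr_ae (Eventually.of_forall fun x => ?_)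
    simp only [add_sub_cancel_right, Complex.real_smul]
    ring

/-- The mean of finitely many translations. -/
def avgShift {E : Type} [Fintype E] (v : E → X) : ShiftAlg X :=
  ∑ e, AddMonoidAlgebra.single (v e) (Fintype.card E : ℝ)⁻¹

/-- The difference of two translations. -/
def diffShift (v w : X) : ShiftAlg X :=
  AddMonoidAlgebra.single v 1 - AddMonoidAlgebra.single w 1

theorem act_avgShift {E : Type} [Fintype E] (v : E → X) (f : X → ℝ) (x : X) :
    act ℝ (avgShift v) f x = (Fintype.card E : ℝ)⁻¹ * ∑ e, f (x - v e) := by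
  simp [avgShift, act_single, Finset.mul_sum]

theorem act_diffShift (v w : X) (f : X → F) (x : X) :
    act F (diffShift v w) f x = f (x - v) - f (x - w) := by
  simp [diffShift, act_single]

/-- The bilinear square function of the differences along the powers of a mean of translations. -/
def diffSum {E : Type} [Fintype E] (v : E → X) (a b : E) (N : ℕ) (g : X → F) (h : X → F') : ℝ≥0∞ :=
  ∑ k ∈ Finset.range N, ∫⁻ x, ‖act F (diffShift (v a) (v b) * avgShift v ^ k) g x‖ₑ
    * ‖act F' (diffShift (v a) (v b) * avgShift v ^ k) h x‖ₑ

theorem act_avgShift_pow_nonneg {E : Type} [Fintype E] (v : E → X) {f : X → ℝ} (hf : ∀ x, 0 ≤ f x)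
    (k : ℕ) (x : X) : 0 ≤ act ℝ (avgShift v ^ k) f x := by
  induction k generalizing x with
  | zero => simpa using hf x
  | succ k ih =>
    rw [pow_succ', act_mul_apply, act_avgShift]
    exact mul_nonneg (by positivity) (Finset.sum_nonneg fun e _ => ih _)

/-- Let W_k be the integral of the Bellman function at (T^k f, T^k h), where T is the mean of the
translations. Jensen's inequality with gain, integrated with the translation invariance of the
measure, says that W_k - W_{k+1} is at least a multiple of the k-th summand. The sum telescopes and
is bounded by W_0, whatever the translations and `N`. -/
theorem diffSum_le_of_nonneg {p q : ℝ} (hpq : p.HolderConjugate q) (hp : 2 ≤ p) {E : Type}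
    [Fintype E] [Nonempty E] : ∃ C : ℝ≥0, ∀ (v : E → X) (a b : E) (N : ℕ) (f h : X → ℝ),
      (∀ x, 0 ≤ f x) → (∀ x, 0 ≤ h x) → AEStronglyMeasurable f volume →
      AEStronglyMeasurable h volume → diffSum v a b N f h
        ≤ C * ((∫⁻ x, ‖f x‖ₑ ^ p) + ∫⁻ x, ‖h x‖ₑ ^ q) := by
  classical
  obtain ⟨C, hC⟩ := exists_bellman_le hpq hp
  have hq := hpq.symm.pos
  set c : ℝ := (Fintype.card E : ℝ)⁻¹ with hc
  have hc0 : 0 < c := by positivity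
  -- The gain in `bellman_jensen` carries the factor c/2 with c = 1/|E|; its inverse enters the
  -- constant.
  refine ⟨(c / 2).toNNReal⁻¹ * C, fun v a b N f h hf hh hfm hhm => ?_⟩
  rcases eq_or_ne a b with rfl | hab
  · simp [diffSum, diffShift]
  set W : ℕ → X → ℝ≥0∞ := fun k x =>
    ENNReal.ofReal (bellman p q (act ℝ (avgShift v ^ k) f x, act ℝ (avgShift v ^ k) h x)) with hW
  set Q : ℕ → X → ℝ≥0∞ := fun k x => ‖act ℝ (diffShift (v a) (v b) * avgShift v ^ k) f x‖ₑ
    * ‖act ℝ (diffShift (v a) (v b) * avgShift v ^ k) h x‖ₑ with hQ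
  have hQm : ∀ k, AEMeasurable (Q k) volume := fun k =>
    (aestronglyMeasurable_act hfm _).enorm.mul (aestronglyMeasurable_act hhm _).enorm
  have hbm : Measurable (bellman p q) := by
    unfold bellman
    fun_prop
  have hWm : ∀ k, AEMeasurable (W k) volume := fun k =>
    (hbm.comp_aemeasurable ((aestronglyMeasurable_act hfm _).aemeasurable.prodMk
      (aestronglyMeasurable_act hhm _).aemeasurable)).ennreal_ofReal
  have hstep : ∀ k, (∫⁻ x, W (k + 1) x) + ENNReal.ofReal (c / 2) * ∫⁻ x, Q k x ≤ ∫⁻ x, W k x := by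
    intro k
    have hpt : ∀ x, W (k + 1) x + ENNReal.ofReal (c / 2) * Q k x
        ≤ ∑ e, ENNReal.ofReal c * W k (x - v e) := by
      intro x
      have hn := fun e => bellman_nonneg hpq hp
        (z := (act ℝ (avgShift v ^ k) f (x - v e), act ℝ (avgShift v ^ k) h (x - v e)))
        ⟨act_avgShift_pow_nonneg v hf k _, act_avgShift_pow_nonneg v hh k _⟩
      have key := bellman_jensen hpq hp hab (x := fun e => act ℝ (avgShift v ^ k) f (x - v e))
        (y := fun e => act ℝ (avgShift v ^ k) h (x - v e))
        (fun e => act_avgShift_pow_nonneg v hf k _) (fun e => act_avgShift_pow_nonneg v hh k _)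
      rw [← act_avgShift, ← act_avgShift, ← act_mul_apply, ← act_mul_apply, ← pow_succ'] at key
      have hQx : Q k x = ENNReal.ofReal
          (|act ℝ (avgShift v ^ k) f (x - v a) - act ℝ (avgShift v ^ k) f (x - v b)| *
            |act ℝ (avgShift v ^ k) h (x - v a) - act ℝ (avgShift v ^ k) h (x - v b)|) := by
        simp only [hQ, act_mul_apply, act_diffShift, Real.enorm_eq_ofReal_abs]
        rw [ENNReal.ofReal_mul (abs_nonneg _)]
      rw [hQx, ← ENNReal.ofReal_mul (by positivity)]
      simp only [hW]
      rw [← ENNReal.ofReal_add (bellman_nonneg hpq hp ⟨act_avgShift_pow_nonneg v hf _ _,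
        act_avgShift_pow_nonneg v hh _ _⟩) (by positivity)]
      simp only [← ENNReal.ofReal_mul hc0.le]
      rw [← ENNReal.ofReal_sum_of_nonneg fun e _ => mul_nonneg hc0.le (hn e)]
      refine ENNReal.ofReal_le_ofReal ?_
      rw [← Finset.mul_sum]
      refine le_trans (le_of_eq ?_) key
      rw [← hc]
      ring
    calc (∫⁻ x, W (k + 1) x) + ENNReal.ofReal (c / 2) * ∫⁻ x, Q k x
        = ∫⁻ x, (W (k + 1) x + ENNReal.ofReal (c / 2) * Q k x) := by
          rw [lintegral_add_left' (hWm _), lintegral_const_mul'' _ (hQm k)]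
      _ ≤ ∫⁻ x, ∑ e, ENNReal.ofReal c * W k (x - v e) := lintegral_mono hpt
      _ = ∑ e, ENNReal.ofReal c * ∫⁻ x, W k x := by
          have hm : ∀ e, AEMeasurable (fun x => W k (x - v e)) volume := fun e =>
            (hWm k).comp_quasiMeasurePreserving
              (measurePreserving_sub_right volume (v e)).quasiMeasurePreserving
          rw [lintegral_finsetSum' _ fun e _ => (hm e).const_mul _]
          refine Finset.sum_congr rfl fun e _ => ?_
          rw [lintegral_const_mul'' _ (hm e), lintegral_sub_right_eq_self]
      _ = ∫⁻ x, W k x := by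
          rw [Finset.sum_const, ← smul_mul_assoc, nsmul_eq_mul, Finset.card_univ,
            ← ENNReal.ofReal_natCast, ← ENNReal.ofReal_mul (by positivity), hc,
            mul_inv_cancel₀ (by positivity), ENNReal.ofReal_one, one_mul]
  have hsum : ∀ N, (∫⁻ x, W N x) + ENNReal.ofReal (c / 2) * ∑ k ∈ Finset.range N, ∫⁻ x, Q k x
      ≤ ∫⁻ x, W 0 x := by
    intro N
    induction N with
    | zero => simp
    | succ N ih =>
      refine le_trans (le_of_eq ?_) ((add_le_add_left (hstep N) _).trans ih)
      rw [Finset.sum_range_succ]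
      ring
  have h0 : ∫⁻ x, W 0 x ≤ C * ((∫⁻ x, ‖f x‖ₑ ^ p) + ∫⁻ x, ‖h x‖ₑ ^ q) := by
    rw [← lintegral_add_left' (hfm.enorm.pow_const p), ← lintegral_const_mul' _ _ (by simp)]
    refine lintegral_mono fun x => ?_
    simp only [hW, pow_zero, map_one, Module.End.one_apply]
    refine (ENNReal.ofReal_le_ofReal (hC (f x, h x) ⟨hf x, hh x⟩)).trans (le_of_eq ?_)
    rw [ENNReal.ofReal_mul C.coe_nonneg, ENNReal.ofReal_coe_nnreal, ENNReal.ofReal_add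
      (Real.rpow_nonneg (hf x) _) (Real.rpow_nonneg (hh x) _), Real.enorm_eq_ofReal (hf x),
      Real.enorm_eq_ofReal (hh x), ENNReal.ofReal_rpow_of_nonneg (hf x) (by linarith),
      ENNReal.ofReal_rpow_of_nonneg (hh x) hq.le]
  have h1 : ENNReal.ofReal (c / 2) * diffSum v a b N f h
      ≤ C * ((∫⁻ x, ‖f x‖ₑ ^ p) + ∫⁻ x, ‖h x‖ₑ ^ q) :=
    (le_add_self.trans (hsum N)).trans h0
  rw [mul_comm, ← ENNReal.le_div_iff_mul_le (Or.inl (by simpa using hc0))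
    (Or.inl ENNReal.ofReal_ne_top)] at h1
  refine h1.trans (le_of_eq ?_)
  rw [ENNReal.coe_mul, ENNReal.coe_inv (by simpa using hc0), ENNReal.div_eq_inv_mul, mul_assoc]
  rfl

theorem diffSum_const_smul {E : Type} [Fintype E] (v : E → X) (a b : E) (N : ℕ) (g : X → F)
    (h : X → F') (r s : ℝ) :
    diffSum v a b N (r • g) (s • h) = ‖r‖ₑ * ‖s‖ₑ * diffSum v a b N g h := by
  rw [diffSum, diffSum, Finset.mul_sum]
  refine Finset.sum_congr rfl fun k _ => ?_
  rw [← lintegral_const_mul' _ _ (ENNReal.mul_ne_top enorm_ne_top enorm_ne_top)]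
  refine lintegral_congr fun x => ?_
  rw [map_smul, map_smul, Pi.smul_apply, Pi.smul_apply, enorm_smul, enorm_smul]
  ring

theorem lintegral_rpow_le_one {Y : Type} [MeasurableSpace Y] {μ : Measure Y} {f : Y → ℝ} {p : ℝ}
    (hp : 1 < p) (hf : eLpNorm f (ENNReal.ofReal p) μ ≤ 1) : ∫⁻ x, ‖f x‖ₑ ^ p ∂μ ≤ 1 := by
  rw [eLpNorm_eq_lintegral_rpow_enorm_toReal (by simpa using by linarith) ENNReal.ofReal_ne_top,
    ENNReal.toReal_ofReal (by linarith)] at hf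
  have := ENNReal.rpow_le_rpow hf (z := p) (by linarith)
  rwa [← ENNReal.rpow_mul, one_div_mul_cancel (by linarith), ENNReal.rpow_one,
    ENNReal.one_rpow] at this

/-- The left-hand side is bilinear, so scaling both functions to norm at most one turns the sum of
the two powers into a product of norms; the sum 1 + 1 accounts for the factor 2. -/
theorem diffSum_le_of_nonneg' {p q : ℝ} (hpq : p.HolderConjugate q) (hp : 2 ≤ p) {E : Type}
    [Fintype E] [Nonempty E] : ∃ C : ℝ≥0, ∀ (v : E → X) (a b : E) (N : ℕ) (f h : X → ℝ),
      (∀ x, 0 ≤ f x) → (∀ x, 0 ≤ h x) → AEStronglyMeasurable f volume →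
      AEStronglyMeasurable h volume → ∀ α β : ℝ, 0 < α → 0 < β →
      eLpNorm f (ENNReal.ofReal p) volume ≤ ENNReal.ofReal α →
      eLpNorm h (ENNReal.ofReal q) volume ≤ ENNReal.ofReal β →
      diffSum v a b N f h ≤ C * ENNReal.ofReal (α * β) := by
  obtain ⟨C, hC⟩ := diffSum_le_of_nonneg (X := X) hpq hp (E := E)
  refine ⟨C * 2, fun v a b N f h hf hh hfm hhm α β hα hβ hfα hhβ => ?_⟩
  have h1 := hC v a b N (α⁻¹ • f) (β⁻¹ • h) (fun x => mul_nonneg (by positivity) (hf x))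
    (fun x => mul_nonneg (by positivity) (hh x)) (hfm.const_smul _) (hhm.const_smul _)
  have hnorm : ∀ {r : ℝ} {g : X → ℝ} {γ : ℝ}, 0 < γ → eLpNorm g (ENNReal.ofReal r) volume
      ≤ ENNReal.ofReal γ → eLpNorm (γ⁻¹ • g) (ENNReal.ofReal r) volume ≤ 1 := by
    intro r g γ hγ hg
    rw [eLpNorm_const_smul, Real.enorm_of_nonneg (inv_nonneg.2 hγ.le)]
    calc _ ≤ ENNReal.ofReal γ⁻¹ * ENNReal.ofReal γ := by gcongr
      _ = 1 := by rw [← ENNReal.ofReal_mul (by positivity), inv_mul_cancel₀ hγ.ne',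
        ENNReal.ofReal_one]
  have h2 := lintegral_rpow_le_one hpq.lt (hnorm hα hfα)
  have h3 := lintegral_rpow_le_one hpq.symm.lt (hnorm hβ hhβ)
  have h4 : diffSum v a b N (α⁻¹ • f) (β⁻¹ • h) ≤ C * 2 := by
    refine h1.trans ?_
    rw [← one_add_one_eq_two]
    gcongr
  have h5 : diffSum v a b N f h
      = ENNReal.ofReal (α * β) * diffSum v a b N (α⁻¹ • f) (β⁻¹ • h) := by
    have := diffSum_const_smul v a b N (α⁻¹ • f) (β⁻¹ • h) α β
    rw [smul_smul, smul_smul, mul_inv_cancel₀ hα.ne', mul_inv_cancel₀ hβ.ne', one_smul,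
      one_smul] at this
    rw [this, ENNReal.ofReal_mul hα.le, Real.enorm_of_nonneg hα.le, Real.enorm_of_nonneg hβ.le]
  rw [h5, mul_comm]
  push_cast
  gcongr

end ShiftAlgebra

/-! ### L^p norms by duality -/

section Duality

variable {Y : Type} [MeasurableSpace Y] {μ : Measure Y} {p q : ℝ}

theorem holderConjugate_ofReal (hpq : p.HolderConjugate q) :
    (ENNReal.ofReal p).HolderConjugate (ENNReal.ofReal q) := hpq.ennrealOfReal

/-- The dual function `|F|^{p-2} conj F`. -/
def dualFun (p : ℝ) (F : Y → ℂ) (y : Y) : ℂ := ((‖F y‖ ^ (p - 2) : ℝ) : ℂ) * conj (F y)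

theorem mul_dualFun (hp : 1 < p) (F : Y → ℂ) (y : Y) :
    F y * dualFun p F y = ((‖F y‖ ^ p : ℝ) : ℂ) := by
  unfold dualFun
  rcases eq_or_ne (F y) 0 with h | h
  · simp [h, Real.zero_rpow (show p ≠ 0 by linarith)]
  · rw [mul_left_comm, Complex.mul_conj, Complex.normSq_eq_norm_sq, ← Complex.ofReal_mul,
      ← Real.rpow_two, ← Real.rpow_add (norm_pos_iff.2 h)]
    simp

theorem norm_dualFun (hp : 1 < p) (F : Y → ℂ) (y : Y) :
    ‖dualFun p F y‖ = ‖F y‖ ^ (p - 1) := by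
  unfold dualFun
  rcases eq_or_ne (F y) 0 with h | h
  · simp [h, Real.zero_rpow (show p - 1 ≠ 0 by linarith)]
  · rw [norm_mul, Complex.norm_real, Real.norm_of_nonneg (by positivity), RCLike.norm_conj]
    conv_lhs => rw [← Real.rpow_one ‖F y‖, ← Real.rpow_mul (norm_nonneg _), one_mul]
    rw [← Real.rpow_add (norm_pos_iff.2 h)]
    ring_nf

theorem norm_dualFun_rpow (hpq : p.HolderConjugate q) (F : Y → ℂ) (y : Y) :
    ‖dualFun p F y‖ ^ q = ‖F y‖ ^ p := by
  rw [norm_dualFun hpq.lt, ← Real.rpow_mul (norm_nonneg _), hpq.sub_one_mul_conj]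

theorem memLp_dualFun (hpq : p.HolderConjugate q) {F : Y → ℂ} (hF : MemLp F (ENNReal.ofReal p) μ) :
    MemLp (dualFun p F) (ENNReal.ofReal q) μ := by
  have hm : AEStronglyMeasurable (dualFun p F) μ := by
    have h1 := hF.1.aemeasurable.norm.pow_const (p - 2)
    exact ((Complex.measurable_ofReal.comp_aemeasurable h1).mul
      (Complex.continuous_conj.measurable.comp_aemeasurable
        hF.1.aemeasurable)).aestronglyMeasurable
  rw [← integrable_norm_rpow_iff hm (by simpa using hpq.symm.pos) ENNReal.ofReal_ne_top,
    ENNReal.toReal_ofReal hpq.symm.nonneg]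
  simp only [norm_dualFun_rpow hpq]
  have := hF.integrable_norm_rpow (by simpa using hpq.pos) ENNReal.ofReal_ne_top
  rwa [ENNReal.toReal_ofReal hpq.nonneg] at this

/-- Testing with |F|^{p-2} conj F gives J ≤ M J^{1/q} with J = ∫ |F|^p. As `F` is known to be in
L^p, J is finite and the power can be cancelled. -/
theorem eLpNorm_le_of_forall_integral_mul_le (hpq : p.HolderConjugate q) {F : Y → ℂ}
    (hF : MemLp F (ENNReal.ofReal p) μ) {M : ℝ} (hM : 0 ≤ M)
    (h : ∀ g : Y → ℂ, MemLp g (ENNReal.ofReal q) μ →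
      ‖∫ y, F y * g y ∂μ‖ ≤ M * (eLpNorm g (ENNReal.ofReal q) μ).toReal) :
    eLpNorm F (ENNReal.ofReal p) μ ≤ ENNReal.ofReal M := by
  have hd := memLp_dualFun hpq hF
  have h1 := h _ hd
  set J := ∫ y, ‖F y‖ ^ p ∂μ with hJ
  have hJ0 : 0 ≤ J := integral_nonneg fun y => by positivity
  have hp0 : ENNReal.ofReal p ≠ 0 := by simpa using hpq.pos
  have hq0 : ENNReal.ofReal q ≠ 0 := by simpa using hpq.symm.pos
  rw [hd.eLpNorm_eq_integral_rpow_norm hq0 ENNReal.ofReal_ne_top,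
    ENNReal.toReal_ofReal hpq.symm.nonneg] at h1
  rw [hF.eLpNorm_eq_integral_rpow_norm hp0 ENNReal.ofReal_ne_top,
    ENNReal.toReal_ofReal hpq.nonneg]
  refine ENNReal.ofReal_le_ofReal ?_
  simp only [mul_dualFun hpq.lt, norm_dualFun_rpow hpq] at h1
  rw [integral_complex_ofReal, Complex.norm_real, ← hJ, Real.norm_of_nonneg hJ0,
    ENNReal.toReal_ofReal (by positivity)] at h1
  rcases hJ0.eq_or_lt with hz | hpos
  · rw [← hJ, ← hz, Real.zero_rpow (inv_ne_zero hpq.ne_zero)]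
    exact hM
  · have h2 : J = J ^ p⁻¹ * J ^ q⁻¹ := by
      rw [← Real.rpow_add hpos, hpq.inv_add_inv_eq_one, Real.rpow_one]
    have h3 : 0 < J ^ q⁻¹ := by positivity
    rw [← hJ]
    nth_rw 1 [h2] at h1
    exact le_of_mul_le_mul_right h1 h3

end Duality

/-! ### L^p bounds for sums of squared differences -/

section Multiplier

variable {X : Type} [NormedAddCommGroup X] [MeasureSpace X] [BorelSpace X] [NormedSpace ℝ X]
  [FiniteDimensional ℝ X] [(volume : Measure X).IsAddHaarMeasure]

/-- The nonnegative parts `(Re z)⁺, (Re z)⁻, (Im z)⁺, (Im z)⁻`. -/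
def posPart4 (l : Fin 4) (z : ℂ) : ℝ :=
  match l with
  | 0 => max z.re 0
  | 1 => max (-z.re) 0
  | 2 => max z.im 0
  | 3 => max (-z.im) 0

theorem posPart4_nonneg (l : Fin 4) (z : ℂ) : 0 ≤ posPart4 l z := by
  fin_cases l <;> simp [posPart4]

theorem posPart4_le (l : Fin 4) (z : ℂ) : posPart4 l z ≤ ‖z‖ := by
  have h1 := abs_le.1 (Complex.abs_re_le_norm z)
  have h2 := abs_le.1 (Complex.abs_im_le_norm z)
  fin_cases l <;> simp [posPart4] <;> linarith

theorem continuous_posPart4 (l : Fin 4) : Continuous (posPart4 l) :=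
  match l with
  | 0 => Complex.continuous_re.max continuous_const
  | 1 => Complex.continuous_re.neg.max continuous_const
  | 2 => Complex.continuous_im.max continuous_const
  | 3 => Complex.continuous_im.neg.max continuous_const

theorem sum_posPart4 (z : ℂ) :
    z = posPart4 0 z • (1 : ℂ) + posPart4 1 z • (-1 : ℂ) + posPart4 2 z • Complex.I
      + posPart4 3 z • (-Complex.I) := by
  apply Complex.ext <;> simp [posPart4] <;>
    [rcases le_total z.re 0 with h | h; rcases le_total z.im 0 with h | h] <;> simp [h]

theorem enorm_act_le (a : ShiftAlg X) (g : X → ℂ) (x : X) :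
    ‖act ℂ a g x‖ₑ ≤ ∑ l, ‖act ℝ a (fun x => posPart4 l (g x)) x‖ₑ := by
  have h1 : g = (fun x => (ContinuousLinearMap.toSpanSingleton ℝ (1 : ℂ)) (posPart4 0 (g x)))
      + (fun x => (ContinuousLinearMap.toSpanSingleton ℝ (-1 : ℂ)) (posPart4 1 (g x)))
      + (fun x => (ContinuousLinearMap.toSpanSingleton ℝ Complex.I) (posPart4 2 (g x)))
      + (fun x => (ContinuousLinearMap.toSpanSingleton ℝ (-Complex.I)) (posPart4 3 (g x))) :=
    funext fun x => by simpa using sum_posPart4 (g x)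
  conv_lhs => rw [h1]
  rw [map_add, map_add, map_add, act_comp, act_comp, act_comp, act_comp, Fin.sum_univ_four]
  simp only [Pi.add_apply, ContinuousLinearMap.toSpanSingleton_apply]
  refine (enorm_add_le _ _).trans (add_le_add ((enorm_add_le _ _).trans
    (add_le_add ((enorm_add_le _ _).trans (add_le_add ?_ ?_)) ?_)) ?_) <;>
  · rw [enorm_smul]
    simp [← ofReal_norm]

theorem diffSum_comm {E : Type} [Fintype E] (v : E → X) (a b : E) (N : ℕ) {F F' : Type}
    [NormedAddCommGroup F] [NormedSpace ℝ F] [NormedAddCommGroup F'] [NormedSpace ℝ F']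
    (g : X → F) (h : X → F') : diffSum v a b N g h = diffSum v a b N h g := by
  simp only [diffSum, mul_comm]

theorem diffSum_le_sum {E : Type} [Fintype E] (v : E → X) (a b : E) (N : ℕ) {g h : X → ℂ}
    (hg : AEStronglyMeasurable g volume) (hh : AEStronglyMeasurable h volume) :
    diffSum v a b N g h ≤ ∑ l, ∑ l', diffSum v a b N (fun x => posPart4 l (g x))
      (fun x => posPart4 l' (h x)) := by
  unfold diffSum
  have h1 : ∀ l, AEStronglyMeasurable (fun x => posPart4 l (g x)) volume := fun l =>
    (continuous_posPart4 l).comp_aestronglyMeasurable hg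
  have h2 : ∀ l, AEStronglyMeasurable (fun x => posPart4 l (h x)) volume := fun l =>
    (continuous_posPart4 l).comp_aestronglyMeasurable hh
  have hm : ∀ k l l', AEMeasurable (fun x => ‖act ℝ (diffShift (v a) (v b) * avgShift v ^ k)
      (fun x => posPart4 l (g x)) x‖ₑ * ‖act ℝ (diffShift (v a) (v b) * avgShift v ^ k)
      (fun x => posPart4 l' (h x)) x‖ₑ) volume := fun k l l' =>
    (aestronglyMeasurable_act (h1 l) _).enorm.mul (aestronglyMeasurable_act (h2 l') _).enorm
  have hswap : ∑ l, ∑ l', ∑ k ∈ Finset.range N, (∫⁻ x,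
      ‖act ℝ (diffShift (v a) (v b) * avgShift v ^ k) (fun x => posPart4 l (g x)) x‖ₑ *
        ‖act ℝ (diffShift (v a) (v b) * avgShift v ^ k) (fun x => posPart4 l' (h x)) x‖ₑ)
      = ∑ k ∈ Finset.range N, ∑ l, ∑ l', ∫⁻ x,
      ‖act ℝ (diffShift (v a) (v b) * avgShift v ^ k) (fun x => posPart4 l (g x)) x‖ₑ *
        ‖act ℝ (diffShift (v a) (v b) * avgShift v ^ k) (fun x => posPart4 l' (h x)) x‖ₑ :=
    (Finset.sum_congr rfl fun l _ => Finset.sum_comm).trans Finset.sum_comm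
  rw [hswap]
  refine Finset.sum_le_sum fun k _ => ?_
  have e : ∀ l, ∑ l', (∫⁻ x, ‖act ℝ (diffShift (v a) (v b) * avgShift v ^ k)
      (fun x => posPart4 l (g x)) x‖ₑ * ‖act ℝ (diffShift (v a) (v b) * avgShift v ^ k)
      (fun x => posPart4 l' (h x)) x‖ₑ) = ∫⁻ x, ∑ l',
      ‖act ℝ (diffShift (v a) (v b) * avgShift v ^ k)
      (fun x => posPart4 l (g x)) x‖ₑ * ‖act ℝ (diffShift (v a) (v b) * avgShift v ^ k)
      (fun x => posPart4 l' (h x)) x‖ₑ := fun l =>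
    (lintegral_finsetSum' _ fun l' _ => hm k l l').symm
  simp only [e]
  rw [← lintegral_finsetSum' _ fun l _ => Finset.aemeasurable_fun_sum _ fun l' _ => hm k l l']
  refine lintegral_mono fun x => ?_
  refine (mul_le_mul' (enorm_act_le _ g x) (enorm_act_le _ h x)).trans (le_of_eq ?_)
  rw [Finset.sum_mul_sum]

theorem eLpNorm_posPart4_le (l : Fin 4) (g : X → ℂ) (p : ℝ≥0∞) :
    eLpNorm (fun x => posPart4 l (g x)) p volume ≤ eLpNorm g p volume :=
  eLpNorm_mono fun x => by
    rw [Real.norm_of_nonneg (posPart4_nonneg l _)]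
    exact posPart4_le l _

/-- The Bellman function lives on the quadrant, so complex functions are split into four nonnegative
parts each; the 4 × 4 pairs give the factor 16. -/
theorem diffSum_le {p q : ℝ} (hpq : p.HolderConjugate q) {E : Type} [Fintype E] [Nonempty E] :
    ∃ C : ℝ≥0, ∀ (v : E → X) (a b : E) (N : ℕ) (g h : X → ℂ), AEStronglyMeasurable g volume →
      AEStronglyMeasurable h volume → ∀ α β : ℝ, 0 < α → 0 < β →
      eLpNorm g (ENNReal.ofReal p) volume ≤ ENNReal.ofReal α →
      eLpNorm h (ENNReal.ofReal q) volume ≤ ENNReal.ofReal β →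
      diffSum v a b N g h ≤ C * ENNReal.ofReal (α * β) := by
  -- One of two conjugate exponents is at least 2, and the bilinear sum is symmetric in its two
  -- functions.
  wlog hp : 2 ≤ p generalizing p q with H
  · have hq : 2 ≤ q := by
      have h1 := hpq.inv_add_inv_eq_one
      have h2 : (1 : ℝ) / 2 ≤ p⁻¹ := by
        rw [one_div]
        exact inv_anti₀ hpq.pos (not_le.1 hp).le
      have h3 : q⁻¹ ≤ 2⁻¹ := by norm_num at h2 ⊢; linarith
      exact (inv_le_inv₀ hpq.symm.pos two_pos).1 h3
    obtain ⟨C, hC⟩ := H hpq.symm hq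
    refine ⟨C, fun v a b N g h hg hh α β hα hβ hgα hhβ => ?_⟩
    rw [diffSum_comm, mul_comm α]
    exact hC v a b N h g hh hg β α hβ hα hhβ hgα
  obtain ⟨C, hC⟩ := diffSum_le_of_nonneg' (X := X) hpq hp (E := E)
  refine ⟨16 * C, fun v a b N g h hg hh α β hα hβ hgα hhβ => ?_⟩
  refine (diffSum_le_sum v a b N hg hh).trans ((Finset.sum_le_sum fun l _ =>
    Finset.sum_le_sum fun l' _ => hC v a b N _ _ (fun x => posPart4_nonneg l _)
      (fun x => posPart4_nonneg l' _) ((continuous_posPart4 l).comp_aestronglyMeasurable hg)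
      ((continuous_posPart4 l').comp_aestronglyMeasurable hh) α β hα hβ
      ((eLpNorm_posPart4_le l g _).trans hgα) ((eLpNorm_posPart4_le l' h _).trans hhβ)).trans
      (le_of_eq ?_))
  simp only [Finset.sum_const, Finset.card_univ, Fintype.card_fin, nsmul_eq_mul]
  push_cast
  ring

/-- The translation combination `a` acts on `L^p` with norm at most `C`. -/
def ActBound (p : ℝ≥0∞) (C : ℝ≥0) (a : ShiftAlg X) : Prop :=
  ∀ g : X → ℂ, MemLp g p volume → eLpNorm (act ℂ a g) p volume ≤ C * eLpNorm g p volume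

theorem ActBound.single (p : ℝ≥0∞) (v : X) (r : ℝ) :
    ActBound p ‖r‖₊ (AddMonoidAlgebra.single v r) := fun g hg =>
  (eLpNorm_act_single hg.1 v r).le

theorem ActBound.mono {p : ℝ≥0∞} {C D : ℝ≥0} {a : ShiftAlg X} (ha : ActBound p C a) (h : C ≤ D) :
    ActBound p D a := fun g hg => (ha g hg).trans (by gcongr)

theorem ActBound.one (p : ℝ≥0∞) : ActBound p 1 (1 : ShiftAlg X) := fun _ _ => by simp

theorem ActBound.mul {p : ℝ≥0∞} {C D : ℝ≥0} {a b : ShiftAlg X} (ha : ActBound p C a)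
    (hb : ActBound p D b) : ActBound p (C * D) (a * b) := fun g hg => by
  rw [act_mul_apply]
  refine (ha _ (memLp_act hg b)).trans ?_
  rw [ENNReal.coe_mul, mul_assoc]
  gcongr
  exact hb g hg

theorem ActBound.add {p : ℝ≥0∞} (hp : 1 ≤ p) {C D : ℝ≥0} {a b : ShiftAlg X} (ha : ActBound p C a)
    (hb : ActBound p D b) : ActBound p (C + D) (a + b) := fun g hg => by
  rw [act_add_apply, ENNReal.coe_add, add_mul]
  exact (eLpNorm_add_le (memLp_act hg a).1 (memLp_act hg b).1 hp).trans
    (add_le_add (ha g hg) (hb g hg))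

theorem ActBound.smul {p : ℝ≥0∞} {C : ℝ≥0} {a : ShiftAlg X} (ha : ActBound p C a) (r : ℝ) :
    ActBound p (‖r‖₊ * C) (r • a) := fun g hg => by
  rw [act_smul_apply, eLpNorm_const_smul, ENNReal.coe_mul, mul_assoc]
  gcongr
  · rfl
  · exact ha g hg

theorem actBound_of_forall_integral {p q : ℝ} (hpq : p.HolderConjugate q) {C : ℝ≥0}
    {a : ShiftAlg X} (h : ∀ (g h : X → ℂ), MemLp g (ENNReal.ofReal p) volume →
      MemLp h (ENNReal.ofReal q) volume → ∀ α β : ℝ, 0 < α → 0 < β →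
      eLpNorm g (ENNReal.ofReal p) volume ≤ ENNReal.ofReal α →
      eLpNorm h (ENNReal.ofReal q) volume ≤ ENNReal.ofReal β →
      ‖∫ x, act ℂ a g x * h x‖ ≤ C * (α * β)) : ActBound (ENNReal.ofReal p) C a := by
  intro g hg
  set G := (eLpNorm g (ENNReal.ofReal p) volume).toReal with hG
  have hGe : eLpNorm g (ENNReal.ofReal p) volume = ENNReal.ofReal G :=
    (ENNReal.ofReal_toReal hg.eLpNorm_ne_top).symm
  have hmain := eLpNorm_le_of_forall_integral_mul_le hpq (memLp_act hg a) (M := C * G)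
    (by positivity) fun f hf => by
      set H := (eLpNorm f (ENNReal.ofReal q) volume).toReal with hH
      have hHe : eLpNorm f (ENNReal.ofReal q) volume = ENNReal.ofReal H :=
        (ENNReal.ofReal_toReal hf.eLpNorm_ne_top).symm
      -- The hypothesis asks for strictly positive bounds, while the norms may vanish; hence the ε
      -- and the limit.
      have hlim : Tendsto (fun ε : ℝ => C * ((G + ε) * (H + ε))) (𝓝[>] 0)
          (𝓝 (C * ((G + 0) * (H + 0)))) := by
        have : Continuous fun ε : ℝ => C * ((G + ε) * (H + ε)) := by fun_prop
        exact (this.tendsto 0).mono_left nhdsWithin_le_nhds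
      have hle := ge_of_tendsto hlim (b := ‖∫ x, act ℂ a g x * f x‖) (by
        filter_upwards [self_mem_nhdsWithin] with ε hε
        have hε : 0 < ε := hε
        refine h g f hg hf _ _ (add_pos_of_nonneg_of_pos ENNReal.toReal_nonneg hε)
          (add_pos_of_nonneg_of_pos ENNReal.toReal_nonneg hε) ?_ ?_
        · rw [hGe]; exact ENNReal.ofReal_le_ofReal (by linarith)
        · rw [hHe]; exact ENNReal.ofReal_le_ofReal (by linarith))
      simpa [mul_assoc] using hle
  rwa [ENNReal.ofReal_mul C.coe_nonneg, ENNReal.ofReal_coe_nnreal, ← hGe] at hmain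

theorem enorm_integral_mul_le_lintegral (g h : X → ℂ) :
    ‖∫ x, g x * h x‖ₑ ≤ ∫⁻ x, ‖g x‖ₑ * ‖h x‖ₑ :=
  (enorm_integral_le_lintegral_enorm _).trans_eq (lintegral_congr fun _ => enorm_mul _ _)

/-- The sums `∑ (τ_a - τ_b) (τ_a - τ_b)* (T T*)^k` are bounded on `L^p`. -/
theorem exists_actBound_sum {p q : ℝ} (hpq : p.HolderConjugate q) {E : Type} [Fintype E]
    [Nonempty E] : ∃ C : ℝ≥0, ∀ (v : E → X) (a b : E) (N : ℕ),
      ActBound (ENNReal.ofReal p) C (diffShift (v a) (v b) * refl (diffShift (v a) (v b)) *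
        ∑ k ∈ Finset.range N, (avgShift v * refl (avgShift v)) ^ k) := by
  haveI := holderConjugate_ofReal hpq
  obtain ⟨C, hC⟩ := diffSum_le (X := X) hpq (E := E)
  refine ⟨C, fun v a b N => actBound_of_forall_integral hpq fun g h hg hh α β hα hβ hgα hhβ => ?_⟩
  set D := diffShift (v a) (v b)
  set T := avgShift v
  -- Translations commute, so D D*(TT*)^k = (D T^k)*(D T^k), and one factor can be moved to the
  -- other function. The estimate for `diffSum` then applies to the sum over k.
  have h1 : ∀ k, ∫ x, act ℂ (D * refl D * (T * refl T) ^ k) g x * h x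
      = ∫ x, act ℂ (D * T ^ k) g x * act ℂ (D * T ^ k) h x := by
    intro k
    have e : D * refl D * (T * refl T) ^ k = refl (D * T ^ k) * (D * T ^ k) := by
      rw [map_mul, map_pow, mul_pow]; ring
    rw [e, act_mul_apply, integral_act_mul (memLp_act hg _) hh, refl_refl]
  have h2 : ∫ x, act ℂ (D * refl D * ∑ k ∈ Finset.range N, (T * refl T) ^ k) g x * h x
      = ∑ k ∈ Finset.range N, ∫ x, act ℂ (D * T ^ k) g x * act ℂ (D * T ^ k) h x := by
    rw [Finset.mul_sum, act_sum_apply]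
    simp only [Finset.sum_apply, Finset.sum_mul]
    rw [integral_finsetSum _ fun k _ => integrable_mul_of_memLp (memLp_act hg _) hh]
    exact Finset.sum_congr rfl fun k _ => h1 k
  have h3 : ‖∫ x, act ℂ (D * refl D * ∑ k ∈ Finset.range N, (T * refl T) ^ k) g x * h x‖ₑ
      ≤ ENNReal.ofReal (C * (α * β)) := by
    rw [h2, ENNReal.ofReal_mul C.coe_nonneg, ENNReal.ofReal_coe_nnreal]
    refine (enorm_sum_le _ _).trans (le_trans ?_ (hC v a b N g h hg.1 hh.1 α β hα hβ hgα hhβ))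
    exact Finset.sum_le_sum fun k _ => enorm_integral_mul_le_lintegral _ _
  rwa [← ofReal_norm, ENNReal.ofReal_le_ofReal_iff (by positivity)] at h3

end Multiplier

/-! ### Combinations of translations acting on convolution kernels -/

section ActSmooth

variable {X : Type} [NormedAddCommGroup X] [NormedSpace ℝ X]
  {F : Type} [NormedAddCommGroup F] [NormedSpace ℝ F]

theorem act_single_eq (v : X) (r : ℝ) (f : X → F) :
    act F (AddMonoidAlgebra.single v r) f = fun x => r • f (x - v) :=
  funext (act_single v r f)

theorem contDiff_act {f : X → F} (hf : ContDiff ℝ ((⊤ : ℕ∞) : WithTop ℕ∞) f) (a : ShiftAlg X) :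
    ContDiff ℝ ((⊤ : ℕ∞) : WithTop ℕ∞) (act F a f) := by
  induction a using AddMonoidAlgebra.induction_linear with
  | zero => rw [map_zero]; exact contDiff_const
  | add a b ha hb => rw [act_add_apply]; exact ha.add hb
  | single v r => rw [act_single_eq]; exact (hf.comp (contDiff_id.sub contDiff_const)).const_smul r

theorem hasCompactSupport_act {f : X → F} (hf : HasCompactSupport f) (a : ShiftAlg X) :
    HasCompactSupport (act F a f) := by
  induction a using AddMonoidAlgebra.induction_linear with
  | zero => simpa using HasCompactSupport.zero
  | add a b ha hb => rw [act_add_apply]; exact ha.add hb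
  | single v r =>
    rw [act_single_eq]
    exact HasCompactSupport.smul_left (f := fun _ => r)
      (hf.comp_homeomorph (Homeomorph.subRight v))

theorem fderiv_act {f : X → F} (hf : ContDiff ℝ ((⊤ : ℕ∞) : WithTop ℕ∞) f) (a : ShiftAlg X)
    (e : X) : (fun x => fderiv ℝ (act F a f) x e) = act F a fun x => fderiv ℝ f x e := by
  have hd : ∀ a : ShiftAlg X, Differentiable ℝ (act F a f) := fun a =>
    (contDiff_act hf a).differentiable (by simp)
  induction a using AddMonoidAlgebra.induction_linear with
  | zero => ext; simp
  | add a b ha hb =>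
    rw [act_add_apply, act_add_apply, ← ha, ← hb]
    ext x
    rw [fderiv_add (hd a x) (hd b x)]
    rfl
  | single v r =>
    rw [act_single_eq, act_single_eq]
    ext x
    have h1 : DifferentiableAt ℝ (fun x => f (x - v)) x :=
      ((hf.differentiable (by simp)) (x - v)).comp x (differentiableAt_id.sub_const v)
    rw [fderiv_fun_const_smul h1, fderiv_comp_sub]
    rfl

variable [MeasureSpace X] [BorelSpace X] [FiniteDimensional ℝ X]
  [(volume : Measure X).IsAddHaarMeasure]

theorem tconv_id_act {σ : X → ℝ} (hσ : Continuous σ) (hσc : HasCompactSupport σ) {g : X → ℂ}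
    (hg : LocallyIntegrable g volume) (a : ShiftAlg X) :
    tconv (ContinuousLinearMap.id ℝ X) (act ℝ a σ) g
      = act ℂ a (tconv (ContinuousLinearMap.id ℝ X) σ g) := by
  have hint : ∀ (a : ShiftAlg X) z, Integrable (fun y => act ℝ a σ y • g (z - y)) volume := by
    intro a z
    have h1 : Integrable (fun y => g y * ((act ℝ a σ (z - y) : ℝ) : ℂ)) volume := by
      refine integrable_mul_of_continuous hg ?_ ?_
      · refine Complex.continuous_ofReal.comp ?_
        have : Continuous (act ℝ a σ) := by
          induction a using AddMonoidAlgebra.induction_linear with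
          | zero => rw [map_zero]; exact continuous_const
          | add a b ha hb => rw [act_add_apply]; exact ha.add hb
          | single v r => rw [act_single_eq]; fun_prop
        exact this.comp (continuous_const.sub continuous_id)
      · exact ((hasCompactSupport_act hσc a).comp_homeomorph (Homeomorph.subLeft z)).comp_left
          (g := Complex.ofReal) (by simp)
    have h2 := h1.comp_sub_left z
    refine h2.congr (Eventually.of_forall fun y => ?_)
    simp [mul_comm]
  induction a using AddMonoidAlgebra.induction_linear with
  | zero => ext; simp [tconv]
  | add a b ha hb =>
    rw [act_add_apply, act_add_apply, ← ha, ← hb]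
    ext z
    simp only [tconv, Pi.add_apply, add_smul, ContinuousLinearMap.id_apply]
    exact integral_add (hint a z) (hint b z)
  | single v r =>
    rw [act_single_eq, act_single_eq]
    ext z
    simp only [tconv, ContinuousLinearMap.id_apply]
    rw [← integral_add_right_eq_self _ v, ← integral_smul]
    refine integral_congr_ae (Eventually.of_forall fun y => ?_)
    simp only [add_sub_cancel_right, smul_eq_mul, mul_smul]
    congr 3
    abel

/-- Translations of the kernel commute with convolution, (aσ) * g = a(σ * g), so the bound for `a`
and Young's inequality with ‖σ‖₁ ≤ 1 suffice. Nothing about the size of aσ itself is used. -/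
theorem eLpNorm_tconv_act_le {p : ℝ≥0∞} (hp : 1 ≤ p) (hpt : p ≠ ∞) {C : ℝ≥0} {a : ShiftAlg X}
    (ha : ActBound p C a) {σ : X → ℝ} (hσ : Continuous σ) (hσc : HasCompactSupport σ)
    (hσ1 : eLpNorm σ 1 volume ≤ 1) {g : X → ℂ} (hg : MemLp g p volume) :
    eLpNorm (tconv (ContinuousLinearMap.id ℝ X) (act ℝ a σ) g) p volume
      ≤ C * eLpNorm g p volume := by
  have hσi : Integrable σ volume := hσ.integrable_of_hasCompactSupport hσc
  rw [tconv_id_act hσ hσc (hg.locallyIntegrable hp)]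
  refine (ha _ (memLp_tconv _ hσi hg hp hpt)).trans ?_
  gcongr
  exact (eLpNorm_tconv_le _ hσi hg.1 hp hpt).trans (mul_le_of_le_one_left (zero_le) hσ1)

end ActSmooth

/-! ### Smooth densities on the line and their means -/

section UnitKernel

/-- A smooth probability density on the line supported in `[-r, r]`. -/
structure UnitKernel (r : ℝ) (φ : ℝ → ℝ) : Prop where
  contDiff : ContDiff ℝ ((⊤ : ℕ∞) : WithTop ℕ∞) φ
  nonneg : ∀ x, 0 ≤ φ x
  integral : ∫ x, φ x = 1
  supp : ∀ x, φ x ≠ 0 → |x| ≤ r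

theorem UnitKernel.hasCompactSupport {r : ℝ} {φ : ℝ → ℝ} (h : UnitKernel r φ) :
    HasCompactSupport φ :=
  HasCompactSupport.intro (isCompact_closedBall 0 r) fun x hx => by
    by_contra h1
    exact hx (by simpa using h.supp x h1)

theorem UnitKernel.integrable {r : ℝ} {φ : ℝ → ℝ} (h : UnitKernel r φ) : Integrable φ volume :=
  h.contDiff.continuous.integrable_of_hasCompactSupport h.hasCompactSupport

theorem exists_unitKernel {r : ℝ} (hr : 0 < r) : ∃ φ, UnitKernel r φ := by
  let f : ContDiffBump (0 : ℝ) := ⟨r / 2, r, by linarith, by linarith⟩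
  refine ⟨f.normed volume, f.contDiff_normed, f.nonneg_normed, f.integral_normed, fun x hx => ?_⟩
  have : x ∈ Function.support (f.normed volume) := hx
  rw [f.support_normed_eq, Metric.mem_ball, dist_zero_right] at this
  exact this.le

/-- The mean of `φ` and its translate by `s`. -/
def meanShift (s : ℝ) (φ : ℝ → ℝ) (x : ℝ) : ℝ := 1 / 2 * (φ x + φ (x - s))

/-- The mean of `φ` over `[x - s, x]`. -/
def meanBox (s : ℝ) (φ : ℝ → ℝ) : ℝ → ℝ :=
  tconv (ContinuousLinearMap.id ℝ ℝ) ((Set.Ioc 0 s).indicator fun _ => s⁻¹) φ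

theorem meanBox_apply {s : ℝ} (hs : 0 < s) (φ : ℝ → ℝ) (x : ℝ) :
    meanBox s φ x = s⁻¹ * ∫ t in (0 : ℝ)..s, φ (x - t) := by
  rw [intervalIntegral.integral_of_le hs.le, ← integral_const_mul,
    ← integral_indicator measurableSet_Ioc]
  refine integral_congr_ae (Eventually.of_forall fun t => ?_)
  by_cases ht : t ∈ Set.Ioc 0 s <;> simp [ht]

theorem meanShift_meanBox {s : ℝ} (hs : 0 < s) {φ : ℝ → ℝ} (hφ : Continuous φ) :
    meanBox s (meanShift s φ) = meanShift s (meanBox s φ) := by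
  ext x
  rw [meanBox_apply hs, meanShift, meanBox_apply hs, meanBox_apply hs]
  simp only [meanShift]
  have h1 : ∀ x, IntervalIntegrable (fun t => φ (x - t)) volume 0 s := fun x =>
    (by fun_prop : Continuous fun t => φ (x - t)).intervalIntegrable _ _
  have h2 : ∀ t, x - t - s = x - s - t := fun t => by ring
  rw [intervalIntegral.integral_const_mul]
  simp only [h2]
  rw [intervalIntegral.integral_add (h1 x) (h1 (x - s))]
  ring

theorem UnitKernel.meanShift {r s : ℝ} (hs : 0 < s) {φ : ℝ → ℝ} (h : UnitKernel r φ) :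
    UnitKernel (r + s) (meanShift s φ) where
  contDiff := contDiff_const.mul (h.contDiff.add (h.contDiff.comp (contDiff_id.sub contDiff_const)))
  nonneg x := mul_nonneg (by norm_num) (add_nonneg (h.nonneg _) (h.nonneg _))
  integral := by
    unfold HalfSpaceSystem.meanShift
    rw [integral_const_mul, integral_add h.integrable (h.integrable.comp_sub_right s),
      integral_sub_right_eq_self, h.integral]
    norm_num
  supp x hx := by
    by_contra hc
    have h1 : φ x = 0 := by
      by_contra h2
      linarith [h.supp x h2]
    have h2 : φ (x - s) = 0 := by
      by_contra h2
      have h3 := abs_sub_abs_le_abs_sub x s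
      rw [abs_of_pos hs] at h3
      linarith [h.supp _ h2]
    exact hx (by simp [HalfSpaceSystem.meanShift, h1, h2])

theorem integrable_box (s : ℝ) :
    Integrable ((Set.Ioc 0 s).indicator fun _ => s⁻¹ : ℝ → ℝ) volume :=
  (integrable_indicator_iff measurableSet_Ioc).2 (integrableOn_const (by simp))

theorem UnitKernel.meanBox {r s : ℝ} (hs : 0 < s) {φ : ℝ → ℝ} (h : UnitKernel r φ) :
    UnitKernel (r + s) (meanBox s φ) where
  contDiff := contDiff_infty_tconv _ (integrable_box s) h.contDiff h.hasCompactSupport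
  nonneg x := by
    rw [meanBox_apply hs]
    exact mul_nonneg (by positivity)
      (intervalIntegral.integral_nonneg hs.le fun t _ => h.nonneg _)
  integral := by
    unfold HalfSpaceSystem.meanBox
    rw [tconv_id_eq_convolution, integral_convolution _ (integrable_box s) h.integrable,
      h.integral, integral_indicator measurableSet_Ioc]
    simp [hs.le, hs.ne']
  supp x hx := by
    by_contra hc
    refine hx ?_
    rw [meanBox_apply hs, intervalIntegral.integral_congr (g := fun _ => 0), intervalIntegral.integral_zero,
      mul_zero]
    intro t ht
    rw [Set.uIcc_of_le hs.le] at ht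
    by_contra h2
    have h3 := abs_sub_abs_le_abs_sub x t
    rw [abs_of_nonneg ht.1] at h3
    linarith [h.supp _ h2, ht.2]

/-- The reason for using box means: their derivative is exactly a finite difference, so that
derivatives of kernels become elements of the algebra of translations. -/
theorem deriv_meanBox {r s : ℝ} (hs : 0 < s) {φ : ℝ → ℝ} (h : UnitKernel r φ) (x : ℝ) :
    deriv (meanBox s φ) x = s⁻¹ * (φ x - φ (x - s)) := by
  have h1 := fderiv_tconv_apply (ContinuousLinearMap.id ℝ ℝ) (integrable_box s)
    (h.contDiff.of_le (by exact_mod_cast le_top)) h.hasCompactSupport x 1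
  rw [← fderiv_apply_one_eq_deriv]
  refine h1.trans ?_
  change meanBox s (fun x => fderiv ℝ φ x 1) x = _
  rw [meanBox_apply hs]
  congr 1
  have h2 : ∀ t ∈ Set.uIcc 0 s, HasDerivAt (fun t => -φ (x - t)) (fderiv ℝ φ (x - t) 1) t := by
    intro t _
    have h3 := ((h.contDiff.differentiable (by simp)) (x - t)).hasDerivAt
    have h4 := (h3.comp t ((hasDerivAt_id t).const_sub x)).neg
    rw [fderiv_apply_one_eq_deriv]
    refine h4.congr_deriv (by ring)
  rw [intervalIntegral.integral_eq_sub_of_hasDerivAt h2]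
  · simp only [sub_zero]
    ring
  · have h3 : Continuous fun y => fderiv ℝ φ y 1 :=
      (h.contDiff.continuous_fderiv (by simp)).clm_apply continuous_const
    exact (h3.comp (continuous_const.sub continuous_id)).intervalIntegrable _ _

end UnitKernel

/-! ### Product densities on the boundary -/

section Tensor

variable {n : ℕ}

/-- The tensor product of functions on the line. -/
def tens (φ : Fin n → ℝ → ℝ) (x : Bdry n) : ℝ := ∏ l, φ l (x l)

theorem contDiff_tens {r : Fin n → ℝ} {φ : Fin n → ℝ → ℝ} (h : ∀ l, UnitKernel (r l) (φ l)) :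
    ContDiff ℝ ((⊤ : ℕ∞) : WithTop ℕ∞) (tens φ) :=
  contDiff_prod fun l _ => (h l).contDiff.comp (EuclideanSpace.proj (𝕜 := ℝ) l).contDiff

theorem tens_nonneg {r : Fin n → ℝ} {φ : Fin n → ℝ → ℝ} (h : ∀ l, UnitKernel (r l) (φ l))
    (x : Bdry n) : 0 ≤ tens φ x := Finset.prod_nonneg fun l _ => (h l).nonneg _

theorem abs_le_of_tens_ne_zero {r : Fin n → ℝ} {φ : Fin n → ℝ → ℝ}
    (h : ∀ l, UnitKernel (r l) (φ l)) {x : Bdry n} (hx : tens φ x ≠ 0) (l : Fin n) :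
    |x l| ≤ r l := (h l).supp _ (Finset.prod_ne_zero_iff.1 hx l (Finset.mem_univ l))

theorem hasCompactSupport_tens {r : Fin n → ℝ} {φ : Fin n → ℝ → ℝ}
    (h : ∀ l, UnitKernel (r l) (φ l)) : HasCompactSupport (tens φ) := by
  have hK : IsCompact (Set.univ.pi fun l => Set.Icc (-r l) (r l)) :=
    isCompact_univ_pi fun l => isCompact_Icc
  have hK2 := hK.image (PiLp.homeomorph 2 fun _ : Fin n => ℝ).symm.continuous
  refine HasCompactSupport.intro hK2 fun x hx => ?_
  by_contra h1
  exact hx ⟨x.ofLp, fun l _ => abs_le.1 (abs_le_of_tens_ne_zero h h1 l), rfl⟩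

theorem integral_tens {r : Fin n → ℝ} {φ : Fin n → ℝ → ℝ} (h : ∀ l, UnitKernel (r l) (φ l)) :
    ∫ x, tens φ x = 1 := by
  have h1 := (PiLp.volume_preserving_ofLp (Fin n)).integral_comp
    (MeasurableEquiv.toLp 2 (Fin n → ℝ)).symm.measurableEmbedding (fun y => ∏ l, φ l (y l))
  refine h1.trans ?_
  rw [integral_fintype_prod_volume_eq_prod]
  exact Finset.prod_eq_one fun l _ => (h l).integral

theorem integrable_tens {r : Fin n → ℝ} {φ : Fin n → ℝ → ℝ} (h : ∀ l, UnitKernel (r l) (φ l)) :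
    Integrable (tens φ) volume :=
  (contDiff_tens h).continuous.integrable_of_hasCompactSupport (hasCompactSupport_tens h)

theorem eLpNorm_tens {r : Fin n → ℝ} {φ : Fin n → ℝ → ℝ} (h : ∀ l, UnitKernel (r l) (φ l)) :
    eLpNorm (tens φ) 1 volume ≤ 1 := by
  rw [eLpNorm_one_eq_lintegral_enorm]
  have h1 : ∀ x, ‖tens φ x‖ₑ = ENNReal.ofReal (tens φ x) := fun x =>
    Real.enorm_of_nonneg (tens_nonneg h x)
  simp only [h1]
  rw [← ofReal_integral_eq_lintegral_ofReal (integrable_tens h)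
    (Eventually.of_forall (tens_nonneg h)), integral_tens h, ENNReal.ofReal_one]

theorem tens_update (φ : Fin n → ℝ → ℝ) (j : Fin n) (ψ : ℝ → ℝ) (x : Bdry n) :
    tens (Function.update φ j ψ) x = ψ (x j) * ∏ l ∈ Finset.univ \ {j}, φ l (x l) := by
  unfold tens
  rw [Finset.prod_eq_mul_prod_sdiff_singleton j _ (by simp), Function.update_self]
  congr 1
  refine Finset.prod_congr rfl fun l hl => ?_
  rw [Function.update_of_ne (by simpa using hl)]

theorem prod_sdiff_add_single (φ : Fin n → ℝ → ℝ) (j : Fin n) (c : ℝ) (x : Bdry n) :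
    ∏ l ∈ Finset.univ \ {j}, φ l ((x + c • EuclideanSpace.single j (1 : ℝ)) l)
      = ∏ l ∈ Finset.univ \ {j}, φ l (x l) := by
  refine Finset.prod_congr rfl fun l hl => ?_
  have : l ≠ j := by simpa using hl
  simp [this]

theorem tens_update_comp_sub (φ : Fin n → ℝ → ℝ) (j : Fin n) (ψ : ℝ → ℝ) (c : ℝ) (x : Bdry n) :
    tens (Function.update φ j fun t => ψ (t - c)) x
      = tens (Function.update φ j ψ) (x - c • EuclideanSpace.single j (1 : ℝ)) := by
  rw [tens_update, tens_update]
  have h := prod_sdiff_add_single φ j (-c) x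
  rw [neg_smul, ← sub_eq_add_neg] at h
  rw [h]
  simp

/-- Translation by `s` in the direction `x_j`. -/
def coordShift (s : ℝ) (j : Fin n) : ShiftAlg (Bdry n) :=
  AddMonoidAlgebra.single (s • EuclideanSpace.single j (1 : ℝ)) 1

theorem act_coordShift (s : ℝ) (j : Fin n) (f : Bdry n → ℝ) (x : Bdry n) :
    act ℝ (coordShift s j) f x = f (x - s • EuclideanSpace.single j (1 : ℝ)) := by
  simp [coordShift, act_single]

theorem tens_update_meanShift (φ : Fin n → ℝ → ℝ) (j : Fin n) (ψ : ℝ → ℝ) (s : ℝ) :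
    tens (Function.update φ j (meanShift s ψ))
      = act ℝ ((1 / 2 : ℝ) • (1 + coordShift s j)) (tens (Function.update φ j ψ)) := by
  ext x
  rw [act_smul_apply, act_add_apply, map_one, Module.End.one_apply, Pi.smul_apply, Pi.add_apply,
    act_coordShift, ← tens_update_comp_sub, tens_update, tens_update, tens_update, meanShift,
    smul_eq_mul]
  ring

theorem fderiv_tens_update_meanBox {r s : ℝ} (hs : 0 < s) {ρ : Fin n → ℝ} {φ : Fin n → ℝ → ℝ}
    (h : ∀ l, UnitKernel (ρ l) (φ l)) (j : Fin n) {ψ : ℝ → ℝ} (hψ : UnitKernel r ψ) :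
    (fun x => fderiv ℝ (tens (Function.update φ j (meanBox s ψ))) x (EuclideanSpace.single j 1))
      = act ℝ (-s⁻¹ • (coordShift s j - 1)) (tens (Function.update φ j ψ)) := by
  ext x
  have hk : ∀ l, UnitKernel (Function.update ρ j (r + s) l)
      (Function.update φ j (meanBox s ψ) l) := fun l => by
    rcases eq_or_ne l j with rfl | hl
    · simpa using hψ.meanBox hs
    · simpa [hl] using h l
  have hd : DifferentiableAt ℝ (tens (Function.update φ j (meanBox s ψ))) x :=
    (contDiff_tens hk).differentiable (by simp) x
  rw [← hd.lineDeriv_eq_fderiv, lineDeriv]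
  have h1 : (fun t : ℝ => tens (Function.update φ j (meanBox s ψ))
      (x + t • EuclideanSpace.single j (1 : ℝ)))
      = fun t => meanBox s ψ (x j + t) * ∏ l ∈ Finset.univ \ {j}, φ l (x l) := by
    ext t
    rw [tens_update, prod_sdiff_add_single]
    simp
  rw [h1, deriv_mul_const_field, deriv_comp_const_add, add_zero, deriv_meanBox hs hψ,
    act_smul_apply, act_sub_apply, map_one, Module.End.one_apply, Pi.smul_apply, Pi.sub_apply,
    act_coordShift, ← tens_update_comp_sub, tens_update, tens_update, smul_eq_mul]
  ring

end Tensor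

/-! ### The symmetrised walk and its second differences -/

section Walk

variable {n : ℕ}

theorem refl_coordShift (s : ℝ) (j : Fin n) :
    refl (coordShift s j) = AddMonoidAlgebra.single (-(s • EuclideanSpace.single j (1 : ℝ))) 1 :=
  refl_single _ _

theorem coordShift_mul_refl (s : ℝ) (j : Fin n) : coordShift s j * refl (coordShift s j) = 1 := by
  rw [refl_coordShift, coordShift, AddMonoidAlgebra.single_mul_single, add_neg_cancel, mul_one,
    AddMonoidAlgebra.one_def]

/-- The mean of the identity and the translation by `s` in the direction `x_j`. -/
def halfStep (s : ℝ) (j : Fin n) : ShiftAlg (Bdry n) := (1 / 2 : ℝ) • (1 + coordShift s j)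

/-- The corners of a cube. -/
def corner (s : ℝ) (S : Finset (Fin n)) : Bdry n :=
  ∑ i ∈ S, s • EuclideanSpace.single i (1 : ℝ)

theorem single_corner (s : ℝ) (S : Finset (Fin n)) :
    (AddMonoidAlgebra.single (corner s S) 1 : ShiftAlg (Bdry n)) = ∏ i ∈ S, coordShift s i := by
  induction S using Finset.induction_on with
  | empty => simp [corner, AddMonoidAlgebra.one_def]
  | insert i S hi ih =>
    rw [Finset.prod_insert hi, ← ih, coordShift, AddMonoidAlgebra.single_mul_single, corner,
      Finset.sum_insert hi, mul_one]
    rfl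

/-- Expanding the product of the (1 + τ_j)/2 gives the uniform mean over the 2^n corners of a cube.
A product of one-dimensional steps is thus a mean of translations, to which the Bellman estimate
applies. -/
theorem avgShift_corner (s : ℝ) :
    avgShift (corner s : Finset (Fin n) → Bdry n) = ∏ j, halfStep s j := by
  have h1 : ∏ j : Fin n, halfStep s j = (1 / 2 : ℝ) ^ n • ∏ j : Fin n, (1 + coordShift s j) := by
    simp only [halfStep, Algebra.smul_def, Finset.prod_mul_distrib, Finset.prod_const,
      Finset.card_univ, Fintype.card_fin, map_pow]
  rw [h1, Finset.prod_one_add, Finset.powerset_univ, Finset.smul_sum, avgShift]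
  refine Finset.sum_congr rfl fun S _ => ?_
  rw [← single_corner, AddMonoidAlgebra.smul_single]
  simp

/-- The product of a mean of translations with its adjoint. -/
def symStep (s : ℝ) (j : Fin n) : ShiftAlg (Bdry n) := halfStep s j * refl (halfStep s j)

theorem avgShift_mul_refl (s : ℝ) :
    avgShift (corner s : Finset (Fin n) → Bdry n) * refl (avgShift (corner s)) =
      ∏ j, symStep s j := by
  rw [avgShift_corner, map_prod, ← Finset.prod_mul_distrib]
  rfl

/-- Since τ τ* = 1, both sides equal (2 - τ - τ*)/4: the defect of a symmetrised step is a second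
difference in its direction. -/
theorem one_sub_symStep (s : ℝ) (j : Fin n) :
    1 - symStep s j = (1 / 4 : ℝ) • ((coordShift s j - 1) * (refl (coordShift s j) - 1)) := by
  have ht := coordShift_mul_refl s j
  rw [symStep, halfStep, map_smul, map_add, map_one, Algebra.smul_def, Algebra.smul_def,
    Algebra.smul_def]
  set h : ShiftAlg (Bdry n) := algebraMap ℝ _ (1 / 2 : ℝ) with hh
  have h4 : algebraMap ℝ (ShiftAlg (Bdry n)) (1 / 4 : ℝ) = h * h := by
    rw [hh, ← map_mul]; norm_num
  have h2 : 2 * h = 1 := by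
    rw [← map_ofNat (algebraMap ℝ (ShiftAlg (Bdry n))) 2, hh, ← map_mul,
      show (2 : ℝ) * (1 / 2) = 1 by norm_num, map_one]
  rw [h4]
  linear_combination (-2 * h ^ 2) * ht - (1 + 2 * h) * h2

/-- The product of the symmetrised steps in the directions before `i`. -/
def stepsBefore (s : ℝ) (i : Fin n) : ShiftAlg (Bdry n) :=
  ∏ j ∈ Finset.univ with j < i, symStep s j

/-- The defect of the whole walk telescopes into second differences, one for each direction; these
become the diagonal derivatives whose sum is a divergence. -/
theorem one_sub_prod_symStep (s : ℝ) :
    1 - ∏ j, symStep s j = ∑ i : Fin n, (1 - symStep s i) * stepsBefore s i := by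
  have h := Finset.prod_one_sub_ordered (Finset.univ : Finset (Fin n)) fun i => 1 - symStep s i
  simp only [sub_sub_cancel] at h
  rw [h, sub_sub_cancel]
  rfl

theorem actBound_halfStep {p : ℝ≥0∞} (hp : 1 ≤ p) (s : ℝ) (j : Fin n) :
    ActBound p 1 (halfStep s j) ∧ ActBound p 1 (refl (halfStep s j)) := by
  have h : ∀ v : Bdry n, ActBound p 1 ((1 / 2 : ℝ) • (1 + AddMonoidAlgebra.single v 1)) := by
    intro v
    refine (((ActBound.one p).add hp (ActBound.single p v 1)).smul (1 / 2)).mono (le_of_eq ?_)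
    rw [← NNReal.coe_inj]
    norm_num
  refine ⟨h _, ?_⟩
  rw [halfStep, map_smul, map_add, map_one, refl_coordShift]
  exact h _

theorem actBound_prod {p : ℝ≥0∞} {ι : Type} (t : Finset ι) {a : ι → ShiftAlg (Bdry n)}
    (h : ∀ i ∈ t, ActBound p 1 (a i)) : ActBound p 1 (∏ i ∈ t, a i) := by
  classical
  induction t using Finset.induction_on with
  | empty => simpa using ActBound.one p
  | insert i t hi ih =>
    rw [Finset.prod_insert hi]
    simpa using (h i (Finset.mem_insert_self i t)).mul
      (ih fun j hj => h j (Finset.mem_insert_of_mem hj))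

theorem actBound_stepsBefore {p : ℝ≥0∞} (hp : 1 ≤ p) (s : ℝ) (i : Fin n) :
    ActBound p 1 (stepsBefore s i) :=
  actBound_prod _ fun j _ => by
    simpa [symStep] using (actBound_halfStep hp s j).1.mul (actBound_halfStep hp s j).2

/-- The geometric sum `∑_{k<N} U^k`, where `U` is the product of the symmetrised steps. -/
def stepSum (s : ℝ) (N : ℕ) : ShiftAlg (Bdry n) :=
  ∑ k ∈ Finset.range N, (∏ j, symStep s j) ^ k

theorem diffShift_corner (s : ℝ) (S T : Finset (Fin n)) :
    diffShift (corner s S) (corner s T) = ∏ i ∈ S, coordShift s i - ∏ i ∈ T, coordShift s i := by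
  rw [diffShift, single_corner, single_corner]

/-- The pure second differences come from the corners {i} and ∅. The mixed ones come by
polarisation: (τ_i - τ_i*)(τ_j - τ_j*) is (τ_i - τ_j)(τ_i - τ_j)* minus (τ_iτ_j - 1)(τ_iτ_j - 1)*,
differences of corners in both cases; hence the constant C + C. -/
theorem exists_actBound_second_diff {p q : ℝ} (hpq : p.HolderConjugate q) :
    ∃ C : ℝ≥0, ∀ (s : ℝ) (N : ℕ),
      (∀ i : Fin n, ActBound (ENNReal.ofReal p) C
        ((coordShift s i - 1) * (refl (coordShift s i) - 1) * stepSum s N)) ∧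
      ∀ i j : Fin n, i ≠ j → ActBound (ENNReal.ofReal p) C
        ((coordShift s i - refl (coordShift s i)) * (coordShift s j - refl (coordShift s j))
          * stepSum s N) := by
  have hp : 1 ≤ ENNReal.ofReal p := by
    rw [ENNReal.one_le_ofReal]; exact hpq.lt.le
  obtain ⟨C, hC⟩ := exists_actBound_sum (X := Bdry n) hpq (E := Finset (Fin n))
  refine ⟨C + C, fun s N => ⟨fun i => ?_, fun i j hij => ?_⟩⟩
  · have h := hC (corner s) {i} ∅ N
    rw [avgShift_mul_refl, diffShift_corner, Finset.prod_singleton, Finset.prod_empty, map_sub,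
      map_one] at h
    exact h.mono le_self_add
  · have h1 := hC (corner s) {i} {j} N
    have h2 := (hC (corner s) {i, j} ∅ N).smul (-1)
    rw [avgShift_mul_refl, diffShift_corner] at h1 h2
    rw [Finset.prod_pair hij, Finset.prod_empty] at h2
    rw [Finset.prod_singleton, Finset.prod_singleton] at h1
    have h3 := (h1.add hp h2).mono (D := C + C) (by simp)
    convert h3 using 1
    have hi := coordShift_mul_refl s i
    have hj := coordShift_mul_refl s j
    rw [map_sub, map_sub, map_mul, map_one, neg_smul, one_smul, stepSum]
    linear_combination (-(1 - coordShift s j * refl (coordShift s j)) *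
      (∑ k ∈ Finset.range N, (∏ j, symStep s j) ^ k)) * hi

end Walk

/-! ### Uniform decay of the iterated walk -/

section Escape

variable {n : ℕ}

/-- The left-hand side does not increase with `N`: passing to N + 1 multiplies it by (2N + 1)(2N +
3)/(2N + 2)² ≤ 1. -/
theorem centralBinom_sq_le (N : ℕ) :
    ((N.centralBinom : ℝ) / 4 ^ N) ^ 2 * (2 * N + 1) ≤ 1 := by
  induction N with
  | zero => simp
  | succ N ih =>
    have h := Nat.succ_mul_centralBinom_succ N
    have h1 : ((N : ℝ) + 1) * ((N + 1).centralBinom : ℝ) = 2 * (2 * N + 1) * N.centralBinom := by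
      exact_mod_cast h
    have h2 : ((N + 1).centralBinom : ℝ) / 4 ^ (N + 1)
        = (2 * N + 1) / (2 * N + 2) * (N.centralBinom / 4 ^ N) := by
      rw [pow_succ]
      field_simp
      linarith
    rw [h2, mul_pow]
    have h3 : ((2 * (N : ℝ) + 1) / (2 * N + 2)) ^ 2 * (2 * (N + 1) + 1) ≤ 2 * N + 1 := by
      rw [div_pow, div_mul_eq_mul_div, div_le_iff₀ (by positivity)]
      nlinarith
    push_cast
    calc _ = ((N.centralBinom : ℝ) / 4 ^ N) ^ 2
          * (((2 * (N : ℝ) + 1) / (2 * N + 2)) ^ 2 * (2 * (N + 1) + 1)) := by ring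
      _ ≤ ((N.centralBinom : ℝ) / 4 ^ N) ^ 2 * (2 * N + 1) := by gcongr
      _ ≤ 1 := ih

/-- The translation combination `a` is a contraction for the supremum norm. -/
def SupContr {X : Type} [NormedAddCommGroup X] (a : ShiftAlg X) : Prop :=
  ∀ (f : X → ℂ) (M : ℝ), (∀ x, ‖f x‖ ≤ M) → ∀ x, ‖act ℂ a f x‖ ≤ M

theorem SupContr.mul {X : Type} [NormedAddCommGroup X] {a b : ShiftAlg X} (ha : SupContr a)
    (hb : SupContr b) : SupContr (a * b) := fun f M hf => by
  rw [act_mul_apply]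
  exact ha _ M (hb f M hf)

theorem SupContr.one {X : Type} [NormedAddCommGroup X] : SupContr (1 : ShiftAlg X) :=
  fun f M hf => by simpa using hf

theorem SupContr.prod {X ι : Type} [NormedAddCommGroup X] (t : Finset ι) {a : ι → ShiftAlg X}
    (h : ∀ i ∈ t, SupContr (a i)) : SupContr (∏ i ∈ t, a i) := by
  classical
  induction t using Finset.induction_on with
  | empty => simpa using SupContr.one
  | insert i t hi ih =>
    rw [Finset.prod_insert hi]
    exact (h i (Finset.mem_insert_self i t)).mul (ih fun j hj => h j (Finset.mem_insert_of_mem hj))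

theorem supContr_symStep (s : ℝ) (j : Fin n) : SupContr (symStep s j) := by
  have h : ∀ v : Bdry n, SupContr ((1 / 2 : ℝ) • (1 + AddMonoidAlgebra.single v 1)) := by
    intro v f M hf x
    rw [act_smul_apply, act_add_apply, map_one, Module.End.one_apply, Pi.smul_apply,
      Pi.add_apply, act_single, one_smul, norm_smul]
    have h1 := norm_add_le (f x) (f (x - v))
    have h2 := hf x
    have h3 := hf (x - v)
    norm_num
    linarith
  refine (h _).mul ?_
  rw [halfStep, map_smul, map_add, map_one, refl_coordShift]
  exact h _

/-- A symmetrised step is τ*(1 + τ)²/4, so its powers have binomial weights C(2N, m)/4^N. -/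
theorem symStep_pow (s : ℝ) (j : Fin n) (N : ℕ) :
    symStep s j ^ N = refl (coordShift s j) ^ N * ((1 / 4 : ℝ) ^ N •
      ∑ m ∈ Finset.range (2 * N + 1), ((2 * N).choose m : ℝ) • coordShift s j ^ m) := by
  have h0 := coordShift_mul_refl s j
  have h1 : symStep s j = (1 / 4 : ℝ) • (refl (coordShift s j) * (coordShift s j + 1) ^ 2) := by
    rw [symStep, halfStep, map_smul, map_add, map_one, smul_mul_smul_comm,
      show (1 / 2 : ℝ) * (1 / 2) = 1 / 4 by norm_num]
    congr 1
    linear_combination (-coordShift s j - 1) * h0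
  rw [h1, smul_pow, mul_pow, ← pow_mul, add_pow, mul_smul_comm]
  congr 2
  refine Finset.sum_congr rfl fun m _ => ?_
  rw [one_pow, mul_one, Algebra.smul_def, mul_comm]
  simp

theorem act_symStep_pow (s : ℝ) (j : Fin n) (N : ℕ) (e : Bdry n → ℂ) (x : Bdry n) :
    act ℂ (symStep s j ^ N) e x = (1 / 4 : ℝ) ^ N • ∑ m ∈ Finset.range (2 * N + 1),
      ((2 * N).choose m : ℝ) • e (x + N • s • EuclideanSpace.single j (1 : ℝ)
        - m • s • EuclideanSpace.single j (1 : ℝ)) := by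
  rw [symStep_pow, act_mul_apply, refl_coordShift, AddMonoidAlgebra.single_pow, act_single,
    one_pow, one_smul, act_smul_apply, Pi.smul_apply, act_sum_apply, Finset.sum_apply]
  congr 1
  refine Finset.sum_congr rfl fun m _ => ?_
  rw [act_smul_apply, Pi.smul_apply, coordShift, AddMonoidAlgebra.single_pow, act_single, one_pow,
    one_smul, smul_neg, sub_neg_eq_add]

theorem card_le_of_norm_sub_le {s R : ℝ} (hs : 0 < s) (hR : 0 ≤ R) {v : Bdry n} (hv : ‖v‖ = s)
    (y : Bdry n) {J : Finset ℕ} (hJ : ∀ m ∈ J, ‖y - m • v‖ ≤ R) :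
    J.card ≤ ⌊2 * R / s⌋₊ + 1 := by
  rcases J.eq_empty_or_nonempty with rfl | hne
  · simp
  have hsub : J ⊆ Finset.Icc (J.min' hne) (J.min' hne + ⌊2 * R / s⌋₊) := by
    intro m hm
    have hle := J.min'_le m hm
    rw [Finset.mem_Icc]
    refine ⟨hle, ?_⟩
    have h1 : (m - J.min' hne) ≤ ⌊2 * R / s⌋₊ := by
      rw [Nat.le_floor_iff (by positivity), le_div_iff₀ hs, Nat.cast_sub hle]
      have h2 := norm_sub_le (y - J.min' hne • v) (y - m • v)
      have h3 : y - J.min' hne • v - (y - m • v) = ((m : ℝ) - (J.min' hne : ℝ)) • v := by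
        rw [sub_smul, Nat.cast_smul_eq_nsmul, Nat.cast_smul_eq_nsmul]; abel
      rw [h3, norm_smul, hv, Real.norm_of_nonneg (by simpa using hle)] at h2
      linarith [hJ m hm, hJ _ (J.min'_mem hne)]
    omega
  refine (Finset.card_le_card hsub).trans ?_
  simp
  omega

/-- Outside a ball `e` is small. Inside it, a walk with step `s` in one direction has a bounded
number of positions, each of weight at most the central binomial coefficient over 4^N, which tends
to zero. One direction is enough, because the steps in the others are contractions for the supremum
norm. -/
theorem exists_act_pow_le {s : ℝ} (hs : 0 < s) (j : Fin n) {e : Bdry n → ℂ} (he : Continuous e)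
    (he0 : Tendsto e (cocompact _) (𝓝 0)) {ε : ℝ} (hε : 0 < ε) :
    ∃ N : ℕ, ∀ x, ‖act ℂ ((∏ j, symStep s j) ^ N) e x‖ ≤ ε := by
  obtain ⟨M, hM⟩ : ∃ M : ℝ, ∀ x, ‖e x‖ ≤ M := by
    obtain ⟨M, hM⟩ := (ZeroAtInftyContinuousMap.isBounded_range
      (⟨⟨e, he⟩, he0⟩ : ZeroAtInftyContinuousMap (Bdry n) ℂ)).exists_norm_le
    exact ⟨M, fun x => hM _ ⟨x, rfl⟩⟩
  have hM0 : 0 ≤ M := (norm_nonneg _).trans (hM 0)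
  obtain ⟨R, hR0, hR⟩ : ∃ R : ℝ, 0 ≤ R ∧ ∀ x, R < ‖x‖ → ‖e x‖ ≤ ε / 2 := by
    have h := (Metric.tendsto_nhds.1 he0) (ε / 2) (by positivity)
    obtain ⟨K, hK, hKs⟩ := mem_cocompact.1 h
    obtain ⟨R, hR⟩ := hK.isBounded.exists_norm_le
    refine ⟨max R 0, le_max_right _ _, fun x hx => ?_⟩
    have h1 : x ∈ Kᶜ := fun h1 => absurd (hR x h1) (not_le.2 ((le_max_left _ _).trans_lt hx))
    have h2 : dist (e x) 0 < ε / 2 := hKs h1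
    rw [dist_zero_right] at h2
    exact h2.le
  set B : ℝ := ((⌊2 * R / s⌋₊ + 1 : ℕ) : ℝ) with hB
  obtain ⟨N, hN⟩ := exists_nat_ge ((B * M) ^ 2 / (ε / 2) ^ 2)
  have hN2 : B * M * ((N.centralBinom : ℝ) / 4 ^ N) ≤ ε / 2 := by
    refine abs_le_of_sq_le_sq' (a := B * M * ((N.centralBinom : ℝ) / 4 ^ N)) ?_ (by positivity) |>.2
    rw [div_le_iff₀ (by positivity)] at hN
    have h1 := centralBinom_sq_le N
    set c := (N.centralBinom : ℝ) / 4 ^ N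
    calc (B * M * c) ^ 2 = (B * M) ^ 2 * c ^ 2 := by ring
      _ ≤ (N * (ε / 2) ^ 2) * c ^ 2 := by gcongr
      _ = (ε / 2) ^ 2 * (c ^ 2 * N) := by ring
      _ ≤ (ε / 2) ^ 2 * 1 := by
        gcongr
        exact le_trans (by gcongr; linarith) h1
      _ = (ε / 2) ^ 2 := mul_one _
  refine ⟨N, fun x => ?_⟩
  -- The direction `j` is made to act first; the other factors then only have to preserve the
  -- supremum bound.
  rw [← Finset.prod_pow, ← Finset.mul_prod_erase _ _ (Finset.mem_univ j), mul_comm,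
    act_mul_apply]
  refine SupContr.prod _ (fun i _ => ?_) _ _ (fun x => ?_) x
  · simpa using SupContr.prod (Finset.range N) fun _ _ => supContr_symStep s i
  rw [act_symStep_pow]
  set v : Bdry n := s • EuclideanSpace.single j (1 : ℝ) with hv
  have hvn : ‖v‖ = s := by rw [hv, norm_smul]; simp [abs_of_pos hs]
  set y := x + N • v
  set J := (Finset.range (2 * N + 1)).filter fun m => ‖y - m • v‖ ≤ R with hJ
  have hcard : (J.card : ℝ) ≤ B := by
    rw [hB]
    exact_mod_cast card_le_of_norm_sub_le hs hR0 hvn y fun m hm => (Finset.mem_filter.1 hm).2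
  have hterm : ∀ m ∈ Finset.range (2 * N + 1), ‖((2 * N).choose m : ℝ) • e (y - m • v)‖
      ≤ ((2 * N).choose m : ℝ) * (ε / 2) + if ‖y - m • v‖ ≤ R then N.centralBinom * M else 0 := by
    intro m _
    rw [norm_smul, Real.norm_of_nonneg (by positivity)]
    split_ifs with h
    · have h1 : ((2 * N).choose m : ℝ) ≤ N.centralBinom := by
        exact_mod_cast Nat.choose_le_centralBinom m N
      refine le_trans ?_ (le_add_of_nonneg_left (by positivity))
      exact mul_le_mul h1 (hM _) (norm_nonneg _) (by positivity)
    · rw [add_zero]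
      gcongr
      exact hR _ (not_le.1 h)
  rw [norm_smul, Real.norm_of_nonneg (by positivity)]
  have hsum : ∑ m ∈ Finset.range (2 * N + 1), ((2 * N).choose m : ℝ) = 4 ^ N := by
    rw [← Nat.cast_sum, Nat.sum_range_choose, pow_mul]; norm_num
  calc (1 / 4 : ℝ) ^ N * ‖∑ m ∈ Finset.range (2 * N + 1), ((2 * N).choose m : ℝ) • e (y - m • v)‖
      ≤ (1 / 4 : ℝ) ^ N * (4 ^ N * (ε / 2) + J.card * (N.centralBinom * M)) := by
        gcongr
        refine (norm_sum_le_of_le _ hterm).trans (le_of_eq ?_)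
        rw [Finset.sum_add_distrib, ← Finset.sum_mul, hsum, ← Finset.sum_filter, Finset.sum_const,
          nsmul_eq_mul]
    _ ≤ (1 / 4 : ℝ) ^ N * (4 ^ N * (ε / 2) + B * (N.centralBinom * M)) := by gcongr
    _ = ε / 2 + B * M * ((N.centralBinom : ℝ) / 4 ^ N) := by
        rw [div_pow, one_pow]; field_simp
    _ ≤ ε := by linarith

end Escape

/-! ### Kernels with divergence close to the point mass -/

section RieszKernel

variable {n : ℕ}

theorem eLpNorm_tconv_neg {X : Type} [NormedAddCommGroup X] [NormedSpace ℝ X] [MeasureSpace X]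
    [BorelSpace X] [FiniteDimensional ℝ X] [(volume : Measure X).IsAddHaarMeasure] {k : X → ℝ}
    (hk : Integrable k volume) {g : X → ℂ} (hg : AEStronglyMeasurable g volume) (p : ℝ≥0∞) :
    eLpNorm (tconv (-ContinuousLinearMap.id ℝ X) k g) p volume
      = eLpNorm (tconv (ContinuousLinearMap.id ℝ X) k fun z => g (-z)) p volume := by
  have hmp : MeasurePreserving (fun z : X => -z) volume volume :=
    Measure.measurePreserving_neg volume
  refine Eq.trans ?_ (eLpNorm_comp_measurePreserving (aestronglyMeasurable_tconv
    (ContinuousLinearMap.id ℝ X) hk.1 (hg.comp_measurePreserving hmp)) hmp)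
  congr 1
  ext z
  simp only [tconv, Function.comp_apply]
  refine integral_congr_ae (Eventually.of_forall fun y => ?_)
  simp [add_comm]

theorem UnitKernel.update {r : Fin n → ℝ} {φ : Fin n → ℝ → ℝ} (h : ∀ l, UnitKernel (r l) (φ l))
    {r' : ℝ} {ψ : ℝ → ℝ} (hψ : UnitKernel r' ψ) (j l : Fin n) :
    UnitKernel (Function.update r j r' l) (Function.update φ j ψ l) := by
  rcases eq_or_ne l j with rfl | hl
  · simpa using hψ
  · simpa [hl] using h l

theorem refl_symStep (s : ℝ) (j : Fin n) : refl (symStep s j) = symStep s j := by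
  rw [symStep, map_mul, refl_refl, mul_comm]

theorem norm_integral_tens_sub_le {r δ : ℝ} {φ : Fin n → ℝ → ℝ} (h : ∀ l, UnitKernel r (φ l))
    {e : Bdry n → ℂ} (he : Continuous e) (hδ : ∀ y : Bdry n, ‖y‖ ≤ n * r → ‖e y - e 0‖ ≤ δ) :
    ‖(∫ y, (tens φ y : ℂ) * e y) - e 0‖ ≤ δ := by
  have hc : HasCompactSupport fun y => (tens φ y : ℂ) :=
    (hasCompactSupport_tens h).comp_left (g := Complex.ofReal) (by simp)
  have hcont : Continuous fun y => (tens φ y : ℂ) :=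
    Complex.continuous_ofReal.comp (contDiff_tens h).continuous
  have h1 : Integrable (fun y => (tens φ y : ℂ) * e y) volume :=
    (hcont.mul he).integrable_of_hasCompactSupport hc.mul_right
  have h2 : Integrable (fun y => (tens φ y : ℂ) * e 0) volume :=
    (hcont.mul continuous_const).integrable_of_hasCompactSupport hc.mul_right
  have h3 : (∫ y, (tens φ y : ℂ) * e y) - e 0 = ∫ y, (tens φ y : ℂ) * (e y - e 0) := by
    simp only [mul_sub]
    rw [integral_sub h1 h2, integral_mul_const, integral_complex_ofReal, integral_tens h]
    simp
  rw [h3]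
  refine (norm_integral_le_of_norm_le ((integrable_tens h).mul_const δ)
    (Eventually.of_forall fun y => ?_)).trans_eq (by rw [integral_mul_const, integral_tens h, one_mul])
  rw [norm_mul, Complex.norm_real, Real.norm_of_nonneg (tens_nonneg h y)]
  by_cases hy : tens φ y = 0
  · simp [hy]
  · refine mul_le_mul_of_nonneg_left (hδ y ?_) (tens_nonneg h y)
    have h4 : y = ∑ l, y l • EuclideanSpace.single l (1 : ℝ) := by
      ext i
      simp [Finset.sum_apply, Pi.single_apply]
    rw [h4]
    refine (norm_sum_le _ _).trans ?_
    have h5 : ∀ l ∈ Finset.univ, ‖y l • (EuclideanSpace.single l (1 : ℝ) : Bdry n)‖ ≤ r := by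
      intro l _
      rw [norm_smul]
      simpa using abs_le_of_tens_ne_zero h hy l
    refine (Finset.sum_le_sum h5).trans (by simp)

/-- Vector fields `κ` with `div κ` close to the point mass at the origin, whose derivatives are
convolution kernels of operators bounded on `L^p`. -/
theorem exists_rieszKernel (hn : 1 ≤ n) {p q : ℝ} (hpq : p.HolderConjugate q) :
    ∃ C : ℝ≥0, ∀ e : Bdry n → ℂ, Continuous e → Tendsto e (cocompact _) (𝓝 0) → ∀ ε : ℝ, 0 < ε →
      ∃ κ : Fin n → Bdry n → ℝ,
        (∀ i, ContDiff ℝ ((⊤ : ℕ∞) : WithTop ℕ∞) (κ i)) ∧ (∀ i, HasCompactSupport (κ i)) ∧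
        (∀ i j, ∀ g : Bdry n → ℂ, MemLp g (ENNReal.ofReal p) volume →
          eLpNorm (tconv (ContinuousLinearMap.id ℝ (Bdry n))
            (fun y => fderiv ℝ (κ i) y (EuclideanSpace.single j 1)) g) (ENNReal.ofReal p) volume
            ≤ C * eLpNorm g (ENNReal.ofReal p) volume) ∧
        (∀ i j, ∀ g : Bdry n → ℂ, MemLp g (ENNReal.ofReal p) volume →
          eLpNorm (tconv (-ContinuousLinearMap.id ℝ (Bdry n))
            (fun y => fderiv ℝ (κ i) y (EuclideanSpace.single j 1)) g) (ENNReal.ofReal p) volume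
            ≤ C * eLpNorm g (ENNReal.ofReal p) volume) ∧
        ‖(∫ y, ((∑ i, fderiv ℝ (κ i) y (EuclideanSpace.single i 1) : ℝ) : ℂ) * e y) - e 0‖
          ≤ ε := by
  have hp : 1 ≤ ENNReal.ofReal p := by
    rw [ENNReal.one_le_ofReal]; exact hpq.lt.le
  obtain ⟨C, hC⟩ := exists_actBound_second_diff (n := n) hpq
  refine ⟨C, fun e he he0 ε hε => ?_⟩
  obtain ⟨r, hr, hre⟩ := Metric.continuousAt_iff.1 (he.continuousAt (x := 0)) (ε / 2) (half_pos hε)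
  -- The density ρ below is supported where every coordinate is at most 3s, hence where |y| ≤ 3ns <
  -- r and `e` varies by less than ε/2.
  set s : ℝ := r / (3 * n + 1) with hsdef
  have hs : 0 < s := by positivity
  have hs3 : n * (s + s + s) < r := by
    have h1 : s * (3 * n + 1) = r := div_mul_cancel₀ _ (by positivity)
    nlinarith
  -- `N` is taken after `s`, so large that U^N e is uniformly small; the bounds on L^p are
  -- insensitive to both.
  obtain ⟨N, hN⟩ := exists_act_pow_le hs (⟨0, hn⟩ : Fin n) he he0 (half_pos hε)
  obtain ⟨γ₀, hγ₀⟩ := exists_unitKernel hs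
  have hγ := hγ₀.meanShift hs
  have hβ := hγ.meanBox hs
  have hα₀ := (hγ₀.meanBox hs).meanBox hs
  have hα := hβ.meanBox hs
  -- Each factor carries two means. The box mean turns a derivative into τ - 1, and the shift mean
  -- supplies the factor (1 + τ)/2 which completes it to τ² - 1 in the mixed derivatives.
  set γ := meanShift s γ₀ with hγdef
  set β := meanBox s γ with hβdef
  set α₀ := meanBox s (meanBox s γ₀) with hα₀def
  have hαeq : meanBox s β = meanShift s α₀ := by
    rw [hβdef, hγdef, meanShift_meanBox hs hγ₀.contDiff.continuous,
      meanShift_meanBox hs (hγ₀.meanBox hs).contDiff.continuous]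
  set B : Fin n → ℝ → ℝ := fun _ => β with hB
  have hBk : ∀ l, UnitKernel (s + s + s) (B l) := fun _ => hβ
  set ρ := tens B with hρ
  set G := stepSum (n := n) s N with hG
  -- The i-th derivative of σ_i contributes -(τ_i - 1)/s. With the factor -s/4 and τ_i* - 1 this
  -- makes up (τ_i - 1)(τ_i* - 1)/4, the defect of the i-th symmetrised step.
  set b : Fin n → ShiftAlg (Bdry n) := fun i =>
    (-s / 4) • ((refl (coordShift s i) - 1) * stepsBefore s i * G) with hb
  set σ : Fin n → Bdry n → ℝ := fun i => tens (Function.update B i (meanBox s β)) with hσ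
  have hσk := fun i => UnitKernel.update hBk hα i
  have hσs : ∀ i, ContDiff ℝ ((⊤ : ℕ∞) : WithTop ℕ∞) (σ i) := fun i => contDiff_tens (hσk i)
  have hσc : ∀ i, HasCompactSupport (σ i) := fun i => hasCompactSupport_tens (hσk i)
  have hdiag : ∀ i, (fun y => fderiv ℝ (act ℝ (b i) (σ i)) y (EuclideanSpace.single i 1))
      = act ℝ ((1 - symStep s i) * stepsBefore s i * G) ρ := by
    intro i
    rw [fderiv_act (hσs i), fderiv_tens_update_meanBox hs hBk i hβ, ← act_mul_apply,
      show Function.update B i β = B from Function.update_eq_self i B]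
    congr 2
    rw [one_sub_symStep]
    simp only [hb, Algebra.smul_def]
    have h1 : algebraMap ℝ (ShiftAlg (Bdry n)) (-s / 4) * algebraMap ℝ _ (-s⁻¹)
        = algebraMap ℝ _ (1 / 4) := by
      rw [← map_mul]; congr 1; field_simp
    linear_combination ((refl (coordShift s i) - 1) * stepsBefore s i * G
      * (coordShift s i - 1)) * h1
  -- In mixed derivatives the means in the directions i and j supply (1 + τ_i)/2 and (1 + τ_j)/2.
  -- Then (τ_i* - 1)(1 + τ_i) = -(τ_i - τ_i*) and (τ_j - 1)(1 + τ_j) = τ_j(τ_j - τ_j*), which leaves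
  -- a bounded mixed second difference; the coefficient is -(1/4)(1/2)².
  have hoff : ∀ i j, i ≠ j → ∃ τ : Bdry n → ℝ, ContDiff ℝ ((⊤ : ℕ∞) : WithTop ℕ∞) τ ∧
      HasCompactSupport τ ∧ eLpNorm τ 1 volume ≤ 1 ∧
      (fun y => fderiv ℝ (act ℝ (b i) (σ i)) y (EuclideanSpace.single j 1))
      = act ℝ ((-(1 / 16) : ℝ) • (coordShift s j * stepsBefore s i *
        ((coordShift s i - refl (coordShift s i)) * (coordShift s j - refl (coordShift s j)) * G)))
        τ := by
    intro i j hij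
    have hk := UnitKernel.update (UnitKernel.update hBk hγ₀ j) hα₀ i
    refine ⟨_, contDiff_tens hk, hasCompactSupport_tens hk, eLpNorm_tens hk, ?_⟩
    have e1 : σ i = tens (Function.update (Function.update B i (meanBox s β)) j (meanBox s γ)) := by
      have : Function.update B i (meanBox s β) j = meanBox s γ := by
        rw [Function.update_of_ne hij.symm]
      rw [← this, Function.update_eq_self]
    rw [fderiv_act (hσs i), e1, fderiv_tens_update_meanBox hs (hσk i) j hγ, hγdef,
      tens_update_meanShift, Function.update_comm hij, hαeq, tens_update_meanShift,
      ← act_mul_apply, ← act_mul_apply, ← act_mul_apply]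
    congr 2
    simp only [hb, Algebra.smul_def]
    have h1 : algebraMap ℝ (ShiftAlg (Bdry n)) (-s / 4) * algebraMap ℝ _ (-s⁻¹)
        * (algebraMap ℝ _ (1 / 2) * algebraMap ℝ _ (1 / 2)) = -algebraMap ℝ _ (-(1 / 16)) := by
      rw [← map_mul, ← map_mul, ← map_mul, ← map_neg]; congr 1; field_simp; norm_num
    have hi := coordShift_mul_refl s i
    have hj := coordShift_mul_refl s j
    set k := algebraMap ℝ (ShiftAlg (Bdry n)) (-(1 / 16)) with hk
    linear_combination (stepsBefore s i * G * (coordShift s j - 1) * (1 + coordShift s j)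
      * (refl (coordShift s i) - 1) * (1 + coordShift s i)) * h1
      - k * stepsBefore s i * G * (coordShift s j ^ 2 - 1) * hi
      + k * stepsBefore s i * G * (coordShift s i - refl (coordShift s i)) * hj
  have hbound : ∀ i j, ∀ g : Bdry n → ℂ, MemLp g (ENNReal.ofReal p) volume →
      eLpNorm (tconv (ContinuousLinearMap.id ℝ (Bdry n))
        (fun y => fderiv ℝ (act ℝ (b i) (σ i)) y (EuclideanSpace.single j 1)) g)
        (ENNReal.ofReal p) volume ≤ C * eLpNorm g (ENNReal.ofReal p) volume := by
    intro i j g hg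
    rcases eq_or_ne i j with rfl | hij
    · rw [hdiag]
      refine eLpNorm_tconv_act_le hp ENNReal.ofReal_ne_top ?_ (contDiff_tens hBk).continuous
        (hasCompactSupport_tens hBk) (eLpNorm_tens hBk) hg
      have h1 := (((hC s N).1 i).mul (actBound_stepsBefore hp s i)).smul (1 / 4)
      rw [one_sub_symStep, smul_mul_assoc, smul_mul_assoc, mul_right_comm]
      refine h1.mono ?_
      rw [mul_one]
      refine mul_le_of_le_one_left zero_le ?_
      rw [← NNReal.coe_le_coe]
      norm_num
    · obtain ⟨τ, h1, h2, h3, h4⟩ := hoff i j hij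
      rw [h4]
      refine eLpNorm_tconv_act_le hp ENNReal.ofReal_ne_top ?_ h1.continuous h2 h3 hg
      have h5 := (((ActBound.single (ENNReal.ofReal p) (s • EuclideanSpace.single j (1 : ℝ)) 1).mul
        (actBound_stepsBefore hp s i)).mul ((hC s N).2 i j hij)).smul (-(1 / 16))
      refine h5.mono ?_
      rw [nnnorm_one, one_mul, one_mul]
      refine mul_le_of_le_one_left zero_le ?_
      rw [← NNReal.coe_le_coe]
      norm_num
  have hint : ∀ i j, Integrable (fun y => fderiv ℝ (act ℝ (b i) (σ i)) y
      (EuclideanSpace.single j 1)) volume := fun i j =>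
    (((contDiff_act (hσs i) (b i)).continuous_fderiv (by simp)).clm_apply
      continuous_const).integrable_of_hasCompactSupport
      ((hasCompactSupport_act (hσc i) (b i)).fderiv_apply ℝ _)
  refine ⟨fun i => act ℝ (b i) (σ i), fun i => contDiff_act (hσs i) _,
    fun i => hasCompactSupport_act (hσc i) _, hbound, fun i j g hg => ?_, ?_⟩
  · have hmp : MeasurePreserving (fun z : Bdry n => -z) volume volume :=
      Measure.measurePreserving_neg volume
    rw [eLpNorm_tconv_neg (hint i j) hg.1]
    refine (hbound i j _ (hg.comp_measurePreserving hmp)).trans_eq ?_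
    congr 1
    exact eLpNorm_comp_measurePreserving hg.1 hmp
  -- The diagonal terms add up to (1 - U)G ρ = ρ - U^N ρ. The first part evaluates `e` near 0; in
  -- the second U^N, which is its own reflection, is moved onto `e`.
  · have hsum : ∀ y, ((∑ i, fderiv ℝ (act ℝ (b i) (σ i)) y (EuclideanSpace.single i 1) : ℝ) : ℂ)
        = (ρ y : ℂ) - act ℂ ((∏ j, symStep s j) ^ N) (fun y => (ρ y : ℂ)) y := by
      intro y
      have h1 : ∑ i, fderiv ℝ (act ℝ (b i) (σ i)) y (EuclideanSpace.single i 1)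
          = act ℝ (1 - (∏ j, symStep s j) ^ N) ρ y := by
        rw [← mul_neg_geom_sum, one_sub_prod_symStep, Finset.sum_mul, act_sum_apply,
          Finset.sum_apply]
        exact Finset.sum_congr rfl fun i _ => congrFun (hdiag i) y
      have h2 := act_comp Complex.ofRealCLM ((∏ j, symStep s j) ^ N) ρ
      simp only [Complex.ofRealCLM_apply] at h2
      rw [h1, h2, act_sub_apply, map_one]
      simp
    simp only [hsum, sub_mul]
    have hρ1 : MemLp (fun y => (ρ y : ℂ)) 1 volume :=
      memLp_one_iff_integrable.2 (integrable_tens hBk).ofReal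
    -- `e` is bounded and ρ integrable: the conjugate exponents here are 1 and ∞.
    obtain ⟨M, hM⟩ := (ZeroAtInftyContinuousMap.isBounded_range
      (⟨⟨e, he⟩, he0⟩ : ZeroAtInftyContinuousMap (Bdry n) ℂ)).exists_norm_le
    have heT : MemLp e ∞ volume := memLp_top_of_bound he.aestronglyMeasurable M
      (Eventually.of_forall fun y => hM _ ⟨y, rfl⟩)
    rw [integral_sub (integrable_mul_of_memLp hρ1 heT)
      (integrable_mul_of_memLp (memLp_act hρ1 _) heT), integral_act_mul hρ1 heT, map_pow, map_prod]
    simp only [refl_symStep]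
    have h1 := norm_integral_tens_sub_le (δ := ε / 2) hBk he fun y hy => by
      have := hre (x := y) (by rw [dist_zero_right]; linarith)
      rw [dist_eq_norm] at this
      exact this.le
    have h2 : ‖∫ y, (ρ y : ℂ) * act ℂ ((∏ j, symStep s j) ^ N) e y‖ ≤ ε / 2 := by
      refine (norm_integral_le_of_norm_le ((integrable_tens hBk).mul_const (ε / 2))
        (Eventually.of_forall fun y => ?_)).trans_eq
          (by rw [integral_mul_const, integral_tens hBk, one_mul])
      rw [norm_mul, Complex.norm_real, Real.norm_of_nonneg (tens_nonneg hBk y)]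
      exact mul_le_mul_of_nonneg_left (hN y) (tens_nonneg hBk y)
    rw [sub_right_comm]
    refine (norm_sub_le _ _).trans ?_
    linarith

end RieszKernel

/-! ### Representation of bounded functionals on `L^q` -/

section Representation

variable {Y : Type} [MeasurableSpace Y] {ν : Measure Y}

theorem Lp_functional_ext {Q : ℝ≥0∞} [Fact (1 ≤ Q)] (hQ : Q ≠ ⊤) [IsFiniteMeasure ν]
    {L₁ L₂ : Lp ℝ Q ν →L[ℝ] ℝ}
    (h : ∀ (A : Set Y) (hA : MeasurableSet A),
      L₁ (indicatorConstLp Q hA (measure_ne_top ν A) 1) =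
        L₂ (indicatorConstLp Q hA (measure_ne_top ν A) 1)) : L₁ = L₂ := by
  ext f
  refine Lp.induction hQ (fun f => L₁ f = L₂ f) (fun c s hs hμs => ?_)
    (fun f g hf hg _ h1 h2 => by rw [map_add, map_add, h1, h2])
    (isClosed_eq L₁.continuous L₂.continuous) f
  have e : ((Lp.simpleFunc.indicatorConst Q hs hμs.ne c : Lp.simpleFunc ℝ Q ν) : Lp ℝ Q ν)
      = c • indicatorConstLp Q hs (measure_ne_top ν s) (1 : ℝ) := by
    rw [Lp.simpleFunc.coe_indicatorConst, indicatorConstLp, indicatorConstLp,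
      ← MemLp.toLp_const_smul]
    refine MemLp.toLp_congr _ _ (ae_of_all _ fun x => ?_)
    by_cases hx : x ∈ s <;> simp [hx]
  rw [e, map_smul, map_smul, h]

theorem hasSum_indicatorConstLp {Q : ℝ≥0∞} [Fact (1 ≤ Q)] (hQ : Q ≠ ⊤) [IsFiniteMeasure ν]
    {f : ℕ → Set Y} (hf : ∀ i, MeasurableSet (f i)) (hd : Pairwise (Function.onFun Disjoint f)) :
    HasSum (fun i => indicatorConstLp Q (hf i) (measure_ne_top ν (f i)) (1 : ℝ))
      (indicatorConstLp Q (MeasurableSet.iUnion hf) (measure_ne_top ν _) (1 : ℝ)) := by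
  have hs : ∀ s : Finset ℕ, MeasurableSet (⋃ i ∈ s, f i) := fun s =>
    s.measurableSet_biUnion fun i _ => hf i
  have key : ∀ s : Finset ℕ, ∑ i ∈ s, indicatorConstLp Q (hf i) (measure_ne_top ν (f i)) (1 : ℝ)
      = indicatorConstLp Q (hs s) (measure_ne_top ν _) (1 : ℝ) := by
    intro s
    induction s using Finset.induction_on with
    | empty => simp
    | insert a s ha ih =>
      rw [Finset.sum_insert ha, ih, ← indicatorConstLp_disjoint_union (hf a) (hs s)]
      · congr 1
        exact (Finset.set_biUnion_insert a s f).symm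
      · rw [Set.disjoint_iUnion₂_right]
        exact fun i hi => hd (fun h => ha (h ▸ hi))
  unfold HasSum
  simp only [SummationFilter.unconditional_filter]
  simp_rw [key]
  refine tendsto_indicatorConstLp_set hQ ?_
  have ht : ∑' i, ν (f i) ≠ ⊤ := by
    rw [← measure_iUnion hd hf]
    exact measure_ne_top _ _
  refine tendsto_of_tendsto_of_tendsto_of_le_of_le tendsto_const_nhds
    (ENNReal.tendsto_tsum_compl_atTop_zero ht) (fun _ => zero_le) fun s => ?_
  refine le_trans (measure_mono ?_) (measure_iUnion_le _)
  rintro y (⟨h1, h2⟩ | ⟨h1, h2⟩)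
  · simp only [Set.mem_iUnion] at h1 h2
    obtain ⟨i, _, hi⟩ := h1
    exact absurd ⟨i, hi⟩ h2
  · simp only [Set.mem_iUnion, not_exists] at h1 h2 ⊢
    obtain ⟨i, hi⟩ := h1
    exact ⟨⟨i, fun his => h2 i his hi⟩, hi⟩

/-- A ↦ L(1_A) is a signed measure, countably additive because indicators of disjoint unions
converge in L^Q, and absolutely continuous because indicators of null sets vanish there. Its
Radon–Nikodym derivative is the density. -/
theorem exists_integrable_of_Lp_functional {Q : ℝ≥0∞} [Fact (1 ≤ Q)] (hQ : Q ≠ ⊤)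
    [IsFiniteMeasure ν] (L : Lp ℝ Q ν →L[ℝ] ℝ) :
    ∃ h : Y → ℝ, Measurable h ∧ Integrable h ν ∧ ∀ (A : Set Y) (hA : MeasurableSet A),
      L (indicatorConstLp Q hA (measure_ne_top ν A) 1) = ∫ y in A, h y ∂ν := by
  classical
  let s : SignedMeasure Y :=
    { measureOf' := fun A => if hA : MeasurableSet A then
        L (indicatorConstLp Q hA (measure_ne_top ν A) 1) else 0
      empty' := by simp
      not_measurable' := fun A hA => by simp [hA]
      m_iUnion' := fun f hf hd => by
        simp only [hf, MeasurableSet.iUnion hf, dif_pos]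
        exact (hasSum_indicatorConstLp hQ hf hd).mapL L }
  have hs : ∀ (A : Set Y) (hA : MeasurableSet A),
      s A = L (indicatorConstLp Q hA (measure_ne_top ν A) 1) := fun A hA => dif_pos hA
  have hac : s ≪ᵥ ν.toENNRealVectorMeasure := by
    refine VectorMeasure.AbsolutelyContinuous.mk fun A hA h0 => ?_
    rw [Measure.toENNRealVectorMeasure_apply_measurable hA] at h0
    rw [hs A hA]
    have hz : indicatorConstLp Q hA (measure_ne_top ν A) (1 : ℝ) = 0 := by
      rw [← norm_eq_zero, norm_indicatorConstLp (one_pos.trans_le (Fact.out : 1 ≤ Q)).ne' hQ]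
      have : Q.toReal ≠ 0 := (ENNReal.toReal_pos (one_pos.trans_le Fact.out).ne' hQ).ne'
      simp [Measure.real, h0, this]
    rw [hz, map_zero]
  refine ⟨s.rnDeriv ν, SignedMeasure.measurable_rnDeriv _ _, SignedMeasure.integrable_rnDeriv _ _,
    fun A hA => ?_⟩
  rw [← hs A hA, ← withDensityᵥ_apply (SignedMeasure.integrable_rnDeriv _ _) hA,
    SignedMeasure.withDensityᵥ_rnDeriv_eq s ν hac]

theorem Lp_functional_eq_integral {P Q : ℝ≥0∞} [P.HolderConjugate Q] [Fact (1 ≤ P)]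
    [Fact (1 ≤ Q)] (hQ : Q ≠ ⊤) [IsFiniteMeasure ν] (L : Lp ℝ Q ν →L[ℝ] ℝ) {F : Y → ℝ}
    (hF : MemLp F P ν)
    (h : ∀ (A : Set Y) (hA : MeasurableSet A),
      L (indicatorConstLp Q hA (measure_ne_top ν A) 1) = ∫ y in A, F y ∂ν)
    {f : Y → ℝ} (hf : MemLp f Q ν) : L (hf.toLp f) = ∫ y, F y * f y ∂ν := by
  have e : L = (ContinuousLinearMap.mul ℝ ℝ).lpPairing ν P Q (hF.toLp F) := by
    refine Lp_functional_ext hQ fun A hA => ?_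
    rw [h A hA, ContinuousLinearMap.lpPairing_eq_integral, ← integral_indicator hA]
    refine integral_congr_ae ?_
    filter_upwards [hF.coeFn_toLp, indicatorConstLp_coeFn (p := Q) (hs := hA)
      (hμs := measure_ne_top ν A) (c := (1 : ℝ))] with y h1 h2
    rw [h1, h2]
    by_cases hy : y ∈ A <;> simp [hy]
  rw [e, ContinuousLinearMap.lpPairing_eq_integral]
  refine integral_congr_ae ?_
  filter_upwards [hF.coeFn_toLp, hf.coeFn_toLp] with y h1 h2
  rw [h1, h2, ContinuousLinearMap.mul_apply']

/-- The density is so far only integrable. Its truncation to |h| ≤ k is bounded, hence in L^p, and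
represents `L` composed with multiplication by an indicator, a contraction. Duality bounds all
truncations by 2M, the factor 2 coming from real and imaginary parts of complex test functions, and
Fatou's lemma gives the bound for `h`. -/
theorem exists_memLp_of_Lp_functional {p q : ℝ} (hpq : p.HolderConjugate q)
    [Fact (1 ≤ ENNReal.ofReal q)] [IsFiniteMeasure ν]
    (L : Lp ℝ (ENNReal.ofReal q) ν →L[ℝ] ℝ) {M : ℝ} (hM : ‖L‖ ≤ M) :
    ∃ h : Y → ℝ, Measurable h ∧ MemLp h (ENNReal.ofReal p) ν ∧
      eLpNorm h (ENNReal.ofReal p) ν ≤ ENNReal.ofReal (2 * M) ∧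
      ∀ (f : Y → ℝ) (hf : MemLp f (ENNReal.ofReal q) ν), L (hf.toLp f) = ∫ y, h y * f y ∂ν := by
  haveI := holderConjugate_ofReal hpq
  haveI : Fact (1 ≤ ENNReal.ofReal p) := ⟨by
    rw [← ENNReal.ofReal_one]; exact ENNReal.ofReal_le_ofReal hpq.lt.le⟩
  have hM0 : 0 ≤ M := (norm_nonneg L).trans hM
  obtain ⟨h, hm, hi, hL⟩ := exists_integrable_of_Lp_functional ENNReal.ofReal_ne_top L
  have hE : ∀ k : ℕ, MeasurableSet {y | |h y| ≤ k} := fun k =>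
    measurableSet_le hm.abs measurable_const
  have hb : ∀ k : ℕ, MemLp ({y | |h y| ≤ k}.indicator h) (ENNReal.ofReal p) ν := fun k =>
    MemLp.of_bound (hm.indicator (hE k)).aestronglyMeasurable k (ae_of_all _ fun y => by
      by_cases hy : |h y| ≤ k
      · simpa [Set.indicator_of_mem (show y ∈ {y | |h y| ≤ k} from hy)] using hy
      · simp [Set.indicator_of_notMem (show y ∉ {y | |h y| ≤ k} from hy)])
  have hbound : ∀ k : ℕ, eLpNorm ({y | |h y| ≤ k}.indicator h) (ENNReal.ofReal p) ν
      ≤ ENNReal.ofReal (2 * M) := by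
    intro k
    set E := {y | |h y| ≤ k} with hEdef
    have hE' : MeasurableSet E := hE k
    have h1 : MemLp (E.indicator fun _ => (1 : ℝ)) ⊤ ν := memLp_indicator_const _ hE' _
      (Or.inr (measure_ne_top _ _))
    let J : Lp ℝ (ENNReal.ofReal q) ν →L[ℝ] Lp ℝ (ENNReal.ofReal q) ν :=
      (ContinuousLinearMap.mul ℝ ℝ).holderL ν ⊤ (ENNReal.ofReal q) (ENNReal.ofReal q) (h1.toLp _)
    have hJ : ∀ f : Lp ℝ (ENNReal.ofReal q) ν, J f =ᵐ[ν] E.indicator f := by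
      intro f
      filter_upwards [(ContinuousLinearMap.mul ℝ ℝ).coeFn_holder (r := ENNReal.ofReal q)
        (h1.toLp _) f, h1.coeFn_toLp] with y h2 h3
      change ((ContinuousLinearMap.mul ℝ ℝ).holder _ (h1.toLp _) f) y = _
      rw [h2, h3]
      by_cases hy : y ∈ E <;> simp [hy]
    have hJn : ∀ f : Lp ℝ (ENNReal.ofReal q) ν, ‖J f‖ ≤ ‖f‖ := fun f => by
      refine Lp.norm_le_norm_of_ae_le ?_
      filter_upwards [hJ f] with y hy
      rw [hy]
      exact norm_indicator_le_norm_self _ _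
    have hJA : ∀ (A : Set Y) (hA : MeasurableSet A),
        (L ∘L J) (indicatorConstLp _ hA (measure_ne_top ν A) 1)
          = ∫ y in A, E.indicator h y ∂ν := by
      intro A hA
      have e : J (indicatorConstLp _ hA (measure_ne_top ν A) 1)
          = indicatorConstLp _ (hE'.inter hA) (measure_ne_top ν _) 1 := by
        refine Lp.ext ((hJ _).trans ?_)
        filter_upwards [indicatorConstLp_coeFn (p := ENNReal.ofReal q) (hs := hA)
          (hμs := measure_ne_top ν A) (c := (1 : ℝ)),
          indicatorConstLp_coeFn (p := ENNReal.ofReal q) (hs := hE'.inter hA)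
          (hμs := measure_ne_top ν _) (c := (1 : ℝ))] with y h2 h3
        rw [h3]
        by_cases hy : y ∈ E
        · rw [Set.indicator_of_mem hy, h2]
          by_cases hyA : y ∈ A <;> simp [hy, hyA]
        · simp [hy]
      rw [ContinuousLinearMap.comp_apply, e, hL, Set.inter_comm, ← setIntegral_indicator hE']
    refine le_trans (le_of_eq ?_) (eLpNorm_le_of_forall_integral_mul_le
      (F := fun y => ((E.indicator h y : ℝ) : ℂ)) hpq (hb k).ofReal (by linarith) fun g hg => ?_)
    · exact eLpNorm_congr_norm_ae (ae_of_all _ fun y => (Complex.norm_real _).symm)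
    have hG : Integrable (fun y => ((E.indicator h y : ℝ) : ℂ) * g y) ν :=
      integrable_mul_of_memLp (p := ENNReal.ofReal p) (q := ENNReal.ofReal q) (hb k).ofReal hg
    have est : ∀ (g' : Y → ℝ) (hg' : MemLp g' (ENNReal.ofReal q) ν), (∀ y, ‖g' y‖ ≤ ‖g y‖) →
        ‖∫ y, E.indicator h y * g' y ∂ν‖ ≤ M * (eLpNorm g (ENNReal.ofReal q) ν).toReal := by
      intro g' hg' hle
      rw [← Lp_functional_eq_integral ENNReal.ofReal_ne_top (L ∘L J) (hb k) hJA hg']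
      refine (L.le_opNorm _).trans ?_
      refine mul_le_mul hM ((hJn _).trans ?_) (norm_nonneg _) hM0
      rw [Lp.norm_toLp]
      exact ENNReal.toReal_mono hg.2.ne (eLpNorm_mono hle)
    have er := est (fun y => (g y).re) hg.re fun y => Complex.abs_re_le_norm _
    have ei := est (fun y => (g y).im) hg.im fun y => Complex.abs_im_le_norm _
    refine (Complex.norm_le_abs_re_add_abs_im _).trans ?_
    have e1 : (∫ y, ((E.indicator h y : ℝ) : ℂ) * g y ∂ν).re = ∫ y, E.indicator h y * (g y).re ∂ν := by
      rw [← RCLike.re_eq_complex_re, ← integral_re hG]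
      simp
    have e2 : (∫ y, ((E.indicator h y : ℝ) : ℂ) * g y ∂ν).im = ∫ y, E.indicator h y * (g y).im ∂ν := by
      rw [← RCLike.im_eq_complex_im, ← integral_im hG]
      simp
    rw [e1, e2, ← Real.norm_eq_abs, ← Real.norm_eq_abs]
    linarith
  have hlim : eLpNorm h (ENNReal.ofReal p) ν ≤ ENNReal.ofReal (2 * M) := by
    refine (Lp.eLpNorm_lim_le_liminf_eLpNorm (f := fun k : ℕ => {y | |h y| ≤ k}.indicator h)
      (fun k => (hb k).1) h (ae_of_all _ fun y => ?_)).trans ?_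
    · refine tendsto_const_nhds.congr' ?_
      filter_upwards [eventually_ge_atTop ⌈|h y|⌉₊] with k hk
      rw [Set.indicator_of_mem]
      exact (Nat.le_ceil |h y|).trans (Nat.cast_le.2 hk)
    · exact (liminf_le_liminf (Eventually.of_forall hbound)).trans (by simp)
  have hmem : MemLp h (ENNReal.ofReal p) ν :=
    ⟨hm.aestronglyMeasurable, hlim.trans_lt ENNReal.ofReal_lt_top⟩
  exact ⟨h, hm, hmem, hlim, fun f hf =>
    Lp_functional_eq_integral ENNReal.ofReal_ne_top L hmem hL hf⟩

/-- The bound makes `T` vanish on the kernel of `e`, so it factors through the range; Hahn–Banach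
extends the factor. -/
theorem exists_functional_of_bound {V E : Type} [AddCommGroup V] [Module ℝ V]
    [NormedAddCommGroup E] [NormedSpace ℝ E] (e : V →ₗ[ℝ] E) (T : V →ₗ[ℝ] ℝ) {M : ℝ} (hM : 0 ≤ M)
    (h : ∀ ψ, ‖T ψ‖ ≤ M * ‖e ψ‖) : ∃ L : E →L[ℝ] ℝ, ‖L‖ ≤ M ∧ ∀ ψ, T ψ = L (e ψ) := by
  obtain ⟨r, hr⟩ := LinearMap.exists_rightInverse_of_surjective e.rangeRestrict
    (LinearMap.range_rangeRestrict e)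
  have hr' : ∀ x : LinearMap.range e, e (r x) = x := fun x => by
    have := congrArg Subtype.val (LinearMap.congr_fun hr x)
    simpa using this
  have key : ∀ ψ, T (r (e.rangeRestrict ψ)) = T ψ := fun ψ => by
    have h0 := h (r (e.rangeRestrict ψ) - ψ)
    have he : e (r (e.rangeRestrict ψ)) = e ψ := hr' _
    rw [map_sub, map_sub, he, sub_self, norm_zero, mul_zero, norm_le_zero_iff,
      sub_eq_zero] at h0
    exact h0
  let f : StrongDual ℝ (LinearMap.range e) := (T ∘ₗ r).mkContinuous M fun x => by
    have := h (r x)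
    rw [hr'] at this
    exact this
  obtain ⟨L, h1, h2⟩ := exists_extension_norm_eq (LinearMap.range e) f
  refine ⟨L, h2 ▸ LinearMap.mkContinuous_norm_le _ hM _, fun ψ => ?_⟩
  exact (key ψ).symm.trans (h1 (e.rangeRestrict ψ)).symm

variable {μ : Measure Y}

theorem eLpNorm_mul_rpow_withDensity {r : ℝ} (hr : 0 < r) {g : Y → ℝ≥0} (hg : Measurable g)
    (hpos : ∀ y, 0 < g y) {f : Y → ℝ} (hf : AEStronglyMeasurable f μ) :
    eLpNorm (fun y => f y * (g y : ℝ) ^ (-(1 / r))) (ENNReal.ofReal r)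
      (μ.withDensity fun y => (g y : ℝ≥0∞)) = eLpNorm f (ENNReal.ofReal r) μ := by
  have h0 : ENNReal.ofReal r ≠ 0 := by simpa using hr
  rw [eLpNorm_eq_lintegral_rpow_enorm_toReal h0 ENNReal.ofReal_ne_top,
    eLpNorm_eq_lintegral_rpow_enorm_toReal h0 ENNReal.ofReal_ne_top, ENNReal.toReal_ofReal hr.le,
    lintegral_withDensity_eq_lintegral_mul₀ hg.coe_nnreal_ennreal.aemeasurable]
  · congr 1
    refine lintegral_congr fun y => ?_
    have hy : (0 : ℝ) < g y := hpos y
    have e1 : ‖f y * (g y : ℝ) ^ (-(1 / r))‖ₑ ^ r = ‖f y‖ₑ ^ r * (g y : ℝ≥0∞)⁻¹ := by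
      rw [enorm_mul, ENNReal.mul_rpow_of_nonneg _ _ hr.le,
        Real.enorm_of_nonneg (Real.rpow_nonneg hy.le _), ENNReal.ofReal_rpow_of_nonneg
        (Real.rpow_nonneg hy.le _) hr.le, ← Real.rpow_mul hy.le, neg_mul, one_div,
        inv_mul_cancel₀ hr.ne', Real.rpow_neg_one, ENNReal.ofReal_inv_of_pos hy,
        ENNReal.ofReal_coe_nnreal]
    rw [Pi.mul_apply, e1, mul_left_comm, ENNReal.mul_inv_cancel, mul_one]
    · simpa using (hpos y).ne'
    · exact ENNReal.coe_ne_top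
  · refine AEMeasurable.pow_const ?_ _
    refine (hf.aemeasurable.mul ?_).enorm
    exact (hg.coe_nnreal_real.pow_const _).aemeasurable

/-- A σ-finite measure μ is exchanged for the finite measure g dμ with a positive integrable `g`.
Multiplication by g^{-1/q} is an isometry from L^q(μ) to L^q(g dμ), and the representing function is
carried back with g^{1/p}. -/
theorem exists_memLp_of_functional_bound {p q : ℝ} (hpq : p.HolderConjugate q) [SigmaFinite μ]
    {V : Type} [AddCommGroup V] [Module ℝ V] (e : V →ₗ[ℝ] (Y → ℝ))
    (he : ∀ ψ, MemLp (e ψ) (ENNReal.ofReal q) μ) (T : V →ₗ[ℝ] ℝ) {M : ℝ} (hM : 0 ≤ M)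
    (h : ∀ ψ, ‖T ψ‖ ≤ M * (eLpNorm (e ψ) (ENNReal.ofReal q) μ).toReal) :
    ∃ F : Y → ℝ, MemLp F (ENNReal.ofReal p) μ ∧
      eLpNorm F (ENNReal.ofReal p) μ ≤ ENNReal.ofReal (2 * M) ∧
      ∀ ψ, T ψ = ∫ y, F y * e ψ y ∂μ := by
  haveI : Fact (1 ≤ ENNReal.ofReal q) := ⟨by
    rw [← ENNReal.ofReal_one]; exact ENNReal.ofReal_le_ofReal hpq.symm.lt.le⟩
  obtain ⟨g, hpos, hg, hgi⟩ := exists_pos_lintegral_lt_of_sigmaFinite μ (one_ne_zero (α := ℝ≥0∞))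
  set ν := μ.withDensity fun y => (g y : ℝ≥0∞) with hν
  haveI : IsFiniteMeasure ν := isFiniteMeasure_withDensity (hgi.trans ENNReal.one_lt_top).ne
  have hgr : ∀ s : ℝ, AEStronglyMeasurable (fun y => (g y : ℝ) ^ s) μ := fun s =>
    (hg.coe_nnreal_real.pow_const _).aestronglyMeasurable
  have hmem : ∀ ψ, MemLp (fun y => e ψ y * (g y : ℝ) ^ (-(1 / q))) (ENNReal.ofReal q) ν := by
    refine fun ψ => ⟨((he ψ).1.mul (hgr _)).mono_ac (withDensity_absolutelyContinuous _ _), ?_⟩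
    rw [hν, eLpNorm_mul_rpow_withDensity hpq.symm.pos hg hpos (he ψ).1]
    exact (he ψ).2
  let e' : V →ₗ[ℝ] Lp ℝ (ENNReal.ofReal q) ν :=
    { toFun := fun ψ => (hmem ψ).toLp _
      map_add' := fun ψ φ => by
        rw [← MemLp.toLp_add]
        exact MemLp.toLp_congr _ _ (ae_of_all _ fun y => by simp [add_mul])
      map_smul' := fun c ψ => by
        rw [RingHom.id_apply, ← MemLp.toLp_const_smul]
        exact MemLp.toLp_congr _ _ (ae_of_all _ fun y => by simp [mul_assoc]) }
  obtain ⟨L, hL, hT⟩ := exists_functional_of_bound e' T hM fun ψ => by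
    change _ ≤ M * ‖(hmem ψ).toLp _‖
    rw [Lp.norm_toLp, hν, eLpNorm_mul_rpow_withDensity hpq.symm.pos hg hpos (he ψ).1]
    exact h ψ
  obtain ⟨F, hFm, hF, hFn, hFi⟩ := exists_memLp_of_Lp_functional hpq L hL
  have hmeas : AEStronglyMeasurable (fun y => F y * (g y : ℝ) ^ (1 / p)) μ :=
    hFm.aestronglyMeasurable.mul (hgr _)
  have hnorm : eLpNorm (fun y => F y * (g y : ℝ) ^ (1 / p)) (ENNReal.ofReal p) μ
      = eLpNorm F (ENNReal.ofReal p) ν := by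
    rw [← eLpNorm_mul_rpow_withDensity hpq.pos hg hpos hmeas]
    congr 1
    funext y
    have hy : (0 : ℝ) < g y := hpos y
    rw [mul_assoc, ← Real.rpow_add hy, add_neg_cancel, Real.rpow_zero, mul_one]
  refine ⟨_, ⟨hmeas, ?_⟩, hnorm.trans_le hFn, fun ψ => ?_⟩
  · rw [hnorm]
    exact hF.2
  · rw [hT ψ]
    change L ((hmem ψ).toLp _) = _
    rw [hFi, hν, integral_withDensity_eq_integral_smul hg]
    refine integral_congr_ae (ae_of_all _ fun y => ?_)
    have hy : (0 : ℝ) < g y := hpos y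
    have e2 : (g y : ℝ) * (g y : ℝ) ^ (-(1 / q)) = (g y : ℝ) ^ (1 / p) := by
      nth_rewrite 1 [← Real.rpow_one (g y : ℝ)]
      rw [← Real.rpow_add hy]
      congr 1
      have := hpq.inv_add_inv_eq_one
      rw [one_div, one_div]
      linarith
    change (g y : ℝ) * (F y * (e ψ y * (g y : ℝ) ^ (-(1 / q)))) = F y * (g y : ℝ) ^ (1 / p) * e ψ y
    rw [← e2]
    ring

end Representation

/-- Real and imaginary parts of `T` are represented separately, each with constant 2M. This is how a
conormal derivative bounded by L^q norms of test functions is seen to be a function in L^p. -/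
theorem exists_funDistr_of_bound {n : ℕ} {p q : ℝ} (hpq : p.HolderConjugate q)
    (T : 𝓓'((⊤ : TopologicalSpace.Opens (Bdry n)), ℂ)) {M : ℝ} (hM : 0 ≤ M)
    (h : ∀ ψ : 𝓓((⊤ : TopologicalSpace.Opens (Bdry n)), ℝ),
      ‖T ψ‖ ≤ M * (eLpNorm ψ (ENNReal.ofReal q) volume).toReal) :
    ∃ F : Bdry n → ℂ, MemLp F (ENNReal.ofReal p) volume ∧
      eLpNorm F (ENNReal.ofReal p) volume ≤ ENNReal.ofReal (4 * M) ∧ T = funDistr ⊤ F := by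
  have h1p : 1 ≤ ENNReal.ofReal p := by
    rw [← ENNReal.ofReal_one]; exact ENNReal.ofReal_le_ofReal hpq.lt.le
  haveI := holderConjugate_ofReal hpq
  let e : 𝓓((⊤ : TopologicalSpace.Opens (Bdry n)), ℝ) →ₗ[ℝ] (Bdry n → ℝ) :=
    { toFun := fun ψ => ψ, map_add' := fun _ _ => rfl, map_smul' := fun _ _ => rfl }
  have he : ∀ ψ, MemLp (e ψ) (ENNReal.ofReal q) volume := fun ψ =>
    ψ.contDiff.continuous.memLp_of_hasCompactSupport ψ.hasCompactSupport
  obtain ⟨F₁, hF₁, hn₁, hT₁⟩ := exists_memLp_of_functional_bound hpq e he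
    { toFun := fun ψ => (T ψ).re
      map_add' := fun φ ψ => by rw [map_add, Complex.add_re]
      map_smul' := fun c ψ => by
        rw [map_smul, Complex.smul_re, RingHom.id_apply] } hM
    fun ψ => (Complex.abs_re_le_norm _).trans (h ψ)
  obtain ⟨F₂, hF₂, hn₂, hT₂⟩ := exists_memLp_of_functional_bound hpq e he
    { toFun := fun ψ => (T ψ).im
      map_add' := fun φ ψ => by rw [map_add, Complex.add_im]
      map_smul' := fun c ψ => by
        rw [map_smul, Complex.smul_im, RingHom.id_apply] } hM
    fun ψ => (Complex.abs_im_le_norm _).trans (h ψ)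
  have m₁ : MemLp (fun x => (F₁ x : ℂ)) (ENNReal.ofReal p) volume := hF₁.ofReal
  have m₂ : MemLp (fun x => (F₂ x : ℂ) * Complex.I) (ENNReal.ofReal p) volume :=
    MemLp.mul_const hF₂.ofReal Complex.I
  have hF : MemLp (fun x => (F₁ x : ℂ) + (F₂ x : ℂ) * Complex.I) (ENNReal.ofReal p) volume :=
    m₁.add m₂
  refine ⟨_, hF, ?_, ?_⟩
  · refine (eLpNorm_add_le m₁.1 m₂.1 h1p).trans ?_
    have e1 : eLpNorm (fun x => (F₁ x : ℂ)) (ENNReal.ofReal p) volume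
        = eLpNorm F₁ (ENNReal.ofReal p) volume :=
      eLpNorm_congr_norm_ae (ae_of_all _ fun y => Complex.norm_real _)
    have e2 : eLpNorm (fun x => (F₂ x : ℂ) * Complex.I) (ENNReal.ofReal p) volume
        = eLpNorm F₂ (ENNReal.ofReal p) volume :=
      eLpNorm_congr_norm_ae (ae_of_all _ fun y => by
        rw [norm_mul, Complex.norm_I, mul_one, Complex.norm_real])
    refine (add_le_add (e1.trans_le hn₁) (e2.trans_le hn₂)).trans ?_
    rw [← ENNReal.ofReal_add (by positivity) (by positivity)]
    exact ENNReal.ofReal_le_ofReal (by linarith)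
  · ext ψ
    rw [funDistr_apply ((hF.locallyIntegrable h1p).locallyIntegrableOn _)]
    have hr : (T ψ).re = ∫ y, F₁ y * ψ y := hT₁ ψ
    have hi : (T ψ).im = ∫ y, F₂ y * ψ y := hT₂ ψ
    have i1 : Integrable (fun y => ((F₁ y * ψ y : ℝ) : ℂ)) volume := by
      exact (integrable_mul_of_memLp (p := ENNReal.ofReal p) (q := ENNReal.ofReal q) hF₁.ofReal
        (he ψ).ofReal).congr (ae_of_all _ fun y => (Complex.ofReal_mul (F₁ y) (ψ y)).symm)
    have i2 : Integrable (fun y => ((F₂ y * ψ y : ℝ) : ℂ)) volume := by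
      exact (integrable_mul_of_memLp (p := ENNReal.ofReal p) (q := ENNReal.ofReal q) hF₂.ofReal
        (he ψ).ofReal).congr (ae_of_all _ fun y => (Complex.ofReal_mul (F₂ y) (ψ y)).symm)
    rw [← Complex.re_add_im (T ψ), hr, hi, ← integral_complex_ofReal, ← integral_complex_ofReal,
      ← integral_mul_const, ← integral_add i1 (i2.mul_const _)]
    refine integral_congr_ae (ae_of_all _ fun y => ?_)
    push_cast
    ring

/-! ### Components of energy functions -/

section Components

variable {n m : ℕ}

theorem locallyIntegrableOn_of_memLp_compact {X : Type} [NormedAddCommGroup X] [MeasureSpace X]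
    [LocallyCompactSpace X] [OpensMeasurableSpace X]
    [IsLocallyFiniteMeasure (volume : Measure X)] {Ω : Set X} (hΩ : IsOpen Ω) {f : X → ℂ}
    (h : ∀ K : Set X, IsCompact K → K ⊆ Ω → MemLp f 2 (volume.restrict K)) :
    LocallyIntegrableOn f Ω volume := by
  rw [locallyIntegrableOn_iff hΩ.isLocallyClosed]
  intro K hKs hK
  haveI : IsFiniteMeasure (volume.restrict K) := ⟨by
    rw [Measure.restrict_apply_univ]; exact hK.measure_lt_top⟩
  exact (h K hK hKs).integrable (by norm_num)

theorem measurableSet_half : MeasurableSet (half n : Set (Space n)) := (half n).isOpen.measurableSet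

theorem EnergyFunction.locallyIntegrableOn (u : EnergyFunction n m) (α : Fin m) :
    LocallyIntegrableOn (fun z => u.toFun z α) (half n) volume :=
  locallyIntegrableOn_of_memLp_compact (half n).isOpen fun K hK hKs =>
    (u.memLp_loc K hK hKs).eval_piLp α

theorem EnergyFunction.memLp_grad_apply (u : EnergyFunction n m) (q : Fin (n + 1) × Fin m) :
    MemLp (fun z => u.grad z q) 2 (volume.restrict (half n)) := u.memLp_grad.eval_piLp q

theorem locallyIntegrableOn_of_memLp {Ω : Set (Space n)} (hΩ : IsOpen Ω) {f : Space n → ℂ}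
    (h : MemLp f 2 (volume.restrict Ω)) : LocallyIntegrableOn f Ω volume :=
  locallyIntegrableOn_of_memLp_compact hΩ fun _ _ hKs =>
    h.mono_measure (Measure.restrict_mono hKs le_rfl)

theorem EnergyFunction.weakDeriv (u : EnergyFunction n m) (i : Fin (n + 1)) (α : Fin m) :
    WeakDeriv (half n : Set (Space n)) (dir i) (fun z => u.toFun z α)
      (fun z => u.grad z (i, α)) :=
  (lineDeriv_funDistr_eq_iff (u.locallyIntegrableOn α)
    (locallyIntegrableOn_of_memLp (half n).isOpen (u.memLp_grad_apply (i, α)))).1 (u.isGrad i α)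

/-- The energy function with given components. -/
def EnergyFunction.ofComponents (v : Fin m → Space n → ℂ)
    (g : Fin (n + 1) × Fin m → Space n → ℂ)
    (hv : ∀ (α : Fin m) (K : Set (Space n)), IsCompact K → K ⊆ half n →
      MemLp (v α) 2 (volume.restrict K))
    (hg : ∀ q, MemLp (g q) 2 (volume.restrict (half n)))
    (hw : ∀ i α, WeakDeriv (half n : Set (Space n)) (dir i) (v α) (g (i, α))) :
    EnergyFunction n m where
  toFun z := WithLp.toLp 2 fun α => v α z
  grad z := WithLp.toLp 2 fun q => g q z
  memLp_loc K hK hKs := MemLp.of_eval_piLp fun α => hv α K hK hKs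
  memLp_grad := MemLp.of_eval_piLp hg
  isGrad i α := (lineDeriv_funDistr_eq_iff
    (locallyIntegrableOn_of_memLp_compact (half n).isOpen (hv α))
    (locallyIntegrableOn_of_memLp (half n).isOpen (hg (i, α)))).2 (hw i α)

theorem WeakDeriv.conj {X : Type} [NormedAddCommGroup X] [NormedSpace ℝ X] [MeasureSpace X]
    {Ω : Set X} {v : X} {f g : X → ℂ} (h : WeakDeriv Ω v f g) :
    WeakDeriv Ω v (fun x => conj (f x)) (fun x => conj (g x)) := by
  intro θ hθ hθc hθs
  have := congrArg conj (h θ hθ hθc hθs)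
  rw [map_neg, ← integral_conj, ← integral_conj] at this
  simpa using this

theorem WeakDeriv.sub {X : Type} [NormedAddCommGroup X] [NormedSpace ℝ X] [MeasureSpace X]
    [OpensMeasurableSpace X] [FiniteDimensional ℝ X]
    {Ω : Set X} {v : X} {f g f' g' : X → ℂ}
    (hf : LocallyIntegrableOn f Ω volume) (hg : LocallyIntegrableOn g Ω volume)
    (hf' : LocallyIntegrableOn f' Ω volume) (hg' : LocallyIntegrableOn g' Ω volume)
    (h : WeakDeriv Ω v f g) (h' : WeakDeriv Ω v f' g') :
    WeakDeriv Ω v (fun x => f x - f' x) (fun x => g x - g' x) := by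
  intro θ hθ hθc hθs
  have key : ∀ {w : X → ℂ} {η : X → ℝ}, LocallyIntegrableOn w Ω volume → Continuous η →
      HasCompactSupport η → tsupport η ⊆ Ω → Integrable (fun x => (η x : ℂ) * w x) volume := by
    intro w η hw hη hηc hηs
    have h0 := (hw.integrableOn_compact_subset hηs hηc.isCompact).continuousOn_mul
      (Complex.continuous_ofReal.comp hη).continuousOn hηc.isCompact
    refine (integrableOn_iff_integrable_of_support_subset fun x hx => ?_).1 h0
    refine subset_tsupport η fun h => hx ?_
    simp [h]
  have hd : Continuous fun x => fderiv ℝ θ x v :=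
    (hθ.continuous_fderiv (by simp)).clm_apply continuous_const
  have hdc : HasCompactSupport fun x => fderiv ℝ θ x v := hθc.fderiv_apply (𝕜 := ℝ) v
  have hds : tsupport (fun x => fderiv ℝ θ x v) ⊆ Ω := (tsupport_fderiv_apply_subset ℝ v).trans hθs
  simp_rw [mul_sub]
  rw [integral_sub (key hg hθ.continuous hθc hθs) (key hg' hθ.continuous hθc hθs),
    integral_sub (key hf hd hdc hds) (key hf' hd hdc hds), h θ hθ hθc hθs, h' θ hθ hθc hθs]
  ring

theorem WeakDeriv.congr {X : Type} [NormedAddCommGroup X] [NormedSpace ℝ X] [MeasureSpace X]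
    {Ω : Set X} {v : X} {f g f' g' : X → ℂ} (h : WeakDeriv Ω v f g) (hf : ∀ x ∈ Ω, f x = f' x)
    (hg : ∀ x ∈ Ω, g x = g' x) : WeakDeriv Ω v f' g' := by
  intro θ hθ hθc hθs
  have e1 : ∀ x, (θ x : ℂ) * g x = (θ x : ℂ) * g' x := fun x => by
    by_cases hx : x ∈ Ω
    · rw [hg x hx]
    · rw [image_eq_zero_of_notMem_tsupport fun h => hx (hθs h)]
      simp
  have e2 : ∀ x, ((fderiv ℝ θ x v : ℝ) : ℂ) * f x = ((fderiv ℝ θ x v : ℝ) : ℂ) * f' x :=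
    fun x => by
    by_cases hx : x ∈ Ω
    · rw [hf x hx]
    · have h0 : fderiv ℝ θ x = 0 :=
        image_eq_zero_of_notMem_tsupport fun h => hx (hθs (tsupport_fderiv_subset ℝ h))
      simp [h0]
  have h1 := h θ hθ hθc hθs
  simp_rw [e1, e2] at h1
  exact h1

/-! ### Traces -/

theorem norm_le_sum_norm_apply {ι : Type} [Fintype ι] (x : EuclideanSpace ℂ ι) :
    ‖x‖ ≤ ∑ i, ‖x i‖ := by
  rw [EuclideanSpace.norm_eq]
  exact Real.sqrt_le_iff.2 ⟨Finset.sum_nonneg fun _ _ => norm_nonneg _,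
    Finset.sum_sq_le_sq_sum_of_nonneg fun _ _ => norm_nonneg _⟩

theorem EnergyFunction.aestronglyMeasurable (u : EnergyFunction n m) (α : Fin m) :
    AEStronglyMeasurable (fun z => u.toFun z α) (volume.restrict (half n)) :=
  (u.locallyIntegrableOn α).aestronglyMeasurable

theorem eventually_slice {v : Space n → ℂ}
    (hv : AEStronglyMeasurable v (volume.restrict (half n))) :
    ∀ᶠ t in 𝓝[>] (0 : ℝ) ⊓ ae volume, AEStronglyMeasurable (fun x => v (t, x)) volume := by
  rw [restrict_half] at hv
  have h := hv.prodMk_left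
  rw [ae_restrict_iff' measurableSet_Ioi] at h
  filter_upwards [mem_inf_of_left self_mem_nhdsWithin, mem_inf_of_right h] with t ht h
  exact h ht

theorem IsTrace.memLp {u : EnergyFunction n m} {f : Bdry n → EuclideanSpace ℂ (Fin m)}
    (h : IsTrace u f) (α : Fin m) {K : Set (Bdry n)} (hK : IsCompact K) :
    MemLp (fun x => f x α) 2 (volume.restrict K) := (h.1 K hK).eval_piLp α

theorem IsTrace.locallyIntegrable {u : EnergyFunction n m}
    {f : Bdry n → EuclideanSpace ℂ (Fin m)} (h : IsTrace u f) (α : Fin m) :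
    LocallyIntegrable (fun x => f x α) volume :=
  locallyIntegrableOn_univ.1 (locallyIntegrableOn_of_memLp_compact isOpen_univ
    fun _ hK _ => h.memLp α hK)

theorem IsTrace.tendsto {u : EnergyFunction n m} {f : Bdry n → EuclideanSpace ℂ (Fin m)}
    (h : IsTrace u f) (α : Fin m) {K : Set (Bdry n)} (hK : IsCompact K) :
    Tendsto (fun t : ℝ => eLpNorm (fun x => u.toFun (t, x) α - f x α) 2 (volume.restrict K))
      (𝓝[>] 0 ⊓ ae volume) (𝓝 0) :=
  tendsto_of_tendsto_of_tendsto_of_le_of_le tendsto_const_nhds (h.2 K hK) (fun _ => zero_le)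
    fun t => eLpNorm_mono fun x => PiLp.norm_apply_le (u.toFun (t, x) - f x) α

theorem isTrace_of_apply {u : EnergyFunction n m} {f : Bdry n → EuclideanSpace ℂ (Fin m)}
    (h1 : ∀ α (K : Set (Bdry n)), IsCompact K → MemLp (fun x => f x α) 2 (volume.restrict K))
    (h2 : ∀ α (K : Set (Bdry n)), IsCompact K →
      Tendsto (fun t : ℝ => eLpNorm (fun x => u.toFun (t, x) α - f x α) 2 (volume.restrict K))
        (𝓝[>] 0 ⊓ ae volume) (𝓝 0)) : IsTrace u f := by
  refine ⟨fun K hK => MemLp.of_eval_piLp fun α => h1 α K hK, fun K hK => ?_⟩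
  have h3 : Tendsto (fun t : ℝ => ∑ α, eLpNorm (fun x => u.toFun (t, x) α - f x α) 2
      (volume.restrict K)) (𝓝[>] 0 ⊓ ae volume) (𝓝 0) := by
    have := tendsto_finsetSum Finset.univ fun α _ => h2 α K hK
    simpa using this
  refine tendsto_of_tendsto_of_tendsto_of_le_of_le' tendsto_const_nhds h3
    (Eventually.of_forall fun _ => zero_le) ?_
  have hm := eventually_all.2 fun α => eventually_slice (u.aestronglyMeasurable α)
  filter_upwards [hm] with t ht
  have ht' : ∀ α, AEStronglyMeasurable (fun x => ‖u.toFun (t, x) α - f x α‖)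
      (volume.restrict K) := fun α => ((ht α).restrict.sub (h1 α K hK).1).norm
  calc eLpNorm (fun x => u.toFun (t, x) - f x) 2 (volume.restrict K)
      ≤ eLpNorm (∑ α, fun x => ‖u.toFun (t, x) α - f x α‖) 2 (volume.restrict K) := by
        refine eLpNorm_mono fun x => ?_
        rw [Finset.sum_apply, Real.norm_of_nonneg (Finset.sum_nonneg fun _ _ => norm_nonneg _)]
        exact norm_le_sum_norm_apply (u.toFun (t, x) - f x)
    _ ≤ ∑ α, eLpNorm (fun x => ‖u.toFun (t, x) α - f x α‖) 2 (volume.restrict K) :=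
        eLpNorm_sum_le (fun α _ => ht' α) (by norm_num)
    _ = _ := Finset.sum_congr rfl fun α _ => eLpNorm_norm _

theorem IsTrace.vanishesAtBdry_sub {u φ : EnergyFunction n m}
    {f : Bdry n → EuclideanSpace ℂ (Fin m)} (hu : IsTrace u f) (hφ : IsTrace φ f) (α : Fin m) :
    VanishesAtBdry ((half n : Set (Space n)).indicator
      fun z => conj (u.toFun z α - φ.toFun z α)) := by
  intro K hK
  have hc : (volume : Measure (Bdry n)).restrict K Set.univ ^ (1 / (1 : ℝ≥0∞).toReal
      - 1 / (2 : ℝ≥0∞).toReal) ≠ ⊤ := by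
    rw [Measure.restrict_apply_univ]
    exact ENNReal.rpow_ne_top_of_nonneg (by norm_num) hK.measure_lt_top.ne
  have h3 := ENNReal.Tendsto.mul_const ((hu.tendsto α hK).add (hφ.tendsto α hK)) (Or.inr hc)
  rw [add_zero, zero_mul] at h3
  refine tendsto_of_tendsto_of_tendsto_of_le_of_le' tendsto_const_nhds h3
    (Eventually.of_forall fun _ => zero_le) ?_
  filter_upwards [mem_inf_of_left self_mem_nhdsWithin, eventually_slice (u.aestronglyMeasurable α),
    eventually_slice (φ.aestronglyMeasurable α)] with t ht h1 h2
  have hf := (hu.memLp α hK).1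
  have e : ∀ x, ‖(half n : Set (Space n)).indicator
      (fun z => conj (u.toFun z α - φ.toFun z α)) (t, x)‖
        = ‖(u.toFun (t, x) α - f x α) - (φ.toFun (t, x) α - f x α)‖ := fun x => by
    rw [Set.indicator_of_mem (show (t, x) ∈ (half n : Set (Space n)) from ht), RCLike.norm_conj]
    congr 1
    ring
  rw [eLpNorm_congr_norm_ae (ae_of_all _ e)]
  refine (eLpNorm_le_eLpNorm_mul_rpow_measure_univ (by norm_num : (1 : ℝ≥0∞) ≤ 2)
    ((h1.restrict.sub hf).sub (h2.restrict.sub hf))).trans ?_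
  gcongr
  exact eLpNorm_sub_le (h1.restrict.sub hf) (h2.restrict.sub hf) (by norm_num)

/-! ### The form and the equation -/

variable {A : Coeff n m}

theorem IsBoundedMeasurable.memLp_flux (hA : IsBoundedMeasurable A) (u : EnergyFunction n m)
    (q : Fin (n + 1) × Fin m) :
    MemLp (fun z => flux A u z q) 2 (volume.restrict (half n)) := by
  obtain ⟨M, hM⟩ := hA.bounded
  have h : ∀ r, MemLp (fun z => A z q r * u.grad z r) 2 (volume.restrict (half n)) := fun r =>
    MemLp.of_le_mul (c := M) (u.memLp_grad_apply r)
      ((hA.measurable q r).mul (u.memLp_grad_apply r).1) (by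
        filter_upwards [hM] with z hz
        rw [norm_mul]
        exact mul_le_mul_of_nonneg_right (hz q r) (norm_nonneg _))
  exact memLp_finsetSum Finset.univ fun r _ => h r

theorem IsBoundedMeasurable.adjointCoeff (hA : IsBoundedMeasurable A) :
    IsBoundedMeasurable (adjointCoeff A) where
  measurable p q := Complex.continuous_conj.comp_aestronglyMeasurable (hA.measurable q p)
  bounded := by
    obtain ⟨M, hM⟩ := hA.bounded
    refine ⟨M, ?_⟩
    filter_upwards [hM] with z hz p q
    exact (RCLike.norm_conj (A z q p)).trans_le (hz q p)

theorem memLp_conj {Y : Type} [MeasurableSpace Y] {μ : Measure Y} {p : ℝ≥0∞} {f : Y → ℂ}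
    (hf : MemLp f p μ) : MemLp (fun y => conj (f y)) p μ :=
  MemLp.of_le hf (Complex.continuous_conj.comp_aestronglyMeasurable hf.1)
    (ae_of_all _ fun y => (RCLike.norm_conj (f y)).le)

theorem energyForm_eq_sum (hA : IsBoundedMeasurable A) (u φ : EnergyFunction n m) :
    energyForm A u φ = ∑ q, ∫ z in half n, flux A u z q * conj (φ.grad z q) := by
  rw [← integral_finsetSum]
  · rfl
  · intro q _
    exact integrable_mul_of_memLp (p := 2) (q := 2) (hA.memLp_flux u q)
      (memLp_conj (φ.memLp_grad_apply q))

theorem energyForm_adjointCoeff (A : Coeff n m) (u φ : EnergyFunction n m) :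
    energyForm (adjointCoeff A) u φ = conj (energyForm A φ u) := by
  rw [energyForm, energyForm, ← integral_conj]
  refine integral_congr_ae (ae_of_all _ fun z => ?_)
  change ((A z)ᴴ *ᵥ (u.grad z).ofLp) ⬝ᵥ star (φ.grad z).ofLp
    = star ((A z *ᵥ (φ.grad z).ofLp) ⬝ᵥ star (u.grad z).ofLp)
  rw [← Matrix.star_dotProduct_star, star_star, Matrix.star_mulVec, dotProduct_comm,
    Matrix.dotProduct_mulVec, dotProduct_comm]

theorem isSolution_iff (hA : IsBoundedMeasurable A) (u : EnergyFunction n m) :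
    IsSolution A u ↔ ∀ α : Fin m, Solenoidal fun i =>
      (half n : Set (Space n)).indicator fun z => flux A u z (i, α) := by
  refine forall_congr' fun α => ?_
  have hl : ∀ i, LocallyIntegrableOn (fun z => flux A u z (i, α)) (half n) volume := fun i =>
    locallyIntegrableOn_of_memLp (half n).isOpen (hA.memLp_flux u (i, α))
  have key : ∀ ψ : 𝓓(half n, ℝ),
      (∑ i : Fin (n + 1), ∂_{dir i} (funDistr (half n) fun z => flux A u z (i, α))) ψ
        = - ∑ i, ∫ z, (half n : Set (Space n)).indicator (fun z => flux A u z (i, α)) z *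
            ((fderiv ℝ ψ z (dir i) : ℝ) : ℂ) := by
    intro ψ
    have hs : ∀ (s : Finset (Fin (n + 1))) (D : Fin (n + 1) → 𝓓'(half n, ℂ)),
        (∑ i ∈ s, D i) ψ = ∑ i ∈ s, D i ψ := by
      intro s D
      induction s using Finset.induction_on with
      | empty => simp
      | insert a s ha ih => rw [Finset.sum_insert ha, Finset.sum_insert ha, _root_.add_apply, ih]
    rw [hs, ← Finset.sum_neg_distrib]
    refine Finset.sum_congr rfl fun i _ => ?_
    rw [Distribution.lineDerivOp_apply_apply, map_neg, funDistr_apply (hl i)]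
    congr 1
    refine integral_congr_ae (ae_of_all _ fun z => ?_)
    change ((fderiv ℝ ψ z (dir i) : ℝ) : ℂ) * _ = _
    by_cases hz : z ∈ (half n : Set (Space n))
    · simp only [Set.indicator_of_mem hz]
      ring
    · have h0 : fderiv ℝ ψ z = 0 := by
        refine image_eq_zero_of_notMem_tsupport fun h => hz ?_
        exact ψ.tsupport_subset (tsupport_fderiv_subset ℝ h)
      simp [h0]
  constructor
  · intro h θ hθ hθc hθs
    have h1 := key ⟨θ, hθ, hθc, hθs⟩
    rw [h] at h1
    exact neg_eq_zero.1 h1.symm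
  · intro h
    ext ψ
    rw [key, h ψ ψ.contDiff ψ.hasCompactSupport ψ.tsupport_subset, neg_zero]
    rfl

/-- The flux of a solution is solenoidal, and the difference of the two functions has trace zero, so
its gradient is orthogonal to the flux. Conjugates appear because the orthogonality relation is
bilinear. -/
theorem energyForm_eq_of_trace_eq (hA : IsBoundedMeasurable A) {u φ φ' : EnergyFunction n m}
    (hu : IsSolution A u) {f : Bdry n → EuclideanSpace ℂ (Fin m)} (hφ : IsTrace φ f)
    (hφ' : IsTrace φ' f) : energyForm A u φ = energyForm A u φ' := by
  rw [← sub_eq_zero, energyForm_eq_sum hA, energyForm_eq_sum hA, ← Finset.sum_sub_distrib,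
    Fintype.sum_prod_type_right]
  refine Finset.sum_eq_zero fun α _ => ?_
  have hl := φ.locallyIntegrableOn α
  have hl' := φ'.locallyIntegrableOn α
  have hg := fun i => φ.memLp_grad_apply (i, α)
  have hg' := fun i => φ'.memLp_grad_apply (i, α)
  have ho := (half n).isOpen
  have key := Solenoidal.orthogonal
    (g := fun i => (half n : Set (Space n)).indicator
      fun z => conj (φ.grad z (i, α) - φ'.grad z (i, α)))
    ((isSolution_iff hA u).1 hu α)
    (fun i => (memLp_indicator_iff_restrict measurableSet_half).2 (hA.memLp_flux u (i, α)))
    (fun i => (memLp_indicator_iff_restrict measurableSet_half).2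
      (memLp_conj ((hg i).sub (hg' i))))
    (fun i z hz => Set.indicator_of_notMem hz _) (hφ.vanishesAtBdry_sub hφ' α)
    ((aestronglyMeasurable_indicator_iff measurableSet_half).2
      (Complex.continuous_conj.comp_aestronglyMeasurable
        ((φ.aestronglyMeasurable α).sub (φ'.aestronglyMeasurable α))))
    (fun z hz => Set.indicator_of_notMem hz _) ?_ ?_
  · rw [← key]
    refine Finset.sum_congr rfl fun i _ => ?_
    rw [← integral_sub]
    · rw [← integral_indicator measurableSet_half]
      refine integral_congr_ae (ae_of_all _ fun z => ?_)
      by_cases hz : z ∈ (half n : Set (Space n))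
      · simp only [Set.indicator_of_mem hz, map_sub]
        ring
      · simp only [Set.indicator_of_notMem hz, mul_zero]
    · exact integrable_mul_of_memLp (p := 2) (q := 2) (hA.memLp_flux u (i, α)) (memLp_conj (hg i))
    · exact integrable_mul_of_memLp (p := 2) (q := 2) (hA.memLp_flux u (i, α)) (memLp_conj (hg' i))
  · refine (locallyIntegrableOn_iff (half n).isOpen.isLocallyClosed).2 fun K hKs hK => ?_
    have h0 : IntegrableOn (fun z => φ.toFun z α - φ'.toFun z α) K volume :=
      (hl.integrableOn_compact_subset hKs hK).sub (hl'.integrableOn_compact_subset hKs hK)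
    exact ((LinearIsometryEquiv.integrable_comp_iff Complex.conjLIE).2 h0).congr
      ((ae_restrict_iff' hK.measurableSet).2 (ae_of_all _ fun z hz => by
        rw [Set.indicator_of_mem (hKs hz)]
        rfl))
  · intro i
    refine (WeakDeriv.sub hl (locallyIntegrableOn_of_memLp ho (hg i)) hl'
      (locallyIntegrableOn_of_memLp ho (hg' i)) (φ.weakDeriv i α)
      (φ'.weakDeriv i α)).conj.congr ?_ ?_
    · intro z hz
      rw [Set.indicator_of_mem hz]
    · intro z hz
      rw [Set.indicator_of_mem hz]

end Components

/-! ### Smooth energy functions -/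

section Smooth

variable {X : Type} [NormedAddCommGroup X] [NormedSpace ℝ X] [MeasureSpace X] [BorelSpace X]
  [FiniteDimensional ℝ X] [(volume : Measure X).IsAddHaarMeasure]

theorem fderiv_ofReal_comp {θ : X → ℝ} {x : X} (h : DifferentiableAt ℝ θ x) (v : X) :
    fderiv ℝ (fun x => (θ x : ℂ)) x v = ((fderiv ℝ θ x v : ℝ) : ℂ) := by
  have := (Complex.ofRealCLM.hasFDerivAt.comp x h.hasFDerivAt).fderiv
  exact congrArg (fun L : X →L[ℝ] ℂ => L v) this

theorem integrable_mul_of_locallyIntegrableOn {Ω : Set X} {w : X → ℂ} {η : X → ℝ}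
    (hw : LocallyIntegrableOn w Ω volume) (hη : Continuous η)
    (hηc : HasCompactSupport η) (hηs : tsupport η ⊆ Ω) :
    Integrable (fun x => (η x : ℂ) * w x) volume := by
  have h0 := (hw.integrableOn_compact_subset hηs hηc.isCompact).continuousOn_mul
    (Complex.continuous_ofReal.comp hη).continuousOn hηc.isCompact
  refine (integrableOn_iff_integrable_of_support_subset fun x hx => ?_).1 h0
  refine subset_tsupport η fun h => hx ?_
  simp [h]

theorem WeakDeriv.mono {Ω Ω' : Set X} (h : Ω' ⊆ Ω) {v : X} {f g : X → ℂ} (hw : WeakDeriv Ω v f g) :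
    WeakDeriv Ω' v f g := fun θ hθ hθc hθs => hw θ hθ hθc (hθs.trans h)

theorem weakDeriv_of_contDiff {f : X → ℂ} (hf : ContDiff ℝ 1 f) (v : X) :
    WeakDeriv Set.univ v f (fun x => fderiv ℝ f x v) := by
  intro θ hθ hθc _
  have hθ1 : ContDiff ℝ 1 θ := hθ.of_le (by exact_mod_cast le_top)
  have hd : ∀ x, DifferentiableAt ℝ θ x := fun x => hθ1.differentiable (by simp) x
  have hc : Continuous fun x => fderiv ℝ θ x v :=
    (hθ.continuous_fderiv (by simp)).clm_apply continuous_const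
  have hcf : Continuous fun x => fderiv ℝ f x v :=
    (hf.continuous_fderiv (by simp)).clm_apply continuous_const
  have hl : ∀ {w : X → ℂ}, Continuous w → LocallyIntegrableOn w Set.univ volume := fun hw =>
    hw.locallyIntegrable.locallyIntegrableOn _
  have e : ∀ x, fderiv ℝ (fun x => (θ x : ℂ)) x v = ((fderiv ℝ θ x v : ℝ) : ℂ) := fun x =>
    fderiv_ofReal_comp (hd x) v
  have := integral_mul_fderiv_eq_neg_fderiv_mul_of_integrable (μ := (volume : Measure X))
    (f := fun x => (θ x : ℂ)) (g := f) (v := v) ?_ ?_ ?_ ?_ ?_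
  · simpa only [e] using this
  · simp only [e]
    exact integrable_mul_of_locallyIntegrableOn (hl hf.continuous) hc (hθc.fderiv_apply (𝕜 := ℝ) v)
      (Set.subset_univ _)
  · exact integrable_mul_of_locallyIntegrableOn (hl hcf) hθ.continuous hθc (Set.subset_univ _)
  · exact integrable_mul_of_locallyIntegrableOn (hl hf.continuous) hθ.continuous hθc
      (Set.subset_univ _)
  · exact fun x _ => Complex.ofRealCLM.differentiableAt.comp x (hd x)
  · exact fun x _ => hf.differentiable (by simp) x

theorem WeakDeriv.smooth_mul {Ω : Set X} {v : X} {f g : X → ℂ} {ζ : X → ℝ}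
    (hζ : ContDiff ℝ ((⊤ : ℕ∞) : WithTop ℕ∞) ζ) (hf : LocallyIntegrableOn f Ω volume)
    (hg : LocallyIntegrableOn g Ω volume) (h : WeakDeriv Ω v f g) :
    WeakDeriv Ω v (fun x => (ζ x : ℂ) * f x)
      (fun x => (ζ x : ℂ) * g x + ((fderiv ℝ ζ x v : ℝ) : ℂ) * f x) := by
  intro θ hθ hθc hθs
  have hc : ∀ {η : X → ℝ}, ContDiff ℝ ((⊤ : ℕ∞) : WithTop ℕ∞) η →
      Continuous fun x => fderiv ℝ η x v := fun hη =>
    (hη.continuous_fderiv (by simp)).clm_apply continuous_const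
  have h1 := h (fun x => θ x * ζ x) (hθ.mul hζ) hθc.mul_right
    ((closure_mono (Function.support_mul_subset_left _ _)).trans hθs)
  have e : ∀ x, fderiv ℝ (fun x => θ x * ζ x) x v
      = θ x * fderiv ℝ ζ x v + ζ x * fderiv ℝ θ x v := fun x => by
    rw [fderiv_fun_mul (hθ.differentiable (by simp) x) (hζ.differentiable (by simp) x)]
    simp
  have hs1 : tsupport (fun x => θ x * fderiv ℝ ζ x v) ⊆ Ω :=
    (closure_mono (Function.support_mul_subset_left _ _)).trans hθs
  have hs2 : tsupport (fun x => ζ x * fderiv ℝ θ x v) ⊆ Ω :=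
    (closure_mono (Function.support_mul_subset_right _ _)).trans
      ((tsupport_fderiv_apply_subset ℝ v).trans hθs)
  have hs3 : tsupport (fun x => θ x * ζ x) ⊆ Ω :=
    (closure_mono (Function.support_mul_subset_left _ _)).trans hθs
  have hdc : HasCompactSupport fun x => fderiv ℝ θ x v := hθc.fderiv_apply (𝕜 := ℝ) v
  have i1 : Integrable (fun x => ((θ x * fderiv ℝ ζ x v : ℝ) : ℂ) * f x) volume :=
    integrable_mul_of_locallyIntegrableOn hf (hθ.continuous.mul (hc hζ))
    hθc.mul_right hs1
  have i2 : Integrable (fun x => ((ζ x * fderiv ℝ θ x v : ℝ) : ℂ) * f x) volume :=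
    integrable_mul_of_locallyIntegrableOn hf (hζ.continuous.mul (hc hθ))
    hdc.mul_left hs2
  have i3 : Integrable (fun x => ((θ x * ζ x : ℝ) : ℂ) * g x) volume :=
    integrable_mul_of_locallyIntegrableOn hg (hθ.continuous.mul hζ.continuous)
    hθc.mul_right hs3
  have e1 : ∫ x, (θ x : ℂ) * ((ζ x : ℂ) * g x + ((fderiv ℝ ζ x v : ℝ) : ℂ) * f x)
      = (∫ x, ((θ x * ζ x : ℝ) : ℂ) * g x) + ∫ x, ((θ x * fderiv ℝ ζ x v : ℝ) : ℂ) * f x := by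
    rw [← integral_add i3 i1]
    refine integral_congr_ae (ae_of_all _ fun x => ?_)
    push_cast
    ring
  have e2 : ∫ x, ((fderiv ℝ (fun x => θ x * ζ x) x v : ℝ) : ℂ) * f x
      = (∫ x, ((θ x * fderiv ℝ ζ x v : ℝ) : ℂ) * f x)
        + ∫ x, ((ζ x * fderiv ℝ θ x v : ℝ) : ℂ) * f x := by
    rw [← integral_add i1 i2]
    refine integral_congr_ae (ae_of_all _ fun x => ?_)
    simp only [e]
    push_cast
    ring
  have e3 : ∫ x, ((fderiv ℝ θ x v : ℝ) : ℂ) * ((ζ x : ℂ) * f x)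
      = ∫ x, ((ζ x * fderiv ℝ θ x v : ℝ) : ℂ) * f x := by
    refine integral_congr_ae (ae_of_all _ fun x => ?_)
    push_cast
    ring
  rw [e1, h1, e2, e3]
  ring

variable {n m : ℕ}

/-- The energy function of a tuple of smooth compactly supported functions. -/
def EnergyFunction.ofSmooth (Φ : Fin m → Space n → ℂ)
    (hΦ : ∀ α, ContDiff ℝ ((⊤ : ℕ∞) : WithTop ℕ∞) (Φ α)) (hc : ∀ α, HasCompactSupport (Φ α)) :
    EnergyFunction n m :=
  EnergyFunction.ofComponents Φ (fun q z => fderiv ℝ (Φ q.2) z (dir q.1))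
    (fun α _ _ _ => ((hΦ α).continuous.memLp_of_hasCompactSupport (hc α)).restrict _)
    (fun q => by
      have h1 : Continuous fun z => fderiv ℝ (Φ q.2) z (dir q.1) :=
        ((hΦ q.2).continuous_fderiv (by simp)).clm_apply continuous_const
      have h2 : HasCompactSupport fun z => fderiv ℝ (Φ q.2) z (dir q.1) :=
        (hc q.2).fderiv_apply (𝕜 := ℝ) _
      exact (h1.memLp_of_hasCompactSupport h2).restrict _)
    (fun i α => (weakDeriv_of_contDiff ((hΦ α).of_le (by exact_mod_cast le_top)) _).mono
      (Set.subset_univ _))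

/-- A smooth function of `t` with compact support that is `1` on `[-1, 1]`. -/
def timeCutoff : ℝ → ℝ := (exists_unit_cutoff ℝ).choose

theorem contDiff_timeCutoff : ContDiff ℝ ((⊤ : ℕ∞) : WithTop ℕ∞) timeCutoff :=
  (exists_unit_cutoff ℝ).choose_spec.1

theorem hasCompactSupport_timeCutoff : HasCompactSupport timeCutoff :=
  (exists_unit_cutoff ℝ).choose_spec.2.1

theorem timeCutoff_eq_one {t : ℝ} (h : |t| ≤ 1) : timeCutoff t = 1 :=
  (exists_unit_cutoff ℝ).choose_spec.2.2.2.1 t h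

/-- The extension `(t, x) ↦ χ(t) ψ(x)` of a function on the boundary. -/
def timeExt (ψ : Bdry n → ℂ) (z : Space n) : ℂ := (timeCutoff z.1 : ℂ) * ψ z.2

theorem contDiff_timeExt {ψ : Bdry n → ℂ} (hψ : ContDiff ℝ ((⊤ : ℕ∞) : WithTop ℕ∞) ψ) :
    ContDiff ℝ ((⊤ : ℕ∞) : WithTop ℕ∞) (timeExt ψ) :=
  (Complex.ofRealCLM.contDiff.comp (contDiff_timeCutoff.comp contDiff_fst)).mul
    (hψ.comp contDiff_snd)

theorem hasCompactSupport_mul_prod {η : ℝ → ℝ} (hη : HasCompactSupport η) {ψ : Bdry n → ℂ}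
    (hψ : HasCompactSupport ψ) :
    HasCompactSupport fun z : Space n => (η z.1 : ℂ) * ψ z.2 := by
  refine HasCompactSupport.intro (hη.isCompact.prod hψ.isCompact) fun z hz => ?_
  rw [Set.mem_prod, not_and_or] at hz
  rcases hz with hz | hz <;> simp [image_eq_zero_of_notMem_tsupport hz]

theorem hasCompactSupport_timeExt {ψ : Bdry n → ℂ} (hψ : HasCompactSupport ψ) :
    HasCompactSupport (timeExt ψ) :=
  hasCompactSupport_mul_prod hasCompactSupport_timeCutoff hψ

theorem fderiv_timeExt_zero {ψ : Bdry n → ℂ} (hψ : ContDiff ℝ ((⊤ : ℕ∞) : WithTop ℕ∞) ψ)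
    (z : Space n) :
    fderiv ℝ (timeExt ψ) z (dir 0) = ((deriv timeCutoff z.1 : ℝ) : ℂ) * ψ z.2 := by
  have h1 : HasFDerivAt (fun z : Space n => (timeCutoff z.1 : ℂ)) _ z :=
    Complex.ofRealCLM.hasFDerivAt.comp z
      ((contDiff_timeCutoff.differentiable (by simp) z.1).hasFDerivAt.comp z hasFDerivAt_fst)
  have h2 : HasFDerivAt (fun z : Space n => ψ z.2) _ z :=
    (hψ.differentiable (by simp) z.2).hasFDerivAt.comp z hasFDerivAt_snd
  have h3 := (h1.mul h2).fderiv
  have h4 : fderiv ℝ (timeExt ψ) z = _ := h3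
  rw [h4, dir_zero]
  simp
  ring

theorem fderiv_timeExt_succ {ψ : Bdry n → ℂ} (hψ : ContDiff ℝ ((⊤ : ℕ∞) : WithTop ℕ∞) ψ)
    (z : Space n) (j : Fin n) :
    fderiv ℝ (timeExt ψ) z (dir j.succ)
      = (timeCutoff z.1 : ℂ) * fderiv ℝ ψ z.2 (EuclideanSpace.single j 1) := by
  have h1 : HasFDerivAt (fun z : Space n => (timeCutoff z.1 : ℂ)) _ z :=
    Complex.ofRealCLM.hasFDerivAt.comp z
      ((contDiff_timeCutoff.differentiable (by simp) z.1).hasFDerivAt.comp z hasFDerivAt_fst)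
  have h2 : HasFDerivAt (fun z : Space n => ψ z.2) _ z :=
    (hψ.differentiable (by simp) z.2).hasFDerivAt.comp z hasFDerivAt_snd
  have h3 := (h1.mul h2).fderiv
  have h4 : fderiv ℝ (timeExt ψ) z = _ := h3
  rw [h4, dir_succ]
  simp

theorem contDiff_test_apply {ι : Type} [Fintype ι] (Ψ : VecTest n ι) (α : ι) :
    ContDiff ℝ ((⊤ : ℕ∞) : WithTop ℕ∞) fun x => Ψ x α :=
  ((EuclideanSpace.proj α : _ →L[ℂ] ℂ).restrictScalars ℝ).contDiff.comp Ψ.contDiff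

theorem hasCompactSupport_test_apply {ι : Type} [Fintype ι] (Ψ : VecTest n ι) (α : ι) :
    HasCompactSupport fun x => Ψ x α :=
  Ψ.hasCompactSupport.comp_left (g := fun v : EuclideanSpace ℂ ι => v α) rfl

/-- An energy function with a given test function as its trace. -/
def testExt (Ψ : VecTest n (Fin m)) : EnergyFunction n m :=
  EnergyFunction.ofSmooth (fun α => timeExt fun x => Ψ x α)
    (fun α => contDiff_timeExt (contDiff_test_apply Ψ α))
    (fun α => hasCompactSupport_timeExt (hasCompactSupport_test_apply Ψ α))

theorem isTrace_testExt (Ψ : VecTest n (Fin m)) : IsTrace (testExt Ψ) Ψ := by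
  refine isTrace_of_apply (fun α K _ =>
    ((contDiff_test_apply Ψ α).continuous.memLp_of_hasCompactSupport
      (hasCompactSupport_test_apply Ψ α)).restrict K) fun α K _ => ?_
  refine tendsto_const_nhds.congr' ?_
  have h1 : ∀ᶠ t in 𝓝[>] (0 : ℝ), t < 1 :=
    (Iio_mem_nhds one_pos : Set.Iio (1 : ℝ) ∈ 𝓝 0) |> mem_nhdsWithin_of_mem_nhds
  filter_upwards [mem_inf_of_left self_mem_nhdsWithin, mem_inf_of_left h1] with t h0 h1
  have : ∀ x, (testExt Ψ).toFun (t, x) α - Ψ x α = 0 := fun x => by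
    change (timeCutoff t : ℂ) * Ψ x α - Ψ x α = 0
    rw [timeCutoff_eq_one (abs_le.2 ⟨by linarith [Set.mem_Ioi.1 h0], le_of_lt h1⟩)]
    simp
  simp [this]

end Smooth

/-! ### The sesquilinear pairing -/

section Pairing

variable {n m : ℕ}

theorem integral_re_sub_im {X : Type} [NormedAddCommGroup X] [NormedSpace ℝ X]
    [MeasureSpace X] [BorelSpace X] [FiniteDimensional ℝ X]
    [(volume : Measure X).IsAddHaarMeasure] {φ b : X → ℂ} (hφ : Continuous φ)
    (hφc : HasCompactSupport φ) (hb : LocallyIntegrable b volume) :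
    (∫ x, (((φ x).re : ℝ) : ℂ) * b x) - Complex.I * ∫ x, (((φ x).im : ℝ) : ℂ) * b x
      = ∫ x, conj (φ x) * b x := by
  have hr : Integrable (fun x => (((φ x).re : ℝ) : ℂ) * b x) volume :=
    integrable_mul_of_locallyIntegrableOn (hb.locallyIntegrableOn Set.univ)
      (Complex.continuous_re.comp hφ) (hφc.comp_left Complex.zero_re) (Set.subset_univ _)
  have hi : Integrable (fun x => (((φ x).im : ℝ) : ℂ) * b x) volume :=
    integrable_mul_of_locallyIntegrableOn (hb.locallyIntegrableOn Set.univ)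
      (Complex.continuous_im.comp hφ) (hφc.comp_left Complex.zero_im) (Set.subset_univ _)
  rw [← integral_const_mul, ← integral_sub hr (hi.const_mul _)]
  refine integral_congr_ae (ae_of_all _ fun x => ?_)
  have : conj (φ x) = ((φ x).re : ℂ) - Complex.I * ((φ x).im : ℂ) := by
    apply Complex.ext <;> simp
  simp only [this]
  ring

variable {ι : Type} [Fintype ι]

/-- The pairing with a distribution of order one given by locally integrable functions. -/
theorem pairing_eq_sum (T : VecDistr n ι) (h : ι → Bdry n → ℂ) (b : ι → Fin n → Bdry n → ℂ)
    (hh : ∀ a, LocallyIntegrable (h a) volume) (hb : ∀ a j, LocallyIntegrable (b a j) volume)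
    (hT : ∀ (a : ι) (ψ : 𝓓((⊤ : TopologicalSpace.Opens (Bdry n)), ℝ)), T a ψ
      = (∫ x, (ψ x : ℂ) * h a x)
        + ∑ j, ∫ x, ((fderiv ℝ ψ x (EuclideanSpace.single j 1) : ℝ) : ℂ) * b a j x)
    (Ψ : VecTest n ι) :
    pairing T Ψ = ∑ a, ((∫ x, conj (Ψ x a) * h a x)
      + ∑ j, ∫ x, conj (fderiv ℝ (fun x => Ψ x a) x (EuclideanSpace.single j 1)) * b a j x) := by
  refine Finset.sum_congr rfl fun a _ => ?_
  have hs := contDiff_test_apply Ψ a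
  have hc := hasCompactSupport_test_apply Ψ a
  have hd : ∀ x, DifferentiableAt ℝ (fun x => Ψ x a) x := hs.differentiable (by simp)
  rw [hT, hT, ← integral_re_sub_im hs.continuous hc (hh a), mul_add, Finset.mul_sum,
    add_sub_add_comm, ← Finset.sum_sub_distrib]
  congr 1
  refine Finset.sum_congr rfl fun j _ => ?_
  have hdc : Continuous fun x => fderiv ℝ (fun x => Ψ x a) x (EuclideanSpace.single j 1) :=
    (hs.continuous_fderiv (by simp)).clm_apply continuous_const
  rw [← integral_re_sub_im hdc (hc.fderiv_apply (𝕜 := ℝ) _) (hb a j)]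
  have e1 : ∀ x, ((fderiv ℝ (fun x => Ψ x a) x (EuclideanSpace.single j 1)).re : ℝ)
      = fderiv ℝ (fun x => (Ψ x a).re) x (EuclideanSpace.single j 1) := fun x =>
    (fderiv_re (hd x) _).symm
  have e2 : ∀ x, ((fderiv ℝ (fun x => Ψ x a) x (EuclideanSpace.single j 1)).im : ℝ)
      = fderiv ℝ (fun x => (Ψ x a).im) x (EuclideanSpace.single j 1) := fun x =>
    (fderiv_im (hd x) _).symm
  simp only [e1, e2]
  rfl

theorem pairing_funDistr (T : VecDistr n ι) (h : ι → Bdry n → ℂ)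
    (hh : ∀ a, LocallyIntegrable (h a) volume) (hT : ∀ a, T a = funDistr ⊤ (h a))
    (Ψ : VecTest n ι) : pairing T Ψ = ∑ a, ∫ x, conj (Ψ x a) * h a x := by
  rw [pairing_eq_sum T h (fun _ _ _ => 0) hh
    (fun _ _ => (integrable_zero _ _ _).locallyIntegrable) ?_ Ψ]
  · simp
  · intro a ψ
    rw [hT, funDistr_apply ((hh a).locallyIntegrableOn _)]
    simp

theorem tangGrad_apply {f : Bdry n → EuclideanSpace ℂ (Fin m)}
    (hf : ∀ α, LocallyIntegrable (fun x => f x α) volume) (q : Fin n × Fin m)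
    (ψ : 𝓓((⊤ : TopologicalSpace.Opens (Bdry n)), ℝ)) :
    tangGrad f q ψ = - ∫ x, ((fderiv ℝ ψ x (EuclideanSpace.single q.1 1) : ℝ) : ℂ) * f x q.2 := by
  rw [tangGrad, Distribution.lineDerivOp_apply_apply, map_neg,
    funDistr_apply ((hf q.2).locallyIntegrableOn _)]
  rfl

theorem pairing_tangGrad {f : Bdry n → EuclideanSpace ℂ (Fin m)}
    (hf : ∀ α, LocallyIntegrable (fun x => f x α) volume) (Ψ : VecTest n (Fin n × Fin m)) :
    pairing (tangGrad f) Ψ = - ∑ q : Fin n × Fin m,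
      ∫ x, conj (fderiv ℝ (fun x => Ψ x q) x (EuclideanSpace.single q.1 1)) * f x q.2 := by
  rw [pairing_eq_sum (tangGrad f) (fun _ _ => 0)
    (fun q j x => if j = q.1 then - f x q.2 else 0)
    (fun _ => (integrable_zero _ _ _).locallyIntegrable) (fun q j => ?_) (fun q ψ => ?_) Ψ,
    ← Finset.sum_neg_distrib]
  · refine Finset.sum_congr rfl fun q _ => ?_
    rw [Finset.sum_eq_single q.1]
    · simp [integral_neg]
    · intro j _ hj
      simp [hj]
    · simp
  · by_cases hj : j = q.1
    · simp only [hj, if_true]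
      exact (hf q.2).neg
    · simp only [hj, if_false]
      exact (integrable_zero _ _ _).locallyIntegrable
  · rw [tangGrad_apply hf, Finset.sum_eq_single q.1]
    · simp [integral_neg]
    · intro j _ hj
      simp [hj]
    · simp

/-! ### Existence of the conormal derivative -/

/-- `∫ η(t) F(t, x) dt`. -/
def sliceInt (η : ℝ → ℝ) (F : Space n → ℂ) (x : Bdry n) : ℂ := ∫ t, (η t : ℂ) * F (t, x)

theorem integrable_slice {η : ℝ → ℝ} (hη : Continuous η) (hηc : HasCompactSupport η)
    {F : Space n → ℂ} (hF : LocallyIntegrable F volume) {ψ : Bdry n → ℂ} (hψ : Continuous ψ)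
    (hψc : HasCompactSupport ψ) :
    Integrable (fun z : Space n => F z * ((η z.1 : ℂ) * ψ z.2)) volume :=
  integrable_mul_of_continuous hF
    ((Complex.continuous_ofReal.comp (hη.comp continuous_fst)).mul (hψ.comp continuous_snd))
    (hasCompactSupport_mul_prod hηc hψc)

theorem sliceInt_mul (η : ℝ → ℝ) (F : Space n → ℂ) (ψ : Bdry n → ℂ) (x : Bdry n) :
    sliceInt η F x * ψ x = ∫ t, F (t, x) * ((η t : ℂ) * ψ x) := by
  rw [sliceInt, ← integral_mul_const]
  refine integral_congr_ae (ae_of_all _ fun t => ?_)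
  ring

theorem integral_sliceInt {η : ℝ → ℝ} (hη : Continuous η) (hηc : HasCompactSupport η)
    {F : Space n → ℂ} (hF : LocallyIntegrable F volume) {ψ : Bdry n → ℂ} (hψ : Continuous ψ)
    (hψc : HasCompactSupport ψ) :
    ∫ z : Space n, F z * ((η z.1 : ℂ) * ψ z.2) = ∫ x, sliceInt η F x * ψ x := by
  simp_rw [sliceInt_mul]
  exact integral_prod_symm _ (integrable_slice hη hηc hF hψ hψc)

theorem locallyIntegrable_sliceInt {η : ℝ → ℝ} (hη : Continuous η) (hηc : HasCompactSupport η)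
    {F : Space n → ℂ} (hF : LocallyIntegrable F volume) :
    LocallyIntegrable (sliceInt η F) volume := by
  rw [locallyIntegrable_iff]
  intro K hK
  obtain ⟨R, hR, hKR⟩ := hK.isBounded.subset_ball_lt 0 0
  obtain ⟨_, _, _, h⟩ := exists_cutoff (Bdry n)
  obtain ⟨θ, hθ, hθc, -, h1, -⟩ := h R hR
  have := (integrable_slice hη hηc hF (Complex.continuous_ofReal.comp hθ.continuous)
    (hθc.comp_left Complex.ofReal_zero)).integral_prod_right
  refine (this.integrableOn (s := K)).congr ((ae_restrict_iff' hK.measurableSet).2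
    (ae_of_all _ fun x hx => ?_))
  have hx1 : θ x = 1 := h1 x (mem_ball_zero_iff.1 (hKR hx)).le
  refine (sliceInt_mul η F (Complex.ofReal ∘ θ) x).symm.trans ?_
  simp [hx1]

/-- The form depends only on the trace, so the energy function may be taken to be the explicit
extension χ(t)Ψ(x). Integrating out t leaves a distribution of order one in Ψ. -/
theorem exists_isConormalDerivative {A : Coeff n m} (hA : IsBoundedMeasurable A)
    {u : EnergyFunction n m} (hu : IsSolution A u) :
    ∃ T : VecDistr n (Fin m), IsConormalDerivative A u T := by
  let F : Fin (n + 1) × Fin m → Space n → ℂ := fun q =>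
    (half n : Set (Space n)).indicator fun z => flux A u z q
  have hF : ∀ q, LocallyIntegrable (F q) volume := fun q =>
    ((memLp_indicator_iff_restrict measurableSet_half).2 (hA.memLp_flux u q)).locallyIntegrable
      (by norm_num)
  have hχ := contDiff_timeCutoff.continuous
  have hχ' : Continuous (deriv timeCutoff) :=
    contDiff_timeCutoff.continuous_deriv (by simp)
  have hχc' : HasCompactSupport (deriv timeCutoff) := hasCompactSupport_timeCutoff.deriv
  have hχc := hasCompactSupport_timeCutoff
  have l0 := fun α => locallyIntegrable_sliceInt hχ' hχc' (hF (0, α))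
  have l1 := fun α (j : Fin n) => locallyIntegrable_sliceInt hχ hχc (hF (j.succ, α))
  -- The normal component of the flux meets χ'(t)Ψ(x) and the tangential ones meet χ(t)∂_jΨ(x); the
  -- signs come from integrating by parts and from the minus sign in the definition of the conormal
  -- derivative.
  let T : VecDistr n (Fin m) := fun α =>
    - funDistr ⊤ (sliceInt (deriv timeCutoff) (F (0, α)))
      + ∑ j : Fin n, ∂_{EuclideanSpace.single j (1 : ℝ)}
          (funDistr ⊤ (sliceInt timeCutoff (F (j.succ, α))))
  refine ⟨T, fun φ Ψ hφ => ?_⟩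
  rw [energyForm_eq_of_trace_eq hA hu hφ (isTrace_testExt Ψ), energyForm_eq_sum hA,
    pairing_eq_sum T (fun α x => - sliceInt (deriv timeCutoff) (F (0, α)) x)
      (fun α j x => - sliceInt timeCutoff (F (j.succ, α)) x) (fun α => (l0 α).neg)
      (fun α j => (l1 α j).neg) ?_ Ψ]
  · rw [Fintype.sum_prod_type_right, ← Finset.sum_neg_distrib]
    refine Finset.sum_congr rfl fun α _ => ?_
    have hs := contDiff_test_apply Ψ α
    have hc := hasCompactSupport_test_apply Ψ α
    rw [Fin.sum_univ_succ, neg_add, ← Finset.sum_neg_distrib]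
    have e : ∀ (q : Fin (n + 1) × Fin m) (η : ℝ → ℝ) (ψ : Bdry n → ℂ), Continuous η →
        HasCompactSupport η → Continuous ψ → HasCompactSupport ψ →
        (∀ z, (testExt Ψ).grad z q = (η z.1 : ℂ) * ψ z.2) →
        ∫ z in half n, flux A u z q * conj ((testExt Ψ).grad z q)
          = - ∫ x, conj (ψ x) * - sliceInt η (F q) x := by
      intro q η ψ hη hηc hψ hψc h
      have hψ' : Continuous fun x => conj (ψ x) := Complex.continuous_conj.comp hψ
      have hψc' : HasCompactSupport fun x => conj (ψ x) := hψc.comp_left (map_zero _)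
      rw [← integral_neg, ← integral_indicator measurableSet_half]
      trans ∫ z : Space n, F q z * ((η z.1 : ℂ) * conj (ψ z.2))
      · refine integral_congr_ae (ae_of_all _ fun z => ?_)
        by_cases hz : z ∈ (half n : Set (Space n))
        · simp only [F, Set.indicator_of_mem hz, h, map_mul, Complex.conj_ofReal]
        · simp only [F, Set.indicator_of_notMem hz, zero_mul]
      · rw [integral_sliceInt hη hηc (hF q) hψ' hψc']
        refine integral_congr_ae (ae_of_all _ fun x => ?_)
        ring
    congr 1
    · exact e (0, α) (deriv timeCutoff) (fun x => Ψ x α) hχ' hχc' hs.continuous hc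
        fun z => fderiv_timeExt_zero hs z
    · refine Finset.sum_congr rfl fun j _ => ?_
      exact e (j.succ, α) timeCutoff _ hχ hχc
        ((hs.continuous_fderiv (by simp)).clm_apply continuous_const)
        (hc.fderiv_apply (𝕜 := ℝ) _) fun z => fderiv_timeExt_succ hs z j
  · intro α ψ
    have hsum : ∀ (s : Finset (Fin n)) (D : Fin n → 𝓓'((⊤ : TopologicalSpace.Opens (Bdry n)), ℂ)),
        (∑ i ∈ s, D i) ψ = ∑ i ∈ s, D i ψ := by
      intro s D
      induction s using Finset.induction_on with
      | empty => simp
      | insert a s ha ih => rw [Finset.sum_insert ha, Finset.sum_insert ha, _root_.add_apply, ih]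
    change (- funDistr ⊤ (sliceInt (deriv timeCutoff) (F (0, α)))
      + ∑ j : Fin n, ∂_{EuclideanSpace.single j (1 : ℝ)}
          (funDistr ⊤ (sliceInt timeCutoff (F (j.succ, α))))) ψ = _
    rw [_root_.add_apply, hsum, _root_.neg_apply, funDistr_apply ((l0 α).locallyIntegrableOn _),
      ← integral_neg]
    congr 1
    · refine integral_congr_ae (ae_of_all _ fun x => ?_)
      simp
    · refine Finset.sum_congr rfl fun j _ => ?_
      rw [Distribution.lineDerivOp_apply_apply, map_neg,
        funDistr_apply ((l1 α j).locallyIntegrableOn _), ← integral_neg]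
      refine integral_congr_ae (ae_of_all _ fun x => ?_)
      simp only [mul_neg]
      rfl

end Pairing

/-! ### The Lax–Milgram correction -/

section LaxMilgram

open scoped InnerProductSpace

/-- Lax–Milgram on the closure of `S`: coercivity passes to the closure by continuity, so the
compression of `B` to it is invertible, and the equation (compression of B) x = -(projection of B y)
is solved. -/
theorem exists_mem_orthogonal_of_coercive {H : Type} [NormedAddCommGroup H]
    [InnerProductSpace ℂ H] [CompleteSpace H] (B : H →L[ℂ] H) (S : Submodule ℂ H) {c : ℝ}
    (hc : 0 < c) (hB : ∀ x ∈ S, c * ‖x‖ ^ 2 ≤ (⟪B x, x⟫_ℂ).re) (y : H) :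
    ∃ x ∈ S.topologicalClosure, ∀ k ∈ S, ⟪B (x + y), k⟫_ℂ = 0 := by
  set W := S.topologicalClosure with hW
  haveI : CompleteSpace W := S.isClosed_topologicalClosure.completeSpace_coe
  have hB' : ∀ x ∈ W, c * ‖x‖ ^ 2 ≤ (⟪B x, x⟫_ℂ).re := by
    intro x hx
    have hcl : IsClosed {x : H | c * ‖x‖ ^ 2 ≤ (⟪B x, x⟫_ℂ).re} :=
      isClosed_le (by fun_prop)
        (Complex.continuous_re.comp (B.continuous.inner continuous_id))
    exact closure_minimal (show (S : Set H) ⊆ _ from fun x hx => hB x hx) hcl hx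
  let f : W →L[ℂ] W := W.orthogonalProjectionOnto ∘L B ∘L W.subtypeL
  have hf : ∀ x : W, ‖x‖ ^ 2 * ((⟨c, hc.le⟩ : ℝ≥0) : ℝ) ≤ ‖⟪f x, x⟫_ℂ‖ := by
    intro x
    have e : ⟪f x, x⟫_ℂ = ⟪B x, (x : H)⟫_ℂ :=
      Submodule.inner_orthogonalProjectionOnto_eq_of_mem_right x (B x)
    rw [e, mul_comm]
    exact (hB' x x.2).trans (Complex.re_le_norm _)
  obtain ⟨g, hg⟩ := ContinuousLinearMap.isUnit_of_forall_le_norm_inner_map f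
    (c := ⟨c, hc.le⟩) hc hf
  let x : W := (↑g⁻¹ : W →L[ℂ] W) (-(W.orthogonalProjectionOnto (B y)))
  have hx : f x = -(W.orthogonalProjectionOnto (B y)) := by
    have h1 : (g : W →L[ℂ] W) * (↑g⁻¹ : W →L[ℂ] W) = 1 := g.mul_inv
    rw [hg] at h1
    exact congrArg (fun L : W →L[ℂ] W => L (-(W.orthogonalProjectionOnto (B y)))) h1
  refine ⟨x, x.2, fun k hk => ?_⟩
  have hk' : k ∈ W := S.le_topologicalClosure hk
  have e1 := Submodule.inner_orthogonalProjectionOnto_eq_of_mem_right (⟨k, hk'⟩ : W)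
    (B ((x : H) + y))
  rw [← e1, map_add, map_add]
  have e2 : W.orthogonalProjectionOnto (B x) = f x := rfl
  rw [e2, hx, neg_add_cancel, inner_zero_left]

variable {n m : ℕ}

/-- `L²` of the half-space with values in the space of gradients. -/
abbrev GradL2 (n m : ℕ) : Type :=
  Lp (EuclideanSpace ℂ (Fin (n + 1) × Fin m)) 2 (volume.restrict (half n : Set (Space n)))

/-- The linear map `ξ ↦ ξ_r e_q`. -/
def entryMap (q r : Fin (n + 1) × Fin m) :
    EuclideanSpace ℂ (Fin (n + 1) × Fin m) →L[ℂ] EuclideanSpace ℂ (Fin (n + 1) × Fin m) :=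
  (EuclideanSpace.proj r : _ →L[ℂ] ℂ).smulRight (EuclideanSpace.single q (1 : ℂ))

theorem exists_mul_Lp {Y E : Type} [MeasurableSpace Y] {μ : Measure Y} [NormedAddCommGroup E]
    [NormedSpace ℂ E] {a : Y → E →L[ℂ] E} (ha : MemLp a ⊤ μ) :
    ∃ B : Lp E 2 μ →L[ℂ] Lp E 2 μ, ∀ G : Lp E 2 μ, B G =ᵐ[μ] fun z => a z (G z) := by
  refine ⟨(ContinuousLinearMap.id ℂ (E →L[ℂ] E)).holderL μ ⊤ 2 2 (ha.toLp a), fun G => ?_⟩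
  filter_upwards [(ContinuousLinearMap.id ℂ (E →L[ℂ] E)).coeFn_holder (r := 2) (ha.toLp a) G,
    ha.coeFn_toLp] with z e1 e2
  refine e1.trans ?_
  rw [e2]
  rfl

theorem memLp_sum_smul {Y E κ : Type} [MeasurableSpace Y] {μ : Measure Y} [Fintype κ]
    [NormedAddCommGroup E] [NormedSpace ℂ E] {a : κ → Y → ℂ} (ha : ∀ k, MemLp (a k) ⊤ μ)
    (L : κ → E) : MemLp (fun z => ∑ k, a k z • L k) ⊤ μ := by
  refine memLp_finsetSum Finset.univ fun k _ => ?_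
  refine MemLp.of_le_mul (c := ‖L k‖) (ha k) ((ha k).1.smul_const _) (ae_of_all _ fun z => ?_)
  rw [norm_smul, mul_comm]

theorem sum_entryMap_apply (M : Matrix (Fin (n + 1) × Fin m) (Fin (n + 1) × Fin m) ℂ)
    (ξ : EuclideanSpace ℂ (Fin (n + 1) × Fin m)) :
    (∑ k : (Fin (n + 1) × Fin m) × (Fin (n + 1) × Fin m), M k.1 k.2 • entryMap k.1 k.2) ξ = WithLp.toLp 2 (M *ᵥ ξ.ofLp) := by
  ext p
  have h : ∀ q r, (entryMap q r ξ : EuclideanSpace ℂ (Fin (n + 1) × Fin m)) p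
      = if q = p then ξ r else 0 := fun q r => by
    simp [entryMap, eq_comm]
  simp only [_root_.sum_apply, _root_.smul_apply, WithLp.ofLp_sum,
    Finset.sum_apply, WithLp.ofLp_smul, Pi.smul_apply, h, smul_eq_mul, Matrix.mulVec, dotProduct,
    mul_ite, mul_zero]
  rw [Fintype.sum_prod_type, Finset.sum_eq_single p]
  · simp
  · intro q _ hq
    simp [hq]
  · simp

theorem exists_mulCoeff {A : Coeff n m} (hA : IsBoundedMeasurable A) :
    ∃ B : GradL2 n m →L[ℂ] GradL2 n m, ∀ G : GradL2 n m,
      B G =ᵐ[volume.restrict (half n)] fun z => WithLp.toLp 2 (A z *ᵥ (G z).ofLp) := by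
  obtain ⟨M, hM⟩ := hA.bounded
  obtain ⟨B, hB⟩ := exists_mul_Lp (memLp_sum_smul
    (κ := (Fin (n + 1) × Fin m) × (Fin (n + 1) × Fin m)) (a := fun k z => A z k.1 k.2)
    (fun k => memLp_top_of_bound (hA.measurable k.1 k.2) M (by
      filter_upwards [hM] with z hz using hz k.1 k.2)) fun k => entryMap k.1 k.2)
  refine ⟨B, fun G => (hB G).trans (ae_of_all _ fun z => ?_)⟩
  exact sum_entryMap_apply (A z) (G z)

theorem continuous_classicalGrad_apply {g : Space n → EuclideanSpace ℂ (Fin m)}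
    (hg : ContDiff ℝ 1 g) (q : Fin (n + 1) × Fin m) :
    Continuous fun z => classicalGrad g z q :=
  (EuclideanSpace.proj q.2 : _ →L[ℂ] ℂ).continuous.comp
    ((hg.continuous_fderiv (by simp)).clm_apply continuous_const)

theorem hasCompactSupport_classicalGrad_apply {g : Space n → EuclideanSpace ℂ (Fin m)}
    (hg : HasCompactSupport g) (q : Fin (n + 1) × Fin m) :
    HasCompactSupport fun z => classicalGrad g z q :=
  (hg.fderiv_apply (𝕜 := ℝ) (dir q.1)).comp_left
    (g := fun v : EuclideanSpace ℂ (Fin m) => v q.2) rfl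

theorem memLp_classicalGrad (g : 𝓓^{1}(half n, EuclideanSpace ℂ (Fin m))) :
    MemLp (classicalGrad g) 2 (volume.restrict (half n)) :=
  MemLp.of_eval_piLp fun q =>
    ((continuous_classicalGrad_apply g.contDiff q).memLp_of_hasCompactSupport
      (hasCompactSupport_classicalGrad_apply g.hasCompactSupport q)).restrict _

theorem differentiable_test_one (g : 𝓓^{1}(half n, EuclideanSpace ℂ (Fin m))) :
    Differentiable ℝ g := g.contDiff.differentiable (by simp)

theorem classicalGrad_add {g h : Space n → EuclideanSpace ℂ (Fin m)} (hg : Differentiable ℝ g)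
    (hh : Differentiable ℝ h) (z : Space n) :
    classicalGrad (g + h) z = classicalGrad g z + classicalGrad h z := by
  ext q
  have : fderiv ℝ (g + h) z = fderiv ℝ g z + fderiv ℝ h z := fderiv_add (hg z) (hh z)
  simp only [classicalGrad, this]
  rfl

theorem classicalGrad_smul {g : Space n → EuclideanSpace ℂ (Fin m)} (hg : Differentiable ℝ g)
    (c : ℂ) (z : Space n) : classicalGrad (c • g) z = c • classicalGrad g z := by
  ext q
  have : fderiv ℝ (c • g) z = c • fderiv ℝ g z := fderiv_const_smul (hg z) c
  simp only [classicalGrad, this]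
  rfl

/-- The image in `L²` of a linear family of functions. -/
def rangeLp {V Y E : Type} [MeasurableSpace Y] {μ : Measure Y} [NormedAddCommGroup E]
    [NormedSpace ℂ E] [AddCommGroup V] [Module ℂ V] (D : V →ₗ[ℂ] (Y → E))
    (hD : ∀ v, MemLp (D v) 2 μ) : Submodule ℂ (Lp E 2 μ) :=
  LinearMap.range
    { toFun := fun v => (hD v).toLp _
      map_add' := fun v w => by
        rw [← MemLp.toLp_add]
        exact MemLp.toLp_congr _ _ (ae_of_all _ fun z => by rw [map_add])
      map_smul' := fun c v => by
        rw [RingHom.id_apply, ← MemLp.toLp_const_smul]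
        exact MemLp.toLp_congr _ _ (ae_of_all _ fun z => by rw [map_smul]) }

theorem mem_rangeLp {V Y E : Type} [MeasurableSpace Y] {μ : Measure Y} [NormedAddCommGroup E]
    [NormedSpace ℂ E] [AddCommGroup V] [Module ℂ V] {D : V →ₗ[ℂ] (Y → E)}
    {hD : ∀ v, MemLp (D v) 2 μ} {G : Lp E 2 μ} :
    G ∈ rangeLp D hD ↔ ∃ v, G = (hD v).toLp _ :=
  ⟨fun ⟨v, hv⟩ => ⟨v, hv.symm⟩, fun ⟨v, hv⟩ => ⟨v, hv.symm⟩⟩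

/-- The gradient as a linear map on test functions. -/
def testGradMap (n m : ℕ) : 𝓓^{1}(half n, EuclideanSpace ℂ (Fin m)) →ₗ[ℂ]
    (Space n → EuclideanSpace ℂ (Fin (n + 1) × Fin m)) where
  toFun g := classicalGrad g
  map_add' g h := funext (classicalGrad_add (differentiable_test_one g) (differentiable_test_one h))
  map_smul' c g := funext (classicalGrad_smul (differentiable_test_one g) c)

/-- The space of gradients of `C¹` functions with compact support in the half-space. -/
def testGradients (n m : ℕ) : Submodule ℂ (GradL2 n m) :=
  rangeLp (testGradMap n m) memLp_classicalGrad

theorem mem_testGradients {G : GradL2 n m} : G ∈ testGradients n m ↔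
    ∃ g : 𝓓^{1}(half n, EuclideanSpace ℂ (Fin m)), G = (memLp_classicalGrad g).toLp _ :=
  mem_rangeLp

/-- Gårding's inequality controls only integrals over gradients of test functions, not `A`
pointwise. Coercivity is therefore available on the closure of these gradients, and the correction
is sought there. -/
theorem exists_gradient_correction {A : Coeff n m} (hA : IsBoundedMeasurable A)
    (hG : Garding A) (R : Space n → EuclideanSpace ℂ (Fin (n + 1) × Fin m))
    (hR : MemLp R 2 (volume.restrict (half n))) :
    ∃ G : GradL2 n m, G ∈ (testGradients n m).topologicalClosure ∧
      ∀ g : 𝓓^{1}(half n, EuclideanSpace ℂ (Fin m)),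
        ∫ z in half n, (A z *ᵥ (G z + R z).ofLp) ⬝ᵥ star (classicalGrad g z).ofLp = 0 := by
  obtain ⟨B, hB⟩ := exists_mulCoeff hA
  obtain ⟨lam, hlam, hg⟩ := hG
  have hinner : ∀ (F : GradL2 n m) (g : 𝓓^{1}(half n, EuclideanSpace ℂ (Fin m))),
      ⟪(memLp_classicalGrad g).toLp _, B F⟫_ℂ
        = ∫ z in half n, (A z *ᵥ (F z).ofLp) ⬝ᵥ star (classicalGrad g z).ofLp := by
    intro F g
    rw [L2.inner_def]
    refine integral_congr_ae ?_
    filter_upwards [hB F, (memLp_classicalGrad g).coeFn_toLp] with z e1 e2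
    rw [e1, e2, EuclideanSpace.inner_eq_star_dotProduct]
  have hcoer : ∀ x ∈ testGradients n m, lam * ‖x‖ ^ 2 ≤ (⟪B x, x⟫_ℂ).re := by
    intro x hx
    obtain ⟨g, rfl⟩ := mem_testGradients.1 hx
    rw [← inner_conj_symm, Complex.conj_re]
    have hm := memLp_classicalGrad g
    have e1 : ‖hm.toLp _‖ ^ 2
        = ∑ i : Fin (n + 1), ∑ α : Fin m, ∫ z in half n, ‖classicalGrad g z (i, α)‖ ^ 2 := by
      rw [← Fintype.sum_prod_type (f := fun q : Fin (n + 1) × Fin m =>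
        ∫ z in half n, ‖classicalGrad g z q‖ ^ 2), ← integral_finsetSum]
      · have e2 : ⟪hm.toLp _, hm.toLp _⟫_ℂ
            = ((∫ z in half n, ∑ q, ‖classicalGrad g z q‖ ^ 2 : ℝ) : ℂ) := by
          rw [L2.inner_def, ← integral_complex_ofReal]
          refine integral_congr_ae ?_
          filter_upwards [hm.coeFn_toLp] with z hz
          rw [hz, inner_self_eq_norm_sq_to_K, ← EuclideanSpace.norm_sq_eq]
          norm_cast
        rw [← inner_self_eq_norm_sq (𝕜 := ℂ), RCLike.re_eq_complex_re, e2, Complex.ofReal_re]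
      · intro q _
        exact (hm.eval_piLp q).integrable_norm_pow (by norm_num)
    rw [e1]
    refine (hg g).trans (le_of_eq ?_)
    have e3 : (fun z => ⟪hm.toLp _ z, B (hm.toLp _) z⟫_ℂ) =ᵐ[volume.restrict (half n)]
        fun z => (A z *ᵥ (classicalGrad g z).ofLp) ⬝ᵥ star (classicalGrad g z).ofLp := by
      filter_upwards [hB (hm.toLp _), hm.coeFn_toLp] with z e1 e2
      rw [e1, e2, EuclideanSpace.inner_eq_star_dotProduct]
    have e4 := (L2.integrable_inner (𝕜 := ℂ) (hm.toLp _) (B (hm.toLp _))).congr e3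
    rw [L2.inner_def, integral_congr_ae e3]
    exact integral_re e4
  obtain ⟨G, hGm, h⟩ := exists_mem_orthogonal_of_coercive B (testGradients n m) hlam hcoer
    (hR.toLp R)
  refine ⟨G, hGm, fun g => ?_⟩
  have h1 := h _ (mem_testGradients.2 ⟨g, rfl⟩)
  rw [← inner_conj_symm, map_eq_zero] at h1
  rw [← h1, hinner]
  refine integral_congr_ae ?_
  filter_upwards [Lp.coeFn_add G (hR.toLp R), hR.coeFn_toLp] with z e1 e2
  rw [e1, Pi.add_apply, e2]

end LaxMilgram

/-! ### Primitives in `t` -/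

section Primitive

variable {n m : ℕ}

theorem tendsto_integral_mul {Y : Type} [MeasurableSpace Y] {ν : Measure Y} {φ f : Y → ℂ}
    {h : ℕ → Y → ℂ} (hφ : MemLp φ 2 ν) (hf : MemLp f 2 ν) (hh : ∀ k, MemLp (h k) 2 ν)
    (hlim : Tendsto (fun k => eLpNorm (fun y => h k y - f y) 2 ν) atTop (𝓝 0)) :
    Tendsto (fun k => ∫ y, φ y * h k y ∂ν) atTop (𝓝 (∫ y, φ y * f y ∂ν)) := by
  rw [tendsto_iff_norm_sub_tendsto_zero]
  have h1 : Tendsto (fun k => (eLpNorm φ 2 ν).toReal *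
      (eLpNorm (fun y => h k y - f y) 2 ν).toReal) atTop (𝓝 0) := by
    have := ((ENNReal.tendsto_toReal ENNReal.zero_ne_top).comp hlim).const_mul
      (eLpNorm φ 2 ν).toReal
    simpa using this
  refine squeeze_zero (fun _ => norm_nonneg _) (fun k => ?_) h1
  rw [← integral_sub (integrable_mul_of_memLp (p := 2) (q := 2) hφ (hh k))
    (integrable_mul_of_memLp (p := 2) (q := 2) hφ hf)]
  simp_rw [← mul_sub]
  exact norm_integral_mul_le (p := 2) (q := 2) hφ ((hh k).sub hf)

/-- `∫_0^t G(s, x) ds`. -/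
def timePrimitive (G : Space n → ℂ) (z : Space n) : ℂ := ∫ s in (0 : ℝ)..z.1, G (s, z.2)

theorem aestronglyMeasurable_timePrimitive {G : Space n → ℂ} (hG : StronglyMeasurable G) :
    AEStronglyMeasurable (timePrimitive G) (volume.restrict (half n)) := by
  let f : Space n → ℝ → ℂ := fun z s =>
    {p : Space n × ℝ | 0 < p.2 ∧ p.2 ≤ p.1.1}.indicator (fun p => G (p.2, p.1.2)) (z, s)
  have hS : MeasurableSet {p : Space n × ℝ | 0 < p.2 ∧ p.2 ≤ p.1.1} :=
    (measurableSet_lt measurable_const measurable_snd).inter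
      (measurableSet_le measurable_snd (measurable_fst.comp measurable_fst))
  have hf : StronglyMeasurable (Function.uncurry f) :=
    (hG.comp_measurable (g := fun p : Space n × ℝ => (p.2, p.1.2))
      (measurable_snd.prodMk (measurable_snd.comp measurable_fst))).indicator hS
  refine (hf.integral_prod_right (ν := volume)).aestronglyMeasurable.congr
    ((ae_restrict_iff' measurableSet_half).2 (ae_of_all _ fun z hz => ?_))
  have hz' : (0 : ℝ) < z.1 := hz
  rw [timePrimitive, intervalIntegral.integral_of_le hz'.le, ← integral_indicator measurableSet_Ioc]
  refine integral_congr_ae (ae_of_all _ fun s => ?_)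
  by_cases hs : s ∈ Set.Ioc 0 z.1
  · rw [Set.indicator_of_mem hs]
    exact Set.indicator_of_mem (show (z, s) ∈ {p : Space n × ℝ | 0 < p.2 ∧ p.2 ≤ p.1.1} from hs) _
  · rw [Set.indicator_of_notMem hs]
    exact Set.indicator_of_notMem
      (show (z, s) ∉ {p : Space n × ℝ | 0 < p.2 ∧ p.2 ≤ p.1.1} from hs) _

theorem ae_intervalIntegrable_slice {G : Space n → ℂ}
    (hG : MemLp G 2 (volume.restrict (half n))) :
    ∀ᵐ x : Bdry n, ∀ t : ℝ, 0 < t → IntervalIntegrable (fun s => G (s, x)) volume 0 t := by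
  have h1 : ∫⁻ z in half n, ‖G z‖ₑ ^ (2 : ℝ) < ⊤ := by
    have := lintegral_rpow_enorm_lt_top_of_eLpNorm_lt_top (by norm_num) (by norm_num) hG.2
    simpa using this
  have h0 : AEMeasurable (fun z => ‖G z‖ₑ ^ (2 : ℝ)) (volume.restrict (half n)) :=
    hG.1.enorm.pow_const _
  rw [lintegral_half h0] at h1
  have hm : AEMeasurable (fun x : Bdry n => ∫⁻ t in Set.Ioi (0 : ℝ), ‖G (t, x)‖ₑ ^ (2 : ℝ))
      volume := by
    rw [restrict_half] at h0
    exact h0.lintegral_prod_left'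
  filter_upwards [ae_lt_top' hm h1.ne, ae_aestronglyMeasurable_slice hG.1] with x hx hxm t ht
  rw [intervalIntegrable_iff_integrableOn_Ioc_of_le ht.le]
  have h2 : MemLp (fun s => G (s, x)) 2 (volume.restrict (Set.Ioi (0 : ℝ))) := by
    refine ⟨hxm, ?_⟩
    rw [eLpNorm_two_eq]
    exact ENNReal.rpow_lt_top_of_nonneg (by norm_num) hx.ne
  exact (h2.mono_measure (Measure.restrict_mono Set.Ioc_subset_Ioi_self le_rfl)).integrable
    (by norm_num)

theorem memLp_timePrimitive {G : Space n → ℂ} (hG : StronglyMeasurable G)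
    (hG2 : MemLp G 2 (volume.restrict (half n))) {L : ℝ} (hL : 0 ≤ L) :
    MemLp (timePrimitive G) 2 (volume.restrict ((half n : Set (Space n)) ∩ {z | z.1 ≤ L})) := by
  have hm := aestronglyMeasurable_timePrimitive hG
  refine ⟨hm.mono_measure (Measure.restrict_mono Set.inter_subset_left le_rfl), ?_⟩
  refine (eLpNorm_hardy hG2.1 hm (ae_of_all _ fun x t _ => rfl) hL).trans_lt ?_
  exact ENNReal.mul_lt_top ENNReal.ofReal_lt_top hG2.2

theorem eLpNorm_timePrimitive_le {G : Space n → ℂ} (hG : MemLp G 2 (volume.restrict (half n)))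
    {t : ℝ} (ht : 0 < t) :
    eLpNorm (fun x => timePrimitive G (t, x)) 2 volume ≤
      ENNReal.ofReal t ^ (1 / (2 : ℝ)) * eLpNorm G 2 (volume.restrict (half n)) := by
  rw [eLpNorm_two_eq, eLpNorm_two_eq, ← ENNReal.mul_rpow_of_nonneg _ _ (by norm_num),
    lintegral_half (hG.1.enorm.pow_const _), ← lintegral_const_mul' _ _ ENNReal.ofReal_ne_top]
  refine ENNReal.rpow_le_rpow (lintegral_mono_ae ?_) (by norm_num)
  filter_upwards [ae_aestronglyMeasurable_slice hG.1] with x hx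
  exact enorm_intervalIntegral_sq_le hx ht.le

/-- By Cauchy–Schwarz the slice at height t has L² norm at most √t times the norm of `G`; such
primitives have trace zero. -/
theorem tendsto_eLpNorm_timePrimitive {G : Space n → ℂ}
    (hG : MemLp G 2 (volume.restrict (half n))) :
    Tendsto (fun t : ℝ => eLpNorm (fun x => timePrimitive G (t, x)) 2 volume)
      (𝓝[>] 0 ⊓ ae volume) (𝓝 0) := by
  have h1 : Tendsto (fun t : ℝ => ENNReal.ofReal t ^ (1 / (2 : ℝ)) *
      eLpNorm G 2 (volume.restrict (half n))) (𝓝[>] 0 ⊓ ae volume) (𝓝 0) := by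
    have h2 : Tendsto (fun t : ℝ => ENNReal.ofReal t ^ (1 / (2 : ℝ))) (𝓝 0) (𝓝 0) := by
      have := ((ENNReal.continuous_rpow_const (y := 1 / (2 : ℝ))).comp
        ENNReal.continuous_ofReal).tendsto (0 : ℝ)
      simpa [Function.comp_def] using this
    have h3 := ENNReal.Tendsto.mul_const (b := eLpNorm G 2 (volume.restrict (half n))) h2
      (Or.inr hG.2.ne)
    rw [zero_mul] at h3
    exact h3.mono_left (inf_le_left.trans nhdsWithin_le_nhds)
  refine tendsto_of_tendsto_of_tendsto_of_le_of_le' tendsto_const_nhds h1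
    (Eventually.of_forall fun _ => zero_le) ?_
  filter_upwards [mem_inf_of_left self_mem_nhdsWithin] with t ht
  exact eLpNorm_timePrimitive_le hG ht

theorem eq_timePrimitive {h : Space n → ℂ} (hh : ContDiff ℝ 1 h)
    (hs : tsupport h ⊆ (half n : Set (Space n))) (t : ℝ) (x : Bdry n) :
    h (t, x) = ∫ s in (0 : ℝ)..t, fderiv ℝ h (s, x) (dir 0) := by
  have hd : ∀ s : ℝ, HasDerivAt (fun s : ℝ => h (s, x)) (fderiv ℝ h (s, x) (dir 0)) s := by
    intro s
    have h1 : HasDerivAt (fun s : ℝ => (s, x)) ((1 : ℝ), (0 : Bdry n)) s :=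
      (hasDerivAt_id s).prodMk (hasDerivAt_const s x)
    rw [dir_zero]
    exact ((hh.differentiable (by simp) (s, x)).hasFDerivAt).comp_hasDerivAt s h1
  have hc : Continuous fun s : ℝ => fderiv ℝ h (s, x) (dir 0) :=
    ((hh.continuous_fderiv (by simp)).comp (by fun_prop)).clm_apply continuous_const
  rw [intervalIntegral.integral_eq_sub_of_hasDerivAt (fun s _ => hd s) (hc.intervalIntegrable _ _)]
  have h0 : h (0, x) = 0 := image_eq_zero_of_notMem_tsupport fun h0 => by
    have : (0 : ℝ) < ((0 : ℝ), x).1 := hs h0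
    exact lt_irrefl _ this
  rw [h0, sub_zero]

/-- A limit of gradients in L² is the gradient of the vertical primitive of its component in t.
Hardy's inequality makes the approximating functions converge to this primitive in L² on every {t ≤
L}, which suffices for passing to the limit against a test function. -/
theorem weakDeriv_timePrimitive {G : Fin (n + 1) → Space n → ℂ}
    (hG : ∀ i, MemLp (G i) 2 (volume.restrict (half n))) (hG0 : StronglyMeasurable (G 0))
    {h : ℕ → Space n → ℂ} (hh : ∀ k, ContDiff ℝ 1 (h k)) (hc : ∀ k, HasCompactSupport (h k))
    (hs : ∀ k, tsupport (h k) ⊆ (half n : Set (Space n)))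
    (hlim : ∀ i, Tendsto (fun k => eLpNorm (fun z => fderiv ℝ (h k) z (dir i) - G i z) 2
      (volume.restrict (half n))) atTop (𝓝 0)) (i : Fin (n + 1)) :
    WeakDeriv (half n : Set (Space n)) (dir i) (timePrimitive (G 0)) (G i) := by
  intro θ hθ hθc hθs
  have hd : ∀ k i, MemLp (fun z => fderiv ℝ (h k) z (dir i)) 2 (volume.restrict (half n)) :=
    fun k i => ((((hh k).continuous_fderiv (by simp)).clm_apply
      continuous_const).memLp_of_hasCompactSupport ((hc k).fderiv_apply (𝕜 := ℝ) _)).restrict _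
  have hC : ∀ {η : Space n → ℝ}, Continuous η → HasCompactSupport η →
      MemLp (fun z => (η z : ℂ)) 2 (volume : Measure (Space n)) := fun hη hηc =>
    (Complex.continuous_ofReal.comp hη).memLp_of_hasCompactSupport
      (hηc.comp_left Complex.ofReal_zero)
  have hθ'c : HasCompactSupport fun z => fderiv ℝ θ z (dir i) := hθc.fderiv_apply (𝕜 := ℝ) _
  have hθ'k : Continuous fun z => fderiv ℝ θ z (dir i) :=
    (hθ.continuous_fderiv (by simp)).clm_apply continuous_const
  have hθ's : tsupport (fun z => fderiv ℝ θ z (dir i)) ⊆ (half n : Set (Space n)) :=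
    (tsupport_fderiv_apply_subset ℝ (dir i)).trans hθs
  obtain ⟨L, hL, hbox⟩ := exists_box hθc
  set D : Set (Space n) := (half n : Set (Space n)) ∩ {z | z.1 ≤ L} with hD
  have hDm : MeasurableSet D := measurableSet_half.inter (measurableSet_le measurable_fst
    measurable_const)
  have hrestr : ∀ {η : Space n → ℝ} (S : Set (Space n)) (w : Space n → ℂ), MeasurableSet S →
      tsupport η ⊆ S → ∫ z, (η z : ℂ) * w z = ∫ z in S, (η z : ℂ) * w z := by
    intro η S w hS hηS
    rw [setIntegral_eq_integral_of_forall_compl_eq_zero]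
    intro z hz
    rw [image_eq_zero_of_notMem_tsupport fun h => hz (hηS h)]
    simp
  have hθ'D : tsupport (fun z => fderiv ℝ θ z (dir i)) ⊆ D := fun z hz =>
    ⟨hθ's hz, (le_abs_self _).trans (hbox z (tsupport_fderiv_apply_subset ℝ (dir i) hz)).1⟩
  have hvm := aestronglyMeasurable_timePrimitive hG0
  have hdiff : ∀ k, eLpNorm (fun z => h k z - timePrimitive (G 0) z) 2 (volume.restrict D) ≤
      ENNReal.ofReal L * eLpNorm (fun z => fderiv ℝ (h k) z (dir 0) - G 0 z) 2
        (volume.restrict (half n)) := by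
    intro k
    refine eLpNorm_hardy ((hd k 0).1.sub (hG 0).1)
      ((hh k).continuous.aestronglyMeasurable.sub hvm) ?_ hL.le
    filter_upwards [ae_intervalIntegrable_slice (hG 0)] with x hx t ht
    refine Eq.trans ?_ (intervalIntegral.integral_sub ?_ (hx t ht)).symm
    · rw [← eq_timePrimitive (hh k) (hs k)]
      rfl
    · exact (((hh k).continuous_fderiv (by simp)).comp (by fun_prop : Continuous fun s : ℝ =>
        ((s, x) : Space n))).clm_apply continuous_const |>.intervalIntegrable _ _
  have lim1 : Tendsto (fun k => ∫ z, (θ z : ℂ) * fderiv ℝ (h k) z (dir i)) atTop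
      (𝓝 (∫ z, (θ z : ℂ) * G i z)) := by
    simp_rw [fun w => hrestr (half n : Set (Space n)) w measurableSet_half hθs]
    exact tendsto_integral_mul ((hC hθ.continuous hθc).restrict _) (hG i) (fun k => hd k i) (hlim i)
  have lim2 : Tendsto (fun k => - ∫ z, ((fderiv ℝ θ z (dir i) : ℝ) : ℂ) * h k z) atTop
      (𝓝 (- ∫ z, ((fderiv ℝ θ z (dir i) : ℝ) : ℂ) * timePrimitive (G 0) z)) := by
    refine Tendsto.neg ?_
    simp_rw [fun w => hrestr D w hDm hθ'D]
    refine tendsto_integral_mul ((hC hθ'k hθ'c).restrict _) (memLp_timePrimitive hG0 (hG 0) hL.le)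
      (fun k => ((hh k).continuous.memLp_of_hasCompactSupport (hc k)).restrict _) ?_
    have := ENNReal.Tendsto.const_mul (a := ENNReal.ofReal L) (hlim 0)
      (Or.inr ENNReal.ofReal_ne_top)
    rw [mul_zero] at this
    exact tendsto_of_tendsto_of_tendsto_of_le_of_le tendsto_const_nhds this (fun _ => zero_le) hdiff
  refine tendsto_nhds_unique lim1 (lim2.congr fun k => ?_)
  exact (weakDeriv_of_contDiff (hh k) (dir i) θ hθ hθc (Set.subset_univ _)).symm

/-- Weak derivatives of the primitive of an element of the closure of test gradients. -/
theorem weakDeriv_timePrimitive_of_mem {G : GradL2 n m}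
    (hG : G ∈ (testGradients n m).topologicalClosure) (i : Fin (n + 1)) (α : Fin m) :
    WeakDeriv (half n : Set (Space n)) (dir i) (timePrimitive fun z => G z (0, α))
      (fun z => G z (i, α)) := by
  obtain ⟨x, hx, hlim⟩ := mem_closure_iff_seq_limit.1 hG
  choose g hg using fun k => mem_testGradients.1 (hx k)
  have hGm : ∀ q, MemLp (fun z => G z q) 2 (volume.restrict (half n)) := fun q =>
    (Lp.memLp G).eval_piLp q
  have hsm : StronglyMeasurable fun z => G z (0, α) :=
    (EuclideanSpace.proj (0, α) : _ →L[ℂ] ℂ).continuous.comp_stronglyMeasurable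
      (Lp.stronglyMeasurable G)
  have hd : ∀ k i z, fderiv ℝ (fun z => g k z α) z (dir i) = classicalGrad (g k) z (i, α) := by
    intro k i z
    have := (((EuclideanSpace.proj α : _ →L[ℂ] ℂ).restrictScalars ℝ).hasFDerivAt.comp z
      (differentiable_test_one (g k) z).hasFDerivAt).fderiv
    exact congrArg (fun L : Space n →L[ℝ] ℂ => L (dir i)) this
  refine weakDeriv_timePrimitive (G := fun i z => G z (i, α)) (h := fun k z => g k z α)
    (fun i => hGm (i, α)) hsm
    (fun k => ((EuclideanSpace.proj α : _ →L[ℂ] ℂ).restrictScalars ℝ).contDiff.comp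
      (g k).contDiff)
    (fun k => (g k).hasCompactSupport.comp_left
      (g := fun v : EuclideanSpace ℂ (Fin m) => v α) rfl)
    (fun k => (closure_mono fun z hz => ?_).trans (g k).tsupport_subset) (fun i => ?_) i
  · exact fun h0 => hz (by simp [h0])
  · simp only [hd]
    have h1 := (Lp.tendsto_Lp_iff_tendsto_eLpNorm' x G).1 hlim
    refine tendsto_of_tendsto_of_tendsto_of_le_of_le tendsto_const_nhds h1 (fun _ => zero_le)
      fun k => ?_
    refine eLpNorm_mono_ae ?_
    have h2 := (memLp_classicalGrad (g k)).coeFn_toLp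
    rw [← hg k] at h2
    filter_upwards [h2] with z hz
    rw [Pi.sub_apply, hz]
    exact PiLp.norm_apply_le (classicalGrad (g k) z - G z) (i, α)

/-- The Dirichlet problem with a test function as boundary value. -/
theorem exists_isSolution {A : Coeff n m} (hA : IsBoundedMeasurable A) (hgar : Garding A)
    (Ψ : VecTest n (Fin m)) : ∃ u : EnergyFunction n m, IsSolution A u ∧ IsTrace u Ψ := by
  set E := testExt Ψ with hE
  -- The solution is the explicit extension E of Ψ minus the primitive of `G`. Its gradient is -(G -
  -- ∇E), so its flux annihilates gradients of test functions, and the primitive does not change the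
  -- trace.
  obtain ⟨G, hGc, hG⟩ := exists_gradient_correction hA hgar (fun z => - E.grad z) E.memLp_grad.neg
  have hGm : ∀ q, MemLp (fun z => G z q) 2 (volume.restrict (half n)) := fun q =>
    (Lp.memLp G).eval_piLp q
  have hsm : ∀ α, StronglyMeasurable fun z => G z (0, α) := fun α =>
    (EuclideanSpace.proj (0, α) : _ →L[ℂ] ℂ).continuous.comp_stronglyMeasurable
      (Lp.stronglyMeasurable G)
  have hvK : ∀ (α : Fin m) (K : Set (Space n)), IsCompact K → K ⊆ half n →
      MemLp (timePrimitive fun z => G z (0, α)) 2 (volume.restrict K) := by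
    intro α K hK hKs
    obtain ⟨L, hL, hbox⟩ := exists_box hK
    have hKL : K ⊆ (half n : Set (Space n)) ∩ {z | z.1 ≤ L} := fun z hz =>
      ⟨hKs hz, (le_abs_self _).trans (hbox z hz).1⟩
    exact (memLp_timePrimitive (hsm α) (hGm (0, α)) hL.le).mono_measure
      (Measure.restrict_mono hKL le_rfl)
  let u : EnergyFunction n m := EnergyFunction.ofComponents
    (fun α z => E.toFun z α - timePrimitive (fun z => G z (0, α)) z)
    (fun q z => E.grad z q - G z q)
    (fun α K hK hKs => ((E.memLp_loc K hK hKs).eval_piLp α).sub (hvK α K hK hKs))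
    (fun q => (E.memLp_grad_apply q).sub (hGm q))
    (fun i α => WeakDeriv.sub (E.locallyIntegrableOn α)
      (locallyIntegrableOn_of_memLp (half n).isOpen (E.memLp_grad_apply (i, α)))
      (locallyIntegrableOn_of_memLp_compact (half n).isOpen (hvK α))
      (locallyIntegrableOn_of_memLp (half n).isOpen (hGm (i, α)))
      (E.weakDeriv i α) (weakDeriv_timePrimitive_of_mem hGc i α))
  have hu : ∀ z, u.grad z = - (G z + - E.grad z) := fun z => by
    ext q
    change E.grad z q - G z q = - (G z q + - E.grad z q)
    ring
  refine ⟨u, (isSolution_iff hA u).2 fun α θ hθ hθc hθs => ?_, isTrace_of_apply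
    (fun α K hK => (isTrace_testExt Ψ).memLp α hK) fun α K hK => ?_⟩
  · have hθ1 : ContDiff ℝ 1 θ := hθ.of_le (by exact_mod_cast le_top)
    let L : ℝ →L[ℝ] EuclideanSpace ℂ (Fin m) :=
      (ContinuousLinearMap.id ℝ ℝ).smulRight (EuclideanSpace.single α (1 : ℂ))
    have hL : ∀ (r : ℝ) (β : Fin m), L r β = if β = α then (r : ℂ) else 0 := by
      intro r β
      by_cases hβ : β = α <;> simp [L, hβ]
    let g : 𝓓^{1}(half n, EuclideanSpace ℂ (Fin m)) :=
      ⟨fun z => L (θ z), L.contDiff.comp hθ1, hθc.comp_left (map_zero L),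
        (closure_mono (show Function.support (fun z => L (θ z)) ⊆ Function.support θ from
          fun z hz h0 => hz (by simp only [h0, map_zero]))).trans hθs⟩
    have hgg : ∀ z (q : Fin (n + 1) × Fin m), classicalGrad g z q
        = if q.2 = α then ((fderiv ℝ θ z (dir q.1) : ℝ) : ℂ) else 0 := by
      intro z q
      have h1 : fderiv ℝ g z = L ∘L fderiv ℝ θ z :=
        (L.hasFDerivAt.comp z (hθ1.differentiable (by simp) z).hasFDerivAt).fderiv
      change fderiv ℝ g z (dir q.1) q.2 = _
      rw [h1]
      exact hL _ _
    have h1 := hG g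
    have hθi : ∀ i, MemLp (fun z => ((fderiv ℝ θ z (dir i) : ℝ) : ℂ)) 2
        (volume.restrict (half n)) := fun i =>
      ((Complex.continuous_ofReal.comp ((hθ.continuous_fderiv (by simp)).clm_apply
        continuous_const)).memLp_of_hasCompactSupport
        ((hθc.fderiv_apply (𝕜 := ℝ) _).comp_left Complex.ofReal_zero)).restrict _
    have e1 : ∀ i, ∫ z, (half n : Set (Space n)).indicator (fun z => flux A u z (i, α)) z *
        ((fderiv ℝ θ z (dir i) : ℝ) : ℂ)
        = ∫ z in half n, flux A u z (i, α) * ((fderiv ℝ θ z (dir i) : ℝ) : ℂ) := by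
      intro i
      rw [← integral_indicator measurableSet_half]
      refine integral_congr_ae (ae_of_all _ fun z => ?_)
      by_cases hz : z ∈ (half n : Set (Space n))
      · simp only [Set.indicator_of_mem hz]
      · simp only [Set.indicator_of_notMem hz, zero_mul]
    simp_rw [e1]
    rw [← integral_finsetSum _ fun i _ => integrable_mul_of_memLp (p := 2) (q := 2)
      (hA.memLp_flux u (i, α)) (hθi i), ← neg_eq_zero, ← integral_neg, ← h1]
    refine integral_congr_ae (ae_of_all _ fun z => ?_)
    simp only [dotProduct, Fintype.sum_prod_type, Pi.star_apply, hgg]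
    rw [← Finset.sum_neg_distrib]
    refine Finset.sum_congr rfl fun i _ => ?_
    rw [Finset.sum_eq_single α]
    · rw [flux, hu, WithLp.ofLp_neg, Matrix.mulVec_neg]
      generalize A z *ᵥ (G z + -E.grad z).ofLp = η
      simp
    · intro β _ hβ
      simp [hβ]
    · simp
  · have hE := (isTrace_testExt Ψ).tendsto α hK
    have hv := tendsto_eLpNorm_timePrimitive (hGm (0, α))
    have h2 := hE.add hv
    rw [add_zero] at h2
    refine tendsto_of_tendsto_of_tendsto_of_le_of_le' tendsto_const_nhds h2
      (Eventually.of_forall fun _ => zero_le) ?_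
    have hsl := eventually_slice (aestronglyMeasurable_timePrimitive (hsm α))
    have hsl' := eventually_slice (E.aestronglyMeasurable α)
    filter_upwards [hsl, hsl'] with t ht ht'
    have e2 : ∀ x, u.toFun (t, x) α - Ψ x α
        = (E.toFun (t, x) α - Ψ x α) - timePrimitive (fun z => G z (0, α)) (t, x) := fun x => by
      change (E.toFun (t, x) α - timePrimitive (fun z => G z (0, α)) (t, x)) - Ψ x α = _
      ring
    simp_rw [e2]
    refine (eLpNorm_sub_le (ht'.restrict.sub
      (contDiff_test_apply Ψ α).continuous.aestronglyMeasurable) ht.restrict (by norm_num)).trans ?_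
    exact add_le_add le_rfl (eLpNorm_mono_measure _ Measure.restrict_le_self)

end Primitive

/-! ### Tangential convolution of energy functions -/

section TangConv

variable {n m : ℕ}

/-- The inclusion of the boundary directions. -/
def bdryIncl (n : ℕ) : Bdry n →L[ℝ] Space n := ContinuousLinearMap.inr ℝ ℝ (Bdry n)

theorem sub_bdryIncl (t : ℝ) (x y : Bdry n) : (t, x) - bdryIncl n y = (t, x - y) := by
  simp [bdryIncl]

theorem norm_le_norm_bdryIncl (y : Bdry n) : ‖y‖ ≤ ‖bdryIncl n y‖ := by
  simp [bdryIncl]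

theorem sub_bdryIncl_mem_half (z : Space n) (y : Bdry n) :
    z - bdryIncl n y ∈ (half n : Set (Space n)) ↔ z ∈ (half n : Set (Space n)) := by
  obtain ⟨t, x⟩ := z
  rw [sub_bdryIncl]
  exact Iff.rfl

theorem tconv_bdryIncl (K : Bdry n → ℝ) (f : Space n → ℂ) (t : ℝ) (x : Bdry n) :
    tconv (bdryIncl n) K f (t, x)
      = tconv (ContinuousLinearMap.id ℝ (Bdry n)) K (fun x => f (t, x)) x := by
  simp only [tconv, sub_bdryIncl, ContinuousLinearMap.id_apply]

theorem tconv_indicator_half (K : Bdry n → ℝ) (f : Space n → ℂ) :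
    tconv (bdryIncl n) K ((half n : Set (Space n)).indicator f)
      = (half n : Set (Space n)).indicator (tconv (bdryIncl n) K f) := by
  funext z
  by_cases hz : z ∈ (half n : Set (Space n))
  · rw [Set.indicator_of_mem hz]
    simp only [tconv]
    refine integral_congr_ae (ae_of_all _ fun y => ?_)
    simp only
    rw [Set.indicator_of_mem ((sub_bdryIncl_mem_half z y).2 hz)]
  · rw [Set.indicator_of_notMem hz]
    simp only [tconv]
    rw [← integral_zero (Bdry n) ℂ]
    refine integral_congr_ae (ae_of_all _ fun y => ?_)
    simp only
    rw [Set.indicator_of_notMem (fun h => hz ((sub_bdryIncl_mem_half z y).1 h)), smul_zero]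

theorem memLp_tconv_half {K : Bdry n → ℝ} (hK : Integrable K volume) {f : Space n → ℂ}
    (hf : MemLp f 2 (volume.restrict (half n))) :
    MemLp (tconv (bdryIncl n) K f) 2 (volume.restrict (half n)) := by
  rw [← memLp_indicator_iff_restrict measurableSet_half] at hf ⊢
  rw [← tconv_indicator_half]
  exact memLp_tconv (bdryIncl n) hK hf (by norm_num) (by norm_num)

theorem conj_tconv {V X : Type} [NormedAddCommGroup V] [NormedSpace ℝ V] [MeasureSpace V]
    [BorelSpace V] [FiniteDimensional ℝ V] [(volume : Measure V).IsAddHaarMeasure]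
    [NormedAddCommGroup X] [NormedSpace ℝ X] [MeasureSpace X] [BorelSpace X]
    [FiniteDimensional ℝ X] [(volume : Measure X).IsAddHaarMeasure]
    (ι : V →L[ℝ] X) (K : V → ℝ) (f : X → ℂ) (z : X) :
    conj (tconv ι K f z) = tconv ι K (fun z => conj (f z)) z := by
  simp only [tconv]
  rw [← integral_conj]
  refine integral_congr_ae (ae_of_all _ fun y => ?_)
  simp

/-- The convolution of an energy function with a kernel in the boundary variables. -/
def EnergyFunction.tangConv (φ : EnergyFunction n m) {K : Bdry n → ℝ} (hK : Continuous K)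
    (hKc : HasCompactSupport K) : EnergyFunction n m :=
  EnergyFunction.ofComponents (fun α => tconv (bdryIncl n) K fun z => φ.toFun z α)
    (fun q => tconv (bdryIncl n) K fun z => φ.grad z q)
    (fun α S hS hSs => memLp_tconv_restrict (bdryIncl n) (hK.integrable_of_hasCompactSupport hKc)
      hKc hS ((φ.memLp_loc _ (isCompact_sweep (bdryIncl n) hKc hS)
        (sweep_subset (bdryIncl n) hSs fun z y hz =>
          (sub_bdryIncl_mem_half z y).2 hz)).eval_piLp α) (by norm_num) (by norm_num))
    (fun q => memLp_tconv_half (hK.integrable_of_hasCompactSupport hKc) (φ.memLp_grad_apply q))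
    (fun i α => (φ.weakDeriv i α).tconv (bdryIncl n) (half n).isOpen
      (fun z y hz => (sub_bdryIncl_mem_half z y).2 hz) (hK.integrable_of_hasCompactSupport hKc) hKc
      (φ.locallyIntegrableOn α)
      (locallyIntegrableOn_of_memLp (half n).isOpen (φ.memLp_grad_apply (i, α))))

/-- An energy function need not be in L², but this convolution equals κ * ∂_jφ almost everywhere in
the half-space and is. That is what makes cutting off in the tangential variables possible. -/
theorem EnergyFunction.memLp_tangConv (φ : EnergyFunction n m) {κ : Bdry n → ℝ}
    (hκ : ContDiff ℝ ((⊤ : ℕ∞) : WithTop ℕ∞) κ) (hκc : HasCompactSupport κ) (j : Fin n)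
    (α : Fin m) :
    MemLp (tconv (bdryIncl n) (fun y => fderiv ℝ κ y (EuclideanSpace.single j 1))
      fun z => φ.toFun z α) 2 (volume.restrict (half n)) := by
  have hd : bdryIncl n (EuclideanSpace.single j 1) = dir j.succ := by
    rw [dir_succ]
    rfl
  have h1 := memLp_tconv_half (hκ.continuous.integrable_of_hasCompactSupport hκc)
    (φ.memLp_grad_apply (j.succ, α))
  refine h1.ae_eq ((ae_restrict_iff' measurableSet_half).2 ?_)
  have h2 := tconv_fderiv_kernel_ae_eq (bdryIncl n) (half n).isOpen
    (fun z y hz => (sub_bdryIncl_mem_half z y).2 hz) (hκ.of_le (by exact_mod_cast le_top)) hκc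
    (φ.locallyIntegrableOn α)
    (locallyIntegrableOn_of_memLp (half n).isOpen (φ.memLp_grad_apply (j.succ, α)))
    (b := EuclideanSpace.single j 1) (by rw [hd]; exact φ.weakDeriv j.succ α)
  filter_upwards [h2] with z hz hz'
  exact (hz hz').symm

theorem fderiv_comp_snd {ζ : Bdry n → ℝ} (hζ : Differentiable ℝ ζ) (z v : Space n) :
    fderiv ℝ (fun z : Space n => ζ z.2) z v = fderiv ℝ ζ z.2 v.2 := by
  have := ((hζ z.2).hasFDerivAt.comp z hasFDerivAt_snd).fderiv
  exact congrArg (fun L : Space n →L[ℝ] ℝ => L v) this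

theorem norm_snd_dir_le (i : Fin (n + 1)) : ‖(dir i : Space n).2‖ ≤ 1 := by
  refine Fin.cases ?_ (fun j => ?_) i
  · rw [dir_zero]
    simp
  · rw [dir_succ]
    simp

/-- The product of an energy function in `L²` with a cutoff function in the boundary variables. -/
def EnergyFunction.cutoff (φ : EnergyFunction n m)
    (hφ : ∀ α, MemLp (fun z => φ.toFun z α) 2 (volume.restrict (half n))) {ζ : Bdry n → ℝ}
    (hζ : ContDiff ℝ ((⊤ : ℕ∞) : WithTop ℕ∞) ζ) {B C : ℝ} (hB : ∀ x, ‖ζ x‖ ≤ B)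
    (hC : ∀ x, ‖fderiv ℝ ζ x‖ ≤ C) : EnergyFunction n m :=
  have hζ' : ContDiff ℝ ((⊤ : ℕ∞) : WithTop ℕ∞) fun z : Space n => ζ z.2 := hζ.comp contDiff_snd
  have h1 : ∀ {f : Space n → ℂ} {μ : Measure (Space n)}, MemLp f 2 μ →
      MemLp (fun z => (ζ z.2 : ℂ) * f z) 2 μ := fun hf =>
    MemLp.of_le_mul (c := B) hf
      ((Complex.continuous_ofReal.comp hζ'.continuous).aestronglyMeasurable.mul hf.1)
      (ae_of_all _ fun z => by
        rw [norm_mul, Complex.norm_real]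
        exact mul_le_mul_of_nonneg_right (hB _) (norm_nonneg _))
  EnergyFunction.ofComponents (fun α z => (ζ z.2 : ℂ) * φ.toFun z α)
    (fun q z => (ζ z.2 : ℂ) * φ.grad z q
      + ((fderiv ℝ (fun z : Space n => ζ z.2) z (dir q.1) : ℝ) : ℂ) * φ.toFun z q.2)
    (fun α _ hS hSs => h1 ((φ.memLp_loc _ hS hSs).eval_piLp α))
    (fun q => (h1 (φ.memLp_grad_apply q)).add
      (MemLp.of_le_mul (c := C) (hφ q.2)
        ((Complex.continuous_ofReal.comp ((hζ'.continuous_fderiv (by simp)).clm_apply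
          continuous_const)).aestronglyMeasurable.mul (hφ q.2).1)
        (ae_of_all _ fun z => by
          rw [norm_mul, Complex.norm_real, fderiv_comp_snd (hζ.differentiable (by simp))]
          refine mul_le_mul_of_nonneg_right ?_ (norm_nonneg _)
          refine ((fderiv ℝ ζ z.2).le_opNorm _).trans ?_
          exact (mul_le_of_le_one_right (norm_nonneg _) (norm_snd_dir_le _)).trans (hC _))))
    (fun i α => WeakDeriv.smooth_mul hζ' (φ.locallyIntegrableOn α)
      (locallyIntegrableOn_of_memLp (half n).isOpen (φ.memLp_grad_apply (i, α)))
      (φ.weakDeriv i α))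

theorem integrable_tconv_integrand {K : Bdry n → ℝ} (hK : Continuous K)
    (hKc : HasCompactSupport K) {f : Bdry n → ℂ} (hf : Integrable f volume) (x : Bdry n) :
    Integrable (fun y => K y • f (x - y)) volume := by
  obtain ⟨C, hC⟩ := hKc.exists_bound_of_continuous hK
  exact (hf.comp_sub_left x).bdd_smul C hK.aestronglyMeasurable (ae_of_all _ hC)

theorem IsTrace.tangConv {φ : EnergyFunction n m} {f : Bdry n → EuclideanSpace ℂ (Fin m)}
    (h : IsTrace φ f) {K : Bdry n → ℝ} (hK : Continuous K) (hKc : HasCompactSupport K) :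
    IsTrace (φ.tangConv hK hKc) fun x => WithLp.toLp 2 fun α =>
      tconv (ContinuousLinearMap.id ℝ (Bdry n)) K (fun x => f x α) x := by
  have hKi := hK.integrable_of_hasCompactSupport (μ := volume) hKc
  set I := ContinuousLinearMap.id ℝ (Bdry n) with hI
  refine isTrace_of_apply (fun α S hS => memLp_tconv_restrict I hKi hKc hS
    (h.memLp α (isCompact_sweep I hKc hS)) (by norm_num) (by norm_num)) fun α S hS => ?_
  have hsw := isCompact_sweep I hKc hS
  have h1 := ENNReal.Tendsto.const_mul (a := eLpNorm K 1 volume) (h.tendsto α hsw)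
    (Or.inr (memLp_one_iff_integrable.2 hKi).2.ne)
  rw [mul_zero] at h1
  refine tendsto_of_tendsto_of_tendsto_of_le_of_le' tendsto_const_nhds h1
    (Eventually.of_forall fun _ => zero_le) ?_
  have hfin := (h.tendsto α hsw).eventually (gt_mem_nhds (ENNReal.zero_lt_top))
  filter_upwards [hfin, eventually_slice (φ.aestronglyMeasurable α)] with t ht hm
  have hf := h.memLp α hsw
  have hd : MemLp (fun x => φ.toFun (t, x) α - f x α) 2 (volume.restrict (sweep I K S)) :=
    ⟨hm.restrict.sub hf.1, ht⟩
  have hφ : MemLp (fun x => φ.toFun (t, x) α) 2 (volume.restrict (sweep I K S)) :=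
    (hd.add hf).ae_eq (ae_of_all _ fun x => by simp)
  refine le_trans (le_of_eq ?_) (eLpNorm_tconv_restrict_le I hKi hKc hS hd.1 (by norm_num)
    (by norm_num))
  refine eLpNorm_congr_ae ((ae_restrict_iff' hS.measurableSet).2 (ae_of_all _ fun x hx => ?_))
  change tconv (bdryIncl n) K (fun z => φ.toFun z α) (t, x) - tconv I K (fun x => f x α) x = _
  haveI : IsFiniteMeasure (volume.restrict (sweep I K S)) := ⟨by
    rw [Measure.restrict_apply_univ]; exact hsw.measure_lt_top⟩
  have hint : ∀ {g : Bdry n → ℂ}, MemLp g 2 (volume.restrict (sweep I K S)) →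
      Integrable ((sweep I K S).indicator g) volume := fun hg =>
    (integrable_indicator_iff hsw.measurableSet).2 (hg.integrable (by norm_num))
  rw [tconv_bdryIncl, ← tconv_indicator_sweep I (fun x => φ.toFun (t, x) α) hx,
    ← tconv_indicator_sweep I (fun x => f x α) hx,
    ← tconv_indicator_sweep I (fun x => φ.toFun (t, x) α - f x α) hx]
  simp only [tconv]
  have i1 : Integrable (fun y => K y •
      (sweep I K S).indicator (fun x => φ.toFun (t, x) α) (x - I y)) volume :=
    integrable_tconv_integrand hK hKc (hint hφ) x
  have i2 : Integrable (fun y => K y • (sweep I K S).indicator (fun x => f x α) (x - I y)) volume :=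
    integrable_tconv_integrand hK hKc (hint hf) x
  rw [← integral_sub i1 i2]
  refine integral_congr_ae (ae_of_all _ fun y => ?_)
  simp only [← smul_sub]
  congr 1
  exact (congrFun (Set.indicator_sub (sweep I K S) (fun x => φ.toFun (t, x) α)
    fun x => f x α) _).symm

end TangConv

/-! ### Convolution and cutoff: pairing with the conormal derivative -/

section CutoffPairing

variable {n m : ℕ}

/-- Smooth cutoff functions which increase to the whole space, with gradients tending to zero. -/
structure IsCutoffSeq (C : ℝ) (ζ : ℕ → Bdry n → ℝ) : Prop where
  contDiff : ∀ k, ContDiff ℝ ((⊤ : ℕ∞) : WithTop ℕ∞) (ζ k)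
  hasCompactSupport : ∀ k, HasCompactSupport (ζ k)
  norm_le : ∀ k x, ‖ζ k x‖ ≤ 1
  eq_one : ∀ (k : ℕ) (x : Bdry n), ‖x‖ ≤ (k : ℝ) + 1 → ζ k x = 1
  fderiv_le : ∀ (k : ℕ) (x : Bdry n), ‖fderiv ℝ (ζ k) x‖ ≤ C / ((k : ℝ) + 1)

theorem exists_isCutoffSeq (n : ℕ) :
    ∃ (C : ℝ) (ζ : ℕ → Bdry n → ℝ), 0 ≤ C ∧ IsCutoffSeq C ζ := by
  obtain ⟨C, D, hC, h⟩ := exists_cutoff (Bdry n)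
  choose ζ h1 h2 h3 h4 h5 h6 h7 h8 using fun k : ℕ => h ((k : ℝ) + 1) (by positivity)
  refine ⟨C, ζ, hC, h1, h2, fun k x => ?_, h4, h5⟩
  rw [Real.norm_eq_abs, abs_of_nonneg (h3 k x).1]
  exact (h3 k x).2

theorem IsCutoffSeq.tendsto {C : ℝ} {ζ : ℕ → Bdry n → ℝ} (hζ : IsCutoffSeq C ζ) (x : Bdry n) :
    Tendsto (fun k => (ζ k x : ℂ)) atTop (𝓝 1) := by
  refine tendsto_const_nhds.congr' ?_
  obtain ⟨N, hN⟩ := exists_nat_ge ‖x‖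
  filter_upwards [eventually_ge_atTop N] with k hk
  rw [hζ.eq_one k x, Complex.ofReal_one]
  have : (N : ℝ) ≤ k := by exact_mod_cast hk
  linarith

theorem tendsto_div_add_one (C : ℝ) : Tendsto (fun k : ℕ => C / ((k : ℝ) + 1)) atTop (𝓝 0) := by
  have := (tendsto_one_div_add_atTop_nhds_zero_nat (𝕜 := ℝ)).const_mul C
  simpa [div_eq_mul_inv] using this

theorem IsCutoffSeq.fderiv_apply_le {C : ℝ} {ζ : ℕ → Bdry n → ℝ} (hζ : IsCutoffSeq C ζ) (k : ℕ)
    (x : Bdry n) {v : Bdry n} (hv : ‖v‖ ≤ 1) : ‖fderiv ℝ (ζ k) x v‖ ≤ C / ((k : ℝ) + 1) :=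
  ((fderiv ℝ (ζ k) x).le_opNorm v).trans
    ((mul_le_of_le_one_right (norm_nonneg _) hv).trans (hζ.fderiv_le k x))

/-- The product of a smooth function with a smooth cutoff function, as a test function. -/
def cutoffTest {ι : Type} [Fintype ι] {ζ : Bdry n → ℝ}
    (hζ : ContDiff ℝ ((⊤ : ℕ∞) : WithTop ℕ∞) ζ) (hζc : HasCompactSupport ζ)
    {g : ι → Bdry n → ℂ} (hg : ∀ a, ContDiff ℝ ((⊤ : ℕ∞) : WithTop ℕ∞) (g a)) : VecTest n ι where
  toFun x := WithLp.toLp 2 fun a => (ζ x : ℂ) * g a x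
  contDiff' := (contDiff_piLp 2).2 fun a => (Complex.ofRealCLM.contDiff.comp hζ).mul (hg a)
  hasCompactSupport' := hζc.mono' (by
    intro x hx
    by_contra h
    refine hx ?_
    have h0 : ζ x = 0 := image_eq_zero_of_notMem_tsupport h
    ext a
    simp [h0])
  tsupport_subset' := fun _ _ => trivial

theorem IsTrace.cutoff {φ : EnergyFunction n m} {f : Bdry n → EuclideanSpace ℂ (Fin m)}
    (h : IsTrace φ f) (hφ : ∀ α, MemLp (fun z => φ.toFun z α) 2 (volume.restrict (half n)))
    {ζ : Bdry n → ℝ} (hζ : ContDiff ℝ ((⊤ : ℕ∞) : WithTop ℕ∞) ζ) {B C : ℝ}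
    (hB : ∀ x, ‖ζ x‖ ≤ B) (hC : ∀ x, ‖fderiv ℝ ζ x‖ ≤ C) :
    IsTrace (φ.cutoff hφ hζ hB hC) fun x => WithLp.toLp 2 fun α => (ζ x : ℂ) * f x α := by
  refine isTrace_of_apply (fun α S hS => ?_) fun α S hS => ?_
  · exact MemLp.of_le_mul (c := B) (h.memLp α hS)
      ((Complex.continuous_ofReal.comp hζ.continuous).aestronglyMeasurable.mul (h.memLp α hS).1)
      (ae_of_all _ fun z => by
        rw [norm_mul]
        refine mul_le_mul_of_nonneg_right ?_ (norm_nonneg _)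
        exact (Complex.norm_real _).trans_le (hB _))
  · have h1 := ENNReal.Tendsto.const_mul (a := ENNReal.ofReal B) (h.tendsto α hS)
      (Or.inr ENNReal.ofReal_ne_top)
    rw [mul_zero] at h1
    refine tendsto_of_tendsto_of_tendsto_of_le_of_le tendsto_const_nhds h1 (fun _ => zero_le)
      fun t => ?_
    refine eLpNorm_le_mul_eLpNorm_of_ae_le_mul (ae_of_all _ fun x => ?_) 2
    change ‖(ζ x : ℂ) * φ.toFun (t, x) α - (ζ x : ℂ) * f x α‖ ≤ _
    rw [← mul_sub, norm_mul, Complex.norm_real]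
    exact mul_le_mul_of_nonneg_right (hB _) (norm_nonneg _)

variable {A : Coeff n m}

/-- The gradient of the product contains φ∇ζ_k; it is dominated since φ is in L², and tends to zero
with ∇ζ_k. -/
theorem tendsto_energyForm_cutoff (hA : IsBoundedMeasurable A) (u : EnergyFunction n m)
    (φ : EnergyFunction n m)
    (hφ : ∀ α, MemLp (fun z => φ.toFun z α) 2 (volume.restrict (half n))) {C : ℝ} (hC : 0 ≤ C)
    {ζ : ℕ → Bdry n → ℝ} (hζ : IsCutoffSeq C ζ) :
    Tendsto (fun k => energyForm A u
      (φ.cutoff hφ (hζ.contDiff k) (hζ.norm_le k) (hζ.fderiv_le k))) atTop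
      (𝓝 (energyForm A u φ)) := by
  simp only [energyForm_eq_sum hA]
  refine tendsto_finsetSum _ fun q _ => ?_
  have hF := hA.memLp_flux u q
  have hG := φ.memLp_grad_apply q
  have hv := hφ q.2
  set F : Space n → ℂ := fun z => flux A u z q
  have hmem := fun k => (φ.cutoff hφ (hζ.contDiff k) (hζ.norm_le k)
    (hζ.fderiv_le k)).memLp_grad_apply q
  have he : ∀ k z, (φ.cutoff hφ (hζ.contDiff k) (hζ.norm_le k) (hζ.fderiv_le k)).grad z q
      = (ζ k z.2 : ℂ) * φ.grad z q
        + ((fderiv ℝ (ζ k) z.2 (dir q.1 : Space n).2 : ℝ) : ℂ) * φ.toFun z q.2 := fun k z => by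
    rw [← fderiv_comp_snd ((hζ.contDiff k).differentiable (by simp))]
    rfl
  have hFG : Integrable (fun z => ‖F z * φ.grad z q‖ + C * ‖F z * φ.toFun z q.2‖)
      (volume.restrict (half n)) :=
    (integrable_mul_of_memLp hF hG).norm.add ((integrable_mul_of_memLp hF hv).norm.const_mul C)
  refine tendsto_integral_of_dominated_convergence _
    (fun k => hF.1.mul (memLp_conj (hmem k)).1) hFG (fun k => ae_of_all _ fun z => ?_)
    (ae_of_all _ fun z => ?_)
  · rw [norm_mul, RCLike.norm_conj, he, norm_mul, norm_mul]
    have h1 : ‖fderiv ℝ (ζ k) z.2 (dir q.1 : Space n).2‖ ≤ C :=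
      (hζ.fderiv_apply_le k z.2 (norm_snd_dir_le q.1)).trans
        (div_le_self hC (by linarith [k.cast_nonneg (α := ℝ)]))
    have h2 : ‖(ζ k z.2 : ℂ) * φ.grad z q
        + ((fderiv ℝ (ζ k) z.2 (dir q.1 : Space n).2 : ℝ) : ℂ) * φ.toFun z q.2‖
        ≤ 1 * ‖φ.grad z q‖ + C * ‖φ.toFun z q.2‖ := by
      refine (norm_add_le _ _).trans ?_
      rw [norm_mul, norm_mul, Complex.norm_real, Complex.norm_real]
      exact add_le_add (mul_le_mul_of_nonneg_right (hζ.norm_le k _) (norm_nonneg _))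
        (mul_le_mul_of_nonneg_right h1 (norm_nonneg _))
    refine (mul_le_mul_of_nonneg_left h2 (norm_nonneg _)).trans_eq ?_
    ring
  · refine Tendsto.const_mul _ ?_
    refine (Complex.continuous_conj.tendsto (φ.grad z q)).comp ?_
    simp only [he]
    have h2 : Tendsto (fun k => ((fderiv ℝ (ζ k) z.2 (dir q.1 : Space n).2 : ℝ) : ℂ)) atTop
        (𝓝 0) := by
      refine squeeze_zero_norm (fun k => ?_) (tendsto_div_add_one C)
      rw [Complex.norm_real]
      exact hζ.fderiv_apply_le k z.2 (norm_snd_dir_le q.1)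
    simpa using ((hζ.tendsto z.2).mul_const (φ.grad z q)).add (h2.mul_const (φ.toFun z q.2))

/-- The energy form of `u` and the translates of `φ` in the boundary directions. -/
def energyCorrel (A : Coeff n m) (u φ : EnergyFunction n m) (y : Bdry n) : ℂ :=
  ∑ q, correl (bdryIncl n) ((half n : Set (Space n)).indicator fun z => flux A u z q)
    ((half n : Set (Space n)).indicator fun z => conj (φ.grad z q)) y

theorem memLp_indicator_flux (hA : IsBoundedMeasurable A) (u : EnergyFunction n m)
    (q : Fin (n + 1) × Fin m) :
    MemLp ((half n : Set (Space n)).indicator fun z => flux A u z q) 2 volume :=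
  (memLp_indicator_iff_restrict measurableSet_half).2 (hA.memLp_flux u q)

theorem EnergyFunction.memLp_indicator_conj_grad (φ : EnergyFunction n m)
    (q : Fin (n + 1) × Fin m) :
    MemLp ((half n : Set (Space n)).indicator fun z => conj (φ.grad z q)) 2 volume :=
  (memLp_indicator_iff_restrict measurableSet_half).2 (memLp_conj (φ.memLp_grad_apply q))

theorem continuous_energyCorrel (hA : IsBoundedMeasurable A) (u φ : EnergyFunction n m) :
    Continuous (energyCorrel A u φ) :=
  continuous_finsetSum _ fun q _ => continuous_correl (bdryIncl n) (memLp_indicator_flux hA u q)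
    (φ.memLp_indicator_conj_grad q)

theorem tendsto_energyCorrel (hA : IsBoundedMeasurable A) (u φ : EnergyFunction n m) :
    Tendsto (energyCorrel A u φ) (cocompact _) (𝓝 0) := by
  have := tendsto_finsetSum Finset.univ fun q _ => tendsto_correl_cocompact (bdryIncl n)
    norm_le_norm_bdryIncl (memLp_indicator_flux hA u q) (φ.memLp_indicator_conj_grad q)
  rw [Finset.sum_const_zero] at this
  exact this

theorem energyCorrel_zero (hA : IsBoundedMeasurable A) (u φ : EnergyFunction n m) :
    energyCorrel A u φ 0 = energyForm A u φ := by
  rw [energyForm_eq_sum hA]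
  refine Finset.sum_congr rfl fun q _ => ?_
  rw [correl, ← integral_indicator measurableSet_half]
  refine integral_congr_ae (ae_of_all _ fun z => ?_)
  simp only [map_zero, sub_zero]
  exact (congrFun (Set.indicator_mul (half n : Set (Space n)) (fun z => flux A u z q)
    (fun z => conj (φ.grad z q))) z).symm

theorem energyForm_tangConv (hA : IsBoundedMeasurable A) (u φ : EnergyFunction n m)
    {K : Bdry n → ℝ} (hK : Continuous K) (hKc : HasCompactSupport K) :
    energyForm A u (φ.tangConv hK hKc) = ∫ y, (K y : ℂ) * energyCorrel A u φ y := by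
  have hKi : Integrable K volume := hK.integrable_of_hasCompactSupport hKc
  have hc : ∀ q, Integrable (fun y => (K y : ℂ) * correl (bdryIncl n)
      ((half n : Set (Space n)).indicator fun z => flux A u z q)
      ((half n : Set (Space n)).indicator fun z => conj (φ.grad z q)) y) volume := fun q =>
    ((Complex.continuous_ofReal.comp hK).mul (continuous_correl (bdryIncl n)
      (memLp_indicator_flux hA u q)
      (φ.memLp_indicator_conj_grad q))).integrable_of_hasCompactSupport
      ((hKc.comp_left (g := fun r : ℝ => (r : ℂ)) Complex.ofReal_zero).mul_right)
  simp only [energyCorrel, Finset.mul_sum]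
  rw [integral_finsetSum _ fun q _ => hc q, energyForm_eq_sum hA]
  refine Finset.sum_congr rfl fun q _ => ?_
  rw [← integral_mul_tconv_eq_correl (bdryIncl n) hKi (memLp_indicator_flux hA u q)
    (φ.memLp_indicator_conj_grad q), tconv_indicator_half, ← integral_indicator measurableSet_half]
  refine integral_congr_ae (ae_of_all _ fun z => ?_)
  have h1 : ∀ z, conj ((φ.tangConv hK hKc).grad z q)
      = tconv (bdryIncl n) K (fun z => conj (φ.grad z q)) z := fun z => conj_tconv _ _ _ _
  simp only [h1]
  exact congrFun (Set.indicator_mul (half n : Set (Space n)) (fun z => flux A u z q)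
    (tconv (bdryIncl n) K fun z => conj (φ.grad z q))) z

/-- The test function `ζ (∂_j κ * f)`. -/
def cutoffConv {ζ : Bdry n → ℝ} (hζ : ContDiff ℝ ((⊤ : ℕ∞) : WithTop ℕ∞) ζ)
    (hζc : HasCompactSupport ζ) {κ : Bdry n → ℝ} (hκ : ContDiff ℝ ((⊤ : ℕ∞) : WithTop ℕ∞) κ)
    (hκc : HasCompactSupport κ) (j : Fin n) {f : Bdry n → EuclideanSpace ℂ (Fin m)}
    (hf : ∀ α, LocallyIntegrable (fun x => f x α) volume) : VecTest n (Fin m) :=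
  cutoffTest hζ hζc fun α => contDiff_tconv_id
    (K := fun y => fderiv ℝ κ y (EuclideanSpace.single j 1))
    ((hκ.fderiv_right (by simp)).clm_apply contDiff_const) (hκc.fderiv_apply (𝕜 := ℝ) _) (hf α)

/-- A conormal derivative is known only on energy functions with test functions as traces. After
convolution with ∂_jκ and cutoff the trace of φ is one, and the cutoff is removed in the form, not
in the pairing. -/
theorem tendsto_pairing_cutoffConv (hA : IsBoundedMeasurable A) {u : EnergyFunction n m}
    {T : VecDistr n (Fin m)} (hT : IsConormalDerivative A u T) {φ : EnergyFunction n m}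
    {f : Bdry n → EuclideanSpace ℂ (Fin m)} (hφ : IsTrace φ f) {C : ℝ} (hC : 0 ≤ C)
    {ζ : ℕ → Bdry n → ℝ} (hζ : IsCutoffSeq C ζ) {κ : Bdry n → ℝ}
    (hκ : ContDiff ℝ ((⊤ : ℕ∞) : WithTop ℕ∞) κ) (hκc : HasCompactSupport κ) (j : Fin n) :
    Tendsto (fun k => pairing T (cutoffConv (hζ.contDiff k) (hζ.hasCompactSupport k) hκ hκc j
      hφ.locallyIntegrable)) atTop
      (𝓝 (-∫ y, ((fderiv ℝ κ y (EuclideanSpace.single j 1) : ℝ) : ℂ) * energyCorrel A u φ y)) := by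
  have hK : Continuous fun y => fderiv ℝ κ y (EuclideanSpace.single j 1) :=
    (hκ.continuous_fderiv (by simp)).clm_apply continuous_const
  have hKc : HasCompactSupport fun y => fderiv ℝ κ y (EuclideanSpace.single j 1) :=
    hκc.fderiv_apply (𝕜 := ℝ) _
  rw [← energyForm_tangConv hA u φ hK hKc]
  have h1 := (tendsto_energyForm_cutoff hA u (φ.tangConv hK hKc)
    (φ.memLp_tangConv hκ hκc j) hC hζ).neg
  refine h1.congr fun k => ?_
  rw [neg_eq_iff_eq_neg]
  exact hT _ (cutoffConv (hζ.contDiff k) (hζ.hasCompactSupport k) hκ hκc j hφ.locallyIntegrable)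
    ((hφ.tangConv hK hKc).cutoff _ _ _ _)

/-- Convolution with the partial derivatives of `κ` and with their reflections is bounded on
`L^p`. -/
def KernelBound (p : ℝ) (C : ℝ≥0) (κ : Bdry n → ℝ) : Prop :=
  ∀ (j : Fin n) (g : Bdry n → ℂ), MemLp g (ENNReal.ofReal p) volume →
    eLpNorm (tconv (ContinuousLinearMap.id ℝ (Bdry n))
      (fun y => fderiv ℝ κ y (EuclideanSpace.single j 1)) g) (ENNReal.ofReal p) volume
      ≤ C * eLpNorm g (ENNReal.ofReal p) volume ∧
    eLpNorm (tconv (-ContinuousLinearMap.id ℝ (Bdry n))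
      (fun y => fderiv ℝ κ y (EuclideanSpace.single j 1)) g) (ENNReal.ofReal p) volume
      ≤ C * eLpNorm g (ENNReal.ofReal p) volume

/-- This replaces the pairing of `T` with the trace `f`, which need not make sense. The form with
translates of φ is continuous and vanishes at infinity, so its value at 0 is recovered up to ε from
its integral against div κ; each of the `n` terms is minus a limit of pairings with test functions.
The required bound `c` must not depend on κ beyond `KernelBound`, but it may hold only for late k
and up to an error, since k tends to infinity before κ changes. -/
theorem exists_norm_energyForm_le (hn : 1 ≤ n) {p q : ℝ} (hpq : p.HolderConjugate q) :
    ∃ C₀ : ℝ≥0, ∀ (A : Coeff n m), IsBoundedMeasurable A → ∀ (u : EnergyFunction n m)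
      (T : VecDistr n (Fin m)), IsConormalDerivative A u T → ∀ (φ : EnergyFunction n m)
      (f : Bdry n → EuclideanSpace ℂ (Fin m)) (hφ : IsTrace φ f) (C : ℝ), 0 ≤ C →
      ∀ (ζ : ℕ → Bdry n → ℝ) (hζ : IsCutoffSeq C ζ) (c : ℝ),
      (∀ (κ : Bdry n → ℝ) (hκ : ContDiff ℝ ((⊤ : ℕ∞) : WithTop ℕ∞) κ) (hκc : HasCompactSupport κ)
        (j : Fin n), KernelBound p C₀ κ → ∀ ε : ℝ, 0 < ε → ∀ᶠ k in atTop,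
        ‖pairing T (cutoffConv (hζ.contDiff k) (hζ.hasCompactSupport k) hκ hκc j
          hφ.locallyIntegrable)‖ ≤ c + ε) →
      ‖energyForm A u φ‖ ≤ n * c := by
  obtain ⟨C₀, hC₀⟩ := exists_rieszKernel hn hpq
  refine ⟨C₀, fun A hA u T hT φ f hφ C hC ζ hζ c h => le_of_forall_pos_le_add fun ε hε => ?_⟩
  obtain ⟨κ, hκ, hκc, h1, h2, h3⟩ := hC₀ _ (continuous_energyCorrel hA u φ)
    (tendsto_energyCorrel hA u φ) ε hε
  rw [energyCorrel_zero hA] at h3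
  have hb : ∀ i, ‖∫ y, ((fderiv ℝ (κ i) y (EuclideanSpace.single i 1) : ℝ) : ℂ)
      * energyCorrel A u φ y‖ ≤ c := fun i => le_of_forall_pos_le_add fun δ hδ => by
    have := le_of_tendsto (tendsto_pairing_cutoffConv hA hT hφ hC hζ (hκ i) (hκc i) i).norm
      (h (κ i) (hκ i) (hκc i) i (fun j g hg => ⟨h1 i j g hg, h2 i j g hg⟩) δ hδ)
    rwa [norm_neg] at this
  have hi : ∀ i, Integrable (fun y => ((fderiv ℝ (κ i) y (EuclideanSpace.single i 1) : ℝ) : ℂ)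
      * energyCorrel A u φ y) volume := fun i =>
    ((Complex.continuous_ofReal.comp (((hκ i).continuous_fderiv (by simp)).clm_apply
      continuous_const)).mul (continuous_energyCorrel hA u φ)).integrable_of_hasCompactSupport
      ((((hκc i).fderiv_apply (𝕜 := ℝ) _).comp_left (g := fun r : ℝ => (r : ℂ))
        Complex.ofReal_zero).mul_right)
  have hs : ∫ y, ((∑ i, fderiv ℝ (κ i) y (EuclideanSpace.single i 1) : ℝ) : ℂ)
      * energyCorrel A u φ y = ∑ i, ∫ y, ((fderiv ℝ (κ i) y (EuclideanSpace.single i 1) : ℝ) : ℂ)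
      * energyCorrel A u φ y := by
    rw [← integral_finsetSum _ fun i _ => hi i]
    refine integral_congr_ae (ae_of_all _ fun y => ?_)
    simp only
    push_cast
    rw [Finset.sum_mul]
  rw [hs] at h3
  have h4 : ‖∑ i, ∫ y, ((fderiv ℝ (κ i) y (EuclideanSpace.single i 1) : ℝ) : ℂ)
      * energyCorrel A u φ y‖ ≤ n * c := by
    refine (norm_sum_le_of_le _ fun i _ => hb i).trans_eq ?_
    simp
  rw [norm_sub_rev] at h3
  have := norm_le_norm_add_norm_sub' (energyForm A u φ)
    (∑ i, ∫ y, ((fderiv ℝ (κ i) y (EuclideanSpace.single i 1) : ℝ) : ℂ) * energyCorrel A u φ y)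
  linarith

end CutoffPairing

/-! ### Estimates for the pairing -/

section PairingBounds

variable {n m : ℕ} {ι : Type} [Fintype ι]

theorem eLpNorm_toLp_le {Y : Type} [MeasurableSpace Y] {μ : Measure Y} {p : ℝ≥0∞} (hp : 1 ≤ p)
    {g : ι → Y → ℂ} (hg : ∀ a, AEStronglyMeasurable (g a) μ) :
    eLpNorm (fun y => (WithLp.toLp 2 fun a => g a y : EuclideanSpace ℂ ι)) p μ
      ≤ ∑ a, eLpNorm (g a) p μ := by
  calc _ ≤ eLpNorm (∑ a, fun y => ‖g a y‖) p μ := eLpNorm_mono_real fun y => by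
          rw [Finset.sum_apply]
          exact norm_le_sum_norm_apply _
    _ ≤ ∑ a, eLpNorm (fun y => ‖g a y‖) p μ := eLpNorm_sum_le (fun a _ => (hg a).norm) hp
    _ = _ := Finset.sum_congr rfl fun a _ => eLpNorm_norm _

theorem eLpNorm_apply_le {Y : Type} [MeasurableSpace Y] {μ : Measure Y} (p : ℝ≥0∞)
    (g : Y → EuclideanSpace ℂ ι) (a : ι) :
    eLpNorm (fun y => g y a) p μ ≤ eLpNorm g p μ :=
  eLpNorm_mono fun y => PiLp.norm_apply_le (g y) a

theorem fderiv_test_apply (Ψ : VecTest n ι) (x v : Bdry n) (a : ι) :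
    fderiv ℝ Ψ x v a = fderiv ℝ (fun x => Ψ x a) x v := by
  have h := (((EuclideanSpace.proj a : EuclideanSpace ℂ ι →L[ℂ] ℂ).restrictScalars ℝ).hasFDerivAt
    (x := Ψ x)).comp x ((Ψ.contDiff.differentiable (by simp)) x).hasFDerivAt
  exact (congrArg (fun L : Bdry n →L[ℝ] ℂ => L v) h.fderiv).symm

theorem continuous_fderiv_test (Ψ : VecTest n ι) (v : Bdry n) (a : ι) :
    Continuous fun x => fderiv ℝ (fun x => Ψ x a) x v :=
  ((contDiff_test_apply Ψ a).continuous_fderiv (by simp)).clm_apply continuous_const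

theorem sobolevNorm_eq (p : ℝ) (Ψ : VecTest n ι) :
    sobolevNorm p Ψ = eLpNorm (fun x => (WithLp.toLp 2 fun q : Fin n × ι =>
      fderiv ℝ (fun x => Ψ x q.2) x (EuclideanSpace.single q.1 (1 : ℝ)) :
        EuclideanSpace ℂ (Fin n × ι))) (ENNReal.ofReal p) volume := by
  simp only [sobolevNorm, fderiv_test_apply]

theorem sobolevNorm_le_sum {p : ℝ} (hp : 1 ≤ ENNReal.ofReal p) (Ψ : VecTest n ι) :
    sobolevNorm p Ψ ≤ ∑ q : Fin n × ι,
      eLpNorm (fun x => fderiv ℝ (fun x => Ψ x q.2) x (EuclideanSpace.single q.1 (1 : ℝ)))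
        (ENNReal.ofReal p) volume := by
  rw [sobolevNorm_eq]
  exact eLpNorm_toLp_le hp fun q => (continuous_fderiv_test Ψ _ q.2).aestronglyMeasurable

theorem eLpNorm_fderiv_le_sobolevNorm (p : ℝ) (Ψ : VecTest n ι) (q : Fin n × ι) :
    eLpNorm (fun x => fderiv ℝ (fun x => Ψ x q.2) x (EuclideanSpace.single q.1 (1 : ℝ)))
      (ENNReal.ofReal p) volume ≤ sobolevNorm p Ψ := by
  rw [sobolevNorm_eq]
  exact eLpNorm_apply_le _ (fun x => (WithLp.toLp 2 fun q : Fin n × ι =>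
      fderiv ℝ (fun x => Ψ x q.2) x (EuclideanSpace.single q.1 (1 : ℝ)) :
        EuclideanSpace ℂ (Fin n × ι))) q

theorem pairing_smul (T : VecDistr n ι) (r : ℝ) (Ψ : VecTest n ι) :
    pairing T (r • Ψ) = (r : ℂ) * pairing T Ψ := by
  simp only [pairing, map_smul, Finset.mul_sum, Complex.real_smul]
  refine Finset.sum_congr rfl fun a _ => ?_
  ring

theorem sobolevNorm_smul (p r : ℝ) (Ψ : VecTest n ι) :
    sobolevNorm p (r • Ψ) = ‖r‖ₑ * sobolevNorm p Ψ := by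
  rw [sobolevNorm, sobolevNorm, ← eLpNorm_const_smul]
  congr 1
  funext x
  ext q
  have h : (⇑(r • Ψ) : Bdry n → EuclideanSpace ℂ ι) = r • ⇑Ψ := rfl
  simp [h, fderiv_const_smul ((Ψ.contDiff.differentiable (by simp)) x)]

theorem norm_pairing_le {q : ℝ} {T : VecDistr n ι} {N : ℝ} (hN : 0 ≤ N)
    (hT : negSobolevNorm q T ≤ ENNReal.ofReal N) {Ψ : VecTest n ι} {c : ℝ} (hc : 0 ≤ c)
    (hΨ : sobolevNorm q.conjExponent Ψ ≤ ENNReal.ofReal c) : ‖pairing T Ψ‖ ≤ N * c := by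
  refine le_of_forall_pos_le_add fun ε hε => ?_
  -- `c` may be zero, and normalising Ψ needs a positive number; the loss N ε/(N + 1) is at most ε.
  set c' := c + ε / (N + 1) with hc'
  have hpos : 0 < c' := by positivity
  have h1 : sobolevNorm q.conjExponent (c'⁻¹ • Ψ) ≤ 1 := by
    rw [sobolevNorm_smul, Real.enorm_eq_ofReal (by positivity)]
    refine (mul_le_mul_right hΨ _).trans ?_
    rw [← ENNReal.ofReal_mul (by positivity), ← ENNReal.ofReal_one]
    refine ENNReal.ofReal_le_ofReal ?_
    rw [inv_mul_le_iff₀ hpos, mul_one, hc']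
    linarith [div_nonneg hε.le (by linarith : (0 : ℝ) ≤ N + 1)]
  have h2 : ‖pairing T (c'⁻¹ • Ψ)‖ₑ ≤ ENNReal.ofReal N :=
    (le_iSup₂ (f := fun (Ψ : VecTest n ι) (_ : sobolevNorm q.conjExponent Ψ ≤ 1) =>
      ‖pairing T Ψ‖ₑ) (c'⁻¹ • Ψ) h1).trans hT
  rw [← ofReal_norm, ENNReal.ofReal_le_ofReal_iff hN, pairing_smul, norm_mul, Complex.norm_real,
    Real.norm_eq_abs, abs_of_pos (inv_pos.2 hpos), inv_mul_le_iff₀ hpos, hc'] at h2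
  have h3 : N * (ε / (N + 1)) ≤ ε := by
    rw [mul_div_assoc', div_le_iff₀ (by linarith)]
    nlinarith
  nlinarith

theorem distrLpNorm_tangGrad_le {p : ℝ} (Ψ : VecTest n (Fin m)) :
    distrLpNorm p (tangGrad Ψ) ≤ sobolevNorm p Ψ := by
  rw [sobolevNorm_eq]
  refine iInf_le_of_le _ (iInf_le_of_le ?_ (iInf_le_of_le ?_ le_rfl))
  · exact MemLp.of_eval_piLp fun q => (continuous_fderiv_test Ψ _ q.2).memLp_of_hasCompactSupport
      ((hasCompactSupport_test_apply Ψ q.2).fderiv_apply (𝕜 := ℝ) _)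
  · intro q
    refine (lineDeriv_funDistr_eq_iff
      ((contDiff_test_apply Ψ q.2).continuous.locallyIntegrable.locallyIntegrableOn _)
      ((continuous_fderiv_test Ψ _ q.2).locallyIntegrable.locallyIntegrableOn _)).2 ?_
    exact weakDeriv_of_contDiff ((contDiff_test_apply Ψ q.2).of_le (by exact_mod_cast le_top)) _

/-- The derivative is moved to the function with gradient bounded in L^p, and Hölder's inequality is
applied to each of the nm components. This is the easy half of the comparison of norms. -/
theorem negSobolevNorm_tangGrad_le {p q : ℝ} (hpq : p.HolderConjugate q) (Ψ : VecTest n (Fin m))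
    {b : ℝ} (hb : 0 ≤ b)
    (hΨ : ∀ α, eLpNorm (fun x => Ψ x α) (ENNReal.ofReal q) volume ≤ ENNReal.ofReal b) :
    negSobolevNorm q (tangGrad Ψ) ≤ ENNReal.ofReal (n * m * b) := by
  haveI := holderConjugate_ofReal hpq
  refine iSup₂_le fun Ξ hΞ => ?_
  rw [hpq.symm.conjExponent_eq] at hΞ
  rw [← ofReal_norm]
  refine ENNReal.ofReal_le_ofReal ?_
  rw [pairing_tangGrad fun α => (contDiff_test_apply Ψ α).continuous.locallyIntegrable, norm_neg]
  refine (norm_sum_le_of_le (f := fun q : Fin n × Fin m =>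
      ∫ x, conj (fderiv ℝ (fun x => Ξ x q) x (EuclideanSpace.single q.1 1)) * Ψ x q.2)
    (n := fun _ => b) _ fun a _ => ?_).trans_eq ?_
  · have h1 : MemLp (fun x => fderiv ℝ (fun x => Ξ x a) x (EuclideanSpace.single a.1 1))
        (ENNReal.ofReal p) volume :=
      (continuous_fderiv_test Ξ _ a).memLp_of_hasCompactSupport
        ((hasCompactSupport_test_apply Ξ a).fderiv_apply (𝕜 := ℝ) _)
    have h2 : MemLp (fun x => Ψ x a.2) (ENNReal.ofReal q) volume :=
      (contDiff_test_apply Ψ a.2).continuous.memLp_of_hasCompactSupport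
        (hasCompactSupport_test_apply Ψ a.2)
    refine (norm_integral_mul_le (memLp_conj h1) h2).trans ?_
    have h3 : eLpNorm (fun x => conj (fderiv ℝ (fun x => Ξ x a) x (EuclideanSpace.single a.1 1)))
        (ENNReal.ofReal p) volume ≤ 1 := by
      refine (eLpNorm_congr_norm_ae (ae_of_all _ fun x => ?_)).trans_le
        ((eLpNorm_fderiv_le_sobolevNorm p Ξ (a.1, a)).trans hΞ)
      exact RCLike.norm_conj _
    have h4 := ENNReal.toReal_le_of_le_ofReal hb (hΨ a.2)
    have h5 := ENNReal.toReal_mono ENNReal.one_ne_top h3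
    rw [ENNReal.toReal_one] at h5
    exact (mul_le_mul h5 h4 ENNReal.toReal_nonneg zero_le_one).trans_eq (one_mul b)
  · simp

end PairingBounds

/-! ### Estimates for the convolution test functions -/

section ConvolutionBounds

variable {n m : ℕ}

theorem eLpNorm_ofReal_mul_le {Y : Type} [MeasurableSpace Y] {μ : Measure Y} {p : ℝ≥0∞}
    {a : Y → ℝ} {B : ℝ} (ha : ∀ y, ‖a y‖ ≤ B) (f : Y → ℂ) :
    eLpNorm (fun y => (a y : ℂ) * f y) p μ ≤ ENNReal.ofReal B * eLpNorm f p μ :=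
  eLpNorm_le_mul_eLpNorm_of_ae_le_mul (ae_of_all _ fun y => by
    rw [norm_mul, Complex.norm_real]
    exact mul_le_mul_of_nonneg_right (ha y) (norm_nonneg _)) p

theorem fderiv_cutoffConv {ζ : Bdry n → ℝ} (hζ : ContDiff ℝ ((⊤ : ℕ∞) : WithTop ℕ∞) ζ)
    (hζc : HasCompactSupport ζ) {κ : Bdry n → ℝ} (hκ : ContDiff ℝ ((⊤ : ℕ∞) : WithTop ℕ∞) κ)
    (hκc : HasCompactSupport κ) (j : Fin n) {f : Bdry n → EuclideanSpace ℂ (Fin m)}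
    (hf : ∀ α, LocallyIntegrable (fun x => f x α) volume) {α : Fin m} {H : Bdry n → ℂ}
    (hH : LocallyIntegrable H volume)
    (hw : WeakDeriv Set.univ (EuclideanSpace.single j 1) (fun x => f x α) H) (x v : Bdry n) :
    fderiv ℝ (fun x => cutoffConv hζ hζc hκ hκc j hf x α) x v
      = (ζ x : ℂ) * tconv (ContinuousLinearMap.id ℝ (Bdry n)) (fun y => fderiv ℝ κ y v) H x
        + ((fderiv ℝ ζ x v : ℝ) : ℂ) * tconv (ContinuousLinearMap.id ℝ (Bdry n)) κ H x := by
  have e : (fun x => cutoffConv hζ hζc hκ hκc j hf x α)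
      = fun x => (ζ x : ℂ) * tconv (ContinuousLinearMap.id ℝ (Bdry n)) κ H x := by
    funext x
    rw [← tconv_fderiv_id_of_weakDeriv hκ hκc hw]
    rfl
  have hd : DifferentiableAt ℝ ζ x := hζ.differentiable (by simp) x
  have hd' : DifferentiableAt ℝ (fun x => (ζ x : ℂ)) x :=
    (Complex.ofRealCLM.contDiff.comp hζ).differentiable (by simp) x
  have ht := (contDiff_tconv_id hκ hκc hH).differentiable (by simp) x
  rw [e, fderiv_fun_mul hd' ht, ← fderiv_tconv_id (hκ.of_le (by exact_mod_cast le_top)) hκc hH,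
    ← fderiv_ofReal_comp hd]
  simp only [_root_.add_apply, _root_.smul_apply, smul_eq_mul]
  ring

/-- One derivative of the kernel is moved to `f`, so the test function is ζ(κ * H_j). If ∂_i meets
κ, the operator bound C₀ applies. If it meets ζ, only Young's inequality is available and the bound
depends on κ, but it carries the factor `c`, which tends to zero as the cutoff spreads. -/
theorem sobolevNorm_cutoffConv_le {p : ℝ} (hp : 1 < p) {ζ : Bdry n → ℝ}
    (hζ : ContDiff ℝ ((⊤ : ℕ∞) : WithTop ℕ∞) ζ) (hζc : HasCompactSupport ζ)
    (hζ1 : ∀ x, ‖ζ x‖ ≤ 1) {c : ℝ} (hc : 0 ≤ c)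
    (hζ2 : ∀ (x : Bdry n) (v : Bdry n), ‖v‖ ≤ 1 → ‖fderiv ℝ ζ x v‖ ≤ c) {κ : Bdry n → ℝ}
    (hκ : ContDiff ℝ ((⊤ : ℕ∞) : WithTop ℕ∞) κ) (hκc : HasCompactSupport κ) {C₀ : ℝ≥0}
    (hb : KernelBound p C₀ κ) (j : Fin n) {f : Bdry n → EuclideanSpace ℂ (Fin m)}
    (hf : ∀ α, LocallyIntegrable (fun x => f x α) volume) {H : Fin n × Fin m → Bdry n → ℂ}
    (hH : ∀ q, MemLp (H q) (ENNReal.ofReal p) volume)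
    (hw : ∀ q, WeakDeriv Set.univ (EuclideanSpace.single q.1 1) (fun x => f x q.2) (H q))
    {D : ℝ} (hD : 0 ≤ D) (hHD : ∀ q, eLpNorm (H q) (ENNReal.ofReal p) volume ≤ ENNReal.ofReal D) :
    sobolevNorm p (cutoffConv hζ hζc hκ hκc j hf)
      ≤ ENNReal.ofReal (n * m * (C₀ * D + c * ((eLpNorm κ 1 volume).toReal * D))) := by
  have h1p : 1 ≤ ENNReal.ofReal p := by
    rw [← ENNReal.ofReal_one]; exact ENNReal.ofReal_le_ofReal hp.le
  have hκi : Integrable κ volume := hκ.continuous.integrable_of_hasCompactSupport hκc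
  refine (sobolevNorm_le_sum h1p _).trans ?_
  refine (Finset.sum_le_sum fun q _ =>
    (?_ : _ ≤ ENNReal.ofReal (C₀ * D + c * ((eLpNorm κ 1 volume).toReal * D)))).trans_eq ?_
  · simp only [fderiv_cutoffConv hζ hζc hκ hκc j hf ((hH (j, q.2)).locallyIntegrable h1p)
      (hw (j, q.2))]
    have hk : Continuous fun y => fderiv ℝ κ y (EuclideanSpace.single q.1 1) :=
      (hκ.continuous_fderiv (by simp)).clm_apply continuous_const
    have hz : Continuous fun y => fderiv ℝ ζ y (EuclideanSpace.single q.1 1) :=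
      (hζ.continuous_fderiv (by simp)).clm_apply continuous_const
    have m1 : AEStronglyMeasurable (fun x => (ζ x : ℂ)
        * tconv (ContinuousLinearMap.id ℝ (Bdry n))
          (fun y => fderiv ℝ κ y (EuclideanSpace.single q.1 1)) (H (j, q.2)) x) volume :=
      (Complex.continuous_ofReal.comp hζ.continuous).aestronglyMeasurable.mul
        (aestronglyMeasurable_tconv _ hk.aestronglyMeasurable (hH (j, q.2)).1)
    have m2 : AEStronglyMeasurable (fun x =>
        ((fderiv ℝ ζ x (EuclideanSpace.single q.1 1) : ℝ) : ℂ)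
          * tconv (ContinuousLinearMap.id ℝ (Bdry n)) κ (H (j, q.2)) x) volume :=
      (Complex.continuous_ofReal.comp hz).aestronglyMeasurable.mul
        (aestronglyMeasurable_tconv _ hκ.continuous.aestronglyMeasurable (hH (j, q.2)).1)
    refine (eLpNorm_add_le m1 m2 h1p).trans ?_
    rw [ENNReal.ofReal_add (by positivity) (by positivity)]
    refine add_le_add ?_ ?_
    · refine (eLpNorm_ofReal_mul_le hζ1 _).trans ?_
      rw [ENNReal.ofReal_one, one_mul]
      refine ((hb q.1 _ (hH (j, q.2))).1).trans ?_
      rw [ENNReal.ofReal_mul (by positivity), ENNReal.ofReal_coe_nnreal]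
      exact mul_le_mul_right (hHD _) _
    · refine (eLpNorm_ofReal_mul_le (fun x => hζ2 x _ (by simp)) _).trans ?_
      rw [ENNReal.ofReal_mul hc, ENNReal.ofReal_mul ENNReal.toReal_nonneg,
        ENNReal.ofReal_toReal (memLp_one_iff_integrable.2 hκi).2.ne]
      refine mul_le_mul_right ((eLpNorm_tconv_le _ hκi (hH (j, q.2)).1 h1p
        ENNReal.ofReal_ne_top).trans ?_) _
      exact mul_le_mul_right (hHD _) _
  · rw [Finset.sum_const, Finset.card_univ, Fintype.card_prod, Fintype.card_fin, Fintype.card_fin,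
      nsmul_eq_mul, ENNReal.ofReal_mul (by positivity)]
    congr 1
    rw [← Nat.cast_mul, ENNReal.ofReal_natCast]

theorem eventually_norm_pairing_cutoffConv_le {p q : ℝ} (hpq : p.HolderConjugate q)
    {S : VecDistr n (Fin m)} {N : ℝ} (hN : 0 ≤ N) (hS : negSobolevNorm q S ≤ ENNReal.ofReal N)
    {C : ℝ} (hC : 0 ≤ C) {ζ : ℕ → Bdry n → ℝ} (hζ : IsCutoffSeq C ζ) {κ : Bdry n → ℝ}
    (hκ : ContDiff ℝ ((⊤ : ℕ∞) : WithTop ℕ∞) κ) (hκc : HasCompactSupport κ) {C₀ : ℝ≥0}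
    (hb : KernelBound p C₀ κ) (j : Fin n) {f : Bdry n → EuclideanSpace ℂ (Fin m)}
    (hf : ∀ α, LocallyIntegrable (fun x => f x α) volume) {H : Fin n × Fin m → Bdry n → ℂ}
    (hH : ∀ q, MemLp (H q) (ENNReal.ofReal p) volume)
    (hw : ∀ q, WeakDeriv Set.univ (EuclideanSpace.single q.1 1) (fun x => f x q.2) (H q))
    {D : ℝ} (hD : 0 ≤ D) (hHD : ∀ q, eLpNorm (H q) (ENNReal.ofReal p) volume ≤ ENNReal.ofReal D)
    {ε : ℝ} (hε : 0 < ε) :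
    ∀ᶠ k in atTop, ‖pairing S (cutoffConv (hζ.contDiff k) (hζ.hasCompactSupport k) hκ hκc j hf)‖
      ≤ N * (n * m * (C₀ * D)) + ε := by
  -- For fixed κ the contribution of ∇ζ_k vanishes in the limit, so the constant that remains
  -- depends on the kernel only through C₀.
  have hlim : Tendsto (fun k : ℕ => N * (n * m * (C₀ * D
      + C / ((k : ℝ) + 1) * ((eLpNorm κ 1 volume).toReal * D)))) atTop
      (𝓝 (N * (n * m * (C₀ * D + 0 * ((eLpNorm κ 1 volume).toReal * D))))) :=
    ((((tendsto_div_add_one C).mul_const _).const_add _).const_mul _).const_mul _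
  have hlt : N * (n * m * (C₀ * D + 0 * ((eLpNorm κ 1 volume).toReal * D)))
      < N * (n * m * (C₀ * D)) + ε := by
    rw [zero_mul, add_zero]
    linarith
  filter_upwards [hlim.eventually (gt_mem_nhds hlt)] with k hk
  refine le_trans ?_ hk.le
  refine norm_pairing_le hN hS (by positivity) ?_
  rw [hpq.symm.conjExponent_eq]
  exact sobolevNorm_cutoffConv_le hpq.lt _ _ (hζ.norm_le k) (by positivity)
    (fun x v hv => hζ.fderiv_apply_le k x hv) hκ hκc hb j hf hH hw hD hHD

theorem re_tconv {κ : Bdry n → ℝ} (I : Bdry n →L[ℝ] Bdry n) (hκ : Continuous κ)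
    (hκc : HasCompactSupport κ) {θ : Bdry n → ℂ} (hθ : Continuous θ) (x : Bdry n) :
    (tconv I κ θ x).re = tconv I κ (fun x => (θ x).re) x ∧
      (tconv I κ θ x).im = tconv I κ (fun x => (θ x).im) x := by
  have hi : Integrable (fun y => κ y • θ (x - I y)) volume :=
    (hκ.smul (hθ.comp (continuous_const.sub I.continuous))).integrable_of_hasCompactSupport
      hκc.smul_right
  constructor
  · have := (Complex.reCLM.integral_comp_comm hi).symm
    simpa [tconv] using this
  · have := (Complex.imCLM.integral_comp_comm hi).symm
    simpa [tconv] using this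

theorem integral_conj_mul_tconv {κ : Bdry n → ℝ} (hκ : Continuous κ) (hκc : HasCompactSupport κ)
    {f θ : Bdry n → ℂ} (hf : LocallyIntegrable f volume)
    (hθ' : ContDiff ℝ ((⊤ : ℕ∞) : WithTop ℕ∞) θ) (hθc : HasCompactSupport θ) :
    ∫ x, conj (θ x) * tconv (ContinuousLinearMap.id ℝ (Bdry n)) κ f x
      = ∫ x, conj (tconv (-ContinuousLinearMap.id ℝ (Bdry n)) κ θ x) * f x := by
  have hθ := hθ'.continuous
  have hi := hκ.integrable_of_hasCompactSupport (μ := volume) hκc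
  have hg : LocallyIntegrable (tconv (ContinuousLinearMap.id ℝ (Bdry n)) κ f) volume :=
    locallyIntegrableOn_univ.1 (locallyIntegrableOn_tconv _ isOpen_univ (fun _ _ _ => trivial) hi
      hκc (hf.locallyIntegrableOn _))
  have hct : Continuous (tconv (-ContinuousLinearMap.id ℝ (Bdry n)) κ θ) :=
    (contDiff_infty_tconv _ hi hθ' hθc).continuous
  rw [← integral_re_sub_im hθ hθc hg,
    ← integral_re_sub_im hct (hasCompactSupport_tconv _ hκc hθc) hf]
  congr 1
  · refine (integral_mul_tconv_adjoint (θ := fun x => (θ x).re) _ isOpen_univ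
      (fun _ _ _ => trivial) hi hκc (hf.locallyIntegrableOn _) (Complex.continuous_re.comp hθ)
      (hθc.comp_left (g := Complex.re) rfl) (Set.subset_univ _)).trans ?_
    simp only [(re_tconv _ hκ hκc hθ _).1]
  · congr 1
    refine (integral_mul_tconv_adjoint (θ := fun x => (θ x).im) _ isOpen_univ
      (fun _ _ _ => trivial) hi hκc (hf.locallyIntegrableOn _) (Complex.continuous_im.comp hθ)
      (hθc.comp_left (g := Complex.im) rfl) (Set.subset_univ _)).trans ?_
    simp only [(re_tconv _ hκ hκc hθ _).2]

/-- The test function with a single nonzero component. -/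
def slotTest {ι : Type} [Fintype ι] [DecidableEq ι] (a : ι) {g : Bdry n → ℂ}
    (hg : ContDiff ℝ ((⊤ : ℕ∞) : WithTop ℕ∞) g) (hgc : HasCompactSupport g) : VecTest n ι where
  toFun x := WithLp.toLp 2 fun b => if b = a then g x else 0
  contDiff' := (contDiff_piLp 2).2 fun b => by
    by_cases hb : b = a
    · simpa [hb] using hg
    · simpa [hb] using contDiff_const
  hasCompactSupport' := hgc.mono' (by
    intro x hx
    by_contra h
    refine hx ?_
    have h0 : g x = 0 := image_eq_zero_of_notMem_tsupport h
    ext b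
    simp [h0])
  tsupport_subset' := fun _ _ => trivial

theorem slotTest_apply {ι : Type} [Fintype ι] [DecidableEq ι] (a : ι) {g : Bdry n → ℂ}
    (hg : ContDiff ℝ ((⊤ : ℕ∞) : WithTop ℕ∞) g) (hgc : HasCompactSupport g) (x : Bdry n) (b : ι) :
    slotTest a hg hgc x b = if b = a then g x else 0 := rfl

theorem fderiv_slotTest_self {ι : Type} [Fintype ι] [DecidableEq ι] (a : ι) {g : Bdry n → ℂ}
    (hg : ContDiff ℝ ((⊤ : ℕ∞) : WithTop ℕ∞) g) (hgc : HasCompactSupport g) (x v : Bdry n) :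
    fderiv ℝ (fun x => slotTest a hg hgc x a) x v = fderiv ℝ g x v := by
  simp only [slotTest_apply, if_true]

theorem fderiv_slotTest_of_ne {ι : Type} [Fintype ι] [DecidableEq ι] {a b : ι} (hb : b ≠ a)
    {g : Bdry n → ℂ} (hg : ContDiff ℝ ((⊤ : ℕ∞) : WithTop ℕ∞) g) (hgc : HasCompactSupport g)
    (x v : Bdry n) : fderiv ℝ (fun x => slotTest a hg hgc x b) x v = 0 := by
  simp [slotTest_apply, hb]

theorem fderiv_tconv_neg_ae_eq {κ : Bdry n → ℝ} (hκ : ContDiff ℝ ((⊤ : ℕ∞) : WithTop ℕ∞) κ)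
    (hκc : HasCompactSupport κ) {θ : Bdry n → ℂ} (hθ : ContDiff ℝ ((⊤ : ℕ∞) : WithTop ℕ∞) θ)
    (hθc : HasCompactSupport θ) (v : Bdry n) :
    (fun x => fderiv ℝ (tconv (-ContinuousLinearMap.id ℝ (Bdry n)) κ θ) x v) =ᵐ[volume]
      fun x => - tconv (-ContinuousLinearMap.id ℝ (Bdry n)) (fun y => fderiv ℝ κ y v) θ x := by
  have hθ1 : ContDiff ℝ 1 θ := hθ.of_le (by exact_mod_cast le_top)
  have hd : LocallyIntegrable (fun x => fderiv ℝ θ x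
      ((-ContinuousLinearMap.id ℝ (Bdry n)) v)) volume :=
    ((hθ.continuous_fderiv (by simp)).clm_apply continuous_const).locallyIntegrable
  have h := tconv_fderiv_kernel_ae_eq (-ContinuousLinearMap.id ℝ (Bdry n)) (b := v) isOpen_univ
    (fun _ _ _ => trivial) (hκ.of_le (by exact_mod_cast le_top)) hκc
    (hθ.continuous.locallyIntegrable.locallyIntegrableOn _) (hd.locallyIntegrableOn _)
    (weakDeriv_of_contDiff hθ1 _)
  filter_upwards [h] with x hx
  rw [hx trivial, fderiv_tconv_apply _ (hκ.continuous.integrable_of_hasCompactSupport hκc) hθ1 hθc]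
  simp only [tconv, ← integral_neg]
  refine integral_congr_ae (ae_of_all _ fun y => ?_)
  simp

/-- Convolution is moved to ζg: up to conjugation, the integral is the pairing of ∇f with the
reflected convolution of κ with ζg, placed in the slot (j, α). All first derivatives of that
convolution are bounded in L^p by the reflected half of `KernelBound`. No derivative falls on ζ, so
the estimate holds for every cutoff. This is the singular half of the comparison of norms. -/
theorem norm_integral_cutoffConv_le {p q : ℝ} (hpq : p.HolderConjugate q)
    {f : Bdry n → EuclideanSpace ℂ (Fin m)}
    (hf : ∀ α, LocallyIntegrable (fun x => f x α) volume) {N : ℝ} (hN : 0 ≤ N)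
    (hfN : negSobolevNorm q (tangGrad f) ≤ ENNReal.ofReal N) {ζ : Bdry n → ℝ}
    (hζ : ContDiff ℝ ((⊤ : ℕ∞) : WithTop ℕ∞) ζ) (hζc : HasCompactSupport ζ)
    (hζ1 : ∀ x, ‖ζ x‖ ≤ 1) {κ : Bdry n → ℝ}
    (hκ : ContDiff ℝ ((⊤ : ℕ∞) : WithTop ℕ∞) κ) (hκc : HasCompactSupport κ) {C₀ : ℝ≥0}
    (hb : KernelBound p C₀ κ) (j : Fin n) (α : Fin m) {g : Bdry n → ℂ}
    (hg : ContDiff ℝ ((⊤ : ℕ∞) : WithTop ℕ∞) g) (hgc : HasCompactSupport g) :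
    ‖∫ x, conj (cutoffConv hζ hζc hκ hκc j hf x α) * g x‖
      ≤ N * (n * (n * m) * (C₀ * (eLpNorm g (ENNReal.ofReal p) volume).toReal)) := by
  have h1p : 1 ≤ ENNReal.ofReal p := by
    rw [← ENNReal.ofReal_one]; exact ENNReal.ofReal_le_ofReal hpq.lt.le
  set θ : Bdry n → ℂ := fun x => (ζ x : ℂ) * g x with hθdef
  have hθ : ContDiff ℝ ((⊤ : ℕ∞) : WithTop ℕ∞) θ := (Complex.ofRealCLM.contDiff.comp hζ).mul hg
  have hθc : HasCompactSupport θ := hgc.mul_left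
  have hgp : MemLp g (ENNReal.ofReal p) volume := hg.continuous.memLp_of_hasCompactSupport hgc
  have hθp : MemLp θ (ENNReal.ofReal p) volume := hθ.continuous.memLp_of_hasCompactSupport hθc
  have hθg : eLpNorm θ (ENNReal.ofReal p) volume ≤ eLpNorm g (ENNReal.ofReal p) volume := by
    refine (eLpNorm_ofReal_mul_le hζ1 g).trans_eq ?_
    rw [ENNReal.ofReal_one, one_mul]
  have hκi : Integrable κ volume := hκ.continuous.integrable_of_hasCompactSupport hκc
  have hk : ∀ v, Continuous fun y => fderiv ℝ κ y v := fun v =>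
    (hκ.continuous_fderiv (by simp)).clm_apply continuous_const
  have hkc : ∀ v, HasCompactSupport fun y => fderiv ℝ κ y v := fun v =>
    hκc.fderiv_apply (𝕜 := ℝ) _
  set w := tconv (-ContinuousLinearMap.id ℝ (Bdry n)) κ θ with hw
  have hws : ContDiff ℝ ((⊤ : ℕ∞) : WithTop ℕ∞) w := contDiff_infty_tconv _ hκi hθ hθc
  have hwc : HasCompactSupport w := hasCompactSupport_tconv _ hκc hθc
  have hdw : ∀ v, (fun x => fderiv ℝ w x v) =ᵐ[volume]
      fun x => - tconv (-ContinuousLinearMap.id ℝ (Bdry n)) (fun y => fderiv ℝ κ y v) θ x :=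
    fun v => fderiv_tconv_neg_ae_eq hκ hκc hθ hθc v
  have hpair : pairing (tangGrad f) (slotTest (j, α) hws hwc)
      = conj (∫ x, conj (cutoffConv hζ hζc hκ hκc j hf x α) * g x) := by
    rw [pairing_tangGrad hf, Finset.sum_eq_single (j, α)]
    · simp only [fderiv_slotTest_self]
      have e1 : ∫ x, conj (fderiv ℝ w x (EuclideanSpace.single j 1)) * f x α
          = - ∫ x, conj (tconv (-ContinuousLinearMap.id ℝ (Bdry n))
            (fun y => fderiv ℝ κ y (EuclideanSpace.single j 1)) θ x) * f x α := by
        rw [← integral_neg]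
        refine integral_congr_ae ?_
        filter_upwards [hdw (EuclideanSpace.single j 1)] with x hx
        rw [hx, map_neg, neg_mul]
      rw [e1, neg_neg, ← integral_conj_mul_tconv (hk _) (hkc _) (hf α) hθ hθc, ← integral_conj]
      refine integral_congr_ae (ae_of_all _ fun x => ?_)
      have e2 : cutoffConv hζ hζc hκ hκc j hf x α = (ζ x : ℂ)
          * tconv (ContinuousLinearMap.id ℝ (Bdry n))
            (fun y => fderiv ℝ κ y (EuclideanSpace.single j 1)) (fun x => f x α) x := rfl
      simp only [e2, hθdef, map_mul, Complex.conj_conj, Complex.conj_ofReal]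
      ring
    · intro b _ hb
      simp [fderiv_slotTest_of_ne hb]
    · simp
  rw [← RCLike.norm_conj, ← hpair]
  refine norm_pairing_le hN hfN (by positivity) ?_
  rw [hpq.symm.conjExponent_eq]
  refine (sobolevNorm_le_sum h1p _).trans ?_
  refine (Finset.sum_le_sum fun a _ => (?_ : _ ≤
    ENNReal.ofReal (C₀ * (eLpNorm g (ENNReal.ofReal p) volume).toReal))).trans_eq ?_
  · by_cases ha : a.2 = (j, α)
    · rw [ha]
      simp only [fderiv_slotTest_self]
      refine ((eLpNorm_congr_ae (hdw _)).trans (eLpNorm_neg _ _ _)).trans_le ?_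
      refine ((hb a.1 θ hθp).2).trans ?_
      rw [ENNReal.ofReal_mul (by positivity), ENNReal.ofReal_coe_nnreal,
        ENNReal.ofReal_toReal hgp.2.ne]
      exact mul_le_mul_right hθg _
    · simp [fderiv_slotTest_of_ne ha]
  · rw [Finset.sum_const, Finset.card_univ, nsmul_eq_mul, ← ENNReal.ofReal_natCast,
      ← ENNReal.ofReal_mul (by positivity)]
    simp only [Fintype.card_prod, Fintype.card_fin, Nat.cast_mul]

/-- Smooth functions of compact support are dense in L^p, and the cut-off convolution, being itself
such a function, is in L^q; the two sides are therefore continuous in `h`. -/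
theorem norm_integral_cutoffConv_le_of_memLp {p q : ℝ} (hpq : p.HolderConjugate q)
    {f : Bdry n → EuclideanSpace ℂ (Fin m)}
    (hf : ∀ α, LocallyIntegrable (fun x => f x α) volume) {N : ℝ} (hN : 0 ≤ N)
    (hfN : negSobolevNorm q (tangGrad f) ≤ ENNReal.ofReal N) {ζ : Bdry n → ℝ}
    (hζ : ContDiff ℝ ((⊤ : ℕ∞) : WithTop ℕ∞) ζ) (hζc : HasCompactSupport ζ)
    (hζ1 : ∀ x, ‖ζ x‖ ≤ 1) {κ : Bdry n → ℝ}
    (hκ : ContDiff ℝ ((⊤ : ℕ∞) : WithTop ℕ∞) κ) (hκc : HasCompactSupport κ) {C₀ : ℝ≥0}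
    (hb : KernelBound p C₀ κ) (j : Fin n) (α : Fin m) {h : Bdry n → ℂ}
    (hh : MemLp h (ENNReal.ofReal p) volume) :
    ‖∫ x, conj (cutoffConv hζ hζc hκ hκc j hf x α) * h x‖
      ≤ N * (n * (n * m) * (C₀ * (eLpNorm h (ENNReal.ofReal p) volume).toReal)) := by
  haveI := holderConjugate_ofReal hpq
  have h1p : 1 ≤ ENNReal.ofReal p := by
    rw [← ENNReal.ofReal_one]; exact ENNReal.ofReal_le_ofReal hpq.lt.le
  set Θ : Bdry n → ℂ := fun x => cutoffConv hζ hζc hκ hκc j hf x α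
  have hΘ : MemLp (fun x => conj (Θ x)) (ENNReal.ofReal q) volume :=
    memLp_conj ((contDiff_test_apply _ α).continuous.memLp_of_hasCompactSupport
      (hasCompactSupport_test_apply _ α))
  set L := (eLpNorm (fun x => conj (Θ x)) (ENNReal.ofReal q) volume).toReal
  have hL : 0 ≤ L := ENNReal.toReal_nonneg
  set B : ℝ := N * (n * (n * m) * C₀) with hB
  have hB0 : 0 ≤ B := by positivity
  refine le_of_forall_pos_le_add fun ε hε => ?_
  -- Replacing `h` by `g` costs Lδ in the integral and Bδ in the bound, together at most ε.
  set δ := ε / (B + L + 1) with hδ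
  have hδ0 : 0 < δ := by positivity
  obtain ⟨g, hgc, hg, hgδ⟩ := hh.exist_eLpNorm_sub_le ENNReal.ofReal_ne_top h1p hδ0
  have hgp : MemLp g (ENNReal.ofReal p) volume := hg.continuous.memLp_of_hasCompactSupport hgc
  have hd := hh.sub hgp
  have hhg : (eLpNorm g (ENNReal.ofReal p) volume).toReal
      ≤ (eLpNorm h (ENNReal.ofReal p) volume).toReal + δ := by
    refine ENNReal.toReal_le_of_le_ofReal (by positivity) ?_
    rw [ENNReal.ofReal_add ENNReal.toReal_nonneg hδ0.le, ENNReal.ofReal_toReal hh.2.ne]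
    have : g = h - (h - g) := by simp
    rw [this]
    exact (eLpNorm_sub_le hh.1 hd.1 h1p).trans (add_le_add_right hgδ _)
  have hsplit : ∫ x, conj (Θ x) * h x
      = (∫ x, conj (Θ x) * g x) + ∫ x, conj (Θ x) * (h - g) x := by
    haveI : (ENNReal.ofReal q).HolderConjugate (ENNReal.ofReal p) := ENNReal.HolderConjugate.symm
    rw [← integral_add (integrable_mul_of_memLp hΘ hgp) (integrable_mul_of_memLp hΘ hd)]
    refine integral_congr_ae (ae_of_all _ fun x => ?_)
    simp only [Pi.sub_apply]
    ring
  rw [hsplit]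
  refine (norm_add_le _ _).trans ?_
  have h1 : ‖∫ x, conj (Θ x) * g x‖ ≤ _ :=
    norm_integral_cutoffConv_le hpq hf hN hfN hζ hζc hζ1 hκ hκc hb j α hg hgc
  have h2 : ‖∫ x, conj (Θ x) * (h - g) x‖ ≤ L * δ := by
    haveI : (ENNReal.ofReal q).HolderConjugate (ENNReal.ofReal p) := ENNReal.HolderConjugate.symm
    exact (norm_integral_mul_le hΘ hd).trans
      (mul_le_mul_of_nonneg_left (ENNReal.toReal_le_of_le_ofReal hδ0.le hgδ) hL)
  have h3 : B * δ + L * δ ≤ ε := by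
    rw [hδ, ← add_mul, mul_div_assoc', div_le_iff₀ (by positivity)]
    nlinarith
  have h4 := mul_le_mul_of_nonneg_left hhg hB0
  rw [hB] at h3 h4
  linarith

end ConvolutionBounds

/-! ### Duality of the two estimates -/

section Duality

variable {n m : ℕ} {A : Coeff n m}

theorem Garding.adjointCoeff (h : Garding A) : Garding (adjointCoeff A) := by
  obtain ⟨lam, hl, h⟩ := h
  refine ⟨lam, hl, fun g => (h g).trans_eq ?_⟩
  refine integral_congr_ae (ae_of_all _ fun z => ?_)
  have e : ∀ ξ : Fin (n + 1) × Fin m → ℂ,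
      (HalfSpaceSystem.adjointCoeff A z *ᵥ ξ) ⬝ᵥ star ξ = star ((A z *ᵥ ξ) ⬝ᵥ star ξ) := fun ξ => by
    rw [← Matrix.star_dotProduct_star, star_star, Matrix.star_mulVec, dotProduct_comm,
      HalfSpaceSystem.adjointCoeff, Matrix.dotProduct_mulVec, dotProduct_comm]
  simp only [e]
  exact (Complex.conj_re _).symm

/-- A real test function as a complex one with a single nonzero component. -/
def realSlot (α : Fin m) (ψ : 𝓓((⊤ : TopologicalSpace.Opens (Bdry n)), ℝ)) : VecTest n (Fin m) :=
  slotTest α (g := fun x => (ψ x : ℂ)) (Complex.ofRealCLM.contDiff.comp ψ.contDiff)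
    (ψ.hasCompactSupport.comp_left (g := fun r : ℝ => (r : ℂ)) Complex.ofReal_zero)

theorem realSlot_apply (α : Fin m) (ψ : 𝓓((⊤ : TopologicalSpace.Opens (Bdry n)), ℝ)) (x : Bdry n)
    (b : Fin m) : realSlot α ψ x b = if b = α then (ψ x : ℂ) else 0 := rfl

theorem pairing_realSlot (T : VecDistr n (Fin m)) (α : Fin m)
    (ψ : 𝓓((⊤ : TopologicalSpace.Opens (Bdry n)), ℝ)) : pairing T (realSlot α ψ) = T α ψ := by
  rw [pairing, Finset.sum_eq_single α]
  · have h1 : TestFunction.postcompCLM (Complex.reCLM ∘L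
        (EuclideanSpace.proj α : EuclideanSpace ℂ (Fin m) →L[ℂ] ℂ).restrictScalars ℝ)
        (realSlot α ψ) = ψ := by
      ext x
      change (realSlot α ψ x α).re = ψ x
      simp [realSlot_apply]
    have h2 : TestFunction.postcompCLM (Complex.imCLM ∘L
        (EuclideanSpace.proj α : EuclideanSpace ℂ (Fin m) →L[ℂ] ℂ).restrictScalars ℝ)
        (realSlot α ψ) = 0 := by
      ext x
      change (realSlot α ψ x α).im = 0
      simp [realSlot_apply]
    rw [h1, h2, map_zero, mul_zero, sub_zero]
  · intro b _ hb
    have h1 : TestFunction.postcompCLM (Complex.reCLM ∘L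
        (EuclideanSpace.proj b : EuclideanSpace ℂ (Fin m) →L[ℂ] ℂ).restrictScalars ℝ)
        (realSlot α ψ) = 0 := by
      ext x
      change (realSlot α ψ x b).re = 0
      simp [realSlot_apply, hb]
    have h2 : TestFunction.postcompCLM (Complex.imCLM ∘L
        (EuclideanSpace.proj b : EuclideanSpace ℂ (Fin m) →L[ℂ] ℂ).restrictScalars ℝ)
        (realSlot α ψ) = 0 := by
      ext x
      change (realSlot α ψ x b).im = 0
      simp [realSlot_apply, hb]
    rw [h1, h2, map_zero, mul_zero, sub_zero]
  · simp

/-- For a test function Ψ with ‖∇Ψ‖_p ≤ 1 the solution `u` with trace Ψ has conormal derivative in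
L^p with norm at most C. The pairing to be bounded is, up to sign and conjugation, the form of `u`
with `w`, and `exists_norm_energyForm_le` reduces it to integrals of an L^p function against
convolutions of w₀. -/
theorem negSobolev_estimate_of_distrLp_estimate (hn : 1 ≤ n) (hA : IsBoundedMeasurable A)
    (hG : Garding A) {p q : ℝ} (hpq : p.HolderConjugate q) {C : ℝ≥0}
    (h : ∀ u : EnergyFunction n m, IsSolution A u →
      ∀ u₀ : Bdry n → EuclideanSpace ℂ (Fin m), IsTrace u u₀ →
      ∀ T : VecDistr n (Fin m), IsConormalDerivative A u T →
        distrLpNorm p T ≤ C * distrLpNorm p (tangGrad u₀)) :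
    ∃ C' : ℝ≥0, 0 < C' ∧
      ∀ w : EnergyFunction n m, IsSolution (adjointCoeff A) w →
      ∀ w₀ : Bdry n → EuclideanSpace ℂ (Fin m), IsTrace w w₀ →
      ∀ T : VecDistr n (Fin m), IsConormalDerivative (adjointCoeff A) w T →
        negSobolevNorm q T ≤ C' * negSobolevNorm q (tangGrad w₀) := by
  have h1p : 1 ≤ ENNReal.ofReal p := by
    rw [← ENNReal.ofReal_one]; exact ENNReal.ofReal_le_ofReal hpq.lt.le
  obtain ⟨C₀, hC₀⟩ := exists_norm_energyForm_le (m := m) hn hpq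
  obtain ⟨Cζ, ζ, hCζ, hζ⟩ := exists_isCutoffSeq n
  refine ⟨n * (m * (n * (n * m) * (C₀ * (C + 1)))) + 1, by positivity,
    fun w _ w₀ hw₀ S hS => ?_⟩
  by_cases hN : negSobolevNorm q (tangGrad w₀) = ∞
  · rw [hN, ENNReal.mul_top (by positivity)]
    exact le_top
  set N := (negSobolevNorm q (tangGrad w₀)).toReal with hNdef
  have hN0 : 0 ≤ N := ENNReal.toReal_nonneg
  have hNe : negSobolevNorm q (tangGrad w₀) = ENNReal.ofReal N := (ENNReal.ofReal_toReal hN).symm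
  rw [hNe]
  refine iSup₂_le fun Ψ hΨ => ?_
  rw [hpq.symm.conjExponent_eq] at hΨ
  obtain ⟨u, hu, hu₀⟩ := exists_isSolution hA hG Ψ
  obtain ⟨T, hT⟩ := exists_isConormalDerivative hA hu
  -- The norm is an infimum over representing functions; the strict inequality selects one.
  have hlt : distrLpNorm p T < C + 1 :=
    (((h u hu Ψ hu₀ T hT).trans (mul_le_mul_right ((distrLpNorm_tangGrad_le Ψ).trans hΨ) _)).trans_eq
      (mul_one _)).trans_lt (ENNReal.lt_add_right ENNReal.coe_ne_top one_ne_zero)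
  simp only [distrLpNorm, iInf_lt_iff] at hlt
  obtain ⟨F, hF, hTF, hFn⟩ := hlt
  have hFn' : ∀ α, (eLpNorm (fun x => F x α) (ENNReal.ofReal p) volume).toReal ≤ C + 1 := fun α => by
    refine ENNReal.toReal_le_of_le_ofReal (by positivity) ?_
    refine ((eLpNorm_apply_le _ F α).trans hFn.le).trans_eq ?_
    rw [ENNReal.ofReal_add (by positivity) zero_le_one, ENNReal.ofReal_coe_nnreal,
      ENNReal.ofReal_one]
  have hkey := hC₀ A hA u T hT w w₀ hw₀ Cζ hCζ ζ hζ
    -- Here the bound for the pairings holds for every k, without error.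
    (m * (N * (n * (n * m) * (C₀ * (C + 1))))) fun κ hκ hκc j hb ε hε =>
      Eventually.of_forall fun k => by
        rw [pairing_funDistr T (fun α x => F x α)
          (fun α => (hF.eval_piLp α).locallyIntegrable h1p) hTF]
        refine le_trans ?_ (le_add_of_nonneg_right hε.le)
        refine (norm_sum_le_of_le _ fun α _ =>
          (norm_integral_cutoffConv_le_of_memLp hpq hw₀.locallyIntegrable hN0 hNe.le
            (hζ.contDiff k) (hζ.hasCompactSupport k) (hζ.norm_le k) hκ hκc hb j α
            (hF.eval_piLp α)).trans (?_ : _ ≤ N * (n * (n * m) * (C₀ * (C + 1))))).trans_eq ?_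
        · have := hFn' α
          gcongr
        · simp
  have e1 : ‖pairing S Ψ‖ = ‖energyForm A u w‖ := by
    rw [← norm_neg, ← hS u Ψ hu₀, energyForm_adjointCoeff, RCLike.norm_conj]
  rw [← ofReal_norm, e1]
  have e2 : ((n * (m * (n * (n * m) * (C₀ * (C + 1)))) + 1 : ℝ≥0) : ℝ≥0∞) * ENNReal.ofReal N
      = ENNReal.ofReal ((n * (m * (n * (n * m) * (C₀ * (C + 1)))) + 1) * N) := by
    rw [ENNReal.ofReal_mul (by positivity), ← ENNReal.ofReal_coe_nnreal]
    push_cast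
    rfl
  rw [e2]
  refine ENNReal.ofReal_le_ofReal (hkey.trans ?_)
  nlinarith

/-- It is enough to bound `T` on real test functions ψ by their L^q norms. The solution `w` of the
adjoint equation with trace ψ in one slot has conormal derivative in Ẇ^{-1,q} with norm controlled
by ‖ψ‖_q, and it is paired with convolutions of u₀, whose gradients are controlled by ∇u₀ in L^p. -/
theorem distrLp_estimate_of_negSobolev_estimate (hn : 1 ≤ n) (hA : IsBoundedMeasurable A)
    (hG : Garding A) {p q : ℝ} (hpq : p.HolderConjugate q) {C : ℝ≥0}
    (h : ∀ w : EnergyFunction n m, IsSolution (adjointCoeff A) w →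
      ∀ w₀ : Bdry n → EuclideanSpace ℂ (Fin m), IsTrace w w₀ →
      ∀ T : VecDistr n (Fin m), IsConormalDerivative (adjointCoeff A) w T →
        negSobolevNorm q T ≤ C * negSobolevNorm q (tangGrad w₀)) :
    ∃ C' : ℝ≥0, 0 < C' ∧
      ∀ u : EnergyFunction n m, IsSolution A u →
      ∀ u₀ : Bdry n → EuclideanSpace ℂ (Fin m), IsTrace u u₀ →
      ∀ T : VecDistr n (Fin m), IsConormalDerivative A u T →
        distrLpNorm p T ≤ C' * distrLpNorm p (tangGrad u₀) := by
  have h1p : 1 ≤ ENNReal.ofReal p := by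
    rw [← ENNReal.ofReal_one]; exact ENNReal.ofReal_le_ofReal hpq.lt.le
  obtain ⟨C₀, hC₀⟩ := exists_norm_energyForm_le (m := m) hn hpq
  obtain ⟨Cζ, ζ, hCζ, hζ⟩ := exists_isCutoffSeq n
  refine ⟨m * (4 * (n * ((C * (n * m)) * (n * m * C₀)))) + 1, by positivity,
    fun u _ u₀ hu₀ T hT => ?_⟩
  -- The added 1 keeps the constant positive even if C or m is zero; multiplication by it then
  -- commutes with the infimum defining the norm of ∇u₀. An infinite right-hand side is the infimum
  -- over the empty set.
  have hne0 : ((m * (4 * (n * ((C * (n * m)) * (n * m * C₀)))) + 1 : ℝ≥0) : ℝ≥0∞) ≠ 0 := by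
    exact_mod_cast (by positivity : (0 : ℝ≥0) <
      m * (4 * (n * ((C * (n * m)) * (n * m * C₀)))) + 1).ne'
  conv_rhs => rw [distrLpNorm]
  simp only [ENNReal.mul_iInf_of_ne hne0 ENNReal.coe_ne_top]
  refine le_iInf fun H => le_iInf fun hH => le_iInf fun hTH => ?_
  set D := (eLpNorm H (ENNReal.ofReal p) volume).toReal with hD
  have hD0 : 0 ≤ D := ENNReal.toReal_nonneg
  have hHD : eLpNorm H (ENNReal.ofReal p) volume = ENNReal.ofReal D :=
    (ENNReal.ofReal_toReal hH.2.ne).symm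
  have hw : ∀ a : Fin n × Fin m, WeakDeriv Set.univ (EuclideanSpace.single a.1 1)
      (fun x => u₀ x a.2) (fun x => H x a) := fun a =>
    (lineDeriv_funDistr_eq_iff (Ω := ⊤) ((hu₀.locallyIntegrable a.2).locallyIntegrableOn _)
      (((hH.eval_piLp a).locallyIntegrable h1p).locallyIntegrableOn _)).1 (hTH a)
  set M : ℝ := n * ((C * (n * m)) * (n * m * (C₀ * D))) with hM
  have hM0 : 0 ≤ M := by positivity
  have hbound : ∀ (α : Fin m) (ψ : 𝓓((⊤ : TopologicalSpace.Opens (Bdry n)), ℝ)),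
      ‖T α ψ‖ ≤ M * (eLpNorm ψ (ENNReal.ofReal q) volume).toReal := by
    intro α ψ
    set b := (eLpNorm ψ (ENNReal.ofReal q) volume).toReal with hb
    have hb0 : 0 ≤ b := ENNReal.toReal_nonneg
    have hψ : MemLp ψ (ENNReal.ofReal q) volume :=
      ψ.contDiff.continuous.memLp_of_hasCompactSupport ψ.hasCompactSupport
    -- The adjoint coefficients satisfy the same hypotheses, so the Dirichlet problem is solvable
    -- for them too.
    obtain ⟨w, hws, hw₀⟩ := exists_isSolution hA.adjointCoeff hG.adjointCoeff (realSlot α ψ)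
    obtain ⟨S, hS⟩ := exists_isConormalDerivative hA.adjointCoeff hws
    have hSn : negSobolevNorm q S ≤ ENNReal.ofReal (C * (n * m * b)) := by
      refine (h w hws _ hw₀ S hS).trans ?_
      rw [ENNReal.ofReal_mul (by positivity), ENNReal.ofReal_coe_nnreal]
      refine mul_le_mul_right (negSobolevNorm_tangGrad_le hpq _ hb0 fun β => ?_) _
      rw [hb, ENNReal.ofReal_toReal hψ.2.ne]
      refine eLpNorm_mono fun x => ?_
      rw [realSlot_apply]
      split_ifs
      · exact (Complex.norm_real _).le
      · simp
    have hkey := hC₀ _ hA.adjointCoeff w S hS u u₀ hu₀ Cζ hCζ ζ hζ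
      (C * (n * m * b) * (n * m * (C₀ * D))) fun κ hκ hκc j hκb ε hε =>
        eventually_norm_pairing_cutoffConv_le hpq (by positivity) hSn hCζ hζ hκ hκc hκb j
          hu₀.locallyIntegrable (H := fun a x => H x a) (fun a => hH.eval_piLp a) hw hD0
          (fun a => (eLpNorm_apply_le _ H a).trans hHD.le) hε
    have e1 : ‖T α ψ‖ = ‖energyForm (adjointCoeff A) w u‖ := by
      rw [energyForm_adjointCoeff, RCLike.norm_conj, hT w _ hw₀, norm_neg, pairing_realSlot]
    rw [e1]
    refine hkey.trans_eq ?_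
    rw [hM]
    ring
  choose F hF hFn hTF using fun α => exists_funDistr_of_bound hpq (T α) hM0 (hbound α)
  have hFm : MemLp (fun x => (WithLp.toLp 2 fun α => F α x : EuclideanSpace ℂ (Fin m)))
      (ENNReal.ofReal p) volume := MemLp.of_eval_piLp hF
  refine (iInf_le_of_le _ (iInf_le_of_le hFm (iInf_le_of_le hTF le_rfl)) :
    distrLpNorm p T ≤ _).trans ?_
  refine (eLpNorm_toLp_le h1p fun α => (hF α).1).trans ?_
  refine (Finset.sum_le_sum fun α _ => hFn α).trans ?_
  rw [Finset.sum_const, Finset.card_univ, Fintype.card_fin, nsmul_eq_mul, hHD,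
    ← ENNReal.ofReal_natCast, ← ENNReal.ofReal_mul (by positivity)]
  have e2 : ((m * (4 * (n * ((C * (n * m)) * (n * m * C₀)))) + 1 : ℝ≥0) : ℝ≥0∞) * ENNReal.ofReal D
      = ENNReal.ofReal ((m * (4 * (n * ((C * (n * m)) * (n * m * C₀)))) + 1) * D) := by
    rw [ENNReal.ofReal_mul (by positivity), ← ENNReal.ofReal_coe_nnreal]
    push_cast
    rfl
  rw [e2]
  refine ENNReal.ofReal_le_ofReal ?_
  rw [hM]
  nlinarith

end Duality

end HalfSpaceSystem

end

/-- The norms are `∞` on distributions outside the space in question; as `C > 0`, nothing is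
claimed when the right-hand side of an estimate is `∞`. -/
theorem mainTheorem6 (n m : ℕ) (hn : 1 ≤ n) (A : Coeff n m)
    (hA : IsBoundedMeasurable A) (hG : Garding A) (p p' : ℝ) (hp : p.HolderConjugate p') :
    (∃ C : ℝ≥0, 0 < C ∧
      ∀ u : EnergyFunction n m, IsSolution A u →
      ∀ u₀ : Bdry n → EuclideanSpace ℂ (Fin m), IsTrace u u₀ →
      ∀ T : VecDistr n (Fin m), IsConormalDerivative A u T →
        distrLpNorm p T ≤ C * distrLpNorm p (tangGrad u₀)) ↔
    (∃ C : ℝ≥0, 0 < C ∧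
      ∀ w : EnergyFunction n m, IsSolution (adjointCoeff A) w →
      ∀ w₀ : Bdry n → EuclideanSpace ℂ (Fin m), IsTrace w w₀ →
      ∀ T : VecDistr n (Fin m), IsConormalDerivative (adjointCoeff A) w T →
        negSobolevNorm p' T ≤ C * negSobolevNorm p' (tangGrad w₀)) :=
  ⟨fun ⟨_, _, h⟩ => negSobolev_estimate_of_distrLp_estimate hn hA hG hp h,
    fun ⟨_, _, h⟩ => distrLp_estimate_of_negSobolev_estimate hn hA hG hp h⟩
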